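/- Let $b<a$ and $q>0$ be real, and put $p=\frac1{1+q^3}$, $r=\sqrt{q^2-q+1}$, $$\frac1{t_0}=1+2\Big(\frac{r(a-b)}{q+1}\Big)^2,\qquad x_0=\frac{(2a-b)q+(2b-a)}{q+1}\,t_0,\qquad c_0=\sqrt{\frac{t_0(1-t_0)}2},$$ $$\mu=\Big(\frac{q^2-q+1}{q}\Big)^{1/4},\qquad A=\frac{q^{1/2}(a-x_0)+q^{-1/2}(b-x_0)}{a-b}.$$ Consider $n$ non-intersecting Brownian motions $x_1(t)<\dots<x_n(t)$ on the line, with transition density $p(t;x,y)=\frac1{\sqrt{\pi t}}e^{-(x-y)^2/t}$, all leaving from $0$ at time $0$, of which $n_1$ end up at $a\sqrt n$ and $n-n_1$ end up at $b\sqrt n$ at time $1$, where $0\le n_1=n_1(n)\le n$ and $|n_1-pn|<1$ (so $n_1=pn$ whenever $pn$ is an integer). Their law is the limit, as distinct starting points tend to $0$ and distinct end points tend to the prescribed ones, of the law with Karlin–McGregor joint density: at times $0<t_1<\dots<t_m<1$ this is proportional to the product over successive times $s<s'$ in the list $0,t_1,\dots,t_m,1$ of $\det\big(p(s'-s;y_i,z_j)\big)_{1\le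 i,j\le n}$, where $y$ and $z$ are the configurations at times $s$ and $s'$. Denote probabilities by $\mathbb P_n$. Then: (i) $\mu>0$ and $c_0=t_0\,\frac{r(a-b)}{q+1}>0$. (ii) For every $t\in(0,1)$ the mean density of the particles in the scale $x/\sqrt n$, that is the mean of the empirical measure $\frac1n\sum_j\delta_{x_j(t)/\sqrt n}$, converges weakly as $n\to\infty$ to a probability measure $\nu_t$. One has $0<t_0<1$; the support of $\nu_t$ is one interval for $0<t\le t_0$ and two disjoint intervals for $t_0<t<1$, the end points of the intervals depending continuously on $t$, and the region filled by these supports has a cusp at $(x_0,t_0)$: the two inner boundary curves, which bound the gap for $t>t_0$, both start at $x_0$, an interior point of the support of $\nu_{t_0}$, at time $t_0$, with a common tangent there. In the unscaled space variable the cusp is at $(x_0\sqrt n,t_0)$. (iii) For all $m$, all times $\tau_1<\dots<\tau_m$ and all bounded Borel sets $E_1,\dots,E_m\subset\mathbb R$ (in particular $E_1=\dots=E_m=E$), $$\lim_{n\to\infty}\mathbb P_n\Big(\bigcap_{1\le i\le m}\Big\{\text{all } x_j\Big(t_0+\Big(\frac{c_0\mu}{n^{1/4}}\Big)^2 2\tau_i\Big)\in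 x_0n^{1/2}+c_0A\tau_i+\frac{c_0\mu}{n^{1/4}}E_i^c\Big\}\Big)=\mathbb P^{\mathcal P}\Big(\bigcap_{1\le i\le m}\{\mathcal P(\tau_i)\cap E_i=\emptyset\}\Big).$$ The right-hand side is the gap probability of the Pearcey process, i.e. the matrix Fredholm determinant $\det\big(I-(\chi_{E_i}K^{\mathcal P}_{\tau_i\tau_j}\chi_{E_j})_{1\le i,j\le m}\big)$ (given by its convergent Fredholm series) of the Pearcey kernel $$K^{\mathcal P}_{s,t}(x,y)=-\frac1{4\pi^2}\int_X dV\int_{-i\infty}^{i\infty}dU\,\frac{e^{-\frac{U^4}4+\frac{tU^2}2-Uy}\,e^{\frac{V^4}4-\frac{sV^2}2+Vx}}{U-V}-\frac{\mathbb I(s<t)}{\sqrt{2\pi(t-s)}}\,e^{-\frac{(x-y)^2}{2(t-s)}},$$ where $X$ consists of the ingoing rays from $\pm\infty e^{i\pi/4}$ to $0$ and the outgoing rays from $0$ to $\pm\infty e^{-i\pi/4}$. -/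

import Mathlib

open Set Filter Topology MeasureTheory
open scoped BoundedContinuousFunction

noncomputable section

/-- The local transition probability `p(t; x, y)` of the Brownian motion. -/
def brownianDensity (t x y : ℝ) : ℝ :=
  Real.exp (-(x - y) ^ 2 / t) / √(Real.pi * t)

/-- The times `0, t_1, …, t_m, 1`. -/
def fullTimes {m : ℕ} (t : Fin m → ℝ) : Fin (m + 2) → ℝ :=
  Fin.cons (α := fun _ => ℝ) 0 (Fin.snoc (α := fun _ => ℝ) t 1)

/-- The configurations `γ, x(t_1), …, x(t_m), δ` at the times `0, t_1, …, t_m, 1`. -/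
def fullConfigs {n m : ℕ} (γ δ : Fin n → ℝ) (x : Fin m → Fin n → ℝ) : Fin (m + 2) → Fin n → ℝ :=
  Fin.cons (α := fun _ => Fin n → ℝ) γ (Fin.snoc (α := fun _ => Fin n → ℝ) x δ)

/-- Joint density (Karlin-McGregor, up to normalization) of the positions, at the times
`0 < t_1 < … < t_m < 1`, of `n` Brownian motions leaving from the points `γ` at time `0`, ending up
at the points `δ` at time `1` and conditioned not to intersect.  It is a symmetric function of the
positions at each time, so that these need not be listed in increasing order. -/
def karlinMcGregor {n m : ℕ} (γ δ : Fin n → ℝ) (t : Fin m → ℝ) (x : Fin m → Fin n → ℝ) : ℝ :=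
  ∏ k : Fin (m + 1), Matrix.det (Matrix.of fun i j : Fin n =>
    brownianDensity (fullTimes t k.succ - fullTimes t k.castSucc)
      (fullConfigs γ δ x k.castSucc i) (fullConfigs γ δ x k.succ j))

/-- Expectation of `F (x(t_1), …, x(t_m))` for non-intersecting Brownian motions going from `γ`
to `δ`. -/
def bridgeExpectation {n m : ℕ} (γ δ : Fin n → ℝ) (t : Fin m → ℝ)
    (F : (Fin m → Fin n → ℝ) → ℝ) : ℝ :=
  (∫ x, F x * karlinMcGregor γ δ t x) / ∫ x, karlinMcGregor γ δ t x

/-- The end points in increasing order: `n - n₁` of them at `b`, then `n₁` of them at `a`. -/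
def endPoints (n n₁ : ℕ) (b a : ℝ) (i : Fin n) : ℝ :=
  if (i : ℕ) + n₁ < n then b else a

/-- Let `n` non-intersecting Brownian motions all leave from `0` at time `0`, while `n₁` of them end
up at `a` and the other ones at `b < a` at time `1`.  The expectation of `F (x(t_1), …, x(t_m))` is
`v`: it is the limit of the expectations for distinct starting points `γ` tending to `0` and
distinct end points `δ` tending to the prescribed ones. -/
def HasNonIntersectingExpectation {m : ℕ} (n n₁ : ℕ) (b a : ℝ) (t : Fin m → ℝ)
    (F : (Fin m → Fin n → ℝ) → ℝ) (v : ℝ) : Prop :=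
  Tendsto (fun z : (Fin n → ℝ) × (Fin n → ℝ) => bridgeExpectation z.1 z.2 t F)
    (𝓝[{γ | StrictMono γ}] 0 ×ˢ 𝓝[{δ | StrictMono δ}] (endPoints n n₁ b a)) (𝓝 v)

/-- The probability of the event `S` for the same non-intersecting Brownian motions is `P`. -/
def HasNonIntersectingProbability {m : ℕ} (n n₁ : ℕ) (b a : ℝ) (t : Fin m → ℝ)
    (S : Set (Fin m → Fin n → ℝ)) (P : ℝ) : Prop :=
  HasNonIntersectingExpectation n n₁ b a t (S.indicator fun _ => 1) P

/-- `ν` is the limiting mean density, at time `t` and in the scale `x / √n`, of `n` non-intersecting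
Brownian motions, `n₁ n` of which end up at `a √n` and the other ones at `b √n`: the mean
empirical measures converge weakly to the probability measure `ν`. -/
def IsLimitingMeanDensity (n₁ : ℕ → ℕ) (b a t : ℝ) (ν : Measure ℝ) : Prop :=
  IsProbabilityMeasure ν ∧ ∀ f : ℝ →ᵇ ℝ, ∃ M : ℕ → ℝ,
    (∀ᶠ n : ℕ in atTop, HasNonIntersectingExpectation n (n₁ n) (b * √n) (a * √n)
      (fun _ : Fin 1 => t) (fun x => (1 / (n : ℝ)) * ∑ j, f (x 0 j / √n)) (M n)) ∧
    Tendsto M atTop (𝓝 (∫ x, f x ∂ν))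

/-- The region with cross-sections `S t`, `0 < t < 1`, is one interval up to time `t₀` and two
disjoint intervals afterwards, and its boundary has a cusp at `(x₀, t₀)`: the two inner boundary
curves emanate from `(x₀, t₀)`, inside the region at time `t₀`, with a common tangent there. -/
def SplitsAtCusp (S : ℝ → Set ℝ) (x₀ t₀ : ℝ) : Prop :=
  t₀ ∈ Ioo (0 : ℝ) 1 ∧ ∃ l g₁ g₂ u : ℝ → ℝ,
    ContinuousOn l (Ioo 0 1) ∧ ContinuousOn u (Ioo 0 1) ∧
    ContinuousOn g₁ (Ico t₀ 1) ∧ ContinuousOn g₂ (Ico t₀ 1) ∧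
    (∀ t ∈ Ioc 0 t₀, l t < u t ∧ S t = Icc (l t) (u t)) ∧
    (∀ t ∈ Ioo t₀ 1, l t < g₁ t ∧ g₁ t < g₂ t ∧ g₂ t < u t ∧
      S t = Icc (l t) (g₁ t) ∪ Icc (g₂ t) (u t)) ∧
    l t₀ < x₀ ∧ x₀ < u t₀ ∧ g₁ t₀ = x₀ ∧ g₂ t₀ = x₀ ∧
    ∃ v : ℝ, HasDerivWithinAt g₁ v (Ici t₀) t₀ ∧ HasDerivWithinAt g₂ v (Ici t₀) t₀

/-- `∫_{-i∞}^{i∞} g(U) dU`. -/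
def imaginaryAxisIntegral (g : ℂ → ℂ) : ℂ :=
  ∫ y : ℝ, g (Complex.I * y) * Complex.I

/-- `∫_X g(V) dV`, where `X` consists of the ingoing rays from `± ∞ e^{iπ/4}` to `0` and the
outgoing rays from `0` to `± ∞ e^{-iπ/4}`. -/
def crossIntegral (g : ℂ → ℂ) : ℂ :=
  let ω : ℂ := Complex.exp (Complex.I * Real.pi / 4)
  let ω' : ℂ := Complex.exp (-(Complex.I * Real.pi / 4))
  (∫ r in Ioi (0 : ℝ), g (-(r * ω)) * ω) - (∫ r in Ioi (0 : ℝ), g (r * ω) * ω)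
    + (∫ r in Ioi (0 : ℝ), g (r * ω') * ω') - (∫ r in Ioi (0 : ℝ), g (-(r * ω')) * ω')

/-- The Pearcey kernel `K^P_{s,t}(x, y)`. -/
def pearceyKernel (s t x y : ℝ) : ℂ :=
  -(1 / (4 * (Real.pi : ℂ) ^ 2)) * crossIntegral (fun V => imaginaryAxisIntegral (fun U =>
      Complex.exp (-U ^ 4 / 4 + t * U ^ 2 / 2 - U * y) *
        Complex.exp (V ^ 4 / 4 - s * V ^ 2 / 2 + V * x) * (1 / (U - V))))
  - if s < t then
      ((Real.exp (-(x - y) ^ 2 / (2 * (t - s))) / √(2 * Real.pi * (t - s)) : ℝ) : ℂ) else 0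

/-- The matrix Fredholm determinant `det (I - (χ_{E_i} K_{ij} χ_{E_j})_{1 ≤ i, j ≤ m})` is `D`: its
Fredholm series has integrable terms and converges to `D`. -/
def HasFredholmDet {m : ℕ} (K : Fin m → Fin m → ℝ → ℝ → ℂ) (E : Fin m → Set ℝ) (D : ℂ) : Prop :=
  (∀ (k : ℕ) (κ : Fin k → Fin m), IntegrableOn
    (fun x : Fin k → ℝ => Matrix.det (Matrix.of fun i j => K (κ i) (κ j) (x i) (x j)))
    (Set.pi univ fun i => E (κ i))) ∧
  HasSum (fun k : ℕ => (-1) ^ k / (k.factorial : ℂ) * ∑ κ : Fin k → Fin m,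
    ∫ x in Set.pi univ fun i => E (κ i),
      Matrix.det (Matrix.of fun i j => K (κ i) (κ j) (x i) (x j))) D

/-- For the Pearcey process, the probability that no particle is in `E_i` at time `τ_i`, for
`1 ≤ i ≤ m`, is `D`. -/
def HasPearceyGapProbability {m : ℕ} (τ : Fin m → ℝ) (E : Fin m → Set ℝ) (D : ℝ) : Prop :=
  HasFredholmDet (fun i j => pearceyKernel (τ i) (τ j)) E (D : ℂ)

end

noncomputable section

open Finset (sum_congr mul_sum sum_mul mem_filter sum_comm sum_le_sum prod_const single_le_sum
  card_univ prod_congr prod_nonneg sum_div measurable_prod prod_mul_distrib sum_nonneg sum_mul_sum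
  prod_eq_one sum_const prod_eq_zero)
open Matrix (det of_apply det_mul det_apply' det_mul_row det_transpose transpose_apply det_one
  det_mul_column of)
open Complex (norm_real exp_add ofReal_mul ofReal add_re real_smul ofReal_re sub_re one_re I_sq
  norm_exp re_ofReal_mul normSq add_im one_im slitPlane ofReal_im normSq_apply I_re sub_im exp_log
  re_le_norm ofReal_one ofReal_zero I_im div_ofReal_re ofReal_injective I_ne_zero ofReal_pow
  ofReal_inv norm_ofNat normSq_pos norm_I mul_re exp_neg norm_two ofRealHom ofReal_div exp_nat_mul
  im_ofReal_mul mul_im abs_re_le_norm zero_re sq_norm I re im)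
open Fin (tail succ_pos snoc lt_def cons)
open Real (norm_of_nonneg norm_eq_abs exp_pos sqrt_mul sq_sqrt sqrt_nonneg pi_pos log_le_log
  exp_nonneg exp log)
open Equiv (Perm)
open Function (Injective uncurry comp_def comp_apply)
open intervalIntegral (integral_of_le)
open ContinuousLinearMap (smulRightL)
open Fintype (card_fin sum_prod_type)
open Metric (mem_ball_self ball)
open scoped Real

local notation "cexp" => Complex.exp

variable {Γ w Γ1 w1 Γ2 w2 : ℝ → ℂ} {V V1 V2 : Set ℂ} {n m n1 k : ℕ} {t q B : ℝ} {δ : Fin n → ℂ}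
  {f : ℂ → ℂ}

/-- Andréief's identity. -/
theorem integral_det_mul_det (q : Fin n → ℝ → ℝ) (r : ℝ → Fin n → ℝ)
    (h : ∀ i j, Integrable (fun y => q i y * r y j)) :
    ∫ x : Fin n → ℝ, det (of fun i j => q i (x j)) *
      det (of fun i j => r (x i) j) =
    (n.factorial : ℝ) * det (of fun i j => ∫ y, q i y * r y j) := by
  have e : (fun x : Fin n → ℝ => det (of fun i j => q i (x j)) *
      det (of fun i j => r (x i) j)) =
      fun x => ∑ σ : Perm (Fin n), ∑ τ : Perm (Fin n),
        ((σ.sign : ℤ) : ℝ) * ((τ.sign : ℤ) : ℝ) *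
        ∏ j, (q (σ j) (x j) * r (x j) (τ j)) := by
    ext x
    rw [← det_transpose (of fun i j => r (x i) j), det_apply',
      det_apply', sum_mul_sum]
    refine sum_congr rfl fun σ _ => sum_congr rfl fun τ _ => ?_
    simp only [of_apply, transpose_apply, prod_mul_distrib]
    ring
  have hi : ∀ σ τ : Perm (Fin n), Integrable (fun x : Fin n → ℝ =>
      ((σ.sign : ℤ) : ℝ) * ((τ.sign : ℤ) : ℝ) * ∏ j, (q (σ j) (x j) * r (x j) (τ j))) :=
    fun σ τ => (Integrable.fintype_prod (f := fun j y => q (σ j) y * r y (τ j))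
      fun j => h (σ j) (τ j)).const_mul _
  rw [e, integral_finsetSum _ fun σ _ => integrable_finsetSum _ fun τ _ => hi σ τ]
  set M := of fun i j => ∫ y, q i y * r y j with hM
  have hs : ∀ σ : Perm (Fin n), ∫ x : Fin n → ℝ, ∑ τ : Perm (Fin n),
        ((σ.sign : ℤ) : ℝ) * ((τ.sign : ℤ) : ℝ) * ∏ j, (q (σ j) (x j) * r (x j) (τ j))
        = M.det := by
    intro σ
    rw [integral_finsetSum _ fun τ _ => hi σ τ]
    have : ∀ τ : Perm (Fin n), ∫ x : Fin n → ℝ,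
        ((σ.sign : ℤ) : ℝ) * ((τ.sign : ℤ) : ℝ) * ∏ j, (q (σ j) (x j) * r (x j) (τ j))
        = ((σ.sign : ℤ) : ℝ) * (((τ.sign : ℤ) : ℝ) * ∏ j, (M.submatrix σ id).transpose (τ j) j) := by
      intro τ
      rw [integral_const_mul, volume_pi,
        integral_fintype_prod_eq_prod (fun j y => q (σ j) y * r y (τ j)), mul_assoc]
      simp [hM]
    rw [sum_congr rfl fun τ _ => this τ, ← mul_sum, ← det_apply',
      det_transpose, Matrix.det_permute, ← mul_assoc]
    have : ((σ.sign : ℤ) : ℝ) * ((σ.sign : ℤ) : ℝ) = 1 := by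
      rcases Int.units_eq_one_or σ.sign with h | h <;> simp [h]
    rw [this, one_mul]
  rw [sum_congr rfl fun σ _ => hs σ]
  simp [card_univ, Fintype.card_perm]

theorem continuous_brownianDensity (t : ℝ) :
    Continuous (fun z : ℝ × ℝ => brownianDensity t z.1 z.2) := by
  unfold brownianDensity; fun_prop

theorem Continuous.brownianDensity {X : Type*} [TopologicalSpace X] {f g : X → ℝ}
    (hf : Continuous f) (hg : Continuous g) (t : ℝ) :
    Continuous (fun x => brownianDensity t (f x) (g x)) :=
  (continuous_brownianDensity t).comp (hf.prodMk hg)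

theorem brownianDensity_nonneg (t x y : ℝ) : 0 ≤ brownianDensity t x y := by
  unfold brownianDensity; positivity

theorem brownianDensity_comm (t x y : ℝ) : brownianDensity t x y = brownianDensity t y x := by
  unfold brownianDensity; rw [show x - y = -(y - x) by ring, neg_sq]

theorem brownianDensity_le (ht : 0 < t) (x y : ℝ) :
    brownianDensity t x y ≤ 1 / √(π * t) := by
  unfold brownianDensity
  gcongr
  rw [Real.exp_le_one_iff]
  have : 0 ≤ (x - y) ^ 2 / t := by positivity
  rw [neg_div]; linarith

theorem integrable_brownianDensity (ht : 0 < t) (x : ℝ) :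
    Integrable (fun y => brownianDensity t x y) := by
  have := ((integrable_exp_neg_mul_sq (b := 1 / t) (by positivity)).comp_sub_left x).div_const
    √(π * t)
  refine this.congr (ae_of_all _ fun y => ?_)
  simp only [brownianDensity]
  congr 2; ring

theorem integral_brownianDensity (ht : 0 < t) (x : ℝ) :
    ∫ y, brownianDensity t x y = 1 := by
  have : (fun y => brownianDensity t x y) =
      fun y => (fun z => exp (-(1 / t) * z ^ 2) / √(π * t)) (x - y) := by
    ext y; simp only [brownianDensity]; congr 2; ring
  rw [this, integral_sub_left_eq_self (fun z => exp (-(1 / t) * z ^ 2) / √(π * t)),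
    integral_div, integral_gaussian]
  rw [show π / (1 / t) = π * t by field_simp]
  exact div_self (by positivity)

/-- The Karlin-McGregor density for paths starting at time `s`. -/
def karlinMcGregorFrom {n m : ℕ} (s : ℝ) (γ δ : Fin n → ℝ) (t : Fin m → ℝ)
    (x : Fin m → Fin n → ℝ) : ℝ :=
  ∏ k : Fin (m + 1), det (of fun i j : Fin n =>
    brownianDensity
      ((cons (α := fun _ => ℝ) s (snoc (α := fun _ => ℝ) t 1) : Fin (m + 2) → ℝ) k.succ -
      (cons (α := fun _ => ℝ) s (snoc (α := fun _ => ℝ) t 1) : Fin (m + 2) → ℝ) k.castSucc)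
      (fullConfigs γ δ x k.castSucc i) (fullConfigs γ δ x k.succ j))

theorem karlinMcGregor_eq_from (γ δ : Fin n → ℝ) (t : Fin m → ℝ)
    (x : Fin m → Fin n → ℝ) : karlinMcGregor γ δ t x = karlinMcGregorFrom 0 γ δ t x := rfl

theorem karlinMcGregorFrom_zero (s : ℝ) (γ δ : Fin n → ℝ) (t : Fin 0 → ℝ)
    (x : Fin 0 → Fin n → ℝ) : karlinMcGregorFrom s γ δ t x =
      det (of fun i j : Fin n => brownianDensity (1 - s) (γ i) (δ j)) := by
  simp [karlinMcGregorFrom, fullConfigs, snoc]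

theorem karlinMcGregorFrom_cons (s : ℝ) (γ δ : Fin n → ℝ) (t : Fin (m + 1) → ℝ)
    (x0 : Fin n → ℝ) (x : Fin m → Fin n → ℝ) :
    karlinMcGregorFrom s γ δ t (cons x0 x : Fin (m + 1) → Fin n → ℝ) =
      det (of fun i j : Fin n => brownianDensity (t 0 - s) (γ i) (x0 j)) *
      karlinMcGregorFrom (t 0) x0 δ (tail t) x := by
  have e1 : (snoc (α := fun _ => ℝ) t 1 : Fin (m + 2) → ℝ) =
      cons (α := fun _ => ℝ) (t 0) (snoc (α := fun _ => ℝ) (tail t) 1) := by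
    rw [Fin.cons_snoc_eq_snoc_cons, Fin.cons_self_tail]
  have e2 : (snoc (α := fun _ => Fin n → ℝ) (cons x0 x : Fin (m + 1) → Fin n → ℝ) δ :
      Fin (m + 2) → Fin n → ℝ) = cons (α := fun _ => Fin n → ℝ) x0
      (snoc (α := fun _ => Fin n → ℝ) x δ) := by
    rw [Fin.cons_snoc_eq_snoc_cons]
  unfold karlinMcGregorFrom fullConfigs
  rw [Fin.prod_univ_succ, e1, e2]
  rfl

/-- The transition density from `(s, u)` to `(1, v)` with weights `h i` at the times `t i`. -/
def weightedDensity : (m : ℕ) → (Fin m → ℝ) → (Fin m → ℝ → ℝ) → ℝ → ℝ → ℝ → ℝ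
  | 0, _, _, s, u, v => brownianDensity (1 - s) u v
  | m + 1, t, h, s, u, v => ∫ y, brownianDensity (t 0 - s) u y * h 0 y *
      weightedDensity m (tail t) (tail h) (t 0) y v

theorem measurable_weightedDensity (m : ℕ) : ∀ (t : Fin m → ℝ) (h : Fin m → ℝ → ℝ)
    (_ : ∀ i, Measurable (h i)) (s v : ℝ),
    Measurable fun u => weightedDensity m t h s u v := by
  induction m with
  | zero =>
    intro t h _ s v
    exact (continuous_id.brownianDensity continuous_const _).measurable
  | succ m ih =>
    intro t h hm s v
    have h1 : Measurable fun z : ℝ × ℝ => brownianDensity (t 0 - s) z.1 z.2 * h 0 z.2 *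
        weightedDensity m (tail t) (tail h) (t 0) z.2 v :=
      ((continuous_brownianDensity _).measurable.mul ((hm 0).comp measurable_snd)).mul
        ((ih (tail t) (tail h) (fun i => hm i.succ) (t 0) v).comp measurable_snd)
    exact (StronglyMeasurable.integral_prod_right' (ν := (volume : Measure ℝ))
      h1.stronglyMeasurable).measurable

theorem exists_weightedDensity_bound (m : ℕ) : ∀ (t : Fin m → ℝ) (h : Fin m → ℝ → ℝ)
    (_ : ∀ i, Measurable (h i)) (_ : ∀ i, ∃ B, ∀ y, |h i y| ≤ B) (s : ℝ) (_ : s < 1)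
    (_ : ∀ i, s < t i) (_ : ∀ i, t i < 1) (_ : StrictMono t),
    ∃ B, ∀ u v, |weightedDensity m t h s u v| ≤ B := by
  induction m with
  | zero =>
    intro t h _ _ s hs _ _ _
    refine ⟨1 / √(π * (1 - s)), fun u v => ?_⟩
    rw [weightedDensity, abs_of_nonneg (brownianDensity_nonneg _ _ _)]
    exact brownianDensity_le (by linarith) _ _
  | succ m ih =>
    intro t h hm hb s hs hst ht1 hmono
    obtain ⟨B, hB⟩ := ih (tail t) (tail h) (fun i => hm i.succ) (fun i => hb i.succ) (t 0)
      (ht1 0) (fun i => hmono (succ_pos i)) (fun i => ht1 i.succ)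
      (fun i j hij => hmono (Fin.succ_lt_succ_iff.mpr hij))
    obtain ⟨B', hB'⟩ := hb 0
    have hΔ : 0 < t 0 - s := by linarith [hst 0]
    have hB0 : 0 ≤ B := (abs_nonneg _).trans (hB 0 0)
    refine ⟨B' * B, fun u v => ?_⟩
    rw [weightedDensity, ← norm_eq_abs]
    refine (norm_integral_le_of_norm_le (g := fun y => brownianDensity (t 0 - s) u y * (B' * B))
      ((integrable_brownianDensity hΔ u).mul_const _) (ae_of_all _ fun y => ?_)).trans ?_
    · rw [norm_mul, norm_mul, norm_of_nonneg (brownianDensity_nonneg _ _ _), mul_assoc]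
      gcongr
      · exact brownianDensity_nonneg _ _ _
      · exact (abs_nonneg _).trans (hB' 0)
      · exact hB' y
      · exact hB y v
    · rw [integral_mul_const, integral_brownianDensity hΔ, one_mul]

theorem continuous_karlinMcGregorFrom (s : ℝ) (δ : Fin n → ℝ) (t : Fin m → ℝ) :
    Continuous fun z : (Fin n → ℝ) × (Fin m → Fin n → ℝ) =>
      karlinMcGregorFrom s z.1 δ t z.2 := by
  have hc : ∀ k : Fin (m + 2), ∀ i, Continuous fun z : (Fin n → ℝ) × (Fin m → Fin n → ℝ) =>
      fullConfigs z.1 δ z.2 k i := by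
    intro k i
    unfold fullConfigs
    refine Fin.cases ?_ (fun k => ?_) k
    · simp only [Fin.cons_zero]; fun_prop
    · simp only [Fin.cons_succ]
      refine Fin.lastCases ?_ (fun k => ?_) k
      · simpa using continuous_const
      · simp only [Fin.snoc_castSucc]; fun_prop
  unfold karlinMcGregorFrom
  refine continuous_finsetProd _ fun k _ => Continuous.matrix_det ?_
  refine continuous_matrix fun i j => ?_
  exact (hc _ i).brownianDensity (hc _ j) _

theorem abs_det_brownianDensity_le (t : ℝ) (γ x : Fin n → ℝ) :
    |det (of fun i j : Fin n => brownianDensity t (γ i) (x j))| ≤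
      ∑ σ : Perm (Fin n), ∏ j, brownianDensity t (γ (σ j)) (x j) := by
  rw [det_apply']
  refine (Finset.abs_sum_le_sum_abs _ _).trans (sum_le_sum fun σ _ => ?_)
  have : |((σ.sign : ℤ) : ℝ)| = 1 := by
    rcases Int.units_eq_one_or σ.sign with h | h <;> simp [h]
  rw [abs_mul, this, one_mul, Finset.abs_prod]
  exact Finset.prod_le_prod (fun _ _ => abs_nonneg _)
    fun j _ => (abs_of_nonneg (brownianDensity_nonneg _ _ _)).le

theorem piFinSuccAbove_symm_zero {X : Type*} [MeasurableSpace X]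
    (z : X × (Fin m → X)) :
    (MeasurableEquiv.piFinSuccAbove (fun _ : Fin (m + 1) => X) 0).symm z =
      cons z.1 z.2 := by
  simp [MeasurableEquiv.piFinSuccAbove]
  rfl

theorem measureReal_univ_fin_zero {X : Type*} [MeasureSpace X]
    [SigmaFinite (volume : Measure X)] : (volume : Measure (Fin 0 → X)).real univ = 1 := by
  rw [measureReal_def, volume_pi, Measure.pi_univ]; simp

theorem integral_fin_succ {X : Type*} [MeasureSpace X] [SigmaFinite (volume : Measure X)]
    (F : (Fin (m + 1) → X) → ℝ) :
    ∫ x, F x = ∫ z : X × (Fin m → X), F (cons z.1 z.2) := by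
  have := (volume_preserving_piFinSuccAbove (fun _ : Fin (m + 1) => X) 0).symm.integral_comp' F
  rw [← this]
  exact integral_congr_ae (ae_of_all _ fun z => by simp only [piFinSuccAbove_symm_zero])

theorem integrable_fin_succ {X : Type*} [MeasureSpace X]
    [SigmaFinite (volume : Measure X)] (F : (Fin (m + 1) → X) → ℝ) :
    Integrable (fun z : X × (Fin m → X) => F (cons z.1 z.2)) ↔ Integrable F := by
  have := (volume_preserving_piFinSuccAbove (fun _ : Fin (m + 1) => X) 0).symm.integrable_comp_emb
    (MeasurableEquiv.measurableEmbedding _) (g := F)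
  rw [← this]
  exact integrable_congr (ae_of_all _ fun z => by
    simp only [comp_apply, piFinSuccAbove_symm_zero])

theorem prod_weights_cons (h : Fin (m + 1) → ℝ → ℝ) (x0 : Fin n → ℝ)
    (x : Fin m → Fin n → ℝ) :
    ∏ i, ∏ j, h i ((cons x0 x : Fin (m + 1) → Fin n → ℝ) i j) =
      (∏ j, h 0 (x0 j)) * ∏ i, ∏ j, tail h i (x i j) := by
  rw [Fin.prod_univ_succ]; rfl

theorem integral_weights_karlinMcGregorFrom (n m : ℕ) : ∀ (t : Fin m → ℝ) (h : Fin m → ℝ → ℝ)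
    (_ : ∀ i, Measurable (h i)) (_ : ∀ i, ∃ B, ∀ y, |h i y| ≤ B) (s : ℝ) (_ : s < 1)
    (_ : ∀ i, s < t i) (_ : ∀ i, t i < 1) (_ : StrictMono t) (δ : Fin n → ℝ),
    (∃ B, ∀ γ : Fin n → ℝ,
      Integrable (fun x => (∏ i, ∏ j, h i (x i j)) * karlinMcGregorFrom s γ δ t x) ∧
      ∫ x, ‖(∏ i, ∏ j, h i (x i j)) * karlinMcGregorFrom s γ δ t x‖ ≤ B) ∧
    ∀ γ : Fin n → ℝ, ∫ x, (∏ i, ∏ j, h i (x i j)) * karlinMcGregorFrom s γ δ t x =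
      (n.factorial : ℝ) ^ m *
        det (of fun i j => weightedDensity m t h s (γ i) (δ j)) := by
  induction m with
  | zero =>
    intro t h _ _ s hs _ _ _ δ
    have hΔ : 0 < 1 - s := by linarith
    have key : ∀ γ : Fin n → ℝ, |det (of fun i j : Fin n =>
        brownianDensity (1 - s) (γ i) (δ j))| ≤
        ∑ σ : Perm (Fin n), ∏ j : Fin n, (1 / √(π * (1 - s))) := fun γ =>
      (abs_det_brownianDensity_le _ _ _).trans (sum_le_sum fun σ _ =>
        Finset.prod_le_prod (fun _ _ => brownianDensity_nonneg _ _ _)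
          fun j _ => brownianDensity_le hΔ _ _)
    refine ⟨⟨∑ σ : Perm (Fin n), ∏ j : Fin n, (1 / √(π * (1 - s))),
      fun γ => ⟨Integrable.of_finite, ?_⟩⟩, fun γ => ?_⟩
    rotate_left
    · simp only [karlinMcGregorFrom_zero, weightedDensity]
      simp [measureReal_univ_fin_zero]
    · simp only [karlinMcGregorFrom_zero]
      simpa [measureReal_univ_fin_zero] using key γ
  | succ m ih =>
    intro t h hm hb s hs hst ht1 hmono δ
    have hΔ : 0 < t 0 - s := by linarith [hst 0]
    have ihs := ih (tail t) (tail h) (fun i => hm i.succ) (fun i => hb i.succ) (t 0)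
      (ht1 0) (fun i => hmono (succ_pos i)) (fun i => ht1 i.succ)
      (fun i j hij => hmono (Fin.succ_lt_succ_iff.mpr hij)) δ
    obtain ⟨⟨B, hB⟩, hI⟩ := ihs
    obtain ⟨C, hC⟩ := exists_weightedDensity_bound m (tail t) (tail h)
      (fun i => hm i.succ) (fun i => hb i.succ) (t 0)
      (ht1 0) (fun i => hmono (succ_pos i)) (fun i => ht1 i.succ)
      (fun i j hij => hmono (Fin.succ_lt_succ_iff.mpr hij))
    obtain ⟨H, hH⟩ := hb 0
    have hH0 : 0 ≤ H := (abs_nonneg _).trans (hH 0)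
    set G : (Fin n → ℝ) → (Fin n → ℝ) → ℝ := fun γ x0 => (∏ j, h 0 (x0 j)) *
      det (of fun i j : Fin n => brownianDensity (t 0 - s) (γ i) (x0 j)) with hG
    set R : (Fin n → ℝ) → (Fin m → Fin n → ℝ) → ℝ := fun x0 x =>
      (∏ i, ∏ j, tail h i (x i j)) * karlinMcGregorFrom (t 0) x0 δ (tail t) x with hR
    have hF : ∀ γ x0 x, (∏ i, ∏ j, h i ((cons x0 x : Fin (m + 1) → Fin n → ℝ) i j)) *
        karlinMcGregorFrom s γ δ t (cons x0 x : Fin (m + 1) → Fin n → ℝ) =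
        G γ x0 * R x0 x := by
      intro γ x0 x
      rw [prod_weights_cons, karlinMcGregorFrom_cons, hG, hR]
      ring
    have hGm : ∀ γ, Measurable (G γ) := by
      intro γ
      refine (measurable_prod _ fun j _ => (hm 0).comp (measurable_pi_apply j)).mul ?_
      refine (Continuous.matrix_det (continuous_matrix fun i j => ?_)).measurable
      exact continuous_const.brownianDensity (continuous_apply j) _
    have hRm : Measurable fun z : (Fin n → ℝ) × (Fin m → Fin n → ℝ) => R z.1 z.2 := by
      refine Measurable.mul ?_ (continuous_karlinMcGregorFrom _ _ _).measurable
      refine measurable_prod _ fun i _ => measurable_prod _ fun j _ => ?_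
      exact (hm i.succ).comp ((measurable_pi_apply j).comp
        ((measurable_pi_apply i).comp measurable_snd))
    have hpi : ∀ (γ : Fin n → ℝ) (σ : Perm (Fin n)), Integrable fun x0 : Fin n → ℝ =>
        ∏ j, brownianDensity (t 0 - s) (γ (σ j)) (x0 j) := fun γ σ =>
      Integrable.fintype_prod fun j => integrable_brownianDensity hΔ (γ (σ j))
    have hGle : ∀ γ x0 : Fin n → ℝ, ‖G γ x0‖ ≤ H ^ n * ∑ σ : Perm (Fin n),
        ∏ j, brownianDensity (t 0 - s) (γ (σ j)) (x0 j) := by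
      intro γ x0
      rw [hG, norm_mul]
      gcongr
      · rw [norm_prod]
        calc ∏ j, ‖h 0 (x0 j)‖ ≤ ∏ _j : Fin n, H :=
              Finset.prod_le_prod (fun _ _ => norm_nonneg _) fun j _ => hH _
          _ = H ^ n := by simp
      · exact abs_det_brownianDensity_le _ _ _
    have hGbi : ∀ γ : Fin n → ℝ, Integrable fun x0 : Fin n → ℝ => H ^ n * ∑ σ : Perm (Fin n),
        ∏ j, brownianDensity (t 0 - s) (γ (σ j)) (x0 j) := fun γ =>
      (integrable_finsetSum _ fun σ _ => hpi γ σ).const_mul _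
    have hGi : ∀ γ, Integrable (G γ) := fun γ =>
      (hGbi γ).mono' (hGm γ).aestronglyMeasurable (ae_of_all _ (hGle γ))
    have hGint : ∀ γ, ∫ x0, ‖G γ x0‖ ≤ H ^ n * n.factorial := by
      intro γ
      refine (integral_mono (hGi γ).norm (hGbi γ) (hGle γ)).trans ?_
      rw [integral_const_mul, integral_finsetSum _ fun σ _ => hpi γ σ]
      have : ∀ σ : Perm (Fin n), ∫ x0 : Fin n → ℝ,
          ∏ j, brownianDensity (t 0 - s) (γ (σ j)) (x0 j) = 1 := by
        intro σ
        rw [volume_pi, integral_fintype_prod_eq_prod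
          (fun j y => brownianDensity (t 0 - s) (γ (σ j)) y)]
        exact prod_eq_one fun j _ => integral_brownianDensity hΔ _
      rw [sum_congr rfl fun σ _ => this σ]
      simp [card_univ, Fintype.card_perm]
    have hGRi : ∀ γ, Integrable
        (fun z : (Fin n → ℝ) × (Fin m → Fin n → ℝ) => G γ z.1 * R z.1 z.2) := by
      intro γ
      have hmeas : Measurable fun z : (Fin n → ℝ) × (Fin m → Fin n → ℝ) =>
        G γ z.1 * R z.1 z.2 := ((hGm γ).comp measurable_fst).mul hRm
      rw [Measure.volume_eq_prod, integrable_prod_iff hmeas.aestronglyMeasurable]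
      refine ⟨ae_of_all _ fun x0 =>
        show Integrable (fun y => G γ x0 * R x0 y) from (hB x0).1.const_mul _, ?_⟩
      refine ((hGi γ).norm.mul_const B).mono'
        hmeas.norm.stronglyMeasurable.integral_prod_right'.aestronglyMeasurable
        (ae_of_all _ fun x0 => ?_)
      simp only [norm_mul, integral_const_mul, norm_norm]
      gcongr
      rw [norm_of_nonneg (integral_nonneg fun _ => by positivity)]
      exact (hB x0).2
    refine ⟨⟨H ^ n * n.factorial * B, fun γ => ⟨?_, ?_⟩⟩, fun γ => ?_⟩
    · rw [← integrable_fin_succ]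
      exact (hGRi γ).congr (ae_of_all _ fun z => (hF γ z.1 z.2).symm)
    · rw [integral_fin_succ, Measure.volume_eq_prod]
      simp only [hF]
      rw [integral_prod _ (hGRi γ).norm]
      refine (integral_mono (g := fun x0 => ‖G γ x0‖ * B) (hGRi γ).norm.integral_prod_left
        ((hGi γ).norm.mul_const B) fun x0 => ?_).trans ?_
      · simp only [norm_mul (G γ _), integral_const_mul]
        gcongr
        exact (hB x0).2
      · rw [integral_mul_const]
        have : 0 ≤ B := (integral_nonneg fun _ => norm_nonneg _).trans (hB 0).2
        gcongr
        exact hGint γ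
    · rw [integral_fin_succ, Measure.volume_eq_prod]
      simp only [hF]
      rw [integral_prod _ (hGRi γ)]
      simp only [integral_const_mul]
      have e : ∀ x0, G γ x0 * ∫ x, R x0 x = (n.factorial : ℝ) ^ m *
          (det (of fun i j => brownianDensity (t 0 - s) (γ i) (x0 j) * h 0 (x0 j)) *
          det (of fun i j =>
            weightedDensity m (tail t) (tail h) (t 0) (x0 i) (δ j))) := by
        intro x0
        rw [hI x0, hG]
        have := det_mul_row (fun j => h 0 (x0 j))
          (of fun i j : Fin n => brownianDensity (t 0 - s) (γ i) (x0 j))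
        simp only [of_apply] at this
        simp only [mul_comm (brownianDensity _ _ _), this]
        ring
      simp only [e]
      rw [integral_const_mul, integral_det_mul_det
        (fun i y => brownianDensity (t 0 - s) (γ i) y * h 0 y)
        (fun y j => weightedDensity m (tail t) (tail h) (t 0) y (δ j))]
      · simp only [weightedDensity]; ring
      · intro i j
        refine ((integrable_brownianDensity hΔ (γ i)).mul_const (H * C)).mono' ?_
          (ae_of_all _ fun y => ?_)
        · exact (((continuous_const.brownianDensity continuous_id _).measurable.mul (hm 0)).mul
            (measurable_weightedDensity m _ _ (fun i => hm i.succ) _ _)).aestronglyMeasurable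
        · rw [norm_mul, norm_mul, norm_of_nonneg (brownianDensity_nonneg _ _ _), mul_assoc]
          gcongr
          · exact brownianDensity_nonneg _ _ _
          · exact hH y
          · exact hC y _

theorem brownianDensity_mul {a b : ℝ} (ha : 0 < a) (hb : 0 < b) (u y v : ℝ) :
    brownianDensity a u y * brownianDensity b y v =
      brownianDensity (a + b) u v *
        brownianDensity (a * b / (a + b)) ((u * b + v * a) / (a + b)) y := by
  unfold brownianDensity
  rw [div_mul_div_comm, div_mul_div_comm, ← Real.exp_add, ← Real.exp_add,
    ← sqrt_mul (by positivity), ← sqrt_mul (by positivity)]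
  congr 1
  · congr 1
    field_simp
    ring
  · congr 1
    field_simp

/-- The Chapman-Kolmogorov equation. -/
theorem integral_brownianDensity_mul {a b : ℝ} (ha : 0 < a) (hb : 0 < b) (u v : ℝ) :
    ∫ y, brownianDensity a u y * brownianDensity b y v = brownianDensity (a + b) u v := by
  simp only [brownianDensity_mul ha hb]
  rw [integral_const_mul, integral_brownianDensity (by positivity), mul_one]

theorem integrableOn_of_continuous_of_isBounded {f : ℝ → ℂ} (hf : Continuous f) {E : Set ℝ}
    (hE : Bornology.IsBounded E) : IntegrableOn f E := by
  obtain ⟨r, hr⟩ := hE.subset_closedBall 0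
  exact (hf.continuousOn.integrableOn_compact (isCompact_closedBall 0 r)).mono_set hr

/-- The weights of the paths from `(t i, x)` which avoid the sets `E j` at the times `t j > t i`,
with final weights `Ψ`. -/
def avoidingWeight : (m : ℕ) → (Fin m → ℝ) → (Fin m → Set ℝ) → (Fin m → ℝ → ℂ) → Fin m → ℝ → ℂ
  | 0, _, _, _ => fun i => i.elim0
  | m + 1, t, E, Ψ => cons (α := fun _ => ℝ → ℂ)
      (fun x => Ψ 0 x - ∑ j : Fin m, ∫ y in E j.succ,
        (brownianDensity (t j.succ - t 0) x y : ℂ) *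
          avoidingWeight m (tail t) (tail E) (tail Ψ) j y)
      (avoidingWeight m (tail t) (tail E) (tail Ψ))

theorem strictMono_tail {t : Fin (m + 1) → ℝ} (ht : StrictMono t) :
    StrictMono (tail t) :=
  fun _ _ hij => ht (Fin.succ_lt_succ_iff.mpr hij)

theorem continuous_setIntegral_brownianDensity {Δ : ℝ} (hΔ : 0 < Δ) {E : Set ℝ}
    (hE : Bornology.IsBounded E) {f : ℝ → ℂ} (hf : Continuous f) :
    Continuous fun x => ∫ y in E, (brownianDensity Δ x y : ℂ) * f y := by
  refine continuous_of_dominated (bound := fun y => 1 / √(π * Δ) * ‖f y‖)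
    (fun x => ?_) (fun x => ae_of_all _ fun y => ?_) ?_ (ae_of_all _ fun y => ?_)
  · exact ((Complex.continuous_ofReal.comp
      (continuous_const.brownianDensity continuous_id _)).mul hf).aestronglyMeasurable
  · rw [norm_mul, norm_real, norm_of_nonneg (brownianDensity_nonneg _ _ _)]
    gcongr
    exact brownianDensity_le hΔ _ _
  · exact (integrableOn_of_continuous_of_isBounded hf hE).norm.const_mul _
  · exact (Complex.continuous_ofReal.comp
      (continuous_id.brownianDensity continuous_const _)).mul continuous_const

theorem continuous_avoidingWeight (m : ℕ) : ∀ {t : Fin m → ℝ} {E : Fin m → Set ℝ}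
    {Ψ : Fin m → ℝ → ℂ}, StrictMono t → (∀ i, Bornology.IsBounded (E i)) →
    (∀ i, Continuous (Ψ i)) → ∀ i, Continuous (avoidingWeight m t E Ψ i) := by
  induction m with
  | zero => exact fun _ _ _ i => i.elim0
  | succ m ih =>
    intro t E Ψ ht hE hΨ i
    have ihs := ih (strictMono_tail ht) (fun i => hE i.succ) (Ψ := tail Ψ) (fun i => hΨ i.succ)
    refine Fin.cases ?_ (fun i => ?_) i
    · refine (hΨ 0).sub (continuous_finsetSum _ fun j _ => ?_)
      exact continuous_setIntegral_brownianDensity (sub_pos.mpr (ht (succ_pos j))) (hE _)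
        (ihs j)
    · exact ihs i

theorem avoidingWeight_eq (m : ℕ) : ∀ (t : Fin m → ℝ) (E : Fin m → Set ℝ) (Ψ : Fin m → ℝ → ℂ)
    (i : Fin m) (x : ℝ), avoidingWeight m t E Ψ i x = Ψ i x - ∑ j, if i < j then
      ∫ y in E j, (brownianDensity (t j - t i) x y : ℂ) * avoidingWeight m t E Ψ j y else 0 := by
  induction m with
  | zero => exact fun _ _ _ i => i.elim0
  | succ m ih =>
    intro t E Ψ i x
    rw [Fin.sum_univ_succ]
    refine Fin.cases ?_ (fun i => ?_) i
    · simp only [lt_self_iff_false, if_false, succ_pos, if_true, zero_add]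
      rfl
    · simp only [Fin.not_lt_zero, if_false, zero_add, Fin.succ_lt_succ_iff]
      exact ih (tail t) (tail E) (tail Ψ) i x

theorem avoidingWeight_sum (m : ℕ) {ι : Type*} (s : Finset ι) (c : ι → ℂ) :
    ∀ {t : Fin m → ℝ} {E : Fin m → Set ℝ} {Ψ : ι → Fin m → ℝ → ℂ}, StrictMono t →
    (∀ i, Bornology.IsBounded (E i)) → (∀ l i, Continuous (Ψ l i)) → ∀ i x,
    avoidingWeight m t E (fun i x => ∑ l ∈ s, c l * Ψ l i x) i x =
      ∑ l ∈ s, c l * avoidingWeight m t E (Ψ l) i x := by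
  induction m with
  | zero => exact fun _ _ _ i => i.elim0
  | succ m ih =>
    intro t E Ψ ht hE hΨ i x
    have ihs : ∀ i x, avoidingWeight m (tail t) (tail E)
        (tail fun i x => ∑ l ∈ s, c l * Ψ l i x) i x =
        ∑ l ∈ s, c l * avoidingWeight m (tail t) (tail E) (tail (Ψ l)) i x :=
      ih (strictMono_tail ht) (fun i => hE i.succ) (Ψ := fun l => tail (Ψ l))
        (fun l i => hΨ l i.succ)
    refine Fin.cases ?_ (fun i => ?_) i
    · simp only [avoidingWeight, Fin.cons_zero, ihs, mul_sub, Finset.sum_sub_distrib]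
      congr 1
      simp only [mul_sum]
      rw [sum_comm]
      refine sum_congr rfl fun j _ => ?_
      rw [integral_finsetSum _ fun l _ => ?_]
      · refine sum_congr rfl fun l _ => ?_
        rw [← integral_const_mul]
        congr 1 with y
        ring
      · refine integrableOn_of_continuous_of_isBounded ?_ (hE _)
        refine Continuous.mul ?_ (continuous_const.mul ?_)
        · exact Complex.continuous_ofReal.comp (continuous_const.brownianDensity continuous_id _)
        · exact continuous_avoidingWeight m (strictMono_tail ht) (fun i => hE i.succ)
            (fun i => hΨ l i.succ) j
    · exact ihs i x

theorem exists_norm_avoidingWeight_le (m : ℕ) : ∀ {t : Fin m → ℝ} {E : Fin m → Set ℝ},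
    StrictMono t → (∀ i, Bornology.IsBounded (E i)) → ∃ C, 0 ≤ C ∧ ∀ (Ψ : Fin m → ℝ → ℂ) (B : ℝ),
    (∀ i x, ‖Ψ i x‖ ≤ B) → ∀ i x, ‖avoidingWeight m t E Ψ i x‖ ≤ C * B := by
  induction m with
  | zero => exact fun _ _ => ⟨0, le_rfl, fun _ _ _ i => i.elim0⟩
  | succ m ih =>
    intro t E ht hE
    obtain ⟨C, hC0, hC⟩ := ih (strictMono_tail ht) (fun i => hE i.succ)
    set C' := 1 + ∑ j : Fin m, (1 / √(π * (t j.succ - t 0)) * C) * volume.real (E j.succ)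
      with hC'
    have hC'0 : 0 ≤ C' := by positivity
    refine ⟨C + C', by positivity, fun Ψ B hB i x => ?_⟩
    have hB0 : 0 ≤ B := (norm_nonneg _).trans (hB 0 0)
    have ihs : ∀ i x, ‖avoidingWeight m (tail t) (tail E) (tail Ψ) i x‖ ≤ C * B :=
      hC (tail Ψ) B fun i x => hB i.succ x
    refine Fin.cases ?_ (fun i => ?_) i
    · refine le_trans (b := C' * B) ?_ (by nlinarith [mul_nonneg hC0 hB0])
      simp only [avoidingWeight, Fin.cons_zero]
      refine (norm_sub_le _ _).trans ?_
      rw [hC', add_mul, one_mul, sum_mul]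
      refine add_le_add (hB 0 x) ((norm_sum_le _ _).trans (sum_le_sum fun j _ => ?_))
      have hΔ : 0 < t j.succ - t 0 := sub_pos.mpr (ht (succ_pos j))
      refine (norm_setIntegral_le_of_norm_le_const (C := 1 / √(π * (t j.succ - t 0)) *
        (C * B)) (hE _).measure_lt_top fun y _ => ?_).trans (le_of_eq (by ring))
      rw [norm_mul, norm_real, norm_of_nonneg (brownianDensity_nonneg _ _ _)]
      gcongr
      · exact brownianDensity_le hΔ _ _
      · exact ihs j y
    · exact (ihs i x).trans (by nlinarith)

theorem tendsto_avoidingWeight (m : ℕ) {ι : Type*} {l : Filter ι} [l.IsCountablyGenerated] :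
    ∀ {t : Fin m → ℝ} {E : Fin m → Set ℝ} {Ψ : ι → Fin m → ℝ → ℂ} {Ψ' : Fin m → ℝ → ℂ} {B : ℝ},
    StrictMono t → (∀ i, Bornology.IsBounded (E i)) → (∀ᶠ ν in l, ∀ i, Continuous (Ψ ν i)) →
    (∀ᶠ ν in l, ∀ i x, ‖Ψ ν i x‖ ≤ B) → (∀ i x, Tendsto (fun ν => Ψ ν i x) l (𝓝 (Ψ' i x))) →
    ∀ i x, Tendsto (fun ν => avoidingWeight m t E (Ψ ν) i x) l
      (𝓝 (avoidingWeight m t E Ψ' i x)) := by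
  induction m with
  | zero => exact fun _ _ _ _ _ i => i.elim0
  | succ m ih =>
    intro t E Ψ Ψ' B ht hE hc hB hlim i x
    have hc' : ∀ᶠ ν in l, ∀ i, Continuous (tail (Ψ ν) i) := hc.mono fun ν h i => h i.succ
    have hB' : ∀ᶠ ν in l, ∀ i x, ‖tail (Ψ ν) i x‖ ≤ B := hB.mono fun ν h i => h i.succ
    have ihs := ih (strictMono_tail ht) (fun i => hE i.succ) hc' hB'
      (Ψ' := tail Ψ') (fun i x => hlim i.succ x)
    obtain ⟨C, hC0, hC⟩ := exists_norm_avoidingWeight_le m (strictMono_tail ht)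
      (E := tail E) (fun i => hE i.succ)
    refine Fin.cases ?_ (fun i => ?_) i
    · simp only [avoidingWeight, Fin.cons_zero]
      refine (hlim 0 x).sub (tendsto_finsetSum _ fun j _ => ?_)
      have hΔ : 0 < t j.succ - t 0 := sub_pos.mpr (ht (succ_pos j))
      refine tendsto_integral_filter_of_dominated_convergence
        (fun _ => 1 / √(π * (t j.succ - t 0)) * (C * B)) ?_ ?_ ?_ ?_
      · filter_upwards [hc'] with ν hν
        refine Continuous.aestronglyMeasurable (Continuous.mul ?_ ?_)
        · exact Complex.continuous_ofReal.comp (continuous_const.brownianDensity continuous_id _)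
        · exact continuous_avoidingWeight m (strictMono_tail ht) (fun i => hE i.succ) hν j
      · filter_upwards [hB'] with ν hν
        refine ae_of_all _ fun y => ?_
        rw [norm_mul, norm_real, norm_of_nonneg (brownianDensity_nonneg _ _ _)]
        gcongr
        · exact brownianDensity_le hΔ _ _
        · exact hC _ _ hν j y
      · exact integrableOn_const (hE _).measure_lt_top.ne
      · exact ae_of_all _ fun y => (ihs j y).const_mul _
    · exact ihs i x

theorem weightedDensity_compl (m : ℕ) : ∀ {t : Fin m → ℝ} {E : Fin m → Set ℝ} {s : ℝ} {v : ℝ},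
    StrictMono t → (∀ i, Bornology.IsBounded (E i)) → (∀ i, MeasurableSet (E i)) →
    (∀ i, s < t i) → (∀ i, t i < 1) → s < 1 → ∀ u,
    (weightedDensity m t (fun i => (E i)ᶜ.indicator 1) s u v : ℂ) =
      brownianDensity (1 - s) u v - ∑ i, ∫ y in E i, (brownianDensity (t i - s) u y : ℂ) *
        avoidingWeight m t E (fun i y => (brownianDensity (1 - t i) y v : ℂ)) i y := by
  induction m with
  | zero => intro t E s v _ _ _ _ _ _ u; simp [weightedDensity]
  | succ m ih =>
    intro t E s v ht hE hEm hst ht1 hs u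
    set Ψ : Fin (m + 1) → ℝ → ℂ := fun i y => (brownianDensity (1 - t i) y v : ℂ) with hΨ
    have hΨc : ∀ i, Continuous (Ψ i) := fun i => Complex.continuous_ofReal.comp
      (continuous_id.brownianDensity continuous_const _)
    have ihs : ∀ u, (weightedDensity m (tail t) (tail fun i => (E i)ᶜ.indicator 1)
        (t 0) u v : ℂ) = avoidingWeight (m + 1) t E Ψ 0 u := fun u =>
      ih (strictMono_tail ht) (E := tail E) (fun i => hE i.succ) (fun i => hEm i.succ)
        (fun i => ht (succ_pos i)) (fun i => ht1 i.succ) (ht1 0) u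
    have hΔ : 0 < t 0 - s := sub_pos.mpr (hst 0)
    set θ := avoidingWeight (m + 1) t E Ψ with hθ
    have hθc : ∀ i, Continuous (θ i) := continuous_avoidingWeight (m + 1) ht hE hΨc
    have hθb : ∃ C, ∀ i x, ‖θ i x‖ ≤ C := by
      obtain ⟨C, hC0, hC⟩ := exists_norm_avoidingWeight_le (m + 1) ht hE
      refine ⟨C * ∑ i, 1 / √(π * (1 - t i)), hC Ψ _ fun i x => ?_⟩
      rw [norm_real, norm_of_nonneg (brownianDensity_nonneg _ _ _)]
      refine (brownianDensity_le (by linarith [ht1 i]) _ _).trans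
        (single_le_sum (f := fun i => 1 / √(π * (1 - t i)))
          (fun i _ => by positivity) (Finset.mem_univ i))
    obtain ⟨C, hC⟩ := hθb
    have hpc : ∀ Δ, Continuous fun y => (brownianDensity Δ u y : ℂ) := fun Δ =>
      Complex.continuous_ofReal.comp (continuous_const.brownianDensity continuous_id _)
    have hpi : Integrable fun y => (brownianDensity (t 0 - s) u y : ℂ) :=
      (integrable_brownianDensity hΔ u).ofReal
    have hpθ : ∀ i, Integrable fun y => (brownianDensity (t 0 - s) u y : ℂ) * θ i y := fun i =>
      hpi.mul_bdd (c := C) (hθc i).aestronglyMeasurable (ae_of_all _ (hC i))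
    have e1 : (weightedDensity (m + 1) t (fun i => (E i)ᶜ.indicator 1) s u v : ℂ) =
        (∫ y, (brownianDensity (t 0 - s) u y : ℂ) * θ 0 y) -
        ∫ y in E 0, (brownianDensity (t 0 - s) u y : ℂ) * θ 0 y := by
      rw [weightedDensity, ← integral_complex_ofReal, ← integral_indicator (hEm 0),
        ← integral_sub (hpθ 0) ((hpθ 0).indicator (hEm 0))]
      congr 1 with y
      push_cast
      rw [ihs y]
      by_cases hy : y ∈ E 0 <;> simp [hy]
    have e2 : ∫ y, (brownianDensity (t 0 - s) u y : ℂ) * θ 0 y = brownianDensity (1 - s) u v -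
        ∑ j : Fin m, ∫ z in E j.succ, (brownianDensity (t j.succ - s) u z : ℂ) * θ j.succ z := by
      have hθ0 : ∀ y, θ 0 y = Ψ 0 y - ∑ j : Fin m, ∫ z in E j.succ,
        (brownianDensity (t j.succ - t 0) y z : ℂ) * θ j.succ z := fun y => rfl
      have hin : ∀ j : Fin m, ∀ y, ‖∫ z in E j.succ,
          (brownianDensity (t j.succ - t 0) y z : ℂ) * θ j.succ z‖ ≤
          1 / √(π * (t j.succ - t 0)) * C * volume.real (E j.succ) := by
        intro j y
        refine norm_setIntegral_le_of_norm_le_const (hE _).measure_lt_top fun z _ => ?_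
        rw [norm_mul, norm_real, norm_of_nonneg (brownianDensity_nonneg _ _ _)]
        have := brownianDensity_le (sub_pos.mpr (ht (succ_pos j))) y z
        gcongr
        exact hC _ _
      have hi2 : ∀ j : Fin m, Integrable fun y => (brownianDensity (t 0 - s) u y : ℂ) *
          ∫ z in E j.succ, (brownianDensity (t j.succ - t 0) y z : ℂ) * θ j.succ z := fun j =>
        hpi.mul_bdd (c := 1 / √(π * (t j.succ - t 0)) * C * volume.real (E j.succ))
          (continuous_setIntegral_brownianDensity (sub_pos.mpr (ht (succ_pos j))) (hE _)
          (hθc _)).aestronglyMeasurable (ae_of_all _ (hin j))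
      have hi1 : Integrable fun y => (brownianDensity (t 0 - s) u y : ℂ) * Ψ 0 y := by
        refine hpi.mul_bdd (c := 1 / √(π * (1 - t 0))) (hΨc 0).aestronglyMeasurable
          (ae_of_all _ fun y => ?_)
        rw [norm_real, norm_of_nonneg (brownianDensity_nonneg _ _ _)]
        exact brownianDensity_le (by linarith [ht1 0]) _ _
      simp only [hθ0, mul_sub, mul_sum]
      rw [integral_sub hi1 (integrable_finsetSum _ fun j _ => hi2 j),
        integral_finsetSum _ fun j _ => hi2 j]
      congr 1
      · simp only [hΨ, ← ofReal_mul]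
        rw [integral_complex_ofReal, integral_brownianDensity_mul hΔ (by linarith [ht1 0])]
        congr 2; ring
      · refine sum_congr rfl fun j _ => ?_
        have hΔj := sub_pos.mpr (ht (succ_pos j))
        simp only [← integral_const_mul]
        rw [integral_integral_swap]
        · congr 1 with z
          simp only [← mul_assoc, ← ofReal_mul]
          rw [integral_mul_const, integral_complex_ofReal, integral_brownianDensity_mul hΔ hΔj]
          congr 3; ring
        · refine ((hpi.norm.mul_prod (integrableOn_const (C := 1 / √(π * (t j.succ - t 0)) * C)
            (hE j.succ).measure_lt_top.ne (μ := volume) (by finiteness))).mono' ?_ ?_)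
          · refine Continuous.aestronglyMeasurable ?_
            refine Continuous.mul ((hpc _).comp continuous_fst) (Continuous.mul ?_
              ((hθc _).comp continuous_snd))
            exact Complex.continuous_ofReal.comp (continuous_brownianDensity _)
          · refine ae_of_all _ fun z => ?_
            simp only [uncurry]
            rw [norm_mul, norm_mul, norm_real (brownianDensity (t j.succ - t 0) _ _),
              norm_of_nonneg (brownianDensity_nonneg _ _ _)]
            have := brownianDensity_le hΔj z.1 z.2
            gcongr
            exact hC _ _
    rw [e1, e2, Fin.sum_univ_succ]
    ring

theorem det_integral_eq_integral_det (μ : Fin n → Measure ℝ) [∀ i, SigmaFinite (μ i)]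
    (f : Fin n → ℝ → ℝ) (hf : ∀ i j, Integrable (f j) (μ i)) :
    det (of fun i j => ∫ y, f j y ∂(μ i)) =
      ∫ x : Fin n → ℝ, det (of fun i j => f j (x i)) ∂(Measure.pi μ) := by
  have h : ∀ σ : Perm (Fin n), Integrable (fun x : Fin n → ℝ =>
      ((σ.sign : ℤ) : ℝ) * ∏ i, f (σ i) (x i)) (Measure.pi μ) := fun σ =>
    (Integrable.fintype_prod (f := fun i y => f (σ i) y) fun i => hf i (σ i)).const_mul _
  simp only [← det_transpose (of _), det_apply', transpose_apply,
    of_apply]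
  rw [integral_finsetSum _ fun σ _ => h σ]
  refine sum_congr rfl fun σ _ => ?_
  rw [integral_const_mul, integral_fintype_prod_eq_prod (fun i y => f (σ i) y)]

/-- Total positivity of the exponential kernel. -/
theorem det_exp_mul_nonneg : ∀ {n : ℕ} {x y : Fin n → ℝ}, Monotone x → Monotone y →
    0 ≤ det (of fun i j => exp (x i * y j)) := by
  intro n
  induction n with
  | zero => intro x y _ _; simp
  | succ n ih =>
    intro x y hx hy
    set z : Fin (n + 1) → ℝ := fun j => y j - y 0 with hz
    have e1 : det (of fun i j => exp (x i * y j)) =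
        (∏ i, exp (x i * y 0)) *
          det (of fun i j => exp (x i * z j)) := by
      rw [← det_mul_column]
      congr 2
      ext i j
      rw [of_apply, ← Real.exp_add]
      congr 1
      simp only [hz]; ring
    rw [e1]
    refine mul_nonneg (prod_nonneg fun i _ => (exp_pos _).le) ?_
    set A := of fun i j => exp (x i * z j) with hA
    set B : Matrix (Fin (n + 1)) (Fin (n + 1)) ℝ := of fun i j =>
      (cons (α := fun _ => ℝ) (A 0 j) (fun i : Fin n => A i.succ j - A i.castSucc j) :
        Fin (n + 1) → ℝ) i with hB
    have e2 : A.det = B.det := by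
      refine Matrix.det_eq_of_forall_row_eq_smul_add_pred (fun _ => 1) (fun j => ?_) fun i j => ?_
      · simp [hB]
      · simp [hB]
    have e3 : B.det = (B.submatrix Fin.succ Fin.succ).det := by
      rw [Matrix.det_succ_column_zero, Fin.sum_univ_succ]
      have : ∀ i : Fin n, B i.succ 0 = 0 := fun i => by simp [hB, hA, hz]
      simp only [this]
      simp [hB, hA, hz]
    set μ : Fin n → Measure ℝ := fun i => volume.restrict (Ioc (x i.castSucc) (x i.succ)) with hμ
    have e4 : B.submatrix Fin.succ Fin.succ = of fun i j =>
        ∫ ξ, z j.succ * exp (ξ * z j.succ) ∂(μ i) := by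
      ext i j
      have hle : x i.castSucc ≤ x i.succ := hx (Fin.castSucc_lt_succ).le
      have : ∫ ξ in x i.castSucc..x i.succ, z j.succ * exp (ξ * z j.succ) =
          exp (x i.succ * z j.succ) - exp (x i.castSucc * z j.succ) := by
        refine intervalIntegral.integral_eq_sub_of_hasDerivAt
          (f := fun ξ => exp (ξ * z j.succ)) (fun ξ _ => ?_)
          (Continuous.intervalIntegrable (by fun_prop) _ _)
        have := ((hasDerivAt_id ξ).mul_const (z j.succ)).exp
        simp only [id, one_mul] at this
        rw [mul_comm]
        exact this
      rw [of_apply, ← integral_of_le hle, this]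
      simp [hB, hA]
    have hint : ∀ i j, Integrable (fun ξ => z (Fin.succ j) * exp (ξ * z j.succ)) (μ i) := by
      intro i j
      have : Continuous fun ξ => z (Fin.succ j) * exp (ξ * z j.succ) := by fun_prop
      exact this.integrableOn_Ioc
    rw [e2, e3, e4, det_integral_eq_integral_det μ (fun j ξ => z j.succ * exp (ξ * z j.succ))
      hint]
    refine integral_nonneg_of_ae ?_
    have hae : ∀ᵐ ξ ∂(Measure.pi μ), ∀ i, ξ i ∈ Ioc (x i.castSucc) (x i.succ) := by
      rw [eventually_all]
      intro i
      exact (Measure.tendsto_eval_ae_ae (μ := μ) (i := i)).eventually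
        (ae_restrict_mem measurableSet_Ioc)
    filter_upwards [hae] with ξ hξ
    have := det_mul_row (fun j : Fin n => z j.succ)
      (of fun i j : Fin n => exp (ξ i * z j.succ))
    simp only [of_apply] at this
    rw [Pi.zero_apply, this]
    refine mul_nonneg (prod_nonneg fun j _ => ?_) (ih ?_ ?_)
    · simpa [hz] using hy (Fin.zero_le j.succ)
    · intro i j hij
      rcases hij.eq_or_lt with h | h
      · rw [h]
      · refine (hξ i).2.trans (le_trans (hx ?_) (hξ j).1.le)
        exact Fin.succ_le_castSucc_iff.mpr h
    · intro i j hij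
      simpa [hz] using hy (Fin.succ_le_succ_iff.mpr hij)

theorem det_brownianDensity_nonneg (ht : 0 < t) {x y : Fin n → ℝ}
    (hx : Monotone x) (hy : Monotone y) :
    0 ≤ det (of fun i j => brownianDensity t (x i) (y j)) := by
  have e : (of fun i j => brownianDensity t (x i) (y j)) =
      of fun i j => (exp (-(x i) ^ 2 / t) / √(π * t)) *
        (of fun i j => exp (-(y j) ^ 2 / t) *
          (of fun i j => exp (x i * (2 * y j / t))) i j) i j := by
    ext i j
    simp only [of_apply, brownianDensity]
    rw [div_mul_eq_mul_div, ← mul_assoc, ← Real.exp_add, ← Real.exp_add]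
    congr 2
    field_simp
    ring
  rw [e, det_mul_column, det_mul_row]
  refine mul_nonneg (prod_nonneg fun i _ => by positivity)
    (mul_nonneg (prod_nonneg fun i _ => by positivity) (det_exp_mul_nonneg hx ?_))
  intro i j hij
  have := hy hij
  simp only
  gcongr

theorem karlinMcGregor_one (γ δ : Fin n → ℝ) (t : Fin 1 → ℝ) (x : Fin 1 → Fin n → ℝ) :
    karlinMcGregor γ δ t x =
      det (of fun i j : Fin n => brownianDensity (t 0) (γ i) (x 0 j)) *
      det (of fun i j : Fin n => brownianDensity (1 - t 0) (x 0 i) (δ j)) := by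
  rw [karlinMcGregor_eq_from, ← Fin.cons_self_tail x, karlinMcGregorFrom_cons,
    karlinMcGregorFrom_zero, sub_zero]
  rfl

theorem karlinMcGregor_one_nonneg {γ δ : Fin n → ℝ} (hγ : Monotone γ) (hδ : Monotone δ)
    {t : Fin 1 → ℝ} (h0 : 0 < t 0) (h1 : t 0 < 1) (x : Fin 1 → Fin n → ℝ) :
    0 ≤ karlinMcGregor γ δ t x := by
  rw [karlinMcGregor_one]
  set σ := Tuple.sort (x 0)
  have hs : Monotone (x 0 ∘ σ) := Tuple.monotone_sort (x 0)
  have h2 := mul_nonneg (det_brownianDensity_nonneg h0 hγ hs)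
    (det_brownianDensity_nonneg (t := 1 - t 0) (by linarith) hs hδ)
  have e1 := Matrix.det_permute' σ
    (of fun i j : Fin n => brownianDensity (t 0) (γ i) (x 0 j))
  have e2 := Matrix.det_permute σ
    (of fun i j : Fin n => brownianDensity (1 - t 0) (x 0 i) (δ j))
  have e3 : ((σ.sign : ℤ) : ℝ) * ((σ.sign : ℤ) : ℝ) = 1 := by
    rcases Int.units_eq_one_or σ.sign with h | h <;> simp [h]
  change 0 ≤ (Matrix.submatrix (of fun i j : Fin n =>
      brownianDensity (t 0) (γ i) (x 0 j)) id σ).det * (Matrix.submatrix (of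
      fun i j : Fin n => brownianDensity (1 - t 0) (x 0 i) (δ j)) σ id).det at h2
  rw [e1, e2, mul_mul_mul_comm, e3, one_mul] at h2
  exact h2

/-- The integral of `g` along the contour `Γ` with complex weight `w`. -/
def contourIntegral (Γ w : ℝ → ℂ) (g : ℂ → ℂ) : ℂ :=
  ∫ s in Icc (0 : ℝ) 1, g (Γ s) * w s

/-- The contour `Γ`, with weight `w`, reproduces the values of entire functions at the points of
`V` through Cauchy's formula. -/
structure IsCauchyContour (Γ w : ℝ → ℂ) (V : Set ℂ) : Prop where
  isOpen : IsOpen V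
  measurable_path : Measurable Γ
  measurable_weight : Measurable w
  bounded_path : ∃ R, ∀ s ∈ Icc (0 : ℝ) 1, ‖Γ s‖ ≤ R
  bounded_weight : ∃ R, ∀ s ∈ Icc (0 : ℝ) 1, ‖w s‖ ≤ R
  separated : ∃ c > 0, ∀ s ∈ Icc (0 : ℝ) 1, ∀ z ∈ V, c ≤ ‖Γ s - z‖
  cauchy : ∀ f : ℂ → ℂ, Differentiable ℂ f → ∀ z ∈ V,
    contourIntegral Γ w (fun v => f v / (v - z)) = f z

namespace IsCauchyContour


theorem integrable (hΓ : IsCauchyContour Γ w V) {g : ℂ → ℂ} (hg : Measurable g) (hB : ∀ s ∈ Icc (0 : ℝ) 1, ‖g (Γ s)‖ ≤ B) :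
    IntegrableOn (fun s => g (Γ s) * w s) (Icc 0 1) := by
  obtain ⟨R, hR⟩ := hΓ.bounded_weight
  refine Measure.integrableOn_of_bounded (M := B * R) (by simp) ?_ ?_
  · exact ((hg.comp hΓ.measurable_path).mul hΓ.measurable_weight).aestronglyMeasurable
  · refine (ae_restrict_mem measurableSet_Icc).mono fun s hs => ?_
    rw [norm_mul]
    exact mul_le_mul (hB s hs) (hR s hs) (norm_nonneg _) ((norm_nonneg _).trans (hB s hs))

theorem exists_norm_le (hΓ : IsCauchyContour Γ w V) : ∃ C, 0 ≤ C ∧ ∀ (g : ℂ → ℂ) (B : ℝ),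
    (∀ s ∈ Icc (0 : ℝ) 1, ‖g (Γ s)‖ ≤ B) → ‖contourIntegral Γ w g‖ ≤ C * B := by
  obtain ⟨R, hR⟩ := hΓ.bounded_weight
  refine ⟨R, (norm_nonneg _).trans (hR 0 (by simp)), fun g B hB => ?_⟩
  refine (norm_setIntegral_le_of_norm_le_const (C := R * B) (by simp) fun s hs => ?_).trans
    (by simp)
  rw [norm_mul, mul_comm]
  exact mul_le_mul (hR s hs) (hB s hs) (norm_nonneg _) ((norm_nonneg _).trans (hR s hs))

theorem tendsto (hΓ : IsCauchyContour Γ w V) {ι : Type*} {l : Filter ι} [l.IsCountablyGenerated]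
    {g : ι → ℂ → ℂ} {g' : ℂ → ℂ} (hg : ∀ᶠ ν in l, Measurable (g ν))
    (hB : ∀ᶠ ν in l, ∀ s ∈ Icc (0 : ℝ) 1, ‖g ν (Γ s)‖ ≤ B)
    (hlim : ∀ s ∈ Icc (0 : ℝ) 1, Tendsto (fun ν => g ν (Γ s)) l (𝓝 (g' (Γ s)))) :
    Tendsto (fun ν => contourIntegral Γ w (g ν)) l (𝓝 (contourIntegral Γ w g')) := by
  obtain ⟨R, hR⟩ := hΓ.bounded_weight
  refine tendsto_integral_filter_of_dominated_convergence (fun _ => B * R) ?_ ?_ ?_ ?_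
  · exact hg.mono fun ν h =>
      ((h.comp hΓ.measurable_path).mul hΓ.measurable_weight).aestronglyMeasurable
  · refine hB.mono fun ν h => (ae_restrict_mem measurableSet_Icc).mono fun s hs => ?_
    rw [norm_mul]
    exact mul_le_mul (h s hs) (hR s hs) (norm_nonneg _) ((norm_nonneg _).trans (h s hs))
  · exact integrableOn_const (by simp)
  · exact (ae_restrict_mem measurableSet_Icc).mono fun s hs => (hlim s hs).mul_const _

theorem exists_norm_path_le (hΓ : IsCauchyContour Γ w V) (hf : Continuous f) :
    ∃ B, 0 ≤ B ∧ ∀ s ∈ Icc (0 : ℝ) 1, ‖f (Γ s)‖ ≤ B := by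
  obtain ⟨R, hR⟩ := hΓ.bounded_path
  obtain ⟨B, hB⟩ := (isCompact_closedBall (0 : ℂ) R).exists_bound_of_continuousOn hf.continuousOn
  exact ⟨B, (norm_nonneg _).trans (hB (Γ 0) (by simpa using hR 0 (by simp))),
    fun s hs => hB _ (by simpa using hR s hs)⟩

theorem sub_ne_zero (hΓ : IsCauchyContour Γ w V) {s : ℝ} (hs : s ∈ Icc (0 : ℝ) 1) {z : ℂ}
    (hz : z ∈ V) : Γ s - z ≠ 0 := by
  obtain ⟨c, hc, h⟩ := hΓ.separated
  exact norm_pos_iff.mp (hc.trans_le (h s hs z hz))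

theorem eventually_mem (hΓ : IsCauchyContour Γ w V) {ι : Type*} {l : Filter ι}
    {δ : ι → Fin n → ℂ} {δ' : Fin n → ℂ} (hδ' : ∀ j, δ' j ∈ V) (hδ : Tendsto δ l (𝓝 δ')) :
    ∀ᶠ ν in l, ∀ j, δ ν j ∈ V :=
  eventually_all.mpr fun j => (tendsto_pi_nhds.mp hδ j).eventually (hΓ.isOpen.mem_nhds (hδ' j))

theorem exists_norm_prod_le (hΓ : IsCauchyContour Γ w V) (n : ℕ) : ∃ C, 0 ≤ C ∧
    ∀ (δ : Fin n → ℂ), (∀ j, δ j ∈ V) → ∀ (S : Finset (Fin n)), ∀ s ∈ Icc (0 : ℝ) 1,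
      ‖(∏ j ∈ S, (Γ s - δ j))⁻¹‖ ≤ C := by
  obtain ⟨c, hc, h⟩ := hΓ.separated
  refine ⟨(max 1 c⁻¹) ^ n, by positivity, fun δ hδ S s hs => ?_⟩
  rw [← Finset.prod_inv_distrib, norm_prod]
  calc ∏ j ∈ S, ‖(Γ s - δ j)⁻¹‖ ≤ ∏ _j ∈ S, max 1 c⁻¹ := by
        refine Finset.prod_le_prod (fun _ _ => norm_nonneg _) fun j _ => ?_
        rw [norm_inv]
        exact (inv_anti₀ hc (h s hs _ (hδ j))).trans (le_max_right _ _)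
    _ = (max 1 c⁻¹) ^ S.card := by simp
    _ ≤ (max 1 c⁻¹) ^ n := pow_le_pow_right₀ (le_max_left _ _)
        (by simpa using Finset.card_le_univ S)

end IsCauchyContour

theorem integral_entire_eq_zero (hΓ : IsCauchyContour Γ w V)
    {z : ℂ} (hz : z ∈ V) (hf : Differentiable ℂ f) : contourIntegral Γ w f = 0 := by
  have := hΓ.cauchy (fun v => (v - z) * f v) (by fun_prop) z hz
  rw [sub_self, zero_mul] at this
  rw [← this]
  refine setIntegral_congr_fun measurableSet_Icc fun s hs => ?_
  simp only
  rw [mul_div_cancel_left₀ _ (hΓ.sub_ne_zero hs hz)]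

theorem integral_inv_prod_eq_zero (hΓ : IsCauchyContour Γ w V) (hδ : ∀ j, δ j ∈ V) {S : Finset (Fin n)} (hS : S.Nonempty) {z : ℂ}
    (hz : z ∈ V) : contourIntegral Γ w (fun v => (∏ j ∈ S, (v - δ j))⁻¹ * (v - z)⁻¹) = 0 := by
  obtain ⟨c, hc, hsep⟩ := hΓ.separated
  obtain ⟨C, hC0, hC⟩ := hΓ.exists_norm_prod_le n
  have hb : ∀ (T : Finset (Fin n)) (z : ℂ), z ∈ V → ∀ s ∈ Icc (0 : ℝ) 1,
      ‖(∏ j ∈ T, (Γ s - δ j))⁻¹ * (Γ s - z)⁻¹‖ ≤ C * c⁻¹ := fun T z hz s hs => by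
    rw [norm_mul, norm_inv (_ - _)]
    exact mul_le_mul (hC δ hδ T s hs) (inv_anti₀ hc (hsep s hs z hz)) (by positivity) hC0
  have hm : ∀ (T : Finset (Fin n)) (z : ℂ),
      Measurable fun v : ℂ => (∏ j ∈ T, (v - δ j))⁻¹ * (v - z)⁻¹ := by
    intro T z; fun_prop
  set G : Finset (Fin n) → ℂ → ℂ := fun T z =>
    contourIntegral Γ w fun v => (∏ j ∈ T, (v - δ j))⁻¹ * (v - z)⁻¹
  have step : ∀ (T : Finset (Fin n)) (i : Fin n), i ∉ T → (∃ k, ∀ z ∈ V, G T z = k) →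
      ∀ z ∈ V, G (insert i T) z = 0 := by
    rintro T i hi ⟨k, hk⟩ z hz
    have hne : ∀ z ∈ V, z ≠ δ i → G (insert i T) z = 0 := by
      intro z hz hzi
      have : G (insert i T) z = (z - δ i)⁻¹ * (G T z - G T (δ i)) := by
        simp only [G, contourIntegral]
        rw [← integral_sub (hΓ.integrable (hm T z) (hb T z hz))
          (hΓ.integrable (hm T (δ i)) (hb T (δ i) (hδ i))), ← integral_const_mul]
        refine setIntegral_congr_fun measurableSet_Icc fun s hs => ?_
        have h1 := hΓ.sub_ne_zero hs hz
        have h2 := hΓ.sub_ne_zero hs (hδ i)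
        have h0 := sub_ne_zero.mpr hzi
        have h3 : (Γ s - δ i)⁻¹ * (Γ s - z)⁻¹ =
            (z - δ i)⁻¹ * ((Γ s - z)⁻¹ - (Γ s - δ i)⁻¹) := by
          field_simp
          ring
        simp only [Finset.prod_insert hi, mul_inv]
        linear_combination (∏ j ∈ T, (Γ s - δ j))⁻¹ * w s * h3
      rw [this, hk z hz, hk _ (hδ i), sub_self, mul_zero]
    by_cases hzi : z = δ i
    · have hV : V ∈ 𝓝[≠] z := mem_nhdsWithin_of_mem_nhds (hΓ.isOpen.mem_nhds hz)
      have hlim : Tendsto (G (insert i T)) (𝓝[≠] z) (𝓝 (G (insert i T) z)) := by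
        refine hΓ.tendsto (B := C * c⁻¹) (Eventually.of_forall fun z' => hm _ z') ?_ fun s hs => ?_
        · filter_upwards [hV] with z' hz'
          exact hb _ z' hz'
        · exact Tendsto.const_mul _ (Tendsto.inv₀ ((continuous_const.sub
            continuous_id).continuousAt.tendsto.mono_left nhdsWithin_le_nhds) (hΓ.sub_ne_zero hs hz))
      refine tendsto_nhds_unique hlim ((tendsto_congr' ?_).mpr tendsto_const_nhds)
      filter_upwards [hV, self_mem_nhdsWithin] with z' hz' hne' using hne z' hz' (hzi ▸ hne')
    · exact hne z hz hzi
  have hconst : ∀ T, ∃ k, ∀ z ∈ V, G T z = k := by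
    intro T
    induction T using Finset.induction_on with
    | empty => exact ⟨1, fun z hz => by simpa [G] using hΓ.cauchy (fun _ => 1) (by fun_prop) z hz⟩
    | insert i T hi ih => exact ⟨0, step T i hi ih⟩
  obtain ⟨i, hi⟩ := hS
  rw [← Finset.insert_erase hi]
  exact step _ i (Finset.notMem_erase i S) (hconst _) z hz

/-- The nodal polynomials `∏_{j < k} (w - δ j)`. -/
def nodal {n : ℕ} (δ : Fin n → ℂ) (k : ℕ) (w : ℂ) : ℂ :=
  ∏ j ∈ Finset.univ.filter fun j : Fin n => (j : ℕ) < k, (w - δ j)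

theorem nodal_zero (δ : Fin n → ℂ) (w : ℂ) : nodal δ 0 w = 1 := by simp [nodal]

theorem nodal_succ (δ : Fin n → ℂ) (k : Fin n) (w : ℂ) :
    nodal δ (k + 1) w = nodal δ k w * (w - δ k) := by
  have : (Finset.univ.filter fun j : Fin n => (j : ℕ) < k + 1) =
      insert k (Finset.univ.filter fun j : Fin n => (j : ℕ) < k) := by
    ext j; simp [Fin.ext_iff]; omega
  rw [nodal, this, Finset.prod_insert (by simp), mul_comm]; rfl

theorem nodal_mul_prod (δ : Fin n → ℂ) {k l : ℕ} (h : k ≤ l) (w : ℂ) :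
    nodal δ k w * ∏ j ∈ Finset.univ.filter fun j : Fin n => k ≤ j ∧ j < l, (w - δ j) =
      nodal δ l w := by
  rw [nodal, nodal, ← Finset.prod_union]
  · refine prod_congr ?_ fun _ _ => rfl
    ext j
    simp only [mem_filter, Finset.mem_univ, true_and, Finset.mem_union]
    omega
  · rw [Finset.disjoint_left]
    intro j hj
    simp only [mem_filter, Finset.mem_univ, true_and] at hj ⊢
    omega

theorem nodal_eq_zero (δ : Fin n → ℂ) {j : Fin n} (h : (j : ℕ) < k) :
    nodal δ k (δ j) = 0 :=
  prod_eq_zero (i := j) (by simpa using h) (sub_self _)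

theorem continuous_nodal (δ : Fin n → ℂ) (k : ℕ) : Continuous (nodal δ k) := by
  unfold nodal; fun_prop

theorem sum_nodal_div_nodal (δ : Fin n → ℂ) {v : ℂ} (hv : ∀ j, v - δ j ≠ 0) (z : ℂ) :
    ∀ K ≤ n, (v - z) * ∑ k ∈ Finset.univ.filter (fun k : Fin n => (k : ℕ) < K),
      nodal δ k z / nodal δ (k + 1) v = 1 - nodal δ K z / nodal δ K v := by
  intro K
  induction K with
  | zero => intro _; simp [nodal_zero]
  | succ K ih =>
    intro hK
    have : (Finset.univ.filter fun j : Fin n => (j : ℕ) < K + 1) =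
        insert (⟨K, hK⟩ : Fin n) (Finset.univ.filter fun j : Fin n => (j : ℕ) < K) := by
      ext j; simp [Fin.ext_iff]; omega
    rw [this, Finset.sum_insert (by simp), mul_add, ih (by omega)]
    have h1 := nodal_succ δ ⟨K, hK⟩ v
    have h2 := nodal_succ δ ⟨K, hK⟩ z
    simp only at h1 h2
    rw [h1, h2]
    have h3 : nodal δ K v ≠ 0 := Finset.prod_ne_zero_iff.mpr fun j _ => hv j
    have h4 := hv ⟨K, hK⟩
    field_simp
    ring

theorem sum_nodal_div_nodal_univ (δ : Fin n → ℂ) {v : ℂ} (hv : ∀ j, v - δ j ≠ 0) (z : ℂ) :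
    (v - z) * ∑ k : Fin n, nodal δ k z / nodal δ (k + 1) v =
      1 - nodal δ n z / nodal δ n v := by
  rw [← sum_nodal_div_nodal δ hv z n le_rfl]
  simp

theorem inv_sub_eq_sum (δ : Fin n → ℂ) {v : ℂ} (hv : ∀ j, v - δ j ≠ 0) (i : Fin n) :
    (v - δ i)⁻¹ = ∑ k : Fin n, nodal δ k (δ i) / nodal δ (k + 1) v := by
  have h := sum_nodal_div_nodal_univ δ hv (δ i)
  rw [nodal_eq_zero δ i.2, zero_div, sub_zero] at h
  exact inv_eq_of_mul_eq_one_right h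

/-- The divided difference of `f` at `δ 0, …, δ k`. -/
def dividedDifference (Γ w : ℝ → ℂ) {n : ℕ} (δ : Fin n → ℂ) (k : ℕ) (f : ℂ → ℂ) : ℂ :=
  contourIntegral Γ w fun v => f v / nodal δ (k + 1) v

section dividedDifference

variable (hΓ : IsCauchyContour Γ w V)
include hΓ

theorem exists_norm_inv_nodal_le (n : ℕ) : ∃ C, 0 ≤ C ∧ ∀ (δ : Fin n → ℂ), (∀ j, δ j ∈ V) →
    ∀ k, ∀ s ∈ Icc (0 : ℝ) 1, ‖(nodal δ k (Γ s))⁻¹‖ ≤ C := by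
  obtain ⟨C, h0, hC⟩ := hΓ.exists_norm_prod_le n
  exact ⟨C, h0, fun δ hδ k s hs => hC δ hδ _ s hs⟩

theorem integrable_dividedDifference (hδ : ∀ j, δ j ∈ V) (k : ℕ) (hf : Continuous f) :
    IntegrableOn (fun s => f (Γ s) / nodal δ (k + 1) (Γ s) * w s) (Icc 0 1) := by
  obtain ⟨C, h0, hC⟩ := exists_norm_inv_nodal_le hΓ n
  obtain ⟨B, hB0, hB⟩ := hΓ.exists_norm_path_le hf
  refine hΓ.integrable (g := fun v => f v / nodal δ (k + 1) v) (B := B * C)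
    (hf.measurable.div (continuous_nodal δ _).measurable) fun s hs => ?_
  rw [div_eq_mul_inv, norm_mul]
  exact mul_le_mul (hB s hs) (hC δ hδ _ s hs) (norm_nonneg _) hB0

theorem newton_interpolation (hδ : ∀ j, δ j ∈ V) (hf : Differentiable ℂ f) (i : Fin n) :
    f (δ i) = ∑ k : Fin n, nodal δ k (δ i) * dividedDifference Γ w δ k f := by
  rw [← hΓ.cauchy f hf (δ i) (hδ i)]
  simp only [dividedDifference, contourIntegral, ← integral_const_mul]
  rw [← integral_finsetSum (f := fun (k : Fin n) s =>
    nodal δ k (δ i) * (f (Γ s) / nodal δ (k + 1) (Γ s) * w s)) _ fun k _ =>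
    (integrable_dividedDifference hΓ hδ k hf.continuous).const_mul _]
  refine setIntegral_congr_fun measurableSet_Icc fun s hs => ?_
  rw [div_eq_mul_inv, inv_sub_eq_sum δ (fun j => hΓ.sub_ne_zero hs (hδ j)) i, mul_sum,
    sum_mul]
  refine sum_congr rfl fun k _ => ?_
  ring

theorem tendsto_dividedDifference {ι : Type*} {l : Filter ι}
    [l.IsCountablyGenerated]
    {δ : ι → Fin n → ℂ} {δ' : Fin n → ℂ} (hδ' : ∀ j, δ' j ∈ V) (hδ : Tendsto δ l (𝓝 δ')) (k : ℕ)
    {f : ι → ℂ → ℂ} {f' : ℂ → ℂ} (hf : ∀ᶠ ν in l, Continuous (f ν)) (hB : ∀ᶠ ν in l, ∀ s ∈ Icc (0 : ℝ) 1, ‖f ν (Γ s)‖ ≤ B)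
    (hlim : ∀ s ∈ Icc (0 : ℝ) 1, Tendsto (fun ν => f ν (Γ s)) l (𝓝 (f' (Γ s)))) :
    Tendsto (fun ν => dividedDifference Γ w (δ ν) k (f ν)) l
      (𝓝 (dividedDifference Γ w δ' k f')) := by
  obtain ⟨C, h0, hC⟩ := exists_norm_inv_nodal_le hΓ n
  refine hΓ.tendsto (B := B * C) ?_ ?_ ?_
  · exact hf.mono fun ν h => h.measurable.div (continuous_nodal _ _).measurable
  · filter_upwards [hB, hΓ.eventually_mem hδ' hδ] with ν h1 h2 s hs
    rw [div_eq_mul_inv, norm_mul]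
    exact mul_le_mul (h1 s hs) (hC _ h2 _ s hs) (norm_nonneg _) ((norm_nonneg _).trans (h1 s hs))
  · intro s hs
    refine (hlim s hs).div ?_ (Finset.prod_ne_zero_iff.mpr fun j _ => hΓ.sub_ne_zero hs (hδ' j))
    exact tendsto_finsetProd _ fun j _ => tendsto_const_nhds.sub ((tendsto_pi_nhds.mp hδ) j)

theorem exists_norm_dividedDifference_le (n : ℕ) : ∃ C, 0 ≤ C ∧ ∀ (δ : Fin n → ℂ),
    (∀ j, δ j ∈ V) → ∀ (k : ℕ) (f : ℂ → ℂ) (B : ℝ), (∀ s ∈ Icc (0 : ℝ) 1, ‖f (Γ s)‖ ≤ B) →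
      ‖dividedDifference Γ w δ k f‖ ≤ C * B := by
  obtain ⟨C, h0, hC⟩ := exists_norm_inv_nodal_le hΓ n
  obtain ⟨C', h0', hC'⟩ := hΓ.exists_norm_le
  refine ⟨C' * C, by positivity, fun δ hδ k f B hB => ?_⟩
  rw [mul_assoc]
  refine hC' _ _ fun s hs => ?_
  rw [div_eq_mul_inv, norm_mul, mul_comm]
  exact mul_le_mul (hC _ hδ _ s hs) (hB s hs) (norm_nonneg _) h0

theorem dividedDifference_nodal (hδ : ∀ j, δ j ∈ V)
    (k l : Fin n) : dividedDifference Γ w δ l (nodal δ k) = if k = l then 1 else 0 := by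
  have hne : ∀ s ∈ Icc (0 : ℝ) 1, ∀ k, nodal δ k (Γ s) ≠ 0 := fun s hs k =>
    Finset.prod_ne_zero_iff.mpr fun j _ => hΓ.sub_ne_zero hs (hδ j)
  rcases lt_trichotomy k l with h | h | h
  · rw [if_neg h.ne, ← integral_inv_prod_eq_zero hΓ hδ (S := Finset.univ.filter fun j : Fin n =>
      (k : ℕ) ≤ j ∧ (j : ℕ) < l) ⟨k, by simpa using h⟩ (hδ l)]
    refine setIntegral_congr_fun measurableSet_Icc fun s hs => ?_
    simp only
    rw [nodal_succ, ← nodal_mul_prod δ (lt_def.mp h).le, mul_assoc, div_mul_eq_div_div,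
      div_self (hne s hs _), one_div, mul_inv]
  · subst h
    rw [if_pos rfl, ← hΓ.cauchy (fun _ => 1) (by fun_prop) (δ k) (hδ k)]
    refine setIntegral_congr_fun measurableSet_Icc fun s hs => ?_
    simp only
    rw [nodal_succ, div_mul_eq_div_div, div_self (hne s hs _)]
  · rw [if_neg h.ne', ← integral_entire_eq_zero hΓ (hδ l) (f := fun v =>
      ∏ j ∈ Finset.univ.filter fun j : Fin n => l + 1 ≤ (j : ℕ) ∧ (j : ℕ) < k, (v - δ j))
      (by fun_prop)]
    refine setIntegral_congr_fun measurableSet_Icc fun s hs => ?_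
    simp only
    rw [← nodal_mul_prod δ (lt_def.mp h), Nat.succ_eq_add_one, mul_div_cancel_left₀ _ (hne s hs _)]

end dividedDifference

/-- `e^{u²}` times the Brownian transition density, for complex starting points `u`. -/
def gaussWeight (t : ℝ) (u : ℂ) (y : ℝ) : ℂ :=
  cexp (u ^ 2 - (u - y) ^ 2 / t) / (√(π * t) : ℝ)

theorem gaussWeight_ofReal (t u y : ℝ) :
    gaussWeight t u y = exp (u ^ 2) * (brownianDensity t u y : ℂ) := by
  unfold gaussWeight brownianDensity
  push_cast
  rw [← mul_div_assoc, ← exp_add]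
  congr 2
  ring

theorem differentiable_gaussWeight (t y : ℝ) : Differentiable ℂ fun u => gaussWeight t u y := by
  unfold gaussWeight; fun_prop

theorem continuous_gaussWeight (t : ℝ) : Continuous fun z : ℝ × ℂ => gaussWeight t z.2 z.1 := by
  unfold gaussWeight; fun_prop

theorem norm_gaussWeight_le (ht : 0 < t) {R : ℝ} {u : ℂ} (hu : ‖u‖ ≤ R) (y : ℝ) :
    ‖gaussWeight t u y‖ ≤
      exp (R ^ 2 + 2 * R ^ 2 / t) / √(π * t) * exp (-y ^ 2 / (2 * t)) := by
  rw [gaussWeight, norm_div, norm_exp, norm_real,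
    norm_of_nonneg (sqrt_nonneg _), div_mul_eq_mul_div, ← Real.exp_add]
  gcongr
  have h1 : (u ^ 2 - (u - y) ^ 2 / t : ℂ).re =
      u.re ^ 2 - u.im ^ 2 - ((u.re - y) ^ 2 - u.im ^ 2) / t := by
    rw [sub_re, div_ofReal_re]
    simp [pow_two]
  have h2 : u.re ^ 2 + u.im ^ 2 ≤ R ^ 2 := by
    have := sq_norm u
    rw [normSq_apply] at this
    nlinarith [norm_nonneg u]
  rw [h1]
  have h3 : u.re ^ 2 - u.im ^ 2 ≤ R ^ 2 := by nlinarith [sq_nonneg u.im]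
  have h4 : -((u.re - y) ^ 2 - u.im ^ 2) / t ≤ (2 * R ^ 2 - y ^ 2 / 2) / t := by
    gcongr
    nlinarith [sq_nonneg (y - 2 * u.re)]
  have h5 : (2 * R ^ 2 - y ^ 2 / 2) / t = 2 * R ^ 2 / t + -y ^ 2 / (2 * t) := by
    field_simp
    ring
  rw [neg_div] at h4
  linarith

theorem norm_gaussWeight_le' (ht : 0 < t) {R : ℝ} {u : ℂ} (hu : ‖u‖ ≤ R) (y : ℝ) :
    ‖gaussWeight t u y‖ ≤ exp (R ^ 2 + 2 * R ^ 2 / t) / √(π * t) := by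
  refine (norm_gaussWeight_le ht hu y).trans (mul_le_of_le_one_right (by positivity) ?_)
  rw [Real.exp_le_one_iff, neg_div]
  have : 0 ≤ y ^ 2 / (2 * t) := by positivity
  linarith

/-- The Gram matrix of the free evolution between divided differences at the starting points `γ`
and at the end points `δ`. -/
def freeGram (Γ1 w1 Γ2 w2 : ℝ → ℂ) {n : ℕ} (γ δ : Fin n → ℂ) : Matrix (Fin n) (Fin n) ℂ :=
  of fun k l => dividedDifference Γ1 w1 γ k (fun u =>
    dividedDifference Γ2 w2 δ l (fun v => cexp (2 * u * v))) / (√π : ℝ)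

/-- Divided differences of the Gaussian weights. -/
def nodeWeight (Γ w : ℝ → ℂ) {n : ℕ} (δ : Fin n → ℂ) (k : Fin n) (t y : ℝ) : ℂ :=
  dividedDifference Γ w δ k fun u => gaussWeight t u y

/-- The Gram matrix of the evolution which avoids the sets `E i` at the times `t i`. -/
def gapGram (Γ1 w1 Γ2 w2 : ℝ → ℂ) {n m : ℕ} (γ δ : Fin n → ℂ) (t : Fin m → ℝ)
    (E : Fin m → Set ℝ) : Matrix (Fin n) (Fin n) ℂ :=
  freeGram Γ1 w1 Γ2 w2 γ δ - of fun k l => ∑ i, ∫ y in E i,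
    nodeWeight Γ1 w1 γ k (t i) y *
      avoidingWeight m t E (fun i => nodeWeight Γ2 w2 δ l (1 - t i)) i y

/-- Values of the nodal polynomials at the nodes. -/
def nodalMatrix {n : ℕ} (γ : Fin n → ℂ) : Matrix (Fin n) (Fin n) ℂ :=
  of fun i k => nodal γ k (γ i)

theorem det_nodalMatrix_ne_zero {γ : Fin n → ℂ} (hγ : Injective γ) :
    (nodalMatrix γ).det ≠ 0 := by
  rw [Matrix.det_of_isLowerTriangular]
  · refine Finset.prod_ne_zero_iff.mpr fun i _ => ?_
    rw [nodalMatrix, of_apply, nodal]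
    refine Finset.prod_ne_zero_iff.mpr fun j hj => ?_
    rw [Ne, sub_eq_zero]
    intro h
    have := hγ h
    subst this
    simp at hj
  · intro i k hik
    exact nodal_eq_zero γ hik

section contour

variable (hΓ : IsCauchyContour Γ w V)
include hΓ

theorem continuous_dividedDifference {X : Type*} [MetricSpace X] [ProperSpace X] (hδ : ∀ j, δ j ∈ V)
    (k : ℕ) {f : X → ℂ → ℂ} (hf : Continuous fun z : X × ℂ => f z.1 z.2) :
    Continuous fun x => dividedDifference Γ w δ k (f x) := by
  rw [continuous_iff_continuousAt]
  intro x
  obtain ⟨R, hR⟩ := hΓ.bounded_path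
  obtain ⟨B, hB⟩ := ((isCompact_closedBall x 1).prod
    (isCompact_closedBall (0 : ℂ) R)).exists_bound_of_continuousOn hf.continuousOn
  refine tendsto_dividedDifference hΓ hδ (tendsto_const_nhds) k (B := B)
    (Eventually.of_forall fun x => hf.comp (Continuous.prodMk_right x)) ?_ ?_
  · filter_upwards [Metric.closedBall_mem_nhds x one_pos] with x' hx' s hs
    exact hB (x', Γ s) ⟨hx', by simpa using hR s hs⟩
  · intro s _
    exact (hf.comp (Continuous.prodMk_left (Γ s))).continuousAt

theorem dividedDifference_sum
    (hδ : ∀ j, δ j ∈ V) (k : ℕ) {ι : Type*} (S : Finset ι) (c : ι → ℂ)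
    {f : ι → ℂ → ℂ} (hf : ∀ l, Continuous (f l)) :
    dividedDifference Γ w δ k (fun u => ∑ l ∈ S, c l * f l u) =
      ∑ l ∈ S, c l * dividedDifference Γ w δ k (f l) := by
  unfold dividedDifference contourIntegral
  simp only [← integral_const_mul]
  rw [← integral_finsetSum (f := fun l s => c l * (f l (Γ s) / nodal δ (k + 1) (Γ s) * w s)) _
    fun l _ => (integrable_dividedDifference hΓ hδ k (hf l)).const_mul _]
  congr 1 with s
  simp only [sum_div, sum_mul]
  refine sum_congr rfl fun l _ => ?_
  ring

theorem continuous_nodeWeight (hδ : ∀ j, δ j ∈ V) (k : Fin n) (t : ℝ) :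
    Continuous (nodeWeight Γ w δ k t) :=
  continuous_dividedDifference hΓ hδ k (f := fun y u => gaussWeight t u y)
    (continuous_gaussWeight t)

theorem exists_norm_nodeWeight_le (n : ℕ) (ht : 0 < t) : ∃ C, 0 ≤ C ∧ ∀ (δ : Fin n → ℂ), (∀ j, δ j ∈ V) →
      ∀ k y, ‖nodeWeight Γ w δ k t y‖ ≤ C * exp (-y ^ 2 / (2 * t)) := by
  obtain ⟨R, hR⟩ := hΓ.bounded_path
  obtain ⟨C, h0, hC⟩ := exists_norm_dividedDifference_le hΓ n
  refine ⟨C * (exp (R ^ 2 + 2 * R ^ 2 / t) / √(π * t)), by positivity,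
    fun δ hδ k y => ?_⟩
  rw [mul_assoc]
  exact hC δ hδ k _ _ fun s hs => norm_gaussWeight_le ht (hR s hs) y

theorem exists_norm_nodeWeight_le' (n : ℕ) (ht : 0 < t) : ∃ C, 0 ≤ C ∧ ∀ (δ : Fin n → ℂ), (∀ j, δ j ∈ V) →
      ∀ k y, ‖nodeWeight Γ w δ k t y‖ ≤ C := by
  obtain ⟨C, h0, hC⟩ := exists_norm_nodeWeight_le hΓ n ht
  refine ⟨C, h0, fun δ hδ k y => (hC δ hδ k y).trans (mul_le_of_le_one_right h0 ?_)⟩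
  rw [Real.exp_le_one_iff, neg_div]
  have : 0 ≤ y ^ 2 / (2 * t) := by positivity
  linarith

theorem nodeWeight_interpolation (hδ : ∀ j, δ j ∈ V) (i : Fin n) (t y : ℝ) :
    gaussWeight t (δ i) y = ∑ k : Fin n, nodalMatrix δ i k * nodeWeight Γ w δ k t y :=
  newton_interpolation hΓ hδ (differentiable_gaussWeight t y) i

theorem tendsto_nodeWeight {ι : Type*} {l : Filter ι} [l.IsCountablyGenerated]
    {δ : ι → Fin n → ℂ} {δ' : Fin n → ℂ} (hδ' : ∀ j, δ' j ∈ V) (hδ : Tendsto δ l (𝓝 δ'))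
    (k : Fin n) (t y : ℝ) :
    Tendsto (fun ν => nodeWeight Γ w (δ ν) k t y) l (𝓝 (nodeWeight Γ w δ' k t y)) := by
  obtain ⟨B, hB0, hB⟩ := hΓ.exists_norm_path_le (differentiable_gaussWeight t y).continuous
  exact tendsto_dividedDifference hΓ hδ' hδ k
    (Eventually.of_forall fun _ => (differentiable_gaussWeight t y).continuous)
    (Eventually.of_forall fun _ => hB) fun s _ => tendsto_const_nhds

end contour

section gram

/-- Integrals of products of linear combinations. -/
theorem integral_sum_mul_sum {μ : Measure ℝ} {p q : Fin n → ℝ → ℂ}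
    (h : ∀ k l, Integrable (fun y => p k y * q l y) μ) (A B : Matrix (Fin n) (Fin n) ℂ)
    (i j : Fin n) : ∫ y, (∑ k, A i k * p k y) * (∑ l, B j l * q l y) ∂μ =
      (A * (of fun k l => ∫ y, p k y * q l y ∂μ) * B.transpose) i j := by
  have hi := fun k l => (h k l).const_mul (A i k * B j l)
  simp only [Matrix.mul_apply, transpose_apply, of_apply, sum_mul, mul_sum]
  rw [sum_comm]
  calc _ = ∫ y, ∑ k, ∑ l, A i k * B j l * (p k y * q l y) ∂μ := by
        congr 1 with y
        rw [sum_comm]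
        refine sum_congr rfl fun k _ => sum_congr rfl fun l _ => ?_
        ring
    _ = _ := by
        rw [integral_finsetSum _ fun k _ => integrable_finsetSum _ fun l _ => hi k l]
        refine sum_congr rfl fun k _ => ?_
        rw [integral_finsetSum _ fun l _ => hi k l]
        refine sum_congr rfl fun l _ => ?_
        rw [integral_const_mul]
        ring

variable (c1 : IsCauchyContour Γ1 w1 V1)
  (c2 : IsCauchyContour Γ2 w2 V2)
include c1 c2

theorem exp_eq_nodal_freeGram {γ δ : Fin n → ℂ} (hγ : ∀ j, γ j ∈ V1) (hδ : ∀ j, δ j ∈ V2) (i j : Fin n) :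
    cexp (2 * γ i * δ j) / (√π : ℝ) =
      (nodalMatrix γ * freeGram Γ1 w1 Γ2 w2 γ δ * (nodalMatrix δ).transpose) i j := by
  have e1 : ∀ u, cexp (2 * u * δ j) = ∑ l : Fin n, nodal δ l (δ j) *
      dividedDifference Γ2 w2 δ l (fun v => cexp (2 * u * v)) := fun u =>
    newton_interpolation c2 hδ (f := fun v => cexp (2 * u * v)) (by fun_prop) j
  have hc : ∀ l : Fin n, Continuous fun u =>
      dividedDifference Γ2 w2 δ l (fun v => cexp (2 * u * v)) := fun l =>
    continuous_dividedDifference c2 hδ l (f := fun u v => cexp (2 * u * v))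
      (by fun_prop)
  have e2 := newton_interpolation c1 hγ (f := fun u => cexp (2 * u * δ j)) (by fun_prop) i
  have e3 : ∀ k : Fin n, dividedDifference Γ1 w1 γ k (fun u => cexp (2 * u * δ j)) =
      ∑ l : Fin n, nodal δ l (δ j) * dividedDifference Γ1 w1 γ k (fun u =>
        dividedDifference Γ2 w2 δ l (fun v => cexp (2 * u * v))) := by
    intro k
    simp only [e1]
    exact dividedDifference_sum c1 hγ k Finset.univ _ hc
  rw [e2]
  simp only [e3, Matrix.mul_apply, nodalMatrix, freeGram, of_apply, transpose_apply,
    sum_mul, mul_sum, sum_div]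
  rw [sum_comm]
  refine sum_congr rfl fun l _ => sum_congr rfl fun k _ => ?_
  ring

theorem integrable_nodeWeight_mul_avoidingWeight {γ δ : Fin n → ℂ} (hγ : ∀ j, γ j ∈ V1) (hδ : ∀ j, δ j ∈ V2)
    {t : Fin m → ℝ} {E : Fin m → Set ℝ} (ht : StrictMono t)
    (hE : ∀ i, Bornology.IsBounded (E i)) (i : Fin m) (k l : Fin n) :
    IntegrableOn (fun y => nodeWeight Γ1 w1 γ k (t i) y *
      avoidingWeight m t E (fun i => nodeWeight Γ2 w2 δ l (1 - t i)) i y) (E i) :=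
  integrableOn_of_continuous_of_isBounded ((continuous_nodeWeight c1 hγ k _).mul
    (continuous_avoidingWeight m ht hE (fun i => continuous_nodeWeight c2 hδ l _) i)) (hE i)

theorem weightedDensity_eq_nodal_gapGram {γ δ : Fin n → ℝ} (hγ : ∀ j, (γ j : ℂ) ∈ V1) (hδ : ∀ j, (δ j : ℂ) ∈ V2)
    {t : Fin m → ℝ} {E : Fin m → Set ℝ} (ht : StrictMono t)
    (hE : ∀ i, Bornology.IsBounded (E i)) (hEm : ∀ i, MeasurableSet (E i))
    (h0 : ∀ i, 0 < t i) (h1 : ∀ i, t i < 1) (i j : Fin n) :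
    (exp (γ i ^ 2) : ℂ) * (exp (δ j ^ 2)) *
      (weightedDensity m t (fun i => (E i)ᶜ.indicator 1) 0 (γ i) (δ j) : ℂ) =
      (nodalMatrix (fun i => (γ i : ℂ)) * gapGram Γ1 w1 Γ2 w2 (fun i => γ i) (fun i => δ i) t E *
        (nodalMatrix (fun i => (δ i : ℂ))).transpose) i j := by
  rw [weightedDensity_compl m ht hE hEm h0 h1 one_pos, gapGram, Matrix.mul_sub, Matrix.sub_mul,
    Matrix.sub_apply, ← exp_eq_nodal_freeGram c1 c2 hγ hδ, mul_sub]
  congr 1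
  · unfold brownianDensity
    push_cast
    rw [← exp_add, ← mul_div_assoc, ← exp_add]
    congr 2
    · ring
    · simp
  have e1 : ∀ i' y, avoidingWeight m t E (fun i y => (brownianDensity (1 - t i) y (δ j) : ℂ)) i' y *
      (exp (δ j ^ 2)) = ∑ l : Fin n, nodalMatrix (fun i => (δ i : ℂ)) j l *
      avoidingWeight m t E (fun i => nodeWeight Γ2 w2 (fun i => (δ i : ℂ)) l (1 - t i)) i' y := by
    intro i' y
    rw [← avoidingWeight_sum m Finset.univ (fun l : Fin n => nodalMatrix (fun i => (δ i : ℂ)) j l) ht hE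
      (fun l i => continuous_nodeWeight c2 hδ l _)]
    simp only [← nodeWeight_interpolation c2 hδ]
    have := avoidingWeight_sum m {()} (fun _ => (exp (δ j ^ 2) : ℂ)) ht hE
      (Ψ := fun _ i y => (brownianDensity (1 - t i) y (δ j) : ℂ)) (fun _ i =>
        Complex.continuous_ofReal.comp (continuous_id.brownianDensity continuous_const _)) i' y
    simp only [Finset.sum_singleton] at this
    rw [mul_comm, ← this]
    congr 1
    ext i y
    rw [gaussWeight_ofReal, brownianDensity_comm]
  rw [show (of fun k l : Fin n => ∑ i, ∫ y in E i, nodeWeight Γ1 w1 (fun i => (γ i : ℂ)) k (t i) y *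
      avoidingWeight m t E (fun i => nodeWeight Γ2 w2 (fun i => (δ i : ℂ)) l (1 - t i)) i y) =
      ∑ i, of fun k l => ∫ y in E i, nodeWeight Γ1 w1 (fun i => (γ i : ℂ)) k (t i) y *
      avoidingWeight m t E (fun i => nodeWeight Γ2 w2 (fun i => (δ i : ℂ)) l (1 - t i)) i y by
    ext; simp [Matrix.sum_apply], mul_sum, Matrix.mul_sum, Matrix.sum_mul, Matrix.sum_apply]
  refine sum_congr rfl fun i' _ => ?_
  rw [← integral_sum_mul_sum (integrable_nodeWeight_mul_avoidingWeight c1 c2 hγ hδ ht hE i'),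
    ← integral_const_mul]
  congr 1 with y
  rw [← e1, ← nodeWeight_interpolation c1 hγ, gaussWeight_ofReal, sub_zero]
  ring

end gram

/-- The Gram matrix of the single-time evolution weighted by `f`. -/
def statGram (Γ1 w1 Γ2 w2 : ℝ → ℂ) {n : ℕ} (γ δ : Fin n → ℂ) (t : ℝ) (f : ℝ → ℝ) :
    Matrix (Fin n) (Fin n) ℂ :=
  of fun k l => ∫ y, f y *
    (nodeWeight Γ1 w1 γ k t y * nodeWeight Γ2 w2 δ l (1 - t) y)

section gram

variable (c1 : IsCauchyContour Γ1 w1 V1)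
  (c2 : IsCauchyContour Γ2 w2 V2)

include c1 c2 in
theorem exists_norm_nodeWeight_mul_le (n : ℕ) (h0 : 0 < t) (h1 : t < 1) :
    ∃ g : ℝ → ℝ, Integrable g ∧ ∀ γ δ : Fin n → ℂ, (∀ j, γ j ∈ V1) → (∀ j, δ j ∈ V2) →
      ∀ k l y, ‖nodeWeight Γ1 w1 γ k t y * nodeWeight Γ2 w2 δ l (1 - t) y‖ ≤ g y := by
  obtain ⟨C1, hC10, hC1⟩ := exists_norm_nodeWeight_le c1 n h0
  obtain ⟨C2, hC20, hC2⟩ := exists_norm_nodeWeight_le' c2 n (sub_pos.mpr h1)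
  refine ⟨fun y => C1 * exp (-(1 / (2 * t)) * y ^ 2) * C2, ((integrable_exp_neg_mul_sq
    (by positivity)).const_mul C1).mul_const C2, fun γ δ hγ hδ k l y => ?_⟩
  rw [norm_mul]
  simp only [show -(1 / (2 * t)) * y ^ 2 = -y ^ 2 / (2 * t) by ring]
  exact mul_le_mul (hC1 _ hγ k y) (hC2 _ hδ l y) (norm_nonneg _) (by positivity)

include c1 c2 in
theorem integrable_nodeWeight_mul_nodeWeight {γ δ : Fin n → ℂ} (hγ : ∀ j, γ j ∈ V1)
    (hδ : ∀ j, δ j ∈ V2) (h0 : 0 < t) (h1 : t < 1) (k l : Fin n) :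
    Integrable fun y => nodeWeight Γ1 w1 γ k t y * nodeWeight Γ2 w2 δ l (1 - t) y := by
  obtain ⟨g, hg, h⟩ := exists_norm_nodeWeight_mul_le c1 c2 n h0 h1
  exact hg.mono' ((continuous_nodeWeight c1 hγ k _).mul
    (continuous_nodeWeight c2 hδ l _)).aestronglyMeasurable (ae_of_all _ (h γ δ hγ hδ k l))

section limits

variable {ι : Type*} {l : Filter ι} [l.IsCountablyGenerated] {γ δ : ι → Fin n → ℂ}
  {γ' δ' : Fin n → ℂ} (hγ' : ∀ j, γ' j ∈ V1) (hδ' : ∀ j, δ' j ∈ V2) (hγ : Tendsto γ l (𝓝 γ'))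
  (hδ : Tendsto δ l (𝓝 δ'))
include c1 c2 hγ' hδ' hγ hδ

theorem tendsto_freeGram :
    Tendsto (fun ν => freeGram Γ1 w1 Γ2 w2 (γ ν) (δ ν)) l
      (𝓝 (freeGram Γ1 w1 Γ2 w2 γ' δ')) := by
  have hev := c2.eventually_mem hδ' hδ
  obtain ⟨R1, hR1⟩ := c1.bounded_path
  obtain ⟨R2, hR2⟩ := c2.bounded_path
  obtain ⟨C, h0, hC⟩ := exists_norm_dividedDifference_le c2 n
  refine tendsto_pi_nhds.mpr fun k => tendsto_pi_nhds.mpr fun j => ?_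
  have hb : ∀ s ∈ Icc (0 : ℝ) 1, ∀ s' ∈ Icc (0 : ℝ) 1,
      ‖cexp (2 * Γ1 s * Γ2 s')‖ ≤ exp (2 * R1 * R2) := by
    intro s hs s' hs'
    rw [norm_exp]
    gcongr
    refine (re_le_norm _).trans ?_
    rw [norm_mul, norm_mul, norm_ofNat]
    have h3 := hR1 s hs
    have h4 := hR2 s' hs'
    have h5 : 0 ≤ R1 := (norm_nonneg _).trans h3
    gcongr
  refine Tendsto.div_const ?_ _
  refine tendsto_dividedDifference c1 hγ' hγ k (B := C * exp (2 * R1 * R2)) ?_ ?_ ?_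
  · filter_upwards [hev] with ν hν
    exact continuous_dividedDifference c2 hν j (f := fun u v => cexp (2 * u * v))
      (by fun_prop)
  · filter_upwards [hev] with ν hν s hs
    exact hC _ hν _ _ _ (hb s hs)
  · intro s hs
    exact tendsto_dividedDifference c2 hδ' hδ j
      (Eventually.of_forall fun _ => by fun_prop)
      (Eventually.of_forall fun _ => hb s hs) fun s _ => tendsto_const_nhds

theorem tendsto_gapGram {t : Fin m → ℝ} {E : Fin m → Set ℝ} (ht : StrictMono t)
    (hE : ∀ i, Bornology.IsBounded (E i)) (h0 : ∀ i, 0 < t i) (h1 : ∀ i, t i < 1) :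
    Tendsto (fun ν => gapGram Γ1 w1 Γ2 w2 (γ ν) (δ ν) t E) l
      (𝓝 (gapGram Γ1 w1 Γ2 w2 γ' δ' t E)) := by
  have hev1 := c1.eventually_mem hγ' hγ
  have hev2 := c2.eventually_mem hδ' hδ
  refine (tendsto_freeGram c1 c2 hγ' hδ' hγ hδ).sub ?_
  refine tendsto_pi_nhds.mpr fun k => tendsto_pi_nhds.mpr fun j => ?_
  simp only [of_apply]
  refine tendsto_finsetSum _ fun i _ => ?_
  choose C1 hC₁0 hC1 using fun i => exists_norm_nodeWeight_le' c1 n (h0 i)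
  choose C2 hC₂0 hC2 using fun i => exists_norm_nodeWeight_le' c2 n (sub_pos.mpr (h1 i))
  obtain ⟨C, hC0, hC⟩ := exists_norm_avoidingWeight_le m ht hE
  have hb : ∀ᶠ ν in l, ∀ i x, ‖nodeWeight Γ2 w2 (δ ν) j (1 - t i) x‖ ≤ ∑ i, C2 i := by
    filter_upwards [hev2] with ν hν i x
    exact (hC2 i _ hν j x).trans (single_le_sum (f := C2) (fun i _ => hC₂0 i)
      (Finset.mem_univ i))
  refine tendsto_integral_filter_of_dominated_convergence
    (fun _ => C1 i * (C * ∑ i, C2 i)) ?_ ?_ ?_ ?_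
  · filter_upwards [hev1, hev2] with ν hν1 hν2
    exact (integrable_nodeWeight_mul_avoidingWeight c1 c2 hν1 hν2 ht hE i k
      j).aestronglyMeasurable
  · filter_upwards [hev1, hb] with ν hν1 hν2
    refine ae_of_all _ fun y => ?_
    rw [norm_mul]
    exact mul_le_mul (hC1 i _ hν1 k y) (hC _ _ hν2 i y) (norm_nonneg _) (hC₁0 i)
  · exact integrableOn_const (hE _).measure_lt_top.ne
  · refine ae_of_all _ fun y => (tendsto_nodeWeight c1 hγ' hγ k (t i) y).mul ?_
    refine tendsto_avoidingWeight m ht hE ?_ hb ?_ i y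
    · filter_upwards [hev2] with ν hν i
      exact continuous_nodeWeight c2 hν j _
    · exact fun i x => tendsto_nodeWeight c2 hδ' hδ j _ x

theorem tendsto_statGram (h0 : 0 < t) (h1 : t < 1) {f : ℝ → ℝ} (hf : Measurable f)
    (hB : ∀ y, |f y| ≤ B) :
    Tendsto (fun ν => statGram Γ1 w1 Γ2 w2 (γ ν) (δ ν) t f) l
      (𝓝 (statGram Γ1 w1 Γ2 w2 γ' δ' t f)) := by
  have hev1 := c1.eventually_mem hγ' hγ
  have hev2 := c2.eventually_mem hδ' hδ
  refine tendsto_pi_nhds.mpr fun k => tendsto_pi_nhds.mpr fun j => ?_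
  obtain ⟨g, hg, h⟩ := exists_norm_nodeWeight_mul_le c1 c2 n h0 h1
  refine tendsto_integral_filter_of_dominated_convergence _ ?_ ?_ (hg.const_mul B) ?_
  · filter_upwards [hev1, hev2] with ν hν1 hν2
    exact (Complex.continuous_ofReal.measurable.comp hf).aestronglyMeasurable.mul
      (integrable_nodeWeight_mul_nodeWeight c1 c2 hν1 hν2 h0 h1 k j).aestronglyMeasurable
  · filter_upwards [hev1, hev2] with ν hν1 hν2
    refine ae_of_all _ fun y => ?_
    rw [norm_mul, norm_real]
    exact mul_le_mul (hB y) (h _ _ hν1 hν2 k j y) (norm_nonneg _) ((abs_nonneg _).trans (hB y))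
  · exact ae_of_all _ fun y => ((tendsto_nodeWeight c1 hγ' hγ k t y).mul
      (tendsto_nodeWeight c2 hδ' hδ j _ y)).const_mul _

end limits

theorem det_nodalMatrix_ofReal_ne_zero {γ : Fin n → ℝ} (hγ : Injective γ) :
    (nodalMatrix fun i => (γ i : ℂ)).det ≠ 0 :=
  det_nodalMatrix_ne_zero fun _ _ h => hγ (ofReal_injective h)

/-- The conjugation which turns Brownian densities into Gaussian weights. -/
def expDiagonal {n : ℕ} (γ : Fin n → ℝ) : Matrix (Fin n) (Fin n) ℂ :=
  Matrix.diagonal fun i => (exp (γ i ^ 2) : ℂ)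

theorem det_expDiagonal_ne_zero (γ : Fin n → ℝ) : (expDiagonal γ).det ≠ 0 := by
  simp [expDiagonal, Finset.prod_ne_zero_iff, -Complex.ofReal_exp]

theorem expDiagonal_mul {γ δ : Fin n → ℝ} {M : Matrix (Fin n) (Fin n) ℝ}
    {G : Matrix (Fin n) (Fin n) ℂ}
    (h : ∀ i j, (exp (γ i ^ 2) : ℂ) * (exp (δ j ^ 2)) * (M i j : ℂ) = G i j) :
    expDiagonal γ * M.map ofReal * expDiagonal δ = G := by
  ext i j
  rw [← h, expDiagonal, expDiagonal, Matrix.mul_diagonal, Matrix.diagonal_mul, Matrix.map_apply,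
    mul_right_comm]

theorem gapGram_empty (γ δ : Fin n → ℂ) (t : Fin m → ℝ) :
    gapGram Γ1 w1 Γ2 w2 γ δ t (fun _ => ∅) = freeGram Γ1 w1 Γ2 w2 γ δ := by
  ext k l
  simp [gapGram]

include c1 c2 in
theorem bridgeExpectation_gap {γ δ : Fin n → ℝ} (hγ : ∀ j, (γ j : ℂ) ∈ V1) (hδ : ∀ j, (δ j : ℂ) ∈ V2)
    (hγi : Injective γ) (hδi : Injective δ)
    {t : Fin m → ℝ} {E : Fin m → Set ℝ} (ht : StrictMono t)
    (hE : ∀ i, Bornology.IsBounded (E i)) (hEm : ∀ i, MeasurableSet (E i))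
    (h0 : ∀ i, 0 < t i) (h1 : ∀ i, t i < 1) :
    (bridgeExpectation γ δ t ({x | ∀ i j, x i j ∉ E i}.indicator fun _ => 1) : ℂ) =
      (gapGram Γ1 w1 Γ2 w2 (fun i => (γ i : ℂ)) (fun i => (δ i : ℂ)) t E).det /
        (freeGram Γ1 w1 Γ2 w2 (fun i => (γ i : ℂ)) (fun i => (δ i : ℂ))).det := by
  have key : ∀ E : Fin m → Set ℝ, (∀ i, Bornology.IsBounded (E i)) → (∀ i, MeasurableSet (E i)) →
      ((∫ x, {x | ∀ i j, x i j ∉ E i}.indicator (fun _ => 1) x * karlinMcGregor γ δ t x : ℝ) : ℂ) =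
      (n.factorial : ℂ) ^ m * (((expDiagonal γ).det * (expDiagonal δ).det)⁻¹ * ((nodalMatrix (fun i => (γ i : ℂ))).det *
        (gapGram Γ1 w1 Γ2 w2 (fun i => (γ i : ℂ)) (fun i => (δ i : ℂ)) t E).det *
        (nodalMatrix (fun i => (δ i : ℂ))).transpose.det)) := by
    intro E hE hEm
    have e := (integral_weights_karlinMcGregorFrom n m t (fun i => (E i)ᶜ.indicator 1)
      (fun i => (measurable_one).indicator (hEm i).compl)
      (fun i => ⟨1, fun y => by by_cases hy : y ∈ E i <;> simp [hy]⟩) 0 one_pos h0 h1 ht δ).2 γ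
    have e' : ∀ x : Fin m → Fin n → ℝ, ({x : Fin m → Fin n → ℝ |
        ∀ i j, x i j ∉ E i}.indicator (fun _ => (1 : ℝ)) x) =
        ∏ i, ∏ j, (E i)ᶜ.indicator 1 (x i j) := by
      intro x
      by_cases hx : ∀ i j, x i j ∉ E i
      · rw [indicator_of_mem (show x ∈ {x : Fin m → Fin n → ℝ | ∀ i j, x i j ∉ E i} from hx)]
        symm
        exact prod_eq_one fun i _ => prod_eq_one fun j _ => by simp [hx i j]
      · rw [indicator_of_notMem (show x ∉ {x : Fin m → Fin n → ℝ | ∀ i j, x i j ∉ E i} from hx)]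
        push Not at hx
        obtain ⟨i, j, hij⟩ := hx
        symm
        exact prod_eq_zero (Finset.mem_univ i)
          (prod_eq_zero (Finset.mem_univ j) (by simp [hij]))
    simp only [e', karlinMcGregor_eq_from]
    rw [e, ofReal_mul, ofReal_pow, Complex.ofReal_natCast]
    congr 1
    have hd := congrArg det (expDiagonal_mul fun i j =>
      weightedDensity_eq_nodal_gapGram c1 c2 hγ hδ ht hE hEm h0 h1 i j)
    simp only [det_mul] at hd
    rw [← hd, mul_right_comm (det _) (det _) (det _), inv_mul_cancel_left₀
      (mul_ne_zero (det_expDiagonal_ne_zero γ) (det_expDiagonal_ne_zero δ))]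
    exact ofRealHom.map_det _
  have k1 := key E hE hEm
  have k2 := key (fun _ => ∅) (fun _ => Bornology.isBounded_empty) (fun _ => MeasurableSet.empty)
  rw [gapGram_empty] at k2
  simp only [mem_empty_iff_false, not_false_eq_true, implies_true, ofPred_true, indicator_univ,
    one_mul] at k2
  rw [bridgeExpectation, ofReal_div, k1, k2]
  have n1 : ((n.factorial : ℂ) ^ m) ≠ 0 := pow_ne_zero _ (by exact_mod_cast n.factorial_ne_zero)
  have n2 := inv_ne_zero (mul_ne_zero (det_expDiagonal_ne_zero γ) (det_expDiagonal_ne_zero δ))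
  rw [det_transpose, mul_div_mul_left _ _ n1, mul_div_mul_left _ _ n2, mul_div_mul_right _ _
    (det_nodalMatrix_ofReal_ne_zero hδi), mul_div_mul_left _ _ (det_nodalMatrix_ofReal_ne_zero hγi)]

end gram

theorem mem_closure_strictMono {δ : Fin n → ℝ} (hδ : Monotone δ) :
    δ ∈ closure {δ : Fin n → ℝ | StrictMono δ} := by
  rw [mem_closure_iff_seq_limit]
  refine ⟨fun N j => δ j + (1 / ((N : ℝ) + 1)) * (j : ℕ), fun N i j hij => ?_, ?_⟩
  · have h1 := hδ hij.le
    have h2 : ((i : ℕ) : ℝ) < (j : ℕ) := by exact_mod_cast hij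
    have h3 : 0 < 1 / ((N : ℝ) + 1) := by positivity
    simp only
    nlinarith
  · refine tendsto_pi_nhds.mpr fun j => ?_
    have := (tendsto_one_div_add_atTop_nhds_zero_nat (𝕜 := ℝ)).mul_const ((j : ℕ) : ℝ)
    simpa using this.const_add (δ j)

theorem monotone_endPoints (n n1 : ℕ) {b a : ℝ} (hba : b ≤ a) :
    Monotone (endPoints n n1 b a) := by
  intro i j hij
  have : (i : ℕ) ≤ j := hij
  unfold endPoints
  split_ifs <;> first | exact le_rfl | exact hba | omega

section confluent

variable {b a : ℝ}

theorem neBot_confluence (n n1 : ℕ) {b a : ℝ} (hba : b ≤ a) :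
    (𝓝[{γ | StrictMono γ}] (0 : Fin n → ℝ) ×ˢ
      𝓝[{δ | StrictMono δ}] (endPoints n n1 b a)).NeBot :=
  (mem_closure_iff_nhdsWithin_neBot.mp (mem_closure_strictMono monotone_const)).prod
    (mem_closure_iff_nhdsWithin_neBot.mp (mem_closure_strictMono (monotone_endPoints n n1 hba)))

theorem tendsto_ofReal_comp {ι : Type*} {l : Filter ι} {f : ι → Fin n → ℝ} {c : Fin n → ℝ}
    (h : Tendsto f l (𝓝 c)) : Tendsto (fun ν i => (f ν i : ℂ)) l (𝓝 fun i => (c i : ℂ)) :=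
  tendsto_pi_nhds.mpr fun j =>
    (Complex.continuous_ofReal.tendsto _).comp ((tendsto_pi_nhds.mp h) j)

variable (c1 : IsCauchyContour Γ1 w1 V1) (c2 : IsCauchyContour Γ2 w2 V2) (hba : b ≤ a)
  (hγ : (0 : ℂ) ∈ V1) (hδ : ∀ j, (endPoints n n1 b a j : ℂ) ∈ V2)
  (hdet : (freeGram Γ1 w1 Γ2 w2 (fun _ => 0) (fun i => (endPoints n n1 b a i : ℂ))).det ≠ 0)
include c1 c2 hba hγ hδ hdet

/-- The limit as starting points tend to `0` and end points to the given ones. -/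
theorem exists_tendsto_confluence {F : (Fin n → ℝ) → (Fin n → ℝ) → ℝ}
    {T : (Fin n → ℂ) → (Fin n → ℂ) → ℂ}
    (hF : ∀ γ δ : Fin n → ℝ, (∀ j, (γ j : ℂ) ∈ V1) → (∀ j, (δ j : ℂ) ∈ V2) → Injective γ →
      Injective δ → (freeGram Γ1 w1 Γ2 w2 (fun i => (γ i : ℂ)) (fun i => (δ i : ℂ))).det ≠ 0 →
      F γ δ = T (fun i => γ i) (fun i => δ i))
    (hT : ∀ {γ δ : (Fin n → ℝ) × (Fin n → ℝ) → Fin n → ℂ}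
      {l : Filter ((Fin n → ℝ) × (Fin n → ℝ))} [l.IsCountablyGenerated],
      Tendsto γ l (𝓝 fun _ => 0) → Tendsto δ l (𝓝 fun i => (endPoints n n1 b a i : ℂ)) →
      Tendsto (fun ν => T (γ ν) (δ ν)) l (𝓝 (T (fun _ => 0) fun i => endPoints n n1 b a i))) :
    ∃ P : ℝ, Tendsto (fun z => F z.1 z.2) (𝓝[{γ | StrictMono γ}] (0 : Fin n → ℝ) ×ˢ
      𝓝[{δ | StrictMono δ}] (endPoints n n1 b a)) (𝓝 P) ∧
      (P : ℂ) = T (fun _ => 0) fun i => (endPoints n n1 b a i : ℂ) := by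
  have := neBot_confluence n n1 hba
  set l := 𝓝[{γ | StrictMono γ}] (0 : Fin n → ℝ) ×ˢ 𝓝[{δ | StrictMono δ}] (endPoints n n1 b a)
  have t1 : Tendsto (fun z : (Fin n → ℝ) × (Fin n → ℝ) => fun i => (z.1 i : ℂ)) l
      (𝓝 fun _ => 0) := by
    simpa using tendsto_ofReal_comp (l := l) (c := 0) (tendsto_fst.mono_right nhdsWithin_le_nhds)
  have t2 : Tendsto (fun z : (Fin n → ℝ) × (Fin n → ℝ) => fun i => (z.2 i : ℂ)) l
      (𝓝 fun i => (endPoints n n1 b a i : ℂ)) :=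
    tendsto_ofReal_comp (tendsto_snd.mono_right nhdsWithin_le_nhds)
  have hlim : Tendsto (fun z => (F z.1 z.2 : ℂ)) l
      (𝓝 (T (fun _ => 0) fun i => endPoints n n1 b a i)) := by
    refine (tendsto_congr' ?_).mpr (hT t1 t2)
    filter_upwards [tendsto_fst.eventually self_mem_nhdsWithin,
      tendsto_snd.eventually self_mem_nhdsWithin, c1.eventually_mem (fun _ => hγ) t1,
      c2.eventually_mem hδ t2, (((continuous_id.matrix_det).tendsto _).comp
        (tendsto_freeGram c1 c2 (fun _ => hγ) hδ t1 t2)).eventually_ne hdet] with z a1 a2 a3 a4 a5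
    exact hF _ _ a3 a4 (StrictMono.injective a1) (StrictMono.injective a2) a5
  have h1 := (Complex.continuous_re.tendsto _).comp hlim
  exact ⟨_, h1, tendsto_nhds_unique ((Complex.continuous_ofReal.tendsto _).comp h1) hlim⟩

theorem hasNonIntersectingProbability_gap {t : Fin m → ℝ} {E : Fin m → Set ℝ} (ht : StrictMono t)
    (hE : ∀ i, Bornology.IsBounded (E i)) (hEm : ∀ i, MeasurableSet (E i))
    (h0 : ∀ i, 0 < t i) (h1 : ∀ i, t i < 1) :
    ∃ P : ℝ, HasNonIntersectingProbability n n1 b a t {x | ∀ i j, x i j ∉ E i} P ∧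
      (P : ℂ) = (gapGram Γ1 w1 Γ2 w2 (fun _ => 0) (fun i => (endPoints n n1 b a i : ℂ)) t E).det /
        (freeGram Γ1 w1 Γ2 w2 (fun _ => 0) (fun i => (endPoints n n1 b a i : ℂ))).det :=
  exists_tendsto_confluence c1 c2 hba hγ hδ hdet
    (T := fun γ δ => (gapGram Γ1 w1 Γ2 w2 γ δ t E).det / (freeGram Γ1 w1 Γ2 w2 γ δ).det)
    (fun _ _ a3 a4 a1 a2 _ => bridgeExpectation_gap c1 c2 a3 a4 a1 a2 ht hE hEm h0 h1)
    fun t1 t2 => (((continuous_id.matrix_det).tendsto _).comp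
      (tendsto_gapGram c1 c2 (fun _ => hγ) hδ t1 t2 ht hE h0 h1)).div
      (((continuous_id.matrix_det).tendsto _).comp
      (tendsto_freeGram c1 c2 (fun _ => hγ) hδ t1 t2)) hdet

end confluent

theorem weightedDensity_one (t : ℝ) (h : ℝ → ℝ) (u v : ℝ) :
    weightedDensity 1 (fun _ => t) (fun _ => h) 0 u v =
      ∫ y, brownianDensity t u y * h y * brownianDensity (1 - t) y v := by
  simp [weightedDensity]

theorem integrable_brownianDensity_mul (h0 : 0 < t) (h1 : t < 1) {f : ℝ → ℝ}
    (hf : Measurable f) (hB : ∀ y, |f y| ≤ B) (u v : ℝ) :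
    Integrable fun y => brownianDensity t u y * f y * brownianDensity (1 - t) y v := by
  refine ((integrable_brownianDensity h0 u).mul_const (B * (1 / √(π * (1 - t))))).mono'
    (((continuous_const.brownianDensity continuous_id _).measurable.mul hf).mul
      (continuous_id.brownianDensity continuous_const _).measurable).aestronglyMeasurable
    (ae_of_all _ fun y => ?_)
  rw [norm_mul, norm_mul, norm_of_nonneg (brownianDensity_nonneg _ _ _), mul_assoc,
    norm_of_nonneg (brownianDensity_nonneg (1 - t) _ _)]
  have h2 := brownianDensity_le (sub_pos.mpr h1) y v
  have h3 := (abs_nonneg _).trans (hB y)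
  have h4 := brownianDensity_nonneg t u y
  exact mul_le_mul_of_nonneg_left (mul_le_mul (hB y) h2 (brownianDensity_nonneg _ _ _) h3) h4

theorem bridgeExpectation_sum (γ δ : Fin n → ℝ) (h0 : 0 < t) (h1 : t < 1)
    {f : ℝ → ℝ} (hf : Measurable f) (hB : ∀ y, |f y| ≤ B)
    (hM : (of fun i j => brownianDensity 1 (γ i) (δ j)).det ≠ 0) :
    bridgeExpectation γ δ (fun _ : Fin 1 => t) (fun x => ∑ j, f (x 0 j)) =
      ((of fun i j => brownianDensity 1 (γ i) (δ j))⁻¹ * of fun i j =>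
        ∫ y, brownianDensity t (γ i) y * f y * brownianDensity (1 - t) y (δ j)).trace := by
  set M := of fun i j => brownianDensity 1 (γ i) (δ j) with hMdef
  set N := of fun i j =>
        ∫ y, brownianDensity t (γ i) y * f y * brownianDensity (1 - t) y (δ j) with hN
  set K : (Fin 1 → Fin n → ℝ) → ℝ := karlinMcGregor γ δ (fun _ => t) with hK
  have hgen : ∀ h : ℝ → ℝ, Measurable h → (∃ B, ∀ y, |h y| ≤ B) →
      (Integrable fun x : Fin 1 → Fin n → ℝ => (∏ j, h (x 0 j)) * K x) ∧
      ∫ x : Fin 1 → Fin n → ℝ, (∏ j, h (x 0 j)) * K x = (n.factorial : ℝ) * (of fun i j =>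
        ∫ y, brownianDensity t (γ i) y * h y * brownianDensity (1 - t) y (δ j)).det := by
    intro h hm hb
    obtain ⟨⟨_, hI⟩, hE⟩ := integral_weights_karlinMcGregorFrom n 1 (fun _ => t) (fun _ => h)
      (fun _ => hm) (fun _ => hb) 0 one_pos (fun _ => h0) (fun _ => h1)
      (Subsingleton.strictMono _) δ
    have hI' := (hI γ).1
    have hE' := hE γ
    simp only [Finset.univ_unique, Fin.default_eq_zero, Finset.prod_singleton, pow_one,
      weightedDensity_one] at hI' hE'
    exact ⟨hI', hE'⟩
  have hMN : ∀ ε : ℝ, (of fun i j => ∫ y, brownianDensity t (γ i) y * (1 + ε * f y) *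
      brownianDensity (1 - t) y (δ j)) = M + ε • N := by
    intro ε
    ext i j
    have e : ∀ y, brownianDensity t (γ i) y * (1 + ε * f y) * brownianDensity (1 - t) y (δ j) =
        brownianDensity t (γ i) y * brownianDensity (1 - t) y (δ j) +
        ε * (brownianDensity t (γ i) y * f y * brownianDensity (1 - t) y (δ j)) := fun y => by ring
    have i1 : Integrable fun y => brownianDensity t (γ i) y * brownianDensity (1 - t) y (δ j) := by
      simpa using integrable_brownianDensity_mul h0 h1 (f := fun _ => 1) (B := 1)
        measurable_const (by simp) (γ i) (δ j)
    have i2 := (integrable_brownianDensity_mul h0 h1 hf hB (γ i) (δ j)).const_mul ε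
    simp only [of_apply, Matrix.add_apply, Matrix.smul_apply, e, hMdef, hN, smul_eq_mul]
    rw [integral_add i1 i2, integral_brownianDensity_mul h0 (sub_pos.mpr h1), integral_const_mul]
    congr 2; ring
  have hKi : Integrable K := by
    have := (hgen (fun _ => 1) measurable_const ⟨1, by simp⟩).1
    simpa using this
  have hZ : ∫ x, K x = (n.factorial : ℝ) * M.det := by
    have := (hgen (fun _ => 1) measurable_const ⟨1, by simp⟩).2
    have e := hMN 0
    simp only [zero_mul, add_zero, zero_smul] at e
    rw [e] at this
    simpa using this
  have hSi : ∀ S : Finset (Fin n), Integrable fun x : Fin 1 → Fin n → ℝ =>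
      (∏ j ∈ S, f (x 0 j)) * K x := by
    intro S
    refine hKi.bdd_mul (c := B ^ S.card) ?_ (ae_of_all _ fun x => ?_)
    · exact (measurable_prod _ fun j _ => hf.comp
        ((measurable_pi_apply j).comp (measurable_pi_apply 0))).aestronglyMeasurable
    · rw [norm_prod, ← prod_const]
      exact Finset.prod_le_prod (fun _ _ => norm_nonneg _) fun j _ => hB _
  have hL : ∀ ε : ℝ, ∑ S ∈ (Finset.univ : Finset (Fin n)).powerset,
      ε ^ S.card * ∫ x, (∏ j ∈ S, f (x 0 j)) * K x =
      (n.factorial : ℝ) * (M + ε • N).det := by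
    intro ε
    have := (hgen (fun y => 1 + ε * f y) (by fun_prop) ⟨1 + |ε| * B, fun y => by
      refine (abs_add_le _ _).trans ?_
      rw [abs_one, abs_mul]
      gcongr
      exact hB y⟩).2
    rw [hMN] at this
    rw [← this]
    simp only [← integral_const_mul]
    rw [← integral_finsetSum _ fun S _ => (hSi S).const_mul _]
    congr 1 with x
    rw [Finset.prod_one_add, sum_mul]
    refine sum_congr rfl fun S _ => ?_
    rw [prod_mul_distrib, prod_const]
    ring
  have hR : ∀ ε : ℝ, (M + ε • N).det = M.det * (1 + (M⁻¹ * N).trace * ε +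
      (det (1 + (Polynomial.X : Polynomial ℝ) • (M⁻¹ * N).map Polynomial.C)).divX.divX.eval ε
        * ε ^ 2) := by
    intro ε
    rw [← Matrix.det_one_add_smul, ← det_mul, mul_add, mul_one, Matrix.mul_smul,
      Matrix.mul_nonsing_inv_cancel_left _ _ (Ne.isUnit hM)]
  set g := (det (1 + (Polynomial.X : Polynomial ℝ) •
    (M⁻¹ * N).map Polynomial.C)).divX.divX
  have d1 : HasDerivAt (fun ε : ℝ => ∑ S ∈ (Finset.univ : Finset (Fin n)).powerset,
      ε ^ S.card * ∫ x, (∏ j ∈ S, f (x 0 j)) * K x) _ 0 :=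
    HasDerivAt.fun_sum fun S _ => (hasDerivAt_pow S.card 0).mul_const _
  have d2 : HasDerivAt (fun ε : ℝ => (n.factorial : ℝ) * (M.det * (1 + (M⁻¹ * N).trace * ε +
      g.eval ε * ε ^ 2))) ((n.factorial : ℝ) * (M.det * (M⁻¹ * N).trace)) 0 := by
    simpa using ((((((hasDerivAt_id (0 : ℝ)).const_mul ((M⁻¹ * N).trace)).const_add 1).add
      ((g.hasDerivAt 0).mul (hasDerivAt_pow 2 (0 : ℝ))))).const_mul M.det).const_mul
        (n.factorial : ℝ)
  have d3 : ∑ j, ∫ x, f (x 0 j) * K x = (n.factorial : ℝ) * (M.det * (M⁻¹ * N).trace) := by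
    rw [← d1.unique (d2.congr_of_eventuallyEq (Eventually.of_forall fun ε => by
      simp only [hL ε, hR ε])), ← Finset.sum_subset (s₁ := Finset.powersetCard 1 Finset.univ)
      fun S _ => Finset.mem_powerset.mpr (Finset.subset_univ S)]
    · rw [Finset.powersetCard_one, Finset.sum_map]
      exact sum_congr rfl fun j _ => by simp
    · intro S _ hS
      have : S.card ≠ 1 := fun h => hS (Finset.mem_powersetCard.mpr ⟨Finset.subset_univ _, h⟩)
      rcases Nat.eq_zero_or_pos S.card with h | h
      · rw [h]; simp
      · rw [zero_pow (by omega)]; simp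
  rw [bridgeExpectation]
  simp only [sum_mul]
  rw [integral_finsetSum _ fun j _ => by simpa using hSi {j}]
  change (∑ j, ∫ x, f (x 0 j) * K x) / ∫ x, K x = _
  rw [d3, hZ, mul_div_mul_left _ _ (by exact_mod_cast n.factorial_ne_zero),
    mul_div_cancel_left₀ _ hM]

theorem trace_inv_mul_of_equiv {P M N Q : Matrix (Fin n) (Fin n) ℂ} (hP : P.det ≠ 0)
    (hQ : Q.det ≠ 0) : ((P * M * Q)⁻¹ * (P * N * Q)).trace = (M⁻¹ * N).trace := by
  rw [Matrix.mul_inv_rev, Matrix.mul_inv_rev]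
  have : Q⁻¹ * (M⁻¹ * P⁻¹) * (P * N * Q) = Q⁻¹ * (M⁻¹ * (P⁻¹ * P) * N * Q) := by
    simp only [Matrix.mul_assoc]
  rw [this, Matrix.nonsing_inv_mul _ hP.isUnit, Matrix.mul_one, Matrix.trace_mul_comm,
    Matrix.mul_assoc, Matrix.mul_nonsing_inv _ hQ.isUnit, Matrix.mul_one]

theorem trace_map_ofReal_inv_mul (M N : Matrix (Fin n) (Fin n) ℝ) (hM : M.det ≠ 0) :
    (((M⁻¹ * N).trace : ℝ) : ℂ) =
      ((M.map ofReal)⁻¹ * N.map ofReal).trace := by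
  have e : (M.map ofReal)⁻¹ = M⁻¹.map ofReal := by
    refine Matrix.inv_eq_left_inv ?_
    have h := congrArg (fun X => X.map (ofRealHom : ℝ →+* ℂ))
      (Matrix.nonsing_inv_mul M hM.isUnit)
    simp only [Matrix.map_mul, Matrix.map_one _ (map_zero _) (map_one _)] at h
    exact h
  rw [e]
  have h2 : (M⁻¹.map ofReal) * N.map ofReal = (M⁻¹ * N).map ofReal :=
    (Matrix.map_mul (f := (ofRealHom : ℝ →+* ℂ))).symm
  rw [h2]
  exact (AddMonoidHom.map_trace (ofRealHom : ℝ →+ ℂ) _)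

section stat

variable (c1 : IsCauchyContour Γ1 w1 V1)
  (c2 : IsCauchyContour Γ2 w2 V2) (h0 : 0 < t) (h1 : t < 1) {f : ℝ → ℝ}
  (hf : Measurable f) (hB : ∀ y, |f y| ≤ B)
include c1 c2 h0 h1 hf hB

theorem bridgeExpectation_sum_eq {γ δ : Fin n → ℝ} (hγ : ∀ j, (γ j : ℂ) ∈ V1)
    (hδ : ∀ j, (δ j : ℂ) ∈ V2) (hγi : Injective γ) (hδi : Injective δ)
    (hdet : (freeGram Γ1 w1 Γ2 w2 (fun i => (γ i : ℂ)) (fun i => (δ i : ℂ))).det ≠ 0) :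
    (bridgeExpectation γ δ (fun _ : Fin 1 => t) (fun x => ∑ j, f (x 0 j)) : ℂ) =
      ((freeGram Γ1 w1 Γ2 w2 (fun i => (γ i : ℂ)) (fun i => (δ i : ℂ)))⁻¹ *
        statGram Γ1 w1 Γ2 w2 (fun i => (γ i : ℂ)) (fun i => (δ i : ℂ)) t f).trace := by
  set M := of fun i j => brownianDensity 1 (γ i) (δ j) with hM
  set N := of fun i j =>
        ∫ y, brownianDensity t (γ i) y * f y * brownianDensity (1 - t) y (δ j) with hN
  have n3 := det_nodalMatrix_ofReal_ne_zero hγi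
  have n4 : (nodalMatrix (fun i => (δ i : ℂ))).transpose.det ≠ 0 := by
    rw [det_transpose]; exact det_nodalMatrix_ofReal_ne_zero hδi
  have eM : expDiagonal γ * M.map ofReal * expDiagonal δ = nodalMatrix (fun i => (γ i : ℂ)) *
      freeGram Γ1 w1 Γ2 w2 (fun i => (γ i : ℂ)) (fun i => (δ i : ℂ)) *
      (nodalMatrix (fun i => (δ i : ℂ))).transpose := by
    refine expDiagonal_mul fun i j => ?_
    rw [← exp_eq_nodal_freeGram c1 c2 hγ hδ, hM, of_apply, brownianDensity]
    push_cast
    rw [mul_one, mul_div_assoc', ← exp_add, ← exp_add]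
    congr 2
    ring
  have eN : expDiagonal γ * N.map ofReal * expDiagonal δ = nodalMatrix (fun i => (γ i : ℂ)) *
      statGram Γ1 w1 Γ2 w2 (fun i => (γ i : ℂ)) (fun i => (δ i : ℂ)) t f *
      (nodalMatrix (fun i => (δ i : ℂ))).transpose := by
    refine expDiagonal_mul fun i j => ?_
    simp only [statGram, mul_left_comm (f _ : ℂ)]
    have hi : ∀ k l, Integrable fun y => nodeWeight Γ1 w1 (fun i => (γ i : ℂ)) k t y *
        ((f y : ℂ) * nodeWeight Γ2 w2 (fun i => (δ i : ℂ)) l (1 - t) y) := fun k l => by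
      simp only [mul_left_comm _ (f _ : ℂ)]
      exact (integrable_nodeWeight_mul_nodeWeight c1 c2 hγ hδ h0 h1 k l).bdd_mul (c := B)
        (Complex.continuous_ofReal.measurable.comp hf).aestronglyMeasurable
        (ae_of_all _ fun y => by rw [norm_real]; exact hB y)
    rw [← integral_sum_mul_sum hi, hN, of_apply, ← integral_complex_ofReal, ← integral_const_mul]
    congr 1 with y
    simp only [mul_left_comm _ (f y : ℂ), ← mul_sum]
    rw [← nodeWeight_interpolation c1 hγ, ← nodeWeight_interpolation c2 hδ, gaussWeight_ofReal,
      gaussWeight_ofReal, brownianDensity_comm (1 - t)]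
    push_cast
    ring
  have dM : M.det ≠ 0 := by
    intro h
    have e := congrArg det eM
    have e2 : (M.map ofReal).det = (M.det : ℂ) := (ofRealHom.map_det M).symm
    simp only [det_mul, e2, h, ofReal_zero, mul_zero, zero_mul] at e
    exact mul_ne_zero (mul_ne_zero n3 hdet) n4 e.symm
  rw [bridgeExpectation_sum γ δ h0 h1 hf hB dM, trace_map_ofReal_inv_mul _ _ dM,
    ← trace_inv_mul_of_equiv (det_expDiagonal_ne_zero γ) (det_expDiagonal_ne_zero δ), eM, eN,
    trace_inv_mul_of_equiv n3 n4]

theorem hasNonIntersectingExpectation_sum {b a : ℝ} (hba : b ≤ a) (hγ : (0 : ℂ) ∈ V1)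
    (hδ : ∀ j, (endPoints n n1 b a j : ℂ) ∈ V2)
    (hdet : (freeGram Γ1 w1 Γ2 w2 (fun _ => 0) (fun i => (endPoints n n1 b a i : ℂ))).det ≠ 0) :
    ∃ P : ℝ, HasNonIntersectingExpectation n n1 b a (fun _ : Fin 1 => t)
      (fun x => ∑ j, f (x 0 j)) P ∧ ((∀ y, 0 ≤ f y) → 0 ≤ P) ∧
      (P : ℂ) = ((freeGram Γ1 w1 Γ2 w2 (fun _ => 0) (fun i => (endPoints n n1 b a i : ℂ)))⁻¹ *
        statGram Γ1 w1 Γ2 w2 (fun _ => 0) (fun i => (endPoints n n1 b a i : ℂ)) t f).trace := by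
  obtain ⟨P, r2, r1⟩ := exists_tendsto_confluence c1 c2 hba hγ hδ hdet
    (T := fun γ δ => ((freeGram Γ1 w1 Γ2 w2 γ δ)⁻¹ * statGram Γ1 w1 Γ2 w2 γ δ t f).trace)
    (fun _ _ a3 a4 a1 a2 a5 => bridgeExpectation_sum_eq c1 c2 h0 h1 hf hB a3 a4 a1 a2 a5)
    fun t1 t2 => by
      have hF := tendsto_freeGram c1 c2 (fun _ => hγ) hδ t1 t2
      refine ((continuous_id.matrix_trace).tendsto _).comp (Tendsto.mul ?_
        (tendsto_statGram c1 c2 (fun _ => hγ) hδ t1 t2 h0 h1 hf hB))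
      simp only [Matrix.inv_def, Ring.inverse_eq_inv']
      exact ((((continuous_id.matrix_det).tendsto _).comp hF).inv₀ hdet).smul
        (((continuous_id.matrix_adjugate).tendsto _).comp hF)
  have := neBot_confluence n n1 hba
  refine ⟨P, r2, fun hpos => ge_of_tendsto r2 ?_, r1⟩
  filter_upwards [tendsto_fst.eventually self_mem_nhdsWithin,
    tendsto_snd.eventually self_mem_nhdsWithin] with z a1 a2
  have hk := fun x => karlinMcGregor_one_nonneg (StrictMono.monotone a1) (StrictMono.monotone a2)
    (t := fun _ => t) h0 h1 x
  exact div_nonneg (integral_nonneg fun x =>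
    mul_nonneg (sum_nonneg fun j _ => hpos _) (hk x)) (integral_nonneg hk)

end stat

/-- The nodal polynomials. -/
def nodalPoly {n : ℕ} (δ : Fin n → ℂ) (k : ℕ) : Polynomial ℂ :=
  ∏ j ∈ Finset.univ.filter fun j : Fin n => (j : ℕ) < k, (Polynomial.X - Polynomial.C (δ j))

theorem nodal_eq_sum_coeff (δ : Fin n → ℂ) (k : Fin n) (w : ℂ) :
    nodal δ k w = ∑ i : Fin n, (nodalPoly δ k).coeff i * w ^ (i : ℕ) := by
  have hd : (nodalPoly δ k).natDegree < n := by
    rw [nodalPoly, Polynomial.natDegree_prod_of_monic _ _ fun j _ => Polynomial.monic_X_sub_C _]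
    simp only [Polynomial.natDegree_X_sub_C, sum_const, smul_eq_mul, mul_one]
    have : (Finset.univ.filter fun j : Fin n => (j : ℕ) < k) = Finset.Iio k := by
      ext j; simp only [mem_filter, Finset.mem_univ, true_and, Finset.mem_Iio, lt_def]
    rw [this, Fin.card_Iio]
    exact k.2
  have : nodal δ k w = (nodalPoly δ k).eval w := by
    simp [nodal, nodalPoly, Polynomial.eval_prod]
  rw [this, Polynomial.eval_eq_sum_range' hd,
    ← Fin.sum_univ_eq_sum_range fun i => (nodalPoly δ k).coeff i * w ^ i]

section confluentStart


theorem dividedDifference_zero_of_tendsto (hΓ : IsCauchyContour Γ w V) (h0 : (0 : ℂ) ∈ V) (k : Fin n) {c : ℕ → ℂ} (hB : ∀ N, ∀ s ∈ Icc (0 : ℝ) 1, ‖∑ j ∈ Finset.range N, c j * Γ s ^ j‖ ≤ B)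
    (hlim : ∀ s ∈ Icc (0 : ℝ) 1, Tendsto (fun N => ∑ j ∈ Finset.range N, c j * Γ s ^ j) atTop
      (𝓝 (f (Γ s)))) :
    dividedDifference Γ w (fun _ : Fin n => 0) k f = c k := by
  have h1 := tendsto_dividedDifference hΓ (ι := ℕ) (l := atTop) (n := n)
    (δ := fun _ _ => 0) (δ' := fun _ => 0) (fun _ => h0) tendsto_const_nhds k
    (f := fun N u => ∑ j ∈ Finset.range N, c j * u ^ j) (f' := f)
    (Eventually.of_forall fun N => by fun_prop) (Eventually.of_forall hB) hlim
  have hp : ∀ j : ℕ, dividedDifference Γ w (fun _ : Fin n => 0) k (fun u => u ^ j) =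
      if j = k then 1 else 0 := by
    intro j
    by_cases hj : j < n
    · have e : (fun u : ℂ => u ^ j) = nodal (fun _ : Fin n => (0 : ℂ)) (⟨j, hj⟩ : Fin n) := by
        ext u
        have : (Finset.univ.filter fun i : Fin n => (i : ℕ) < j) = Finset.Iio ⟨j, hj⟩ := by
          ext i; simp only [mem_filter, Finset.mem_univ, true_and, Finset.mem_Iio, lt_def]
        simp [nodal, this]
      rw [e, dividedDifference_nodal hΓ (fun _ => h0)]
      simp [Fin.ext_iff]
    · have hk := k.2
      rw [if_neg (by omega)]
      refine Eq.trans ?_ (integral_entire_eq_zero hΓ h0 (f := fun u => u ^ (j - ((k : ℕ) + 1)))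
        (by fun_prop))
      refine setIntegral_congr_fun measurableSet_Icc fun s hs => ?_
      have : (Finset.univ.filter fun i : Fin n => (i : ℕ) < k + 1) = Finset.Iic k := by
        ext i; simp only [mem_filter, Finset.mem_univ, true_and, Finset.mem_Iic, Fin.le_def,
          Nat.lt_succ_iff]
      have hs0 : Γ s ≠ 0 := by simpa using hΓ.sub_ne_zero hs h0
      simp only [nodal, this, sub_zero, prod_const, Fin.card_Iic]
      congr 1
      rw [div_eq_iff (pow_ne_zero _ hs0), ← pow_add, show j - (k + 1) + (k + 1) = j by omega]
  refine tendsto_nhds_unique h1 (tendsto_atTop_of_eventually_const (i₀ := (k : ℕ) + 1) fun N hN => ?_)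
  rw [dividedDifference_sum hΓ (fun _ => h0) k _ c (f := fun j u => u ^ j) fun j => by fun_prop]
  simp only [hp, mul_ite, mul_one, mul_zero]
  rw [Finset.sum_ite_eq' ]
  simp [show (k : ℕ) < N by omega]

theorem norm_sum_pow_div_factorial_le (z : ℂ) (N : ℕ) :
    ‖∑ j ∈ Finset.range N, z ^ j / (j.factorial : ℂ)‖ ≤ exp ‖z‖ := by
  refine (norm_sum_le _ _).trans ((sum_le_sum fun j _ => ?_).trans
    (Real.sum_le_exp_of_nonneg (norm_nonneg z) N))
  simp

theorem tendsto_sum_pow_div_factorial (z : ℂ) :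
    Tendsto (fun N => ∑ j ∈ Finset.range N, z ^ j / (j.factorial : ℂ)) atTop
      (𝓝 (cexp z)) := by
  rw [Complex.exp_eq_exp_ℂ]
  exact (NormedSpace.expSeries_div_hasSum_exp z).tendsto_sum_nat

theorem dividedDifference_zero_exp (hΓ : IsCauchyContour Γ w V) (h0 : (0 : ℂ) ∈ V) (k : Fin n) (z : ℂ) :
    dividedDifference Γ w (fun _ : Fin n => 0) k (fun u => cexp (2 * u * z)) =
      (2 * z) ^ (k : ℕ) / ((k : ℕ).factorial : ℂ) := by
  obtain ⟨R, hR⟩ := hΓ.bounded_path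
  have e : ∀ N (u : ℂ), ∑ j ∈ Finset.range N, (2 * z) ^ j / (j.factorial : ℂ) * u ^ j =
      ∑ j ∈ Finset.range N, (2 * u * z) ^ j / (j.factorial : ℂ) := fun N u =>
    sum_congr rfl fun j _ => by rw [div_mul_eq_mul_div, ← mul_pow]; ring_nf
  refine dividedDifference_zero_of_tendsto hΓ h0 k
    (c := fun j => (2 * z) ^ j / (j.factorial : ℂ)) (B := exp (2 * R * ‖z‖)) ?_ ?_
  · intro N s hs
    rw [e]
    refine (norm_sum_pow_div_factorial_le _ _).trans (Real.exp_le_exp.mpr ?_)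
    rw [norm_mul, norm_mul, norm_two]
    gcongr
    exact hR s hs
  · intro s hs
    simp only [e]
    exact tendsto_sum_pow_div_factorial _

/-- The matrix which inverts `freeGram` when all paths leave from `0`. -/
def startMatrix (δ : Fin n → ℂ) : Matrix (Fin n) (Fin n) ℂ :=
  of fun k i => (√π : ℝ) * ((nodalPoly δ k).coeff i *
    (((i : ℕ).factorial : ℂ) / 2 ^ (i : ℕ)))

theorem freeGram_zero_apply (h1 : IsCauchyContour Γ1 w1 V1) (h2 : IsCauchyContour Γ2 w2 V2) (h0 : (0 : ℂ) ∈ V1) (hδ : ∀ j, δ j ∈ V2) (k l : Fin n) :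
    freeGram Γ1 w1 Γ2 w2 (fun _ => 0) δ k l = 2 ^ (k : ℕ) / ((k : ℕ).factorial : ℂ) *
      dividedDifference Γ2 w2 δ l (fun v => v ^ (k : ℕ)) / (√π : ℝ) := by
  obtain ⟨R1, hR1⟩ := h1.bounded_path
  obtain ⟨R2, hR2⟩ := h2.bounded_path
  have hR₁0 : 0 ≤ R1 := (norm_nonneg _).trans (hR1 0 (by simp))
  obtain ⟨C, hC0, hC⟩ := exists_norm_dividedDifference_le h2 n
  rw [freeGram, of_apply]
  congr 1
  have e : ∀ N (u : ℂ), ∑ j ∈ Finset.range N, 2 ^ j / (j.factorial : ℂ) *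
      dividedDifference Γ2 w2 δ l (fun v => v ^ j) * u ^ j =
      dividedDifference Γ2 w2 δ l
        (fun v => ∑ j ∈ Finset.range N, (2 * u * v) ^ j / (j.factorial : ℂ)) := fun N u => by
    have := dividedDifference_sum h2 hδ l (Finset.range N)
      (fun j => (2 * u) ^ j / (j.factorial : ℂ)) (f := fun j v => v ^ j) fun j => by fun_prop
    have e2 : (fun v => ∑ j ∈ Finset.range N, (2 * u * v) ^ j / (j.factorial : ℂ)) =
        fun v => ∑ j ∈ Finset.range N, (2 * u) ^ j / (j.factorial : ℂ) * v ^ j := by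
      ext v
      exact sum_congr rfl fun j _ => by rw [mul_pow (2 * u) v]; ring
    rw [e2, this]
    exact sum_congr rfl fun j _ => by rw [mul_pow]; ring
  have hb : ∀ N, ∀ s ∈ Icc (0 : ℝ) 1, ∀ s' ∈ Icc (0 : ℝ) 1,
      ‖∑ j ∈ Finset.range N, (2 * Γ1 s * Γ2 s') ^ j / (j.factorial : ℂ)‖ ≤
        exp (2 * R1 * R2) := fun N s hs s' hs' => by
    refine (norm_sum_pow_div_factorial_le _ _).trans (Real.exp_le_exp.mpr ?_)
    rw [norm_mul, norm_mul, norm_two]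
    have := hR1 s hs
    have := hR2 s' hs'
    gcongr
  refine dividedDifference_zero_of_tendsto h1 h0 k
    (c := fun j => 2 ^ j / (j.factorial : ℂ) * dividedDifference Γ2 w2 δ l (fun v => v ^ j))
    (B := C * exp (2 * R1 * R2)) ?_ ?_
  · intro N s hs
    rw [e]
    exact hC δ hδ l _ _ fun s' hs' => hb N s hs s' hs'
  · intro s hs
    simp only [e]
    refine tendsto_dividedDifference h2 hδ tendsto_const_nhds l (B := exp (2 * R1 * R2))
      (Eventually.of_forall fun N => by fun_prop)
      (Eventually.of_forall fun N s' hs' => hb N s hs s' hs') fun s' hs' => ?_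
    exact tendsto_sum_pow_div_factorial _

theorem startMatrix_mul_freeGram (h1 : IsCauchyContour Γ1 w1 V1) (h2 : IsCauchyContour Γ2 w2 V2) (h0 : (0 : ℂ) ∈ V1) (hδ : ∀ j, δ j ∈ V2) :
    startMatrix δ * freeGram Γ1 w1 Γ2 w2 (fun _ => 0) δ = 1 := by
  have hpi : ((√π : ℝ) : ℂ) ≠ 0 := by
    exact_mod_cast (Real.sqrt_pos.mpr pi_pos).ne'
  ext k l
  rw [Matrix.mul_apply, Matrix.one_apply, ← dividedDifference_nodal h2 hδ k l]
  have e : nodal δ k = fun v => ∑ i : Fin n, (nodalPoly δ k).coeff i * v ^ (i : ℕ) := by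
    ext v; exact nodal_eq_sum_coeff δ k v
  rw [e, dividedDifference_sum h2 hδ l _ (fun i : Fin n => (nodalPoly δ k).coeff i)
    (f := fun i v => v ^ (i : ℕ)) fun i => by fun_prop]
  refine sum_congr rfl fun i _ => ?_
  rw [freeGram_zero_apply h1 h2 h0 hδ, startMatrix, of_apply]
  have : ((i : ℕ).factorial : ℂ) ≠ 0 := by exact_mod_cast (i : ℕ).factorial_ne_zero
  field_simp

theorem det_freeGram_zero_ne_zero (h1 : IsCauchyContour Γ1 w1 V1) (h2 : IsCauchyContour Γ2 w2 V2) (h0 : (0 : ℂ) ∈ V1) (hδ : ∀ j, δ j ∈ V2) : (freeGram Γ1 w1 Γ2 w2 (fun _ => 0) δ).det ≠ 0 := by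
  intro h
  have := congrArg det (startMatrix_mul_freeGram h1 h2 h0 hδ)
  rw [det_mul, h, mul_zero, det_one] at this
  exact zero_ne_one this

/-- The functions biorthogonal to the divided differences of the Gaussian weights, for paths
leaving from `0`, as integrals along the vertical line through `c`. -/
def lineWeight (c : ℝ) (δ : Fin n → ℂ) (k : Fin n) (t y : ℝ) : ℂ :=
  (∫ s : ℝ, nodal δ k (c + s * I) *
    cexp ((c + s * I - y) ^ 2 / (1 - t : ℝ) - (c + s * I) ^ 2)) /
    (√(π * (1 - t)) : ℝ)

theorem gaussWeight_eq_integral (c : ℝ) (h0 : 0 < t) (h1 : t < 1) (u : ℂ) (y : ℝ) :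
    (√π : ℝ) * gaussWeight t u y = (∫ s : ℝ,
      cexp ((c + s * I - y) ^ 2 / (1 - t : ℝ) - (c + s * I) ^ 2) *
      cexp (2 * u * (c + s * I))) / (√(π * (1 - t)) : ℝ) := by
  have h1' : 0 < 1 - t := sub_pos.mpr h1
  have ht : (t : ℂ) ≠ 0 := by exact_mod_cast h0.ne'
  have ht1 : (1 - t : ℂ) ≠ 0 := by exact_mod_cast h1'.ne'
  set b : ℂ := ((-(t / (1 - t)) : ℝ) : ℂ) with hb
  have hbneg : -(t / (1 - t)) < 0 := neg_neg_of_pos (div_pos h0 h1')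
  have e : ∀ s : ℝ,
      cexp ((c + s * I - y) ^ 2 / (1 - t : ℝ) - (c + s * I) ^ 2) *
      cexp (2 * u * (c + s * I)) = cexp (b * s ^ 2 +
        (2 * I * ((c - y) / (1 - t) - c + u)) * s +
        ((c - y) ^ 2 / (1 - t) - c ^ 2 + 2 * u * c)) := by
    intro s
    rw [← exp_add]
    congr 1
    rw [hb]
    push_cast
    field_simp
    linear_combination (s ^ 2 * t : ℂ) * I_sq
  simp only [e]
  rw [integral_cexp_quadratic (by rw [hb, ofReal_re]; exact hbneg)]
  have e2 : ((π : ℂ) / -b) ^ (1 / 2 : ℂ) = ((√(π * (1 - t) / t) : ℝ) : ℂ) := by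
    rw [hb, Real.sqrt_eq_rpow, Complex.ofReal_cpow (by positivity)]
    push_cast
    congr 1
    field_simp
  rw [e2, gaussWeight]
  have e3 : (√π : ℝ) * (√(π * (1 - t)) : ℝ) =
      √(π * (1 - t) / t) * √(π * t) := by
    rw [← sqrt_mul pi_pos.le, ← sqrt_mul (by positivity)]
    congr 1
    field_simp
  have e3' : ((√π : ℝ) : ℂ) * (√(π * (1 - t)) : ℝ) =
      (√(π * (1 - t) / t) : ℝ) * (√(π * t) : ℝ) := by exact_mod_cast e3
  have n1 : ((√(π * (1 - t)) : ℝ) : ℂ) ≠ 0 := by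
    exact_mod_cast (Real.sqrt_pos.mpr (by positivity)).ne'
  have n2 : ((√(π * t) : ℝ) : ℂ) ≠ 0 := by
    exact_mod_cast (Real.sqrt_pos.mpr (by positivity)).ne'
  rw [mul_div_assoc', div_eq_div_iff n2 n1]
  have e4 : u ^ 2 - (u - y) ^ 2 / t = (c - y : ℂ) ^ 2 / (1 - t) - c ^ 2 + 2 * u * c -
      (2 * I * ((c - y) / (1 - t) - c + u)) ^ 2 / (4 * b) := by
    rw [hb, mul_pow, mul_pow, I_sq]
    push_cast
    field_simp
    ring
  rw [e4]
  linear_combination (cexp ((c - y : ℂ) ^ 2 / (1 - t) - c ^ 2 + 2 * u * c -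
      (2 * I * ((c - y) / (1 - t) - c + u)) ^ 2 / (4 * b))) * e3'

end confluentStart

/-- The boundary of the square with vertices `±1`, `±i`. -/
def diamond : Set ℂ := {w | |w.re| + |w.im| = 1}

/-- Half of the boundary of the square with center `1`, in the upper half plane for `e = 1` and in
the lower half plane for `e = -1`. -/
def armPath (e r : ℝ) : ℂ := r + (e * min r (2 - r) : ℝ) * I

/-- The derivative of `armPath`. -/
def armDeriv (e r : ℝ) : ℂ := 1 + (if r < 1 then e else -e : ℝ) * I

theorem continuous_armPath (e : ℝ) : Continuous (armPath e) := by
  unfold armPath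
  fun_prop

theorem measurable_armDeriv (e : ℝ) : Measurable (armDeriv e) := by
  unfold armDeriv
  have : Measurable fun r : ℝ => if r < 1 then e else -e := .ite measurableSet_Iio (by simp) (by simp)
  fun_prop

theorem norm_armDeriv_le {e r : ℝ} (he : |e| = 1) : ‖armDeriv e r‖ ≤ 2 := by
  refine (norm_add_le _ _).trans ?_
  split_ifs <;> simp [he] <;> norm_num

theorem armPath_sub_one_mem_diamond {e r : ℝ} (he : |e| = 1) (hr : r ∈ Icc (0 : ℝ) 2) :
    armPath e r - 1 ∈ diamond := by
  have h0 : 0 ≤ min r (2 - r) := le_min hr.1 (by linarith [hr.2])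
  simp only [diamond, Set.mem_ofPred_eq, armPath, sub_re, add_re, ofReal_re,
    re_ofReal_mul, I_re, mul_zero, add_zero, one_re, sub_im,
    add_im, ofReal_im, zero_add, im_ofReal_mul, I_im, mul_one,
    one_im, sub_zero, abs_mul, he, one_mul, abs_of_nonneg h0]
  grind

theorem hasDerivAt_armPath (e : ℝ) {r : ℝ} (hr : r ≠ 1) :
    HasDerivAt (armPath e) (armDeriv e r) r := by
  have key : ∀ a b : ℝ, HasDerivAt (fun r : ℝ => (r + (a + b * r : ℝ) * I : ℂ)) (1 + (b : ℝ) * I) r :=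
    fun a b => (Complex.ofRealCLM.hasDerivAt.add
      (((((hasDerivAt_id r).const_mul b).const_add a).ofReal_comp).mul_const I)).congr_deriv (by simp)
  rcases hr.lt_or_gt with h | h
  · rw [armDeriv, if_pos h]
    refine (key 0 e).congr_of_eventuallyEq (Filter.mem_of_superset (Iio_mem_nhds h) ?_)
    intro s (hs : s < 1)
    simp [armPath]
    left
    linarith
  · rw [armDeriv, if_neg h.not_gt]
    refine (key (2 * e) (-e)).congr_of_eventuallyEq (Filter.mem_of_superset (Ioi_mem_nhds h) ?_)
    intro s (hs : 1 < s)
    simp [armPath, min_eq_right (show 2 - s ≤ s by linarith)]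
    ring

theorem half_lt_norm_diamond {w : ℂ} (hw : w ∈ diamond) : 1 / 2 ≤ ‖w‖ := by
  have h : |w.re| + |w.im| = 1 := hw
  linarith [abs_re_le_norm w, Complex.abs_im_le_norm w]

theorem neg_one_le_re_diamond {w : ℂ} (hw : w ∈ diamond) : 0 ≤ 1 + w.re := by
  have h : |w.re| + |w.im| = 1 := hw
  linarith [neg_abs_le w.re, abs_nonneg w.im]

/-- The integral along the boundary of a square with a vertex at `0`, as the difference of two
arms. -/
def armsIntegral (h : ℝ) (g : ℂ → ℂ) : ℂ :=
  (∫ r in (0 : ℝ)..2, g (h * armPath (-1) r) * (h * armDeriv (-1) r)) -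
    ∫ r in (0 : ℝ)..2, g (h * armPath 1 r) * (h * armDeriv 1 r)

section

variable {h : ℝ} {g G : ℂ → ℂ}

theorem continuousOn_arm (hg : ContinuousOn (fun w => g (h * (1 + w))) diamond) {e : ℝ}
    (he : |e| = 1) : ContinuousOn (fun r => g (h * armPath e r)) (Icc 0 2) := by
  refine (hg.comp ((continuous_armPath e).sub continuous_const).continuousOn
    fun r hr => armPath_sub_one_mem_diamond he hr).congr fun r _ => ?_
  simp

theorem intervalIntegrable_arm (hg : ContinuousOn (fun w => g (h * (1 + w))) diamond) {e : ℝ}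
    (he : |e| = 1) :
    IntervalIntegrable (fun r => g (h * armPath e r) * (h * armDeriv e r)) volume 0 2 := by
  rw [intervalIntegrable_iff_integrableOn_Icc_of_le zero_le_two]
  refine (continuousOn_arm hg he).integrableOn_Icc.mul_bdd (c := |h| * 2)
    ((measurable_armDeriv e).const_mul _).aestronglyMeasurable (ae_of_all _ fun r => ?_)
  rw [norm_mul, norm_real, norm_eq_abs]
  gcongr
  exact norm_armDeriv_le he

theorem integral_arm_eq_sub (hg : ContinuousOn (fun w => g (h * (1 + w))) diamond) {e : ℝ}
    (he : |e| = 1)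
    (hG : ∀ r ∈ Icc (0 : ℝ) 2, HasDerivAt G (g (h * armPath e r)) (h * armPath e r)) :
    ∫ r in (0 : ℝ)..2, g (h * armPath e r) * (h * armDeriv e r) = G (h * 2) - G 0 := by
  have := integral_eq_of_hasDerivAt_off_countable_of_le (fun r => G (h * armPath e r))
    (fun r => g (h * armPath e r) * (h * armDeriv e r)) zero_le_two (countable_singleton 1)
    (fun r hr => ((hG r hr).continuousAt.comp (f := fun r => h * armPath e r)
      ((continuous_armPath e).const_mul _).continuousAt).continuousWithinAt)
    (fun r hr => (hG r (Ioo_subset_Icc_self hr.1)).comp r ((hasDerivAt_armPath e hr.2).const_mul _))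
    (intervalIntegrable_arm hg he)
  rw [this]
  simp [armPath]

theorem armsIntegral_eq_zero_of_primitive (hg : ContinuousOn (fun w => g (h * (1 + w))) diamond)
    (hG : ∀ w ∈ diamond, HasDerivAt G (g (h * (1 + w))) (h * (1 + w))) : armsIntegral h g = 0 := by
  have := fun {e : ℝ} (he : |e| = 1) => integral_arm_eq_sub hg he fun r hr => by
    simpa using hG _ (armPath_sub_one_mem_diamond he hr)
  rw [armsIntegral, this (by simp), this (by simp), sub_self]

theorem armsIntegral_inv (hh : h ≠ 0) {p : ℂ} (hp : ‖p - h‖ < |h| / 4) :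
    armsIntegral h (fun v => (v - p)⁻¹) = 2 * π * I := by
  have hh' : (h : ℂ) ≠ 0 := by exact_mod_cast hh
  have hw0 : ∀ w ∈ diamond, w ≠ 0 := fun w hw => norm_pos_iff.mp (by linarith [half_lt_norm_diamond hw])
  have hlt : ∀ w ∈ diamond, ‖(h - p) / (h * w)‖ < 1 := fun w hw => by
    have := half_lt_norm_diamond hw
    rw [norm_div, norm_mul, norm_real, norm_eq_abs, norm_sub_rev, div_lt_one (by positivity)]
    nlinarith [abs_pos.mpr hh]
  have hs : ∀ w ∈ diamond, 1 + (h - p) / (h * w) ∈ slitPlane := fun w hw =>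
    Complex.mem_slitPlane_of_norm_lt_one (hlt w hw)
  have e0 : ∀ w ∈ diamond, h * (1 + w) - p = h * w * (1 + (h - p) / (h * w)) := fun w hw => by
    have := hw0 w hw
    field_simp
    ring
  have hne : ∀ w ∈ diamond, h * (1 + w) - p ≠ 0 := fun w hw => by
    rw [e0 w hw]
    exact mul_ne_zero (mul_ne_zero hh' (hw0 w hw)) (Complex.slitPlane_ne_zero (hs w hw))
  have key : ∀ {e : ℝ}, |e| = 1 → ∫ r in (0 : ℝ)..2, (h * armPath e r - p)⁻¹ * (h * armDeriv e r) =
      Complex.log (-e * I) - Complex.log (e * I) +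
        (Complex.log (1 + (h - p) / h) - Complex.log (1 - (h - p) / h)) := fun {e} he => by
    rw [integral_arm_eq_sub (g := fun v => (v - p)⁻¹) (G := fun v =>
      Complex.log (-e * I * ((v - h) / h)) + Complex.log (1 + (h - p) / (v - h)))
      (ContinuousOn.inv₀ (by fun_prop) hne) he fun r hr => ?_]
    · rw [show (h * 2 - h : ℂ) = h by ring, div_self hh', zero_sub, neg_div_self hh', div_neg]
      ring_nf
    · have hm := armPath_sub_one_mem_diamond he hr
      have h1 := hs _ hm
      have h2 := hw0 _ hm
      have e1 : (armPath e r - 1).re = r - 1 := by simp [armPath]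
      have e2 : (armPath e r - 1).im = e * min r (2 - r) := by simp [armPath]
      have h3 : -e * I * (armPath e r - 1) ∈ slitPlane := by
        have h4 : e * e = 1 := by rw [← abs_mul_abs_self, he, mul_one]
        have h5 : 0 ≤ min r (2 - r) := le_min hr.1 (by linarith [hr.2])
        rw [Complex.mem_slitPlane_iff]
        rcases h5.eq_or_lt with h5 | h5
        · have : |r - 1| + |e * min r (2 - r)| = 1 := e1 ▸ e2 ▸ hm
          right
          simp [e1, e2]
          grind
        · left
          simp [e1, e2, ← mul_assoc, h4]
          grind
      have e3 : (h * armPath e r - h : ℂ) = h * (armPath e r - 1) := by ring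
      have d0 := (hasDerivAt_id (h * armPath e r : ℂ)).sub_const (h : ℂ)
      have d1 := (d0.div_const (h : ℂ)).const_mul (-e * I)
      have d2 := (((d0.fun_inv (by simp [e3, hh', h2])).const_mul (h - p)).const_add 1).clog
        (by simpa [e3, div_eq_mul_inv] using h1)
      refine ((d1.clog (by simpa [e3, hh'] using h3)).add d2).congr_deriv ?_
      have h6 : (h * armPath e r - p : ℂ) ≠ 0 := by simpa using hne _ hm
      have h7 : (h * armPath e r - h : ℂ) ≠ 0 := e3 ▸ mul_ne_zero hh' h2
      have h8 : (e : ℂ) ≠ 0 := by rintro h; simp_all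
      have h9 : 1 + (h - p) * (h * armPath e r - h : ℂ)⁻¹ =
          (h * armPath e r - p) / (h * armPath e r - h) := by field_simp; ring
      simp only [id, h9]
      field_simp
      ring
  rw [armsIntegral, key (by simp), key (by simp)]
  simp [Complex.log_neg_I, Complex.log_I]
  ring

theorem armsIntegral_inv_eq_zero {p ε : ℂ} (hε : ε ≠ 0)
    (hp : ∀ w ∈ diamond, ε * (h * (1 + w) - p) ∈ slitPlane) :
    armsIntegral h (fun v => (v - p)⁻¹) = 0 := by
  refine armsIntegral_eq_zero_of_primitive (G := fun v => Complex.log (ε * (v - p)))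
    (ContinuousOn.inv₀ (by fun_prop) fun w hw =>
      right_ne_zero_of_mul (Complex.slitPlane_ne_zero (hp w hw))) fun w hw => ?_
  refine ((((hasDerivAt_id _).sub_const p).const_mul ε).clog (hp w hw)).congr_deriv ?_
  rw [mul_one, div_mul_eq_div_div, div_self hε, one_div]
  rfl

theorem armsIntegral_div_sub {p : ℂ} (hf : Differentiable ℂ f)
    (hne : ∀ w ∈ diamond, h * (1 + w) - p ≠ 0) :
    armsIntegral h (fun v => f v / (v - p)) = f p * armsIntegral h (fun v => (v - p)⁻¹) := by
  have hd : Differentiable ℂ (dslope f p) := by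
    rw [← differentiableOn_univ]
    exact (Complex.differentiableOn_dslope univ_mem).mpr hf.differentiableOn
  obtain ⟨G, hG⟩ := hd.isExactOn_univ
  have e0 := armsIntegral_eq_zero_of_primitive (h := h) (G := G) (g := dslope f p)
    (hd.continuous.comp (by fun_prop)).continuousOn fun w _ => hG _ (mem_univ _)
  have c1 : ContinuousOn (fun w => f (h * (1 + w)) / (h * (1 + w) - p)) diamond :=
    (hf.continuous.comp (by fun_prop)).continuousOn.div (by fun_prop) hne
  have c2 : ContinuousOn (fun w => (h * (1 + w) - p)⁻¹) diamond := .inv₀ (by fun_prop) hne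
  have key : ∀ {e : ℝ}, |e| = 1 → (∫ r in (0 : ℝ)..2, dslope f p (h * armPath e r) *
      (h * armDeriv e r)) = (∫ r in (0 : ℝ)..2, f (h * armPath e r) / (h * armPath e r - p) *
      (h * armDeriv e r)) - f p * ∫ r in (0 : ℝ)..2, (h * armPath e r - p)⁻¹ * (h * armDeriv e r) := by
    intro e he
    rw [← intervalIntegral.integral_const_mul, ← intervalIntegral.integral_sub
      (intervalIntegrable_arm (g := fun v => f v / (v - p)) c1 he)
      ((intervalIntegrable_arm (g := fun v => (v - p)⁻¹) c2 he).const_mul _)]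
    refine intervalIntegral.integral_congr fun r hr => ?_
    rw [uIcc_of_le zero_le_two] at hr
    have := hne _ (armPath_sub_one_mem_diamond he hr)
    simp only [add_sub_cancel] at this
    simp only [dslope_of_ne _ (sub_ne_zero.mp this), slope_def_field]
    ring
  rw [armsIntegral, key (by simp), key (by simp)] at e0
  rw [armsIntegral, armsIntegral]
  linear_combination e0

theorem armsIntegral_mul (h e : ℝ) (g : ℂ → ℂ) :
    armsIntegral (h * e) g = h * armsIntegral e (fun ζ => g (h * ζ)) := by
  unfold armsIntegral
  rw [mul_sub, ← intervalIntegral.integral_const_mul, ← intervalIntegral.integral_const_mul]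
  congr 2 <;> ext r <;> push_cast <;> ring_nf

end
/-- The signs of the four arms of two squares. -/
def armSign (k : ℕ) : ℝ := (-1) ^ (k + 1)

/-- The scales of the four arms of two squares. -/
def armScale (h q : ℝ) (k : ℕ) : ℝ := if k < 2 then h else -(q * h)

/-- The boundaries of two squares with common vertex `z`, as a contour. -/
def squarePath (z h q s : ℝ) : ℂ :=
  z + armScale h q ⌊4 * s⌋₊ * armPath (armSign ⌊4 * s⌋₊) (8 * s - 2 * ⌊4 * s⌋₊)

/-- The weight of the contour formed by two squares. -/
def squareWeight (h q s : ℝ) : ℂ := 8 * (-armSign ⌊4 * s⌋₊ * (armScale h q ⌊4 * s⌋₊ *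
  armDeriv (armSign ⌊4 * s⌋₊) (8 * s - 2 * ⌊4 * s⌋₊)) / (2 * π * I))

theorem abs_armSign (k : ℕ) : |armSign k| = 1 := by simp [armSign]

theorem armScale_eq (h q : ℝ) (k : ℕ) : armScale h q k = h ∨ armScale h q k = -(q * h) :=
  ite_eq_or_eq ..

theorem exists_squarePath_eq (z h q : ℝ) {s : ℝ} (hs : 0 ≤ s) : ∃ e, (e = h ∨ e = -(q * h)) ∧
    ∃ w ∈ diamond, squarePath z h q s = z + e * (1 + w) := by
  refine ⟨_, armScale_eq h q ⌊4 * s⌋₊, _, armPath_sub_one_mem_diamond (abs_armSign ⌊4 * s⌋₊)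
    ⟨?_, ?_⟩, by rw [add_sub_cancel, squarePath]⟩
  · linarith [Nat.floor_le (by linarith : 0 ≤ 4 * s)]
  · linarith [Nat.lt_floor_add_one (4 * s)]

theorem contourIntegral_square {z h q : ℝ} {g : ℂ → ℂ}
    (hg : ∀ e, e = h ∨ e = -(q * h) → ContinuousOn (fun w => g (z + e * (1 + w))) diamond) :
    contourIntegral (squarePath z h q) (squareWeight h q) g = (2 * π * I)⁻¹ *
      (armsIntegral h (fun v => g (z + v)) + armsIntegral (-(q * h)) (fun v => g (z + v))) := by
  set A : ℝ → ℝ → ℂ := fun c e => ∫ r in (0 : ℝ)..2, g (z + c * armPath e r) * (c * armDeriv e r)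
  set F : ℕ → ℝ → ℂ := fun k r => -armSign k / (2 * π * I) *
    (g (z + armScale h q k * armPath (armSign k) r) * (armScale h q k * armDeriv (armSign k) r))
  have hi : ∀ k, IntervalIntegrable (F k) volume 0 2 := fun k =>
    (intervalIntegrable_arm (g := fun v => g (z + v)) (hg _ (armScale_eq h q k))
      (abs_armSign k)).const_mul _
  have hfl : ∀ k : ℕ, ∀ s ∈ Ioo ((k : ℝ) / 4) ((k + 1 : ℕ) / 4), 
      g (squarePath z h q s) * squareWeight h q s = 8 * F k (8 * s - 2 * k) := fun k s hs => by
    have : ⌊4 * s⌋₊ = k := by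
      have h1 := hs.1
      have h2 := hs.2
      rw [Nat.floor_eq_iff (by linarith [k.cast_nonneg (α := ℝ)])]
      push_cast at h2
      constructor <;> linarith
    rw [squarePath, squareWeight, this]
    ring
  have hle : ∀ k : ℕ, (k : ℝ) / 4 ≤ (k + 1 : ℕ) / 4 := fun k => by push_cast; linarith
  have hi4 : ∀ k : ℕ, k < 4 → IntervalIntegrable (fun s => g (squarePath z h q s) * squareWeight h q s)
      volume ((k : ℝ) / 4) ((k + 1 : ℕ) / 4) := fun k _ => by
    have := (((hi k).comp_sub_right (2 * k)).comp_mul_left (c := 8)).const_mul 8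
    rw [show (0 + 2 * k : ℝ) / 8 = k / 4 by ring,
      show (2 + 2 * k : ℝ) / 8 = (k + 1 : ℕ) / 4 by push_cast; ring] at this
    exact this.congr_uIoo fun s hs => (hfl k s (uIoo_of_le (hle k) ▸ hs)).symm
  have e := intervalIntegral.sum_integral_adjacent_intervals hi4
  rw [contourIntegral, integral_Icc_eq_integral_Ioc, ← integral_of_le zero_le_one]
  have e1 : ∀ k : ℕ, ∫ s in (k : ℝ) / 4..(k + 1 : ℕ) / 4, g (squarePath z h q s) * squareWeight h q s =
      -armSign k / (2 * π * I) * A (armScale h q k) (armSign k) := fun k => by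
    have : ∫ r in (0 : ℝ)..2, F k r = -armSign k / (2 * π * I) *
      A (armScale h q k) (armSign k) := intervalIntegral.integral_const_mul ..
    rw [← this, intervalIntegral.integral_congr_Ioo_of_le (hle k) (hfl k),
      intervalIntegral.integral_const_mul, intervalIntegral.integral_comp_mul_sub _ (by norm_num),
      real_smul]
    push_cast
    ring_nf
  simp only [e1, Finset.sum_range_succ, Finset.sum_range_zero, armSign, armScale] at e
  norm_num at e
  rw [← e]
  change _ = _ * (A h (-1) - A h 1 + (A (-(q * h)) (-1) - A (-(q * h)) 1))
  field_simp
  linear_combination -(A h (-1) + A (-(q * h)) (-1)) * I_sq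

theorem re_mul_diamond_sub_ge {e e' : ℝ} {p : ℂ} (h : e' * e < 0) (hp : ‖p - e'‖ < |e'| / 4) {w : ℂ}
    (hw : w ∈ diamond) : e' ^ 2 / 4 ≤ (-(e' : ℂ) * (e * (1 + w) - p)).re := by
  have h1 := mul_le_mul_of_nonneg_left ((abs_re_le_norm (p - e')).trans hp.le) (abs_nonneg e')
  have h2 := neg_one_le_re_diamond hw
  rw [← abs_mul] at h1
  have h3 := neg_le_of_abs_le h1
  have h4 := abs_mul_abs_self e'
  rw [← Complex.ofReal_neg, re_ofReal_mul]
  simp only [sub_re, ofReal_re, re_ofReal_mul, add_re,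
    one_re] at h3 ⊢
  nlinarith

theorem norm_diamond_sub_ge {e e' : ℝ} {p : ℂ} (h : e = e' ∨ e' * e < 0) (hp : ‖p - e'‖ < |e'| / 4)
    {w : ℂ} (hw : w ∈ diamond) : |e'| / 4 ≤ ‖e * (1 + w) - p‖ := by
  have h0 : 0 < |e'| := by linarith [norm_nonneg (p - e')]
  rcases h with rfl | h
  · have h1 := norm_sub_norm_le (e * w) (p - e)
    have h2 := mul_le_mul_of_nonneg_left (half_lt_norm_diamond hw) h0.le
    rw [norm_mul, norm_real, norm_eq_abs, show e * w - (p - e) = e * (1 + w) - p by ring]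
      at h1
    linarith
  · have h1 := (re_mul_diamond_sub_ge h hp hw).trans (re_le_norm _)
    rw [norm_mul, norm_neg, norm_real, norm_eq_abs, ← sq_abs] at h1
    nlinarith

theorem isCauchyContour_square (z : ℝ) {h q : ℝ} (hh : 0 < h) (hq : 0 < q) :
    IsCauchyContour (squarePath z h q) (squareWeight h q)
      (ball ((z + h : ℝ) : ℂ) (h / 4) ∪ ball ((z - q * h : ℝ) : ℂ) (q * h / 4)) := by
  have hqh := mul_pos hq hh
  have hfl : Measurable fun s : ℝ => ⌊4 * s⌋₊ := Nat.measurable_floor.comp (by fun_prop)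
  have hm : ∀ {F : ℕ × ℝ → ℂ}, (∀ k, Measurable fun s => F (k, s)) → Measurable fun s =>
      F (⌊4 * s⌋₊, s) := fun hF =>
    (measurable_from_prod_countable_right hF).comp (hfl.prodMk measurable_id)
  have hsc : ∀ k, |armScale h q k| ≤ h + q * h := fun k => by
    rcases armScale_eq h q k with e | e <;> rw [e]
    · rw [abs_of_pos hh]; linarith
    · rw [abs_neg, abs_of_pos hqh]; linarith
  have hopp : ∀ e e' : ℝ, e = h ∨ e = -(q * h) → e' = h ∨ e' = -(q * h) → e = e' ∨ e' * e < 0 := by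
    rintro e e' (rfl | rfl) (rfl | rfl) <;> first | exact .inl rfl | exact .inr (by nlinarith)
  have hmem : ∀ p ∈ ball ((z + h : ℝ) : ℂ) (h / 4) ∪ ball ((z - q * h : ℝ) : ℂ)
      (q * h / 4), ∃ e, (e = h ∨ e = -(q * h)) ∧ ‖p - z - e‖ < |e| / 4 := by
    rintro p (hp | hp) <;> rw [Metric.mem_ball, Complex.dist_eq] at hp
    · exact ⟨h, .inl rfl, by simpa [abs_of_pos hh, sub_sub] using hp⟩
    · refine ⟨_, .inr rfl, ?_⟩
      rw [abs_neg, abs_of_pos hqh, sub_sub]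
      simpa [← sub_eq_add_neg] using hp
  refine ⟨Metric.isOpen_ball.union Metric.isOpen_ball, ?_, ?_, ?_, ?_, ?_, ?_⟩
  · refine hm (F := fun x => z + armScale h q x.1 * armPath (armSign x.1) (8 * x.2 - 2 * x.1))
      fun k => ?_
    have := (continuous_armPath (armSign k)).measurable
    dsimp only
    fun_prop
  · refine hm (F := fun x => 8 * (-armSign x.1 * (armScale h q x.1 *
      armDeriv (armSign x.1) (8 * x.2 - 2 * x.1)) / (2 * π * I))) fun k => ?_
    have := measurable_armDeriv (armSign k)
    dsimp only
    fun_prop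
  · refine ⟨‖(z : ℂ)‖ + (h + q * h) * (1 + 1), fun s hs => ?_⟩
    obtain ⟨e, he, w, hw, e1⟩ := exists_squarePath_eq z h q hs.1
    have h1 : ‖w‖ ≤ 1 := (Complex.norm_le_abs_re_add_abs_im w).trans_eq hw
    have h2 : |e| ≤ h + q * h := by
      rcases he with rfl | rfl
      · rw [abs_of_pos hh]; linarith
      · rw [abs_neg, abs_of_pos hqh]; linarith
    calc _ ≤ ‖(z : ℂ)‖ + ‖(e : ℂ)‖ * (‖(1 : ℂ)‖ + ‖w‖) := by
          rw [e1]
          refine (norm_add_le _ _).trans ?_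
          rw [norm_mul]
          gcongr
          exact norm_add_le _ _
      _ ≤ ‖(z : ℂ)‖ + (h + q * h) * (1 + 1) := by
          rw [norm_real e, norm_one]
          gcongr
          exact h2
  · refine ⟨8 * (1 * ((h + q * h) * 2) / ‖(2 * π * I : ℂ)‖), fun s hs => ?_⟩
    rw [squareWeight, norm_mul, norm_div, norm_mul, norm_mul, norm_neg, norm_real,
      norm_real, norm_ofNat, norm_eq_abs, norm_eq_abs, abs_armSign]
    gcongr
    · exact hsc _
    · exact norm_armDeriv_le (abs_armSign _)
  · refine ⟨min h (q * h) / 4, by positivity, fun s hs p hp => ?_⟩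
    obtain ⟨e', he', hp⟩ := hmem p hp
    obtain ⟨e, he, w, hw, e1⟩ := exists_squarePath_eq z h q hs.1
    rw [e1, show z + e * (1 + w) - p = e * (1 + w) - (p - z) by ring]
    refine le_trans ?_ (norm_diamond_sub_ge (hopp e e' he he') hp hw)
    gcongr
    rcases he' with rfl | rfl
    · exact (min_le_left _ _).trans (le_abs_self _)
    · exact (min_le_right _ _).trans (abs_neg (q * h) ▸ le_abs_self _)
  · intro f hf p hp
    obtain ⟨e', he', hp⟩ := hmem p hp
    have he0 : 0 < |e'| := by linarith [norm_nonneg (p - z - e')]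
    have hne : ∀ e, e = h ∨ e = -(q * h) → ∀ w ∈ diamond, e * (1 + w) - (p - z) ≠ 0 := fun e he w hw =>
      norm_pos_iff.mp (by linarith [norm_diamond_sub_ge (hopp e e' he he') hp hw])
    have e1 : ∀ v, f (z + v) / (z + v - p) = f (z + v) / (v - (p - z)) := fun v => by
      rw [sub_sub_eq_add_sub, add_comm v]
    have hval : ∀ e, e = h ∨ e = -(q * h) → armsIntegral e (fun v => f (z + v) / (v - (p - z))) =
        f p * if e = e' then 2 * π * I else 0 := fun e he => by
      rw [armsIntegral_div_sub (f := fun v => f (z + v)) (by fun_prop) (hne e he), add_sub_cancel]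
      split_ifs with h
      · rw [h, armsIntegral_inv (abs_pos.mp he0) hp]
      · rw [armsIntegral_inv_eq_zero (ε := -(e' : ℂ)) (by simpa using abs_pos.mp he0) fun w hw =>
          .inl (lt_of_lt_of_le (by have := abs_pos.mp he0; positivity) (re_mul_diamond_sub_ge ((hopp e e' he he').resolve_left h) hp hw))]
    rw [contourIntegral_square]
    · simp only [e1]
      rw [hval _ (.inl rfl), hval _ (.inr rfl)]
      have := Complex.two_pi_I_ne_zero
      have : h ≠ -(q * h) := by linarith
      rcases he' with rfl | rfl <;> simp [this, this.symm] <;> field_simp <;> simp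
    · intro e he
      simp only [e1]
      exact (hf.continuous.comp (by fun_prop)).continuousOn.div (by fun_prop) (hne e he)

theorem exists_isCauchyContour_zero : ∃ (Γ w : ℝ → ℂ) (V : Set ℂ), IsCauchyContour Γ w V ∧
    0 ∈ V :=
  ⟨_, _, _, isCauchyContour_square (-1) one_pos one_pos, .inl (by simp)⟩

/-- The Gaussian factor of the vertical line integrals. -/
def lineGauss (c t y s : ℝ) : ℂ :=
  cexp ((c + s * I - y) ^ 2 / (1 - t : ℝ) - (c + s * I) ^ 2)

theorem norm_lineGauss (c y s : ℝ) (h1 : t < 1) : ‖lineGauss c t y s‖ =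
    exp ((c - y) ^ 2 / (1 - t) - c ^ 2) * exp (-(t / (1 - t)) * s ^ 2) := by
  have h1' : 1 - t ≠ 0 := (sub_pos.mpr h1).ne'
  rw [lineGauss, norm_exp, ← Real.exp_add]
  congr 1
  rw [sub_re, div_ofReal_re]
  simp only [pow_two, mul_re, mul_im, add_re, add_im,
    sub_re, sub_im, ofReal_re, ofReal_im, I_re, I_im]
  field_simp
  ring

theorem continuous_lineGauss (c t y : ℝ) : Continuous (lineGauss c t y) := by
  unfold lineGauss; fun_prop

theorem integrable_exp_abs_mul_gaussian (B : ℝ) {β : ℝ} (hβ : 0 < β) :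
    Integrable fun s : ℝ => exp (B * |s|) * exp (-β * s ^ 2) := by
  refine ((integrable_exp_neg_mul_sq (half_pos hβ)).const_mul
    (exp (B ^ 2 / (2 * β)))).mono' (by fun_prop) (ae_of_all _ fun s => ?_)
  rw [← Real.exp_add, ← Real.exp_add, norm_of_nonneg (exp_pos _).le]
  refine Real.exp_le_exp.mpr ?_
  have h : B ^ 2 / (2 * β) + -(β / 2) * s ^ 2 - (B * |s| + -β * s ^ 2) =
      (B - β * |s|) ^ 2 / (2 * β) := by
    field_simp
    rw [← sq_abs s]
    ring
  have : 0 ≤ (B - β * |s|) ^ 2 / (2 * β) := by positivity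
  linarith

theorem integrable_mul_lineGauss (c y : ℝ) (h0 : 0 < t) (h1 : t < 1) {f : ℝ → ℂ}
    (hf : AEStronglyMeasurable f) {C B : ℝ} (hB : ∀ s, ‖f s‖ ≤ C * exp (B * |s|)) :
    Integrable fun s => f s * lineGauss c t y s := by
  refine ((integrable_exp_abs_mul_gaussian B (div_pos h0 (sub_pos.mpr h1))).const_mul
    (C * exp ((c - y) ^ 2 / (1 - t) - c ^ 2))).mono'
    (hf.mul (continuous_lineGauss c t y).aestronglyMeasurable) (ae_of_all _ fun s => ?_)
  rw [norm_mul, norm_lineGauss c y s h1]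
  calc _ ≤ (C * exp (B * |s|)) * (exp ((c - y) ^ 2 / (1 - t) - c ^ 2) *
      exp (-(t / (1 - t)) * s ^ 2)) := by gcongr; exact hB s
    _ = _ := by ring

theorem norm_vertical_le (c s : ℝ) : ‖(c + s * I : ℂ)‖ ≤ |c| + |s| := by
  refine (norm_add_le _ _).trans (le_of_eq ?_)
  simp

theorem exists_norm_nodal_vertical_le (c : ℝ) (δ : Fin n → ℂ) (k : ℕ) :
    ∃ C, ∀ s : ℝ, ‖nodal δ k (c + s * I)‖ ≤ C * exp (n * |s|) := by
  refine ⟨∏ j ∈ Finset.univ.filter fun j : Fin n => (j : ℕ) < k, exp (|c| + ‖δ j‖),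
    fun s => ?_⟩
  rw [nodal, norm_prod]
  calc _ ≤ ∏ j ∈ Finset.univ.filter fun j : Fin n => (j : ℕ) < k,
        exp (|c| + ‖δ j‖) * exp |s| := by
        refine Finset.prod_le_prod (fun _ _ => norm_nonneg _) fun j _ => ?_
        rw [← Real.exp_add]
        have h1 := norm_vertical_le c s
        have h2 := norm_sub_le (c + s * I : ℂ) (δ j)
        have h3 := Real.add_one_le_exp (|c| + ‖δ j‖ + |s|)
        linarith
    _ ≤ _ := by
      rw [prod_mul_distrib]
      gcongr
      rw [prod_const, ← Real.exp_nat_mul]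
      refine Real.exp_le_exp.mpr ?_
      gcongr
      simpa using Finset.card_le_univ (Finset.univ.filter fun j : Fin n => (j : ℕ) < k)

theorem integrable_nodal_mul_lineGauss (c y : ℝ) (h0 : 0 < t) (h1 : t < 1)
    (δ : Fin n → ℂ) (k : ℕ) :
    Integrable fun s : ℝ => nodal δ k (c + s * I) * lineGauss c t y s := by
  obtain ⟨C, hC⟩ := exists_norm_nodal_vertical_le c δ k
  exact integrable_mul_lineGauss c y h0 h1
    ((continuous_nodal δ k).comp (by fun_prop)).aestronglyMeasurable hC

theorem integral_dividedDifference (hΓ : IsCauchyContour Γ w V) (hδ : ∀ j, δ j ∈ V) (k : ℕ) {F : ℝ → ℂ → ℂ}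
    (hF : Continuous (uncurry F)) {g : ℝ → ℝ} (hg : Integrable g)
    (hb : ∀ y, ∀ s ∈ Icc (0 : ℝ) 1, ‖F y (Γ s)‖ ≤ g y) :
    ∫ y, dividedDifference Γ w δ k (F y) = dividedDifference Γ w δ k fun v => ∫ y, F y v := by
  obtain ⟨R, hR⟩ := hΓ.bounded_weight
  obtain ⟨C, hC0, hC⟩ := exists_norm_inv_nodal_le hΓ n
  have hΓm := hΓ.measurable_path
  have hi : Integrable (uncurry fun y s => F y (Γ s) / nodal δ (k + 1) (Γ s) * w s)
      (volume.prod (volume.restrict (Icc (0 : ℝ) 1))) := by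
    refine (hg.mul_prod (integrable_const (C * R))).mono' ?_ ?_
    · exact (((hF.measurable.comp (measurable_fst.prodMk (hΓm.comp measurable_snd))).div
        ((continuous_nodal δ _).measurable.comp (hΓm.comp measurable_snd))).mul
        (hΓ.measurable_weight.comp measurable_snd)).aestronglyMeasurable
    · filter_upwards [Measure.quasiMeasurePreserving_snd.ae (ae_restrict_mem measurableSet_Icc)]
        with z hz
      rw [uncurry, norm_mul, div_eq_mul_inv, norm_mul, mul_assoc]
      have := hb z.1 _ hz
      have := hC δ hδ (k + 1) _ hz
      have := hR _ hz
      gcongr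
      exact (norm_nonneg _).trans (hb z.1 _ hz)
  unfold dividedDifference contourIntegral
  rw [integral_integral_swap hi]
  simp only [integral_mul_const, integral_div]

section confluentStart


theorem dividedDifference_lineIntegral (hΓ : IsCauchyContour Γ w V) (hz : (0 : ℂ) ∈ V) (c y : ℝ) (h0 : 0 < t) (h1 : t < 1) (k : Fin n) :
    dividedDifference Γ w (fun _ : Fin n => 0) k (fun u => ∫ s : ℝ, lineGauss c t y s *
        cexp (2 * u * (c + s * I))) =
      ∫ s : ℝ, (2 * (c + s * I)) ^ (k : ℕ) / ((k : ℕ).factorial : ℂ) *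
        lineGauss c t y s := by
  obtain ⟨R, hR⟩ := hΓ.bounded_path
  have hF : Continuous fun z : ℝ × ℂ => lineGauss c t y z.1 *
      cexp (2 * z.2 * (c + z.1 * I)) := by
    unfold lineGauss
    fun_prop
  have hg := (integrable_exp_abs_mul_gaussian (2 * R) (div_pos h0 (sub_pos.mpr h1))).const_mul
    (exp ((c - y) ^ 2 / (1 - t) - c ^ 2) * exp (2 * R * |c|))
  refine (integral_dividedDifference hΓ (fun _ : Fin n => hz) k (F := fun s u => lineGauss c t y s *
    cexp (2 * u * (c + s * I))) hF hg fun s r hr => ?_).symm.trans ?_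
  · rw [norm_mul, norm_lineGauss c y _ h1, norm_exp]
    have b1 : (2 * Γ r * (c + s * I)).re ≤ 2 * R * |c| + 2 * R * |s| := by
      refine (re_le_norm _).trans ?_
      rw [norm_mul, norm_mul, norm_two, mul_assoc 2 R, mul_assoc 2 R, ← mul_add, ← mul_add,
        mul_assoc]
      gcongr
      · exact (norm_nonneg _).trans (hR r hr)
      · exact hR r hr
      · exact norm_vertical_le c s
    have b2 := Real.exp_le_exp.mpr b1
    rw [Real.exp_add] at b2
    exact (mul_le_mul_of_nonneg_left b2 (by positivity)).trans_eq (by ring)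
  · congr 1 with s
    rw [← dividedDifference_zero_exp hΓ hz k, dividedDifference, dividedDifference,
      contourIntegral, contourIntegral, ← integral_mul_const]
    congr 1 with r
    ring

theorem sum_startMatrix_mul_nodeWeight (hΓ : IsCauchyContour Γ w V) (hz : (0 : ℂ) ∈ V) (c y : ℝ) (h0 : 0 < t) (h1 : t < 1)
    (δ : Fin n → ℂ) (k : Fin n) :
    ∑ i, startMatrix δ k i * nodeWeight Γ w (fun _ => 0) i t y = lineWeight c δ k t y := by
  have h1' : 0 < 1 - t := sub_pos.mpr h1
  have e1 : ∀ i : Fin n, (√π : ℝ) * nodeWeight Γ w (fun _ => 0) i t y =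
      (∫ s : ℝ, (2 * (c + s * I)) ^ (i : ℕ) / ((i : ℕ).factorial : ℂ) *
        lineGauss c t y s) / (√(π * (1 - t)) : ℝ) := by
    intro i
    rw [← dividedDifference_lineIntegral hΓ hz c y h0 h1 i]
    unfold nodeWeight dividedDifference contourIntegral
    rw [← integral_const_mul, ← integral_div]
    congr 1 with r
    have := gaussWeight_eq_integral c h0 h1 (Γ r) y
    unfold lineGauss
    linear_combination (w r / nodal (fun _ : Fin n => (0 : ℂ)) (i + 1) (Γ r)) * this
  have hfac : ∀ i : Fin n, ((i : ℕ).factorial : ℂ) ≠ 0 := fun i => by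
    exact_mod_cast (i : ℕ).factorial_ne_zero
  have hi : ∀ i : Fin n, Integrable fun s : ℝ => (nodalPoly δ k).coeff i *
      (c + s * I) ^ (i : ℕ) * lineGauss c t y s := by
    intro i
    have := integrable_nodal_mul_lineGauss c y h0 h1 (fun _ : Fin n => (0 : ℂ)) i
    have hc : (Finset.univ.filter fun j : Fin n => (j : ℕ) < i) = Finset.Iio i := by
      ext j; simp only [mem_filter, Finset.mem_univ, true_and, Finset.mem_Iio, lt_def]
    simp only [nodal, hc, sub_zero, prod_const, Fin.card_Iio] at this
    simp only [mul_assoc]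
    exact this.const_mul _
  have e2 : ∀ i : Fin n, startMatrix δ k i * nodeWeight Γ w (fun _ => 0) i t y =
      (∫ s : ℝ, (nodalPoly δ k).coeff i * (c + s * I) ^ (i : ℕ) * lineGauss c t y s) /
        (√(π * (1 - t)) : ℝ) := by
    intro i
    have e3 : ∀ s : ℝ, (nodalPoly δ k).coeff i * (c + s * I) ^ (i : ℕ) * lineGauss c t y s
        = (nodalPoly δ k).coeff i * (((i : ℕ).factorial : ℂ) / 2 ^ (i : ℕ)) *
        ((2 * (c + s * I)) ^ (i : ℕ) / ((i : ℕ).factorial : ℂ) * lineGauss c t y s) := by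
      intro s
      rw [mul_pow]
      field_simp [hfac i]
    simp only [e3]
    rw [integral_const_mul, startMatrix, of_apply]
    linear_combination ((nodalPoly δ k).coeff i * (((i : ℕ).factorial : ℂ) / 2 ^ (i : ℕ))) * e1 i
  simp only [e2]
  rw [← sum_div, ← integral_finsetSum _ fun i _ => hi i, lineWeight]
  congr 2 with s
  rw [nodal_eq_sum_coeff, sum_mul]
  rfl

theorem hasNonIntersectingProbability_gap_lineWeight (c1 : IsCauchyContour Γ1 w1 V1)
    (c2 : IsCauchyContour Γ2 w2 V2)
    {b a : ℝ} (hba : b ≤ a) (hz : (0 : ℂ) ∈ V1)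
    (hδ : ∀ j, (endPoints n n1 b a j : ℂ) ∈ V2)
    {t : Fin m → ℝ} {E : Fin m → Set ℝ} (ht : StrictMono t)
    (hE : ∀ i, Bornology.IsBounded (E i)) (hEm : ∀ i, MeasurableSet (E i))
    (h0 : ∀ i, 0 < t i) (h1 : ∀ i, t i < 1) (c : ℝ) :
    ∃ P : ℝ, HasNonIntersectingProbability n n1 b a t {x | ∀ i j, x i j ∉ E i} P ∧
      (P : ℂ) = det (1 - of fun k l => ∑ i, ∫ y in E i,
        lineWeight c (fun i => (endPoints n n1 b a i : ℂ)) k (t i) y *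
        avoidingWeight m t E (fun i => nodeWeight Γ2 w2
          (fun i => (endPoints n n1 b a i : ℂ)) l (1 - t i)) i y) := by
  set δ : Fin n → ℂ := fun i => (endPoints n n1 b a i : ℂ)
  have hδ' : ∀ j, δ j ∈ V2 := hδ
  have hdet := det_freeGram_zero_ne_zero (n := n) c1 c2 hz hδ'
  obtain ⟨P, hP, e⟩ := hasNonIntersectingProbability_gap c1 c2 hba hz hδ hdet ht hE hEm h0 h1
  refine ⟨P, hP, ?_⟩
  have hT := startMatrix_mul_freeGram c1 c2 hz hδ'
  have hTd : (startMatrix δ).det * (freeGram Γ1 w1 Γ2 w2 (fun _ => 0) δ).det = 1 := by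
    rw [← det_mul, hT, det_one]
  rw [e, div_eq_iff hdet]
  have key : startMatrix δ * gapGram Γ1 w1 Γ2 w2 (fun _ => 0) δ t E =
      1 - of fun k l => ∑ i, ∫ y in E i, lineWeight c δ k (t i) y *
        avoidingWeight m t E (fun i => nodeWeight Γ2 w2 δ l (1 - t i)) i y := by
    rw [gapGram, Matrix.mul_sub, hT]
    congr 1
    ext k l
    rw [Matrix.mul_apply]
    simp only [of_apply, mul_sum]
    rw [sum_comm]
    refine sum_congr rfl fun i _ => ?_
    simp only [← integral_const_mul]
    rw [← integral_finsetSum _ fun k' _ =>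
      (integrable_nodeWeight_mul_avoidingWeight c1 c2 (γ := fun _ => 0) (fun _ => hz) hδ' ht
        hE i k' l).const_mul _]
    congr 1 with y
    rw [← sum_startMatrix_mul_nodeWeight c1 hz c y (h0 i) (h1 i) δ k, sum_mul]
    simp only [mul_assoc]
  rw [← key, det_mul]
  linear_combination -(gapGram Γ1 w1 Γ2 w2 (fun _ => 0) δ t E).det * hTd

end confluentStart

theorem sum_submatrix_det_eq {ι : Type*} [Fintype ι] [DecidableEq ι] (M : Matrix ι ι ℂ) (k : ℕ) :
    ∑ f : Fin k → ι, (M.submatrix f f).det = (k.factorial : ℂ) *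
      ∑ s ∈ Finset.powersetCard k (Finset.univ : Finset ι),
        (M.submatrix (Subtype.val : s → ι) (Subtype.val : s → ι)).det := by
  have h0 : ∑ f : Fin k → ι, (M.submatrix f f).det =
      ∑ f ∈ Finset.univ.filter (fun f : Fin k → ι => Injective f),
        (M.submatrix f f).det := by
    refine (Finset.sum_filter_of_ne fun f _ hf => ?_).symm
    by_contra hinj
    obtain ⟨i, j, hij, hne⟩ : ∃ i j, f i = f j ∧ i ≠ j := by
      simpa [Injective] using hinj
    refine hf (Matrix.det_zero_of_row_eq hne ?_)
    ext l
    simp [hij]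
  rw [h0, ← Finset.sum_fiberwise_of_maps_to (s := Finset.univ.filter
    (fun f : Fin k → ι => Injective f)) (t := Finset.powersetCard k Finset.univ)
    (g := fun f => Finset.univ.image f), mul_sum]
  · refine sum_congr rfl fun s hs => ?_
    have hsc := (Finset.mem_powersetCard.mp hs).2
    have hcard : (Finset.univ.filter (fun f : Fin k → ι => Injective f) |>.filter
        fun f => Finset.univ.image f = s).card = k.factorial := by
      have e : Fintype.card (Fin k ≃ s) = k.factorial := by
        have e0 : Fin k ≃ s := (finCongr hsc.symm).trans s.equivFin.symm
        rw [Fintype.card_equiv e0, card_fin]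
      rw [← e, ← card_univ]
      symm
      refine Finset.card_bij (fun e _ i => (e i : ι)) ?_ ?_ ?_
      · intro e _
        simp only [mem_filter, Finset.mem_univ, true_and]
        refine ⟨Subtype.val_injective.comp e.injective, ?_⟩
        ext x
        simp only [Finset.mem_image, Finset.mem_univ, true_and]
        exact ⟨fun ⟨i, hi⟩ => hi ▸ (e i).2, fun hx => ⟨e.symm ⟨x, hx⟩, by simp⟩⟩
      · intro e _ e' _ h
        ext i
        exact congrFun h i
      · intro f hf
        simp only [mem_filter, Finset.mem_univ, true_and] at hf
        have hm : ∀ i, f i ∈ s := fun i => hf.2 ▸ Finset.mem_image_of_mem f (Finset.mem_univ i)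
        refine ⟨Equiv.ofBijective (fun i => (⟨f i, hm i⟩ : s)) ⟨fun i j hij => hf.1 ?_, ?_⟩,
          Finset.mem_univ _, rfl⟩
        · exact congrArg Subtype.val hij
        · rintro ⟨x, hx⟩
          rw [← hf.2] at hx
          obtain ⟨i, -, hi⟩ := Finset.mem_image.mp hx
          exact ⟨i, Subtype.ext hi⟩
    have hval : ∀ f ∈ (Finset.univ.filter (fun f : Fin k → ι => Injective f) |>.filter
        fun f => Finset.univ.image f = s), (M.submatrix f f).det =
        (M.submatrix (Subtype.val : s → ι) (Subtype.val : s → ι)).det := by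
      intro f hf
      simp only [mem_filter, Finset.mem_univ, true_and] at hf
      have hm : ∀ i, f i ∈ s := fun i => hf.2 ▸ Finset.mem_image_of_mem f (Finset.mem_univ i)
      let e : Fin k ≃ s := Equiv.ofBijective (fun i => (⟨f i, hm i⟩ : s))
        ⟨fun i j hij => hf.1 (congrArg Subtype.val hij), by
          rintro ⟨x, hx⟩
          rw [← hf.2] at hx
          obtain ⟨i, -, hi⟩ := Finset.mem_image.mp hx
          exact ⟨i, Subtype.ext hi⟩⟩
      rw [← Matrix.det_submatrix_equiv_self e, Matrix.submatrix_submatrix]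
      rfl
    rw [sum_congr rfl hval, sum_const, hcard, nsmul_eq_mul]
  · intro f hf
    simp only [mem_filter, Finset.mem_univ, true_and] at hf
    rw [Finset.mem_powersetCard]
    exact ⟨Finset.subset_univ _, by rw [Finset.card_image_of_injective _ hf]; simp⟩

/-- The Fredholm expansion of the determinant of a matrix. -/
theorem hasSum_det_one_sub {ι : Type*} [Fintype ι] [DecidableEq ι] (M : Matrix ι ι ℂ) :
    HasSum (fun k : ℕ => (-1) ^ k / (k.factorial : ℂ) * ∑ f : Fin k → ι, (M.submatrix f f).det)
      (1 - M).det := by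
  set P : Polynomial ℂ := (1 + (Polynomial.X : Polynomial ℂ) • (-M).map Polynomial.C).det with hP
  have h1 : P.eval 1 = (1 - M).det := by
    have h := RingHom.map_det (Polynomial.evalRingHom (1 : ℂ))
      (1 + (Polynomial.X : Polynomial ℂ) • (-M).map Polynomial.C)
    rw [Polynomial.coe_evalRingHom] at h
    rw [hP, h]
    congr 1
    ext i j
    by_cases h : i = j
    · subst h; simp [sub_eq_add_neg]
    · simp [Matrix.one_apply_ne h, sub_eq_add_neg]
  have h2 : ∀ k : ℕ, (-1) ^ k / (k.factorial : ℂ) * ∑ f : Fin k → ι, (M.submatrix f f).det =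
      P.coeff k := by
    intro k
    rw [hP, Matrix.coeff_det_one_add_X_smul_eq_sum_minors, sum_submatrix_det_eq]
    have : (k.factorial : ℂ) ≠ 0 := by exact_mod_cast k.factorial_ne_zero
    rw [← mul_assoc, div_mul_cancel₀ _ this, mul_sum]
    refine sum_congr rfl fun s hs => ?_
    have e : (-M).submatrix (Subtype.val : s → ι) (Subtype.val : s → ι) =
        -M.submatrix (Subtype.val : s → ι) (Subtype.val : s → ι) := rfl
    rw [e, Matrix.det_neg, Fintype.card_coe, (Finset.mem_powersetCard.mp hs).2]
  simp only [h2]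
  rw [← h1, Polynomial.eval_eq_sum, Polynomial.sum]
  simp only [one_pow, mul_one]
  exact hasSum_sum_of_ne_finset_zero fun k hk => Polynomial.notMem_support_iff.mp hk

open scoped ComplexOrder in
theorem norm_det_sq_le (M : Matrix (Fin k) (Fin k) ℂ) {C : ℝ}
    (hC : ∀ i j, ‖M i j‖ ≤ C) : ‖M.det‖ ^ 2 ≤ (k * C ^ 2) ^ k := by
  rcases Nat.eq_zero_or_pos k with rfl | hk
  · simp
  have hC0 : 0 ≤ C := (norm_nonneg _).trans (hC ⟨0, hk⟩ ⟨0, hk⟩)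
  have hps := Matrix.posSemidef_self_mul_conjTranspose M
  have hH := hps.isHermitian
  set ev := hH.eigenvalues with hev
  have hev0 : ∀ i, 0 ≤ ev i := fun i => hps.eigenvalues_nonneg i
  have hdet : ‖M.det‖ ^ 2 = ∏ i, ev i := by
    have h1 := hH.det_eq_prod_eigenvalues
    rw [det_mul, Matrix.det_conjTranspose] at h1
    have h2 : ((‖M.det‖ ^ 2 : ℝ) : ℂ) = ((∏ i, ev i : ℝ) : ℂ) := by
      rw [← Complex.normSq_eq_norm_sq, ← Complex.mul_conj]
      simpa using h1
    exact_mod_cast h2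
  have htr : ∑ i, ev i ≤ k * (k * C ^ 2) := by
    have h1 := hH.trace_eq_sum_eigenvalues
    have h2 : ((∑ i, ev i : ℝ) : ℂ) = ((∑ i, ∑ j, ‖M i j‖ ^ 2 : ℝ) : ℂ) := by
      have h3 : (M * M.conjTranspose).trace = ∑ i, ∑ j, ((‖M i j‖ ^ 2 : ℝ) : ℂ) := by
        simp only [Matrix.trace, Matrix.diag_apply, Matrix.mul_apply, Matrix.conjTranspose_apply]
        refine sum_congr rfl fun i _ => sum_congr rfl fun j _ => ?_
        rw [← Complex.normSq_eq_norm_sq, ← Complex.mul_conj]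
        rfl
      rw [h1] at h3
      push_cast at h3 ⊢
      simpa using h3
    have h4 : ∑ i, ev i = ∑ i, ∑ j, ‖M i j‖ ^ 2 := by exact_mod_cast h2
    rw [h4]
    calc ∑ i, ∑ j, ‖M i j‖ ^ 2 ≤ ∑ _i : Fin k, ∑ _j : Fin k, C ^ 2 := by
          gcongr with i _ j _; exact hC i j
      _ = _ := by simp
  have hk' : (0 : ℝ) < k := by exact_mod_cast hk
  have ham := Real.geom_mean_le_arith_mean Finset.univ (fun _ : Fin k => (1 : ℝ)) ev
    (fun _ _ => zero_le_one) (by simpa using hk) (fun i _ => hev0 i)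
  simp only [Real.rpow_one, sum_const, card_univ, card_fin, nsmul_eq_mul,
    mul_one, one_mul] at ham
  rw [hdet]
  have hp0 : 0 ≤ ∏ i, ev i := prod_nonneg fun i _ => hev0 i
  calc ∏ i, ev i = ((∏ i, ev i) ^ ((k : ℝ)⁻¹)) ^ k := by
        rw [← Real.rpow_natCast, ← Real.rpow_mul hp0, inv_mul_cancel₀ hk'.ne', Real.rpow_one]
    _ ≤ ((∑ i, ev i) / k) ^ k := by
        gcongr
    _ ≤ (k * C ^ 2) ^ k := by
        have : (∑ i, ev i) / k ≤ k * C ^ 2 := by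
          rw [div_le_iff₀ hk']; linarith
        have h0 : 0 ≤ (∑ i, ev i) / k := div_nonneg (sum_nonneg fun i _ => hev0 i) hk'.le
        gcongr

/-- Hadamard's inequality. -/
theorem norm_det_le_sqrt_pow (M : Matrix (Fin k) (Fin k) ℂ) {C : ℝ}
    (hC : ∀ i j, ‖M i j‖ ≤ C) : ‖M.det‖ ≤ √((k * C ^ 2) ^ k) :=
  Real.le_sqrt_of_sq_le (norm_det_sq_le M hC)

theorem summable_hadamard (C L : ℝ) :
    Summable fun k : ℕ => 1 / (k.factorial : ℝ) * (√((k * C ^ 2) ^ k) * L ^ k) := by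
  set X := 4 * exp 1 * C ^ 2 * L ^ 2 with hX
  have hs : Summable fun k : ℕ => (X ^ k / k.factorial + (1 / 4) ^ k) / 2 :=
    ((Real.summable_pow_div_factorial X).add
      (summable_geometric_of_lt_one (by norm_num) (by norm_num))).div_const 2
  refine Summable.of_norm_bounded hs fun k => ?_
  have hf : (0 : ℝ) < k.factorial := by exact_mod_cast k.factorial_pos
  rw [norm_mul, norm_mul, norm_pow, norm_of_nonneg (sqrt_nonneg _),
    norm_of_nonneg (by positivity : (0 : ℝ) ≤ 1 / (k.factorial : ℝ))]
  have hkk : (k : ℝ) ^ k ≤ k.factorial * exp 1 ^ k := by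
    have := Real.pow_div_factorial_le_exp (k : ℝ) (Nat.cast_nonneg k) k
    rw [div_le_iff₀ hf, mul_comm] at this
    rwa [← Real.exp_nat_mul, mul_one]
  set u := 1 / (k.factorial : ℝ) * (√((k * C ^ 2) ^ k) * ‖L‖ ^ k) with hu
  have hu0 : 0 ≤ u := by positivity
  have hu2 : u ^ 2 ≤ X ^ k / k.factorial * (1 / 4) ^ k := by
    have e1 : u ^ 2 = 1 / (k.factorial : ℝ) ^ 2 * ((k : ℝ) ^ k * (C ^ 2 * L ^ 2) ^ k) := by
      rw [hu, mul_pow, mul_pow, sq_sqrt (by positivity), ← pow_mul, mul_comm k 2, pow_mul,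
        norm_eq_abs, sq_abs]
      simp only [mul_pow, one_div, inv_pow]
      ring
    have e2 : X ^ k / k.factorial * (1 / 4) ^ k =
        1 / (k.factorial : ℝ) ^ 2 * ((k.factorial * exp 1 ^ k) * (C ^ 2 * L ^ 2) ^ k) := by
      have : X ^ k * (1 / 4) ^ k = exp 1 ^ k * (C ^ 2 * L ^ 2) ^ k := by
        rw [← mul_pow, ← mul_pow, hX]; congr 1; ring
      rw [div_mul_eq_mul_div, this]
      field_simp
    rw [e1, e2]
    gcongr
  have hX0 : 0 ≤ X := by positivity
  have hA0 : 0 ≤ X ^ k / k.factorial := by positivity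
  have hB0 : (0 : ℝ) ≤ (1 / 4) ^ k := by positivity
  refine abs_le_of_sq_le_sq' (b := (X ^ k / k.factorial + (1 / 4) ^ k) / 2) ?_ (by positivity) |>.2
  nlinarith [sq_nonneg (X ^ k / k.factorial - (1 / 4) ^ k)]

/-- The terms of the Fredholm series. -/
def fredholmTerm {m : ℕ} (K : Fin m → Fin m → ℝ → ℝ → ℂ) (E : Fin m → Set ℝ) (k : ℕ) : ℂ :=
  (-1) ^ k / (k.factorial : ℂ) * ∑ κ : Fin k → Fin m,
    ∫ x in Set.pi univ fun i => E (κ i),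
      det (of fun i j => K (κ i) (κ j) (x i) (x j))

section fredholm

variable {E : Fin m → Set ℝ}

theorem volume_pi_lt_top (hE : ∀ i, Bornology.IsBounded (E i)) (κ : Fin k → Fin m) :
    volume (Set.pi univ fun i => E (κ i)) < ⊤ := by
  rw [volume_pi_pi]
  exact ENNReal.prod_lt_top fun i _ => (hE (κ i)).measure_lt_top

theorem volumeReal_pi_le {L : ℝ} (hL : ∀ i, volume.real (E i) ≤ L) (κ : Fin k → Fin m) :
    volume.real (Set.pi univ fun i => E (κ i)) ≤ L ^ k := by
  rw [measureReal_def, volume_pi_pi, ENNReal.toReal_prod]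
  calc _ ≤ ∏ _i : Fin k, L := Finset.prod_le_prod (fun _ _ => ENNReal.toReal_nonneg)
        fun i _ => hL (κ i)
    _ = _ := by simp

theorem norm_fredholmTerm_le (hE : ∀ i, Bornology.IsBounded (E i)) {L : ℝ} (hL : ∀ i, volume.real (E i) ≤ L)
    {K : Fin m → Fin m → ℝ → ℝ → ℂ} {C : ℝ}
    (hC : ∀ i j, ∀ x ∈ E i, ∀ y ∈ E j, ‖K i j x y‖ ≤ C) (k : ℕ) :
    ‖fredholmTerm K E k‖ ≤ 1 / (k.factorial : ℝ) * (√((k * C ^ 2) ^ k) * (m * L) ^ k) := by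
  rw [fredholmTerm, norm_mul, norm_div, norm_pow, norm_neg, norm_one, one_pow, Complex.norm_natCast]
  gcongr
  calc _ ≤ ∑ κ : Fin k → Fin m, √((k * C ^ 2) ^ k) * L ^ k := by
        refine (norm_sum_le _ _).trans (sum_le_sum fun κ _ => ?_)
        refine (norm_setIntegral_le_of_norm_le_const (volume_pi_lt_top hE κ) fun x hx => ?_).trans
          (mul_le_mul_of_nonneg_left (volumeReal_pi_le hL κ) (sqrt_nonneg _))
        refine norm_det_le_sqrt_pow _ fun i j => ?_
        exact hC _ _ _ (hx i (mem_univ i)) _ (hx j (mem_univ j))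
    _ = _ := by simp; ring

theorem measurable_det_kernel {K : Fin m → Fin m → ℝ → ℝ → ℂ}
    (hK : ∀ i j, Measurable fun z : ℝ × ℝ => K i j z.1 z.2) (κ : Fin k → Fin m) :
    Measurable fun x : Fin k → ℝ =>
      det (of fun i j => K (κ i) (κ j) (x i) (x j)) := by
  simp only [det_apply', of_apply]
  refine Finset.measurable_sum _ fun σ _ => Measurable.const_mul (measurable_prod _
    fun i _ => ?_) _
  have h := (hK (κ (σ i)) (κ i)).comp
    ((measurable_pi_apply (X := fun _ : Fin k => ℝ) (σ i)).prodMk (measurable_pi_apply i))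
  exact h

theorem tendsto_hasFredholmDet (hE : ∀ i, Bornology.IsBounded (E i))
    (hEm : ∀ i, MeasurableSet (E i)) {K : ℕ → Fin m → Fin m → ℝ → ℝ → ℂ}
    {K' : Fin m → Fin m → ℝ → ℝ → ℂ}
    (hm : ∀ N i j, Measurable fun z : ℝ × ℝ => K N i j z.1 z.2) {C : ℝ}
    (hC : ∀ N i j, ∀ x ∈ E i, ∀ y ∈ E j, ‖K N i j x y‖ ≤ C)
    (hlim : ∀ i j, ∀ x ∈ E i, ∀ y ∈ E j, Tendsto (fun N => K N i j x y) atTop (𝓝 (K' i j x y))) :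
    ∃ D, HasFredholmDet K' E D ∧ ∀ D' : ℕ → ℂ, (∀ N, HasFredholmDet (K N) E (D' N)) →
      Tendsto D' atTop (𝓝 D) := by
  obtain ⟨L, hL⟩ : ∃ L, ∀ i, volume.real (E i) ≤ L :=
    ⟨∑ i, volume.real (E i), fun i => single_le_sum (f := fun i => volume.real (E i))
      (fun _ _ => measureReal_nonneg) (Finset.mem_univ i)⟩
  have hdet : ∀ {k : ℕ} (κ : Fin k → Fin m), ∀ x ∈ Set.pi univ fun i => E (κ i),
      Tendsto (fun N => det (of fun i j => K N (κ i) (κ j) (x i) (x j))) atTop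
        (𝓝 (det (of fun i j => K' (κ i) (κ j) (x i) (x j)))) := by
    intro k κ x hx
    refine (Continuous.matrix_det continuous_id).continuousAt.tendsto.comp ?_
    refine tendsto_pi_nhds.mpr fun i => tendsto_pi_nhds.mpr fun j => ?_
    exact hlim _ _ _ (hx i (mem_univ i)) _ (hx j (mem_univ j))
  have hms : ∀ {k : ℕ} (κ : Fin k → Fin m), MeasurableSet (Set.pi univ fun i => E (κ i)) :=
    fun κ => MeasurableSet.univ_pi fun i => hEm (κ i)
  have hC' : ∀ i j, ∀ x ∈ E i, ∀ y ∈ E j, ‖K' i j x y‖ ≤ C := fun i j x hx y hy =>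
    le_of_tendsto (hlim i j x hx y hy).norm (Eventually.of_forall fun N => hC N i j x hx y hy)
  have hbd : ∀ {J : Fin m → Fin m → ℝ → ℝ → ℂ}, (∀ i j, ∀ x ∈ E i, ∀ y ∈ E j, ‖J i j x y‖ ≤ C) →
      ∀ {k : ℕ} (κ : Fin k → Fin m), ∀ x ∈ Set.pi univ fun i => E (κ i),
      ‖det (of fun i j => J (κ i) (κ j) (x i) (x j))‖ ≤ √((k * C ^ 2) ^ k) :=
    fun hJ k κ x hx => norm_det_le_sqrt_pow _ fun i j =>
      hJ _ _ _ (hx i (mem_univ i)) _ (hx j (mem_univ j))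
  have hsum : Summable fun k : ℕ => 1 / (k.factorial : ℝ) * (√((k * C ^ 2) ^ k) * (m * L) ^ k) :=
    summable_hadamard C (m * L)
  have hae : ∀ {k : ℕ} (κ : Fin k → Fin m), AEStronglyMeasurable (fun x : Fin k → ℝ =>
      det (of fun i j => K' (κ i) (κ j) (x i) (x j)))
      (volume.restrict (Set.pi univ fun i => E (κ i))) := fun κ =>
    aestronglyMeasurable_of_tendsto_ae atTop
      (fun N => (measurable_det_kernel (hm N) κ).aestronglyMeasurable)
      ((ae_restrict_mem (hms κ)).mono fun x hx => hdet κ x hx)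
  refine ⟨∑' k, fredholmTerm K' E k, ⟨fun k κ => ?_, ?_⟩, fun D' hD' => ?_⟩
  · exact (integrableOn_const (C := √((k * C ^ 2) ^ k)) (volume_pi_lt_top hE κ).ne).mono' (hae κ)
      ((ae_restrict_mem (hms κ)).mono fun x hx => hbd hC' κ x hx)
  · exact (Summable.of_norm_bounded hsum fun k => norm_fredholmTerm_le hE hL hC' k).hasSum
  · have e : D' = fun N => ∑' k, fredholmTerm (K N) E k := funext fun N => (hD' N).2.tsum_eq.symm
    rw [e]
    refine tendsto_tsum_of_dominated_convergence hsum (fun k => ?_)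
      (Eventually.of_forall fun N k => norm_fredholmTerm_le hE hL (hC N) k)
    refine Tendsto.const_mul _ (tendsto_finsetSum _ fun κ _ => ?_)
    refine tendsto_integral_of_dominated_convergence (fun _ => √((k * C ^ 2) ^ k))
      (fun N => (measurable_det_kernel (hm N) κ).aestronglyMeasurable)
      (integrableOn_const (volume_pi_lt_top hE κ).ne) (fun N => ?_) ?_
    · exact (ae_restrict_mem (hms κ)).mono fun x hx => hbd (hC N) κ x hx
    · exact (ae_restrict_mem (hms κ)).mono fun x hx => hdet κ x hx

theorem HasFredholmDet.unique {K : Fin m → Fin m → ℝ → ℝ → ℂ} {D D' : ℂ}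
    (h : HasFredholmDet K E D) (h' : HasFredholmDet K E D') : D = D' := h.2.unique h'.2

theorem HasFredholmDet.gauge {K : Fin m → Fin m → ℝ → ℝ → ℂ} {D : ℂ} (h : HasFredholmDet K E D)
    {g : Fin m → ℝ → ℂ} (hg : ∀ i x, g i x ≠ 0) :
    HasFredholmDet (fun i j x y => g i x * K i j x y * (g j y)⁻¹) E D := by
  have e : ∀ {k : ℕ} (κ : Fin k → Fin m) (x : Fin k → ℝ),
      det (of fun i j => g (κ i) (x i) * K (κ i) (κ j) (x i) (x j) *
        (g (κ j) (x j))⁻¹) = det (of fun i j => K (κ i) (κ j) (x i) (x j)) := by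
    intro k κ x
    have e1 : (of fun i j => g (κ i) (x i) * K (κ i) (κ j) (x i) (x j) *
        (g (κ j) (x j))⁻¹) = of fun i j => g (κ i) (x i) * (of fun i j =>
          (g (κ j) (x j))⁻¹ * (of fun i j => K (κ i) (κ j) (x i) (x j)) i j) i j := by
      ext i j
      simp only [of_apply]
      ring
    rw [e1, det_mul_column, det_mul_row, ← mul_assoc, ← prod_mul_distrib,
      prod_congr rfl fun i _ => mul_inv_cancel₀ (hg (κ i) (x i)), Finset.prod_const_one,
      one_mul]
  simpa only [HasFredholmDet, e] using h

section discrete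

variable {J : Type*} [Fintype J] [MeasurableSpace J] [MeasurableSingletonClass J]

theorem integral_pi_comp_eq_sum (hE : ∀ i, Bornology.IsBounded (E i)) {q : ℝ → J}
    (hq : Measurable q) (κ : Fin k → Fin m) (g : (Fin k → J) → ℂ) :
    IntegrableOn (fun x : Fin k → ℝ => g fun i => q (x i)) (Set.pi univ fun i => E (κ i)) ∧
    ∫ x in Set.pi univ fun i => E (κ i), g (fun i => q (x i)) =
      ∑ c : Fin k → J, (∏ i, (volume.real (q ⁻¹' {c i} ∩ E (κ i)) : ℂ)) * g c := by
  have hfin : ∀ i, IsFiniteMeasure (volume.restrict (E (κ i))) := fun i =>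
    ⟨by rw [Measure.restrict_apply_univ]; exact (hE _).measure_lt_top⟩
  have hmq : Measurable fun (x : Fin k → ℝ) (i : Fin k) => q (x i) := by fun_prop
  have hmg : Measurable g := measurable_of_finite g
  have e0 : (volume : Measure (Fin k → ℝ)).restrict (Set.pi univ fun i => E (κ i)) =
      Measure.pi fun i => (volume : Measure ℝ).restrict (E (κ i)) :=
    Measure.restrict_pi_pi (fun _ => volume) _
  have e1 : (Measure.pi fun i => (volume : Measure ℝ).restrict (E (κ i))).map
      (fun (x : Fin k → ℝ) (i : Fin k) => q (x i)) =
      Measure.pi fun i => ((volume : Measure ℝ).restrict (E (κ i))).map q :=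
    Measure.pi_map_pi (fun i => hq.aemeasurable)
  have hint : Integrable g (Measure.pi fun i => ((volume : Measure ℝ).restrict (E (κ i))).map q) :=
    Integrable.of_finite
  rw [IntegrableOn, e0]
  rw [← e1] at hint
  refine ⟨hint.comp_measurable hmq, ?_⟩
  have e2 := integral_map hmq.aemeasurable (μ := Measure.pi fun i =>
    (volume : Measure ℝ).restrict (E (κ i))) (f := g) hmg.aestronglyMeasurable
  rw [← e2, e1, integral_fintype (e1 ▸ hint)]
  refine sum_congr rfl fun c _ => ?_
  rw [measureReal_def, Measure.pi_singleton, ENNReal.toReal_prod, real_smul]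
  push_cast
  congr 1
  refine prod_congr rfl fun i _ => ?_
  rw [Measure.map_apply hq (measurableSet_singleton _),
    Measure.restrict_apply (hq (measurableSet_singleton _)), measureReal_def]

theorem setIntegral_comp_eq_sum (hE : ∀ i, Bornology.IsBounded (E i)) {q : ℝ → J}
    (hq : Measurable q) (i : Fin m) (g : J → ℂ) :
    ∫ y in E i, g (q y) = ∑ c, (volume.real (q ⁻¹' {c} ∩ E i) : ℂ) * g c := by
  have hfin : IsFiniteMeasure (volume.restrict (E i)) :=
    ⟨by rw [Measure.restrict_apply_univ]; exact (hE _).measure_lt_top⟩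
  rw [← integral_map (μ := volume.restrict (E i)) hq.aemeasurable
    (measurable_of_finite g).aestronglyMeasurable, integral_fintype Integrable.of_finite]
  refine sum_congr rfl fun c _ => ?_
  rw [real_smul, measureReal_def, Measure.map_apply hq (measurableSet_singleton _),
    Measure.restrict_apply (hq (measurableSet_singleton _)), measureReal_def]

theorem hasFredholmDet_discrete [DecidableEq J] (hE : ∀ i, Bornology.IsBounded (E i)) {q : ℝ → J}
    (hq : Measurable q) (M : Fin m → Fin m → J → J → ℂ) :
    HasFredholmDet (fun i j x y => M i j (q x) (q y)) E
      (det (1 - of fun a b : Fin m × J => M a.1 b.1 a.2 b.2 *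
        (volume.real (q ⁻¹' {b.2} ∩ E b.1) : ℂ))) := by
  refine ⟨fun k κ => (integral_pi_comp_eq_sum hE hq κ fun c =>
    det (of fun i j => M (κ i) (κ j) (c i) (c j))).1, ?_⟩
  convert hasSum_det_one_sub (of fun a b : Fin m × J => M a.1 b.1 a.2 b.2 *
        (volume.real (q ⁻¹' {b.2} ∩ E b.1) : ℂ)) using 1
  ext k
  congr 1
  rw [← (Equiv.arrowProdEquivProdArrow (Fin k) (fun _ => Fin m) (fun _ => J)).symm.sum_comp,
    sum_prod_type]
  refine sum_congr rfl fun κ _ => ?_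
  rw [(integral_pi_comp_eq_sum hE hq κ fun c =>
    det (of fun i j => M (κ i) (κ j) (c i) (c j))).2]
  refine sum_congr rfl fun c _ => ?_
  rw [← det_mul_row]
  congr 1
  ext i j
  simp [Equiv.arrowProdEquivProdArrow, mul_comm]

theorem hasFredholmDet_discrete_finiteRank [DecidableEq J] (hE : ∀ i, Bornology.IsBounded (E i)) {q : ℝ → J}
    (hq : Measurable q) (W : Fin m → Fin m → J → J → ℂ)
    (hW : ∀ i j, ¬ i < j → ∀ c d, W i j c d = 0) (Θ Φ : Fin n → Fin m → J → ℂ) :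
    HasFredholmDet (fun i j x y => (∑ k, (Θ k i (q x) + ∑ j', ∫ z in E j',
      W i j' (q x) (q z) * Θ k j' (q z)) * Φ k j (q y)) - W i j (q x) (q y)) E
      (det (1 - of fun k l => ∑ i, ∫ y in E i, Φ k i (q y) * Θ l i (q y))) := by
  set ω : Fin m × J → ℂ := fun b => (volume.real (q ⁻¹' {b.2} ∩ E b.1) : ℂ) with hω
  have e1 : ∀ k i c, (∑ j', ∫ z in E j', W i j' c (q z) * Θ k j' (q z)) =
      ∑ b : Fin m × J, ω b * (W i b.1 c b.2 * Θ k b.1 b.2) := by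
    intro k i c
    rw [sum_prod_type]
    exact sum_congr rfl fun j' _ =>
      setIntegral_comp_eq_sum hE hq j' fun d => W i j' c d * Θ k j' d
  have e2 : ∀ k l, (∑ i, ∫ y in E i, Φ k i (q y) * Θ l i (q y)) =
      ∑ b : Fin m × J, ω b * (Φ k b.1 b.2 * Θ l b.1 b.2) := by
    intro k l
    rw [sum_prod_type]
    exact sum_congr rfl fun i _ => setIntegral_comp_eq_sum hE hq i fun d => Φ k i d * Θ l i d
  have h := hasFredholmDet_discrete hE hq fun i j c d => (∑ k, (Θ k i c + ∑ j', ∫ z in E j',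
      W i j' c (q z) * Θ k j' (q z)) * Φ k j d) - W i j c d
  convert h using 1
  set WD : Matrix (Fin m × J) (Fin m × J) ℂ := of fun a b => W a.1 b.1 a.2 b.2 * ω b with hWD
  set T : Matrix (Fin m × J) (Fin n) ℂ := of fun a k => Θ k a.1 a.2 with hT
  set P : Matrix (Fin n) (Fin m × J) ℂ := of fun k b => Φ k b.1 b.2 * ω b with hP
  have e3 : (1 - of fun a b : Fin m × J => ((∑ k, (Θ k a.1 a.2 + ∑ j', ∫ z in E j',
      W a.1 j' a.2 (q z) * Θ k j' (q z)) * Φ k b.1 b.2) - W a.1 b.1 a.2 b.2) * ω b) =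
      (1 + WD) * (1 - T * P) := by
    have : (1 + WD) * (1 - T * P) = 1 - ((T + WD * T) * P - WD) := by
      simp only [Matrix.add_mul, Matrix.mul_sub, Matrix.one_mul, Matrix.mul_one, Matrix.mul_assoc]
      abel
    rw [this]
    congr 1
    ext a b
    simp only [of_apply, Matrix.sub_apply, Matrix.mul_apply, Matrix.add_apply, e1, hWD, hT,
      hP, sub_mul, sum_mul]
    congr 1
    refine sum_congr rfl fun k _ => ?_
    rw [mul_assoc]
    congr 2
    refine sum_congr rfl fun c _ => ?_
    ring
  have e4 : (1 + WD).det = 1 := by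
    have hbt : (1 + WD).BlockTriangular Prod.fst := by
      intro a b hab
      have hne : a ≠ b := fun h => by subst h; exact lt_irrefl _ hab
      rw [Matrix.add_apply, Matrix.one_apply_ne hne, hWD, of_apply,
        hW _ _ (not_lt.mpr hab.le), zero_mul, zero_add]
    rw [hbt.det_fintype]
    refine prod_eq_one fun i _ => ?_
    have : (1 + WD).toSquareBlock Prod.fst i = 1 := by
      ext a b
      change (1 + WD) a.1 b.1 = _
      rw [Matrix.add_apply, hWD, of_apply,
        hW _ _ (by rw [a.2, b.2]; exact lt_irrefl _), zero_mul, add_zero, Matrix.one_apply,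
        Matrix.one_apply]
      simp only [Subtype.ext_iff]
    rw [this, det_one]
  rw [e3, det_mul, e4, one_mul, Matrix.det_one_sub_mul_comm]
  congr 2
  ext k l
  simp only [e2, of_apply, Matrix.mul_apply, hP, hT]
  refine sum_congr rfl fun b _ => ?_
  ring

end discrete

end fredholm

/-- The discretization of `[-R, R]` into cells of length `1 / (N + 1)`. -/
def cellIndex (R N : ℕ) (x : ℝ) : Fin (2 * R * (N + 1) + 1) :=
  ⟨min ⌊(x + R) * (N + 1)⌋₊ (2 * R * (N + 1)), Nat.lt_succ_of_le (min_le_right _ _)⟩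

/-- The base points of the cells. -/
def cellPoint (R N : ℕ) (c : Fin (2 * R * (N + 1) + 1)) : ℝ := (c : ℕ) / ((N : ℝ) + 1) - R

theorem measurable_cellIndex (R N : ℕ) : Measurable (cellIndex R N) := by
  have h : Measurable fun x : ℝ => ⌊(x + R) * (N + 1)⌋₊ := Nat.measurable_floor.comp (by fun_prop)
  exact (measurable_from_top (f := fun k : ℕ => (⟨min k (2 * R * (N + 1)),
    Nat.lt_succ_of_le (min_le_right _ _)⟩ : Fin (2 * R * (N + 1) + 1)))).comp h

theorem cellPoint_mem (R N : ℕ) (c : Fin (2 * R * (N + 1) + 1)) :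
    cellPoint R N c ∈ Icc (-(R : ℝ)) R := by
  have h : ((c : ℕ) : ℝ) ≤ 2 * R * (N + 1) := by exact_mod_cast Nat.lt_succ_iff.mp c.2
  have hN : (0 : ℝ) < N + 1 := by positivity
  unfold cellPoint
  constructor
  · have : (0 : ℝ) ≤ (c : ℕ) / ((N : ℝ) + 1) := by positivity
    linarith
  · have : (c : ℕ) / ((N : ℝ) + 1) ≤ 2 * R := by rwa [div_le_iff₀ hN]
    linarith

theorem tendsto_cellPoint (R : ℕ) {x : ℝ} (hx : x ∈ Icc (-(R : ℝ)) R) :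
    Tendsto (fun N => cellPoint R N (cellIndex R N x)) atTop (𝓝 x) := by
  rw [tendsto_iff_dist_tendsto_zero]
  refine squeeze_zero (fun _ => dist_nonneg) (fun N => ?_) tendsto_one_div_add_atTop_nhds_zero_nat
  have hN : (0 : ℝ) < N + 1 := by positivity
  have h0 : 0 ≤ (x + R) * (N + 1) := mul_nonneg (by linarith [hx.1]) hN.le
  have hfl : ⌊(x + R) * (N + 1)⌋₊ ≤ 2 * R * (N + 1) := by
    refine Nat.floor_le_of_le ?_
    push_cast
    have := hx.2
    gcongr
    linarith
  have e : ((cellIndex R N x : ℕ) : ℝ) = ⌊(x + R) * (N + 1)⌋₊ := by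
    simp only [cellIndex, min_eq_left hfl]
  rw [Real.dist_eq, cellPoint, e, abs_sub_comm, abs_of_nonneg]
  · have h1 := Nat.lt_floor_add_one ((x + R) * (N + 1))
    have h2 : x + R ≤ (⌊(x + R) * (N + 1)⌋₊ + 1) / ((N : ℝ) + 1) := by
      rw [le_div_iff₀ hN]; exact h1.le
    rw [add_div] at h2
    linarith
  · have h1 := Nat.floor_le h0
    have h2 : ⌊(x + R) * (N + 1)⌋₊ / ((N : ℝ) + 1) ≤ x + R := by
      rw [div_le_iff₀ hN]; exact h1
    linarith

section fredholm

variable {E : Fin m → Set ℝ}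

/-- The Fredholm determinant of a finite rank perturbation of a triangular kernel. -/
theorem hasFredholmDet_finiteRank (hE : ∀ i, Bornology.IsBounded (E i))
    (hEm : ∀ i, MeasurableSet (E i)) {W : Fin m → Fin m → ℝ → ℝ → ℂ}
    (hWc : ∀ i j, Continuous fun z : ℝ × ℝ => W i j z.1 z.2)
    (hW : ∀ i j, ¬ i < j → ∀ x y, W i j x y = 0) {Θ Φ : Fin n → Fin m → ℝ → ℂ}
    (hΘ : ∀ k i, Continuous (Θ k i)) (hΦ : ∀ k i, Continuous (Φ k i)) :
    HasFredholmDet (fun i j x y => (∑ k, (Θ k i x + ∑ j', ∫ z in E j',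
      W i j' x z * Θ k j' z) * Φ k j y) - W i j x y) E
      (det (1 - of fun k l => ∑ i, ∫ y in E i, Φ k i y * Θ l i y)) := by
  obtain ⟨R, hR⟩ : ∃ R : ℕ, ∀ i, E i ⊆ Icc (-(R : ℝ)) R := by
    have hb : Bornology.IsBounded (⋃ i, E i) := Bornology.isBounded_iUnion.mpr hE
    obtain ⟨r, hr⟩ := hb.subset_closedBall 0
    obtain ⟨R, hR⟩ := exists_nat_ge r
    refine ⟨R, fun i x hx => ?_⟩
    have := hr (mem_iUnion.mpr ⟨i, hx⟩)
    rw [Real.closedBall_eq_Icc] at this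
    exact ⟨by linarith [this.1], by linarith [this.2]⟩
  set r : ℕ → ℝ → ℝ := fun N x => cellPoint R N (cellIndex R N x) with hr
  have hrm : ∀ N x, r N x ∈ Icc (-(R : ℝ)) R := fun N x => cellPoint_mem R N _
  have hrt : ∀ i, ∀ x ∈ E i, Tendsto (fun N => r N x) atTop (𝓝 x) := fun i x hx =>
    tendsto_cellPoint R (hR i hx)
  have hrme : ∀ N, Measurable (r N) := fun N =>
    (measurable_of_finite (cellPoint R N)).comp (measurable_cellIndex R N)
  obtain ⟨CW, hCW⟩ : ∃ C, ∀ i j, ∀ x ∈ Icc (-(R : ℝ)) R, ∀ y ∈ Icc (-(R : ℝ)) R,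
      ‖W i j x y‖ ≤ C := by
    have hc : Continuous fun z : ℝ × ℝ => fun (i j : Fin m) => W i j z.1 z.2 :=
      continuous_pi fun i => continuous_pi fun j => hWc i j
    obtain ⟨C, hC⟩ := ((isCompact_Icc (a := -(R : ℝ)) (b := R)).prod
      (isCompact_Icc (a := -(R : ℝ)) (b := R))).exists_bound_of_continuousOn hc.continuousOn
    exact ⟨C, fun i j x hx y hy => (norm_le_pi_norm (fun j => W i j x y) j).trans
      ((norm_le_pi_norm (fun i j => W i j x y) i).trans (hC (x, y) ⟨hx, hy⟩))⟩
  have hbd : ∀ {F : Fin n → Fin m → ℝ → ℂ}, (∀ k i, Continuous (F k i)) →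
      ∃ C, 0 ≤ C ∧ ∀ k i, ∀ x ∈ Icc (-(R : ℝ)) R, ‖F k i x‖ ≤ C := by
    intro F hF
    have hc : Continuous fun x : ℝ => fun (k : Fin n) (i : Fin m) => F k i x :=
      continuous_pi fun i => continuous_pi fun j => hF i j
    obtain ⟨C, hC⟩ := (isCompact_Icc (a := -(R : ℝ)) (b := R)).exists_bound_of_continuousOn
      hc.continuousOn
    exact ⟨max C 0, le_max_right _ _, fun k i x hx =>
      (norm_le_pi_norm (fun i => F k i x) i).trans
      ((norm_le_pi_norm (fun k i => F k i x) k).trans ((hC x hx).trans (le_max_left _ _)))⟩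
  obtain ⟨CΘ, hCΘ0, hCΘ⟩ := hbd hΘ
  obtain ⟨CΦ, hCΦ0, hCΦ⟩ := hbd hΦ
  obtain ⟨L, hL⟩ : ∃ L, ∀ i, volume.real (E i) ≤ L :=
    ⟨∑ i, volume.real (E i), fun i => single_le_sum (f := fun i => volume.real (E i))
      (fun _ _ => measureReal_nonneg) (Finset.mem_univ i)⟩
  have hvol : ∀ i, volume (E i) < ⊤ := fun i => (hE i).measure_lt_top
  have hdisc := fun N => hasFredholmDet_discrete_finiteRank hE (measurable_cellIndex R N)
    (fun i j c d => W i j (cellPoint R N c) (cellPoint R N d)) (fun i j h c d => hW i j h _ _)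
    (fun k i c => Θ k i (cellPoint R N c)) (fun k i c => Φ k i (cellPoint R N c))
  set K : ℕ → Fin m → Fin m → ℝ → ℝ → ℂ := fun N i j x y => (∑ k, (Θ k i (r N x) +
    ∑ j', ∫ z in E j', W i j' (r N x) (r N z) * Θ k j' (r N z)) * Φ k j (r N y)) -
    W i j (r N x) (r N y) with hK
  have hWΘ : ∀ N k i j', ∀ x ∈ Icc (-(R : ℝ)) R,
      ‖∫ z in E j', W i j' x (r N z) * Θ k j' (r N z)‖ ≤ CW * CΘ * L := by
    intro N k i j' x hx
    have hCW0 : 0 ≤ CW := (norm_nonneg _).trans (hCW i i x hx x hx)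
    refine (norm_setIntegral_le_of_norm_le_const (C := CW * CΘ) (hvol j') fun z _ => ?_).trans ?_
    · rw [norm_mul]
      exact mul_le_mul (hCW _ _ _ hx _ (hrm N z)) (hCΘ _ _ _ (hrm N z)) (norm_nonneg _) hCW0
    · gcongr
      exact hL j'
  have hKm : ∀ N i j, Measurable fun z : ℝ × ℝ => K N i j z.1 z.2 := by
    intro N i j
    have h1 : Measurable fun z : ℝ × ℝ => r N z.1 := (hrme N).comp measurable_fst
    have h2 : Measurable fun z : ℝ × ℝ => r N z.2 := (hrme N).comp measurable_snd
    have h3 : ∀ k j', Measurable fun x =>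
        ∫ z in E j', W i j' (r N x) (r N z) * Θ k j' (r N z) := fun k j' => by
      have hw : Measurable fun z : ℝ × ℝ => W i j' (r N z.1) (r N z.2) * Θ k j' (r N z.2) :=
        ((hWc i j').measurable.comp (h1.prodMk h2)).mul ((hΘ k j').measurable.comp h2)
      exact (hw.stronglyMeasurable.integral_prod_right' (ν := volume.restrict (E j'))).measurable
    refine Measurable.sub (Finset.measurable_sum _ fun k _ => Measurable.mul (Measurable.add
      ((hΘ k i).measurable.comp h1) (Finset.measurable_sum _ fun j' _ =>
        (h3 k j').comp measurable_fst)) ((hΦ k j).measurable.comp h2))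
      ((hWc i j).measurable.comp (h1.prodMk h2))
  have hKb : ∀ N i j, ∀ x ∈ E i, ∀ y ∈ E j,
      ‖K N i j x y‖ ≤ n * ((CΘ + m * (CW * CΘ * L)) * CΦ) + CW := by
    intro N i j x hx y hy
    refine (norm_sub_le _ _).trans (add_le_add ?_ (hCW _ _ _ (hrm N x) _ (hrm N y)))
    refine (norm_sum_le _ _).trans ?_
    calc _ ≤ ∑ _k : Fin n, (CΘ + m * (CW * CΘ * L)) * CΦ := by
          refine sum_le_sum fun k _ => ?_
          rw [norm_mul]
          have h1 : ‖Θ k i (r N x) + ∑ j', ∫ z in E j', W i j' (r N x) (r N z) *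
              Θ k j' (r N z)‖ ≤ CΘ + m * (CW * CΘ * L) := by
            refine (norm_add_le _ _).trans (add_le_add (hCΘ _ _ _ (hrm N x)) ?_)
            refine (norm_sum_le _ _).trans ((sum_le_sum fun j' _ =>
              hWΘ N k i j' _ (hrm N x)).trans (le_of_eq ?_))
            simp
          exact mul_le_mul h1 (hCΦ _ _ _ (hrm N y)) (norm_nonneg _) ((norm_nonneg _).trans h1)
      _ = _ := by simp
  have hKt : ∀ i j, ∀ x ∈ E i, ∀ y ∈ E j, Tendsto (fun N => K N i j x y) atTop
      (𝓝 ((∑ k, (Θ k i x + ∑ j', ∫ z in E j', W i j' x z * Θ k j' z) * Φ k j y) - W i j x y)) := by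
    intro i j x hx y hy
    have hw : ∀ {j : Fin m}, ∀ y ∈ E j, Tendsto (fun N => W i j (r N x) (r N y)) atTop
        (𝓝 (W i j x y)) := fun {j} y hy =>
      ((hWc i j).tendsto (x, y)).comp ((hrt i x hx).prodMk_nhds (hrt j y hy))
    refine Tendsto.sub (tendsto_finsetSum _ fun k _ => Tendsto.mul (Tendsto.add
      (((hΘ k i).tendsto x).comp (hrt i x hx)) (tendsto_finsetSum _ fun j' _ => ?_))
      (((hΦ k j).tendsto y).comp (hrt j y hy))) (hw y hy)
    refine tendsto_integral_of_dominated_convergence (fun _ => CW * CΘ) (fun N => ?_)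
      (integrableOn_const (hvol j').ne) (fun N => ae_of_all _ fun z => ?_)
      ((ae_restrict_mem (hEm j')).mono fun z hz => ?_)
    · exact (((hWc i j').measurable.comp (measurable_const.prodMk (hrme N))).mul
        ((hΘ k j').measurable.comp (hrme N))).aestronglyMeasurable
    · rw [norm_mul]
      exact mul_le_mul (hCW _ _ _ (hrm N x) _ (hrm N z)) (hCΘ _ _ _ (hrm N z)) (norm_nonneg _)
        ((norm_nonneg _).trans (hCW i j' _ (hrm N x) _ (hrm N z)))
    · exact (hw z hz).mul (((hΘ k j').tendsto z).comp (hrt j' z hz))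
  obtain ⟨D, hD, hD'⟩ := tendsto_hasFredholmDet hE hEm hKm hKb hKt
  convert hD
  refine tendsto_nhds_unique ?_ (hD' _ hdisc)
  refine (Continuous.matrix_det continuous_id).continuousAt.tendsto.comp ?_
  refine tendsto_pi_nhds.mpr fun k => tendsto_pi_nhds.mpr fun l => ?_
  refine Tendsto.const_sub _ ?_
  simp only [of_apply]
  refine tendsto_finsetSum _ fun i _ => ?_
  refine tendsto_integral_of_dominated_convergence (fun _ => CΦ * CΘ) (fun N => ?_)
    (integrableOn_const (hvol i).ne) (fun N => ae_of_all _ fun y => ?_)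
    ((ae_restrict_mem (hEm i)).mono fun y hy => ?_)
  · exact (((hΦ k i).measurable.comp (hrme N)).mul
      ((hΘ l i).measurable.comp (hrme N))).aestronglyMeasurable
  · rw [norm_mul]
    exact mul_le_mul (hCΦ _ _ _ (hrm N y)) (hCΘ _ _ _ (hrm N y)) (norm_nonneg _) hCΦ0
  · exact (((hΦ k i).tendsto y).comp (hrt i y hy)).mul (((hΘ l i).tendsto y).comp (hrt i y hy))

/-- The Fredholm determinant of the kernel with final weights `Ψ` and initial weights `Φ`. -/
theorem hasFredholmDet_avoidingWeight (hE : ∀ i, Bornology.IsBounded (E i))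
    (hEm : ∀ i, MeasurableSet (E i)) {t : Fin m → ℝ} (ht : StrictMono t)
    {Ψ Φ : Fin n → Fin m → ℝ → ℂ} (hΨ : ∀ k i, Continuous (Ψ k i))
    (hΦ : ∀ k i, Continuous (Φ k i)) :
    HasFredholmDet (fun i j x y => (∑ k, Ψ k i x * Φ k j y) -
      if i < j then (brownianDensity (t j - t i) x y : ℂ) else 0) E
      (det (1 - of fun k l => ∑ i, ∫ y in E i, Φ k i y *
        avoidingWeight m t E (Ψ l) i y)) := by
  have h := hasFredholmDet_finiteRank (n := n) hE hEm
    (W := fun i j x y => if i < j then (brownianDensity (t j - t i) x y : ℂ) else 0)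
    (Θ := fun k => avoidingWeight m t E (Ψ k)) (Φ := Φ) ?_ ?_
    (fun k i => continuous_avoidingWeight m ht hE (hΨ k) i) hΦ
  · convert h using 7 with i j x y k
    have e : (∑ j', ∫ z in E j', (if i < j' then (brownianDensity (t j' - t i) x z : ℂ) else 0) *
        avoidingWeight m t E (Ψ k) j' z) = ∑ j', if i < j' then ∫ z in E j',
        (brownianDensity (t j' - t i) x z : ℂ) * avoidingWeight m t E (Ψ k) j' z else 0 :=
      sum_congr rfl fun j' _ => by split_ifs <;> simp
    rw [avoidingWeight_eq, e]
    ring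
  · intro i j
    split_ifs
    · exact Complex.continuous_ofReal.comp (continuous_brownianDensity _)
    · exact continuous_const
  · intro i j h x y
    exact if_neg h

end fredholm

theorem contourIntegral_mul_sum_nodal (hΓ : IsCauchyContour Γ w V)
    (hδ : ∀ j, δ j ∈ V) {z : ℂ} {c : ℝ} (hc : 0 < c)
    (hz : ∀ s ∈ Icc (0 : ℝ) 1, c ≤ ‖Γ s - z‖) (hf : Continuous f)
    (h0 : contourIntegral Γ w (fun v => f v / (v - z)) = 0) :
    ∑ k : Fin n, nodal δ k z * dividedDifference Γ w δ k f =
      -(nodal δ n z * contourIntegral Γ w (fun v => f v / (nodal δ n v * (v - z)))) := by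
  obtain ⟨C, hC0, hC⟩ := exists_norm_inv_nodal_le hΓ n
  obtain ⟨B, hB0, hB⟩ := hΓ.exists_norm_path_le hf
  have hci : ∀ s ∈ Icc (0 : ℝ) 1, ‖(Γ s - z)⁻¹‖ ≤ c⁻¹ := fun s hs => by
    rw [norm_inv]; exact inv_anti₀ hc (hz s hs)
  have i1 : IntegrableOn (fun s => f (Γ s) / (Γ s - z) * w s) (Icc 0 1) :=
    hΓ.integrable (g := fun v => f v / (v - z)) (B := B * c⁻¹)
      (hf.measurable.div (by fun_prop)) fun s hs => by
        rw [div_eq_mul_inv, norm_mul]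
        exact mul_le_mul (hB s hs) (hci s hs) (norm_nonneg _) hB0
  have i2 : IntegrableOn (fun s => f (Γ s) / (nodal δ n (Γ s) * (Γ s - z)) * w s) (Icc 0 1) :=
    hΓ.integrable (g := fun v => f v / (nodal δ n v * (v - z))) (B := B * (C * c⁻¹))
      (hf.measurable.div ((continuous_nodal δ n).measurable.mul (by fun_prop))) fun s hs => by
        rw [div_eq_mul_inv, norm_mul, mul_inv, norm_mul]
        exact mul_le_mul (hB s hs) (mul_le_mul (hC δ hδ n s hs) (hci s hs) (norm_nonneg _) hC0)
          (by positivity) hB0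
  have e1 : ∑ k : Fin n, nodal δ k z * dividedDifference Γ w δ k f =
      contourIntegral Γ w (fun v => f v / (v - z)) -
        nodal δ n z * contourIntegral Γ w (fun v => f v / (nodal δ n v * (v - z))) := by
    simp only [dividedDifference, contourIntegral, ← integral_const_mul]
    rw [← integral_finsetSum (f := fun (k : Fin n) s =>
      nodal δ k z * (f (Γ s) / nodal δ (k + 1) (Γ s) * w s)) _ fun k _ =>
      (integrable_dividedDifference hΓ hδ k hf).const_mul _, ← integral_sub i1 (i2.const_mul _)]
    refine setIntegral_congr_fun measurableSet_Icc fun s hs => ?_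
    have hvz : Γ s - z ≠ 0 := norm_pos_iff.mp (hc.trans_le (hz s hs))
    have hn : nodal δ n (Γ s) ≠ 0 :=
      Finset.prod_ne_zero_iff.mpr fun j _ => hΓ.sub_ne_zero hs (hδ j)
    have h := sum_nodal_div_nodal_univ δ (fun j => hΓ.sub_ne_zero hs (hδ j)) z
    have e : ∑ k : Fin n, nodal δ k z * (f (Γ s) / nodal δ (k + 1) (Γ s) * w s) =
        f (Γ s) * w s * ∑ k : Fin n, nodal δ k z / nodal δ (k + 1) (Γ s) := by
      rw [mul_sum]
      exact sum_congr rfl fun k _ => by ring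
    simp only [e]
    rw [show ∑ k : Fin n, nodal δ k z / nodal δ (k + 1) (Γ s) =
      (1 - nodal δ n z / nodal δ n (Γ s)) / (Γ s - z) by rw [← h]; field_simp]
    field_simp
  rw [e1, h0, zero_sub]

theorem sum_lineWeight_mul_nodeWeight (hΓ : IsCauchyContour Γ w V)
    (hδ : ∀ j, δ j ∈ V) {c s t : ℝ} (h0 : 0 < s) (h1 : s < 1) (x y : ℝ)
    (hz : ∀ u : ℝ, u ≠ 0 → (∃ d > 0, ∀ r ∈ Icc (0 : ℝ) 1, d ≤ ‖Γ r - (c + u * I)‖) ∧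
      contourIntegral Γ w (fun v => gaussWeight (1 - t) v x / (v - (c + u * I))) = 0) :
    ∑ k : Fin n, lineWeight c δ k s y * nodeWeight Γ w δ k (1 - t) x =
      -(∫ u : ℝ, nodal δ n (c + u * I) * lineGauss c s y u *
        contourIntegral Γ w (fun v => gaussWeight (1 - t) v x /
          (nodal δ n v * (v - (c + u * I))))) / (√(π * (1 - s)) : ℝ) := by
  have e1 : ∀ k : Fin n, lineWeight c δ k s y * nodeWeight Γ w δ k (1 - t) x =
      (∫ u : ℝ, nodal δ k (c + u * I) * lineGauss c s y u * nodeWeight Γ w δ k (1 - t) x) /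
      (√(π * (1 - s)) : ℝ) := fun k => by
    rw [integral_mul_const, lineWeight, div_mul_eq_mul_div]; rfl
  simp only [e1]
  rw [← sum_div, ← integral_finsetSum (f := fun (k : Fin n) (u : ℝ) =>
    nodal δ k (c + u * I) * lineGauss c s y u * nodeWeight Γ w δ k (1 - t) x) _ fun k _ =>
    (integrable_nodal_mul_lineGauss c y h0 h1 δ k).mul_const (nodeWeight Γ w δ k (1 - t) x),
    ← integral_neg]
  congr 1
  refine integral_congr_ae ?_
  have hae : ∀ᵐ u : ℝ, u ≠ 0 := by simp [ae_iff]
  filter_upwards [hae] with u hu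
  obtain ⟨⟨d, hd, hd'⟩, h0⟩ := hz u hu
  have := contourIntegral_mul_sum_nodal hΓ hδ hd hd'
    (differentiable_gaussWeight (1 - t) x).continuous h0
  rw [mul_right_comm, ← neg_mul, ← this, sum_mul]
  exact sum_congr rfl fun k _ => by rw [nodeWeight]; ring

theorem nodal_endPoints (hn : n1 ≤ n) (b a : ℝ) (w : ℂ) :
    nodal (fun i : Fin n => (endPoints n n1 b a i : ℂ)) n w = (w - a) ^ n1 * (w - b) ^ (n - n1) := by
  have h1 : (Finset.univ.filter fun j : Fin n => (j : ℕ) < n) = Finset.univ :=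
    Finset.filter_true_of_mem fun j _ => j.2
  have h2 : ∀ j : Fin n, w - (endPoints n n1 b a j : ℂ) =
      if (j : ℕ) + n1 < n then w - b else w - a := fun j => by
    unfold endPoints; split_ifs <;> rfl
  have h3 : (Finset.univ.filter fun j : Fin n => (j : ℕ) + n1 < n).card = n - n1 := by
    have : (Finset.univ.filter fun j : Fin n => (j : ℕ) + n1 < n).map Fin.valEmbedding =
        Finset.range (n - n1) := by
      ext k
      simp only [Finset.mem_map, mem_filter, Finset.mem_univ, true_and,
        Fin.valEmbedding_apply, Finset.mem_range]
      exact ⟨fun ⟨j, hj, hk⟩ => by omega, fun hk => ⟨⟨k, by omega⟩, by simp only; omega, rfl⟩⟩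
    rw [← Finset.card_map Fin.valEmbedding, this, Finset.card_range]
  have h4 : (Finset.univ.filter fun j : Fin n => ¬ (j : ℕ) + n1 < n).card = n1 := by
    have := Finset.card_filter_add_card_filter_not (s := (Finset.univ : Finset (Fin n)))
      (fun j : Fin n => (j : ℕ) + n1 < n)
    rw [h3, card_univ, card_fin] at this
    omega
  rw [nodal, h1, prod_congr rfl fun j _ => h2 j, Finset.prod_ite, prod_const,
    prod_const, h3, h4, mul_comm]

theorem half_le_norm_diamond {w : ℂ} (hw : w ∈ diamond) {e : ℝ} (u : ℝ) :
    |u| / 2 ≤ ‖(e * (1 + w) - u * I : ℂ)‖ := by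
  rw [diamond, Set.mem_ofPred_eq] at hw
  have h1 := abs_re_le_norm (e * (1 + w) - u * I : ℂ)
  have h2 := Complex.abs_im_le_norm (e * (1 + w) - u * I : ℂ)
  simp only [sub_re, re_ofReal_mul, add_re, one_re, I_re,
    mul_zero, sub_zero, sub_im, im_ofReal_mul, add_im, one_im,
    zero_add, I_im, mul_one, abs_mul] at h1 h2
  have h3 : |w.im| ≤ |1 + w.re| := by
    have := neg_abs_le w.re
    linarith [le_abs_self (1 + w.re)]
  have h4 : |u| - |e| * |w.im| ≤ |e * w.im - u| := by
    have := abs_sub_abs_le_abs_sub u (e * w.im)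
    rwa [abs_sub_comm u, abs_mul] at this
  have := mul_le_mul_of_nonneg_left h3 (abs_nonneg e)
  linarith

theorem re_im_of_diamond {w : ℂ} (hw : w ∈ diamond) : 0 < 1 + w.re ∨ (w.re = -1 ∧ w.im = 0) := by
  rw [diamond, Set.mem_ofPred_eq] at hw
  have h1 := neg_abs_le w.re
  have h2 := abs_nonneg w.im
  rcases h2.eq_or_lt with h | h
  · have h0 := abs_eq_zero.mp h.symm
    rcases (le_of_sub_nonneg (by linarith : 0 ≤ 1 + w.re - 0)).eq_or_lt with h' | h'
    · exact Or.inr ⟨by linarith, h0⟩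
    · exact Or.inl h'
  · exact Or.inl (by linarith)

theorem armsIntegral_div_sub_vertical {e : ℝ} (he : e ≠ 0) {u : ℝ} (hu : u ≠ 0) (hf : Differentiable ℂ f) : armsIntegral e (fun v => f v / (v - u * I)) = 0 := by
  rw [armsIntegral_div_sub hf fun w hw => norm_pos_iff.mp
    ((half_pos (abs_pos.mpr hu)).trans_le (half_le_norm_diamond hw u)),
    armsIntegral_inv_eq_zero (ε := (e : ℂ)) (by exact_mod_cast he) fun w hw => ?_, mul_zero]
  rw [Complex.mem_slitPlane_iff]
  have he2 := pow_pos (abs_pos.mpr he) 2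
  rw [sq_abs] at he2
  simp only [mul_re, mul_im, sub_re, add_re, one_re,
    sub_im, add_im, one_im, ofReal_re, ofReal_im,
    I_re, I_im, mul_zero, mul_one, zero_mul, zero_add, add_zero, sub_zero, sub_self]
  rcases re_im_of_diamond hw with h' | ⟨_, h'⟩
  · left
    nlinarith [mul_pos he2 h']
  · right
    rw [h', mul_zero, zero_sub]
    exact mul_ne_zero he (neg_ne_zero.mpr hu)

theorem contourIntegral_square_eq_arms {c h q : ℝ} {g : ℂ → ℂ}
    (hg : ∀ e ∈ ({1, -q} : Set ℝ), ContinuousOn (fun w => g (c + h * (e * (1 + w)))) diamond) :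
    contourIntegral (squarePath c h q) (squareWeight h q) g =
      (2 * π * I)⁻¹ * (h * (armsIntegral 1 (fun ζ => g (c + h * ζ)) +
        armsIntegral (-q) (fun ζ => g (c + h * ζ)))) := by
  rw [contourIntegral_square, mul_add (h : ℂ), ← armsIntegral_mul h 1 (fun v => g (c + v)),
    ← armsIntegral_mul h (-q) (fun v => g (c + v)), mul_one, mul_neg, mul_comm h q]
  rintro e (rfl | rfl)
  · simpa using hg 1 (by simp)
  · refine (hg (-q) (by simp)).congr fun w _ => ?_
    push_cast
    ring_nf

theorem armsIntegral_const_mul (h : ℝ) (k : ℂ) (g : ℂ → ℂ) :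
    armsIntegral h (fun ζ => k * g ζ) = k * armsIntegral h g := by
  unfold armsIntegral
  simp only [mul_assoc k, intervalIntegral.integral_const_mul, mul_sub]

/-- The saddle point function of the double contour integral for the correlation kernel. -/
def saddleWeight (β κ q : ℝ) (n1 n2 : ℕ) (ζ : ℂ) : ℂ :=
  cexp (β * ζ - κ * ζ ^ 2) / ((1 - ζ) ^ n1 * (1 + ζ / q) ^ n2)

theorem nodal_endPoints_affine (hn : n1 ≤ n) {c h q : ℝ} (hq : q ≠ 0) (ζ : ℂ) :
    nodal (fun i : Fin n => (endPoints n n1 (c - q * h) (c + h) i : ℂ)) n (c + h * ζ) =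
      ((-h) ^ n1 * (q * h) ^ (n - n1)) * ((1 - ζ) ^ n1 * (1 + ζ / q) ^ (n - n1)) := by
  have hq' : (q : ℂ) ≠ 0 := by exact_mod_cast hq
  rw [nodal_endPoints hn, mul_mul_mul_comm, ← mul_pow, ← mul_pow]
  congr 2
  · push_cast; ring
  · push_cast; field_simp; ring

theorem contourIntegral_gaussWeight_div_sub_vertical {c h q : ℝ} (hh : 0 < h) (hq : 0 < q) {u : ℝ}
    (hu : u ≠ 0) (t x : ℝ) : contourIntegral (squarePath c h q) (squareWeight h q)
      (fun v => gaussWeight t v x / (v - (c + u * I))) = 0 := by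
  have hd := differentiable_gaussWeight t x
  have h0 : ∀ e, e = h ∨ e = -(q * h) → e ≠ 0 := by rintro e (rfl | rfl) <;> simp [hh.ne', hq.ne']
  rw [contourIntegral_square]
  · simp only [add_sub_add_left_eq_sub]
    have key := fun e he => armsIntegral_div_sub_vertical (h0 e he) hu
      (hd.comp (by fun_prop : Differentiable ℂ fun v : ℂ => (c : ℂ) + v))
    simp only [Function.comp] at key
    rw [key _ (.inl rfl), key _ (.inr rfl), add_zero, mul_zero]
  · intro e he
    refine ContinuousOn.div (hd.continuous.comp (by fun_prop)).continuousOn (by fun_prop)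
      fun w hw => norm_pos_iff.mp ?_
    rw [add_sub_add_left_eq_sub]
    exact (half_pos (abs_pos.mpr hu)).trans_le (half_le_norm_diamond hw u)

theorem continuousOn_diamond_gaussWeight_div_nodal (hn : n1 ≤ n) {c h q : ℝ}
    (hh : 0 < h) (hq : 0 < q) (t x : ℝ) {u : ℝ} (hu : u ≠ 0) {e : ℝ} (he : e ∈ ({1, -q} : Set ℝ)) :
    ContinuousOn (fun w : ℂ => (fun v => gaussWeight t v x /
      (nodal (fun i : Fin n => (endPoints n n1 (c - q * h) (c + h) i : ℂ)) n v *
        (v - (c + (h * u : ℝ) * I)))) (c + h * (e * (1 + w)))) diamond := by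
  have hq' : (q : ℂ) ≠ 0 := by exact_mod_cast hq.ne'
  have hh' : (h : ℂ) ≠ 0 := by exact_mod_cast hh.ne'
  refine ContinuousOn.div ?_ ?_ fun w hw => mul_ne_zero ?_ ?_
  · exact ((differentiable_gaussWeight t x).continuous.comp (by fun_prop)).continuousOn
  · exact (((continuous_nodal _ n).comp (by fun_prop :
      Continuous fun w : ℂ => (c + h * (e * (1 + w)) : ℂ))).mul (by fun_prop)).continuousOn
  · have hw0 : w ≠ 0 := by rintro rfl; simp [diamond] at hw
    have hre := re_im_of_diamond hw
    have hre' : 0 ≤ 1 + w.re := by rcases hre with h | h <;> linarith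
    rw [nodal_endPoints_affine hn hq.ne']
    refine mul_ne_zero (mul_ne_zero (pow_ne_zero _ (neg_ne_zero.mpr hh'))
      (pow_ne_zero _ (mul_ne_zero hq' hh'))) (mul_ne_zero (pow_ne_zero _ ?_) (pow_ne_zero _ ?_))
    · rcases he with rfl | rfl
      · simpa using hw0
      · intro h0
        have := congrArg re h0
        simp only [sub_re, one_re, re_ofReal_mul, add_re,
          zero_re] at this
        nlinarith [mul_nonneg hq.le hre']
    · rcases he with rfl | rfl
      · intro h0
        have := congrArg re h0
        rw [add_re, div_ofReal_re, re_ofReal_mul, add_re,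
          one_re, zero_re, one_mul] at this
        have := div_nonneg hre' hq.le
        linarith
      · push_cast
        field_simp
        simpa using hw0
  · rw [show (c + h * (e * (1 + w)) - (c + (h * u : ℝ) * I) : ℂ) =
      h * (e * (1 + w) - u * I) by push_cast; ring]
    refine mul_ne_zero hh' (norm_pos_iff.mp (lt_of_lt_of_le ?_ (half_le_norm_diamond hw u)))
    exact half_pos (abs_pos.mpr hu)

theorem gaussWeight_div_nodal_affine (hn : n1 ≤ n) {c h q t : ℝ} (hq : q ≠ 0)
    (ht1 : t < 1) (x u : ℝ) (ζ : ℂ) :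
    gaussWeight (1 - t) (c + h * ζ) x /
        (nodal (fun i : Fin n => (endPoints n n1 (c - q * h) (c + h) i : ℂ)) n (c + h * ζ) *
        (c + h * ζ - (c + (h * u : ℝ) * I))) =
      (exp (c ^ 2 - (c - x) ^ 2 / (1 - t)) : ℝ) / ((√(π * (1 - t)) : ℝ) *
        ((-h) ^ n1 * (q * h) ^ (n - n1)) * h) *
      (saddleWeight (2 * (x - t * c) * h / (1 - t))
          (t * h ^ 2 / (1 - t)) q n1 (n - n1) ζ / (ζ - u * I)) := by
  have ht' : ((1 - t : ℝ) : ℂ) ≠ 0 := by exact_mod_cast (sub_pos.mpr ht1).ne'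
  rw [nodal_endPoints_affine hn hq, gaussWeight, saddleWeight]
  rw [show ((c : ℂ) + h * ζ) ^ 2 - (c + h * ζ - x) ^ 2 / (1 - t : ℝ) =
    ((c ^ 2 - (c - x) ^ 2 / (1 - t) : ℝ) : ℂ) + ((2 * (x - t * c) * h / (1 - t) : ℝ) * ζ -
      (t * h ^ 2 / (1 - t) : ℝ) * ζ ^ 2) by
      push_cast at ht' ⊢
      field_simp
      ring]
  rw [exp_add, ← Complex.ofReal_exp]
  rw [show (c + h * ζ - (c + (h * u : ℝ) * I) : ℂ) = h * (ζ - u * I) by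
    push_cast; ring]
  simp only [div_eq_mul_inv, mul_inv]
  ring

theorem nodal_mul_lineGauss_affine (hn : n1 ≤ n) {c h q s : ℝ} (hq : q ≠ 0)
    (hs1 : s < 1) (y u : ℝ) :
    nodal (fun i : Fin n => (endPoints n n1 (c - q * h) (c + h) i : ℂ)) n
        (c + (h * u : ℝ) * I) * lineGauss c s y (h * u) =
      ((-h) ^ n1 * (q * h) ^ (n - n1)) * (exp (-(c ^ 2 - (c - y) ^ 2 / (1 - s))) : ℝ) *
        (saddleWeight (2 * (y - s * c) * h / (1 - s)) (s * h ^ 2 / (1 - s)) q n1 (n - n1)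
          (u * I))⁻¹ := by
  have hs' : ((1 - s : ℝ) : ℂ) ≠ 0 := by exact_mod_cast (sub_pos.mpr hs1).ne'
  rw [show (c + (h * u : ℝ) * I : ℂ) = c + h * (u * I) by push_cast; ring,
    nodal_endPoints_affine hn hq, lineGauss, saddleWeight, inv_div,
    div_eq_mul_inv _ (cexp _), ← exp_neg]
  rw [show (c + (h * u : ℝ) * I - y : ℂ) ^ 2 / (1 - s : ℝ) -
    (c + (h * u : ℝ) * I) ^ 2 = ((-(c ^ 2 - (c - y) ^ 2 / (1 - s)) : ℝ) : ℂ) +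
      (-((2 * (y - s * c) * h / (1 - s) : ℝ) * (u * I) -
      (s * h ^ 2 / (1 - s) : ℝ) * (u * I) ^ 2)) by
      push_cast at hs' ⊢
      field_simp
      ring]
  rw [exp_add, ← Complex.ofReal_exp]
  ring

theorem sum_lineWeight_mul_nodeWeight_eq_arms (hn : n1 ≤ n) {c h q s t : ℝ}
    (hh : 0 < h) (hq : 0 < q) (hs0 : 0 < s) (hs1 : s < 1) (ht1 : t < 1) (x y : ℝ)
    (hδ : δ = fun i => (endPoints n n1 (c - q * h) (c + h) i : ℂ)) :
    ∑ k : Fin n, lineWeight c δ k s y * nodeWeight (squarePath c h q)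
        (squareWeight h q) δ k (1 - t) x =
      (exp ((c ^ 2 - (c - x) ^ 2 / (1 - t)) - (c ^ 2 - (c - y) ^ 2 / (1 - s))) : ℝ) *
      (-(h / (2 * π ^ 2 * I * (√((1 - s) * (1 - t)) : ℝ))) *
      ∫ u : ℝ, (saddleWeight (2 * (y - s * c) * h / (1 - s)) (s * h ^ 2 / (1 - s)) q n1 (n - n1)
          (u * I))⁻¹ *
        (armsIntegral 1 (fun ζ => saddleWeight (2 * (x - t * c) * h / (1 - t))
            (t * h ^ 2 / (1 - t)) q n1 (n - n1) ζ / (ζ - u * I)) +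
          armsIntegral (-q) (fun ζ => saddleWeight (2 * (x - t * c) * h / (1 - t))
            (t * h ^ 2 / (1 - t)) q n1 (n - n1) ζ / (ζ - u * I)))) := by
  have hqh := mul_pos hq hh
  have hq' : (q : ℂ) ≠ 0 := by exact_mod_cast hq.ne'
  have hh' : (h : ℂ) ≠ 0 := by exact_mod_cast hh.ne'
  have hΓ := isCauchyContour_square c hh hq
  have hδV : ∀ j, δ j ∈ ball ((c + h : ℝ) : ℂ) (h / 4) ∪
      ball ((c - q * h : ℝ) : ℂ) (q * h / 4) := fun j => by
    rw [hδ]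
    simp only [endPoints]
    split_ifs
    · right; exact mem_ball_self (by positivity)
    · left; exact mem_ball_self (by positivity)
  rw [sum_lineWeight_mul_nodeWeight hΓ hδV hs0 hs1 x y fun u hu => ⟨⟨|u| / 2,
    half_pos (abs_pos.mpr hu), fun r hr => ?_⟩, ?_⟩]
  rotate_left
  · obtain ⟨e, _, w, hw, h1⟩ := exists_squarePath_eq c h q hr.1
    rw [h1, add_sub_add_left_eq_sub]
    exact half_le_norm_diamond hw u
  · exact contourIntegral_gaussWeight_div_sub_vertical hh hq hu (1 - t) x
  · have hsub := Measure.integral_comp_mul_left (fun u : ℝ => nodal δ n (c + u * I) *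
      lineGauss c s y u * contourIntegral (squarePath c h q)
        (squareWeight h q) (fun v => gaussWeight (1 - t) v x /
          (nodal δ n v * (v - (c + u * I))))) h
    rw [abs_of_pos (inv_pos.mpr hh), real_smul, ofReal_inv,
      eq_inv_mul_iff_mul_eq₀ hh'] at hsub
    rw [← hsub]
    set N : ℂ := (-h) ^ n1 * (q * h) ^ (n - n1) with hN
    have hN0 : N ≠ 0 := mul_ne_zero (pow_ne_zero _ (neg_ne_zero.mpr hh'))
        (pow_ne_zero _ (mul_ne_zero hq' hh'))
    have hae : ∀ᵐ u : ℝ, u ≠ 0 := by simp [ae_iff]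
    rw [integral_congr_ae (hae.mono fun u hu => ?_)]
    rotate_left
    · exact fun u => N * (exp (-(c ^ 2 - (c - y) ^ 2 / (1 - s))) : ℝ) *
        ((2 * π * I)⁻¹ * (h * ((exp (c ^ 2 - (c - x) ^ 2 / (1 - t)) : ℝ) /
          ((√(π * (1 - t)) : ℝ) * N * h)))) *
        ((saddleWeight (2 * (y - s * c) * h / (1 - s)) (s * h ^ 2 / (1 - s)) q n1 (n - n1)
          (u * I))⁻¹ *
        (armsIntegral 1 (fun ζ => saddleWeight (2 * (x - t * c) * h / (1 - t))
            (t * h ^ 2 / (1 - t)) q n1 (n - n1) ζ / (ζ - u * I)) +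
          armsIntegral (-q) (fun ζ => saddleWeight (2 * (x - t * c) * h / (1 - t))
            (t * h ^ 2 / (1 - t)) q n1 (n - n1) ζ / (ζ - u * I))))
    · simp only [hδ]
      rw [nodal_mul_lineGauss_affine hn hq.ne' hs1, contourIntegral_square_eq_arms fun e he =>
        continuousOn_diamond_gaussWeight_div_nodal hn hh hq _ x hu he]
      simp only [gaussWeight_div_nodal_affine hn hq.ne' ht1, armsIntegral_const_mul, ← hN]
      ring
    rw [integral_const_mul, sub_eq_add_neg (c ^ 2 - (c - x) ^ 2 / (1 - t)), Real.exp_add,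
      sqrt_mul (sub_pos.mpr hs1).le, sqrt_mul pi_pos.le, sqrt_mul pi_pos.le]
    have hpi : (√π : ℂ) * √π = π := by
      rw [← ofReal_mul, Real.mul_self_sqrt pi_pos.le]
    have hpi0 : (√π : ℂ) ≠ 0 := by exact_mod_cast (Real.sqrt_pos.mpr pi_pos).ne'
    have hs0 : (√(1 - s) : ℂ) ≠ 0 := by exact_mod_cast (Real.sqrt_pos.mpr (sub_pos.mpr hs1)).ne'
    have ht0 : (√(1 - t) : ℂ) ≠ 0 := by exact_mod_cast (Real.sqrt_pos.mpr (sub_pos.mpr ht1)).ne'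
    push_cast
    rw [← hpi]
    field_simp

theorem norm_saddleWeight {β κ q : ℝ} {n1 n2 : ℕ} {ζ : ℂ} (h1 : 1 - ζ ≠ 0) (h2 : 1 + ζ / q ≠ 0) :
    ‖saddleWeight β κ q n1 n2 ζ‖ = exp (β * ζ.re - κ * (ζ ^ 2).re -
      (n1 * (log (normSq (1 - ζ)) / 2) +
        n2 * (log (normSq (1 + ζ / q)) / 2))) := by
  have e : ∀ (w : ℂ) (k : ℕ), w ≠ 0 → ‖w‖ ^ k =
      exp (k * (log (normSq w) / 2)) := fun w k hw => by
    rw [Complex.normSq_eq_norm_sq, Real.log_pow, Nat.cast_ofNat, mul_div_cancel_left₀ _ two_ne_zero,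
      ← Real.log_pow, Real.exp_log (pow_pos (norm_pos_iff.mpr hw) _)]
  rw [saddleWeight, norm_div, norm_mul, norm_pow, norm_pow, norm_exp, e _ _ h1, e _ _ h2,
    ← Real.exp_add, ← Real.exp_sub]
  simp

theorem log_edge_le (hq : 0 < q) {α β c : ℝ} (hα : 0 < α)
    (h : ∀ r ∈ Ioo (0 : ℝ) 1, β + 4 * c * r ^ 3 ≤ (2 * r - 1) / (1 - 2 * r + 2 * r ^ 2) +
      q ^ 3 * ((q + 2 * r) / (α + 2 * q * r + 2 * r ^ 2))) {r : ℝ} (hr : r ∈ Icc (0 : ℝ) 1) :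
    β * r + c * r ^ 4 - log (1 - 2 * r + 2 * r ^ 2) / 2 -
      q ^ 3 * (log (α + 2 * q * r + 2 * r ^ 2) - log α) / 2 ≤ 0 := by
  have hd : ∀ r : ℝ, 0 ≤ r → HasDerivAt (fun r => β * r + c * r ^ 4 -
      log (1 - 2 * r + 2 * r ^ 2) / 2 - q ^ 3 * (log (α + 2 * q * r + 2 * r ^ 2) - log α) / 2)
      (β + 4 * c * r ^ 3 - ((2 * r - 1) / (1 - 2 * r + 2 * r ^ 2) +
        q ^ 3 * ((q + 2 * r) / (α + 2 * q * r + 2 * r ^ 2)))) r := by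
    intro r hr
    have p1 := (((hasDerivAt_id r).const_mul 2).const_sub 1).add
      (((hasDerivAt_id r).pow 2).const_mul 2)
    have p2 := (((hasDerivAt_id r).const_mul (2 * q)).const_add α).add
      (((hasDerivAt_id r).pow 2).const_mul 2)
    refine HasDerivAt.congr_deriv (((((hasDerivAt_id r).const_mul β).add
      (((hasDerivAt_id r).pow 4).const_mul c)).sub ((p1.log ?_).div_const 2)).sub
      ((((p2.log ?_).sub_const (log α)).const_mul (q ^ 3)).div_const 2)) ?_
    · exact (show 0 < 1 - 2 * r + 2 * r ^ 2 by nlinarith [sq_nonneg (r - 1 / 2)]).ne'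
    · exact (show 0 < α + 2 * q * r + 2 * r ^ 2 by positivity).ne'
    · simp; ring
  have := antitoneOn_of_hasDerivWithinAt_nonpos (convex_Icc 0 1)
    (fun r hr => (hd r hr.1).continuousAt.continuousWithinAt)
    (fun r hr => (hd r (interior_subset hr).1).hasDerivWithinAt)
    (fun r hr => sub_nonpos.mpr (h r (by simpa using hr))) (left_mem_Icc.mpr zero_le_one) hr hr.1
  simpa using this

theorem log_first_edge_le {r : ℝ} (hq : 0 < q) (hr : r ∈ Icc (0 : ℝ) 1) :
    (q ^ 2 - 1) * r - log (1 - 2 * r + 2 * r ^ 2) / 2 -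
      q ^ 3 * (log (q ^ 2 + 2 * q * r + 2 * r ^ 2) - log (q ^ 2)) / 2 ≤
    -((1 + q) * min q 1 / (q ^ 2 + 2 * q + 2)) * r ^ 4 := by
  set c := (1 + q) * min q 1 / (q ^ 2 + 2 * q + 2) with hc
  suffices h : ∀ r ∈ Ioo (0 : ℝ) 1, q ^ 2 - 1 + 4 * c * r ^ 3 ≤
      (2 * r - 1) / (1 - 2 * r + 2 * r ^ 2) +
      q ^ 3 * ((q + 2 * r) / (q ^ 2 + 2 * q * r + 2 * r ^ 2)) by
    linarith [log_edge_le hq (by positivity) h hr]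
  rintro r ⟨r0, r1⟩
  have a1 : 0 < 1 - 2 * r + 2 * r ^ 2 := by nlinarith [sq_nonneg (r - 1 / 2)]
  have a2 : 0 < q ^ 2 + 2 * q * r + 2 * r ^ 2 := by positivity
  have e : (2 * r - 1) / (1 - 2 * r + 2 * r ^ 2) +
      q ^ 3 * ((q + 2 * r) / (q ^ 2 + 2 * q * r + 2 * r ^ 2)) = q ^ 2 - 1 +
      4 * r ^ 3 * ((1 + q) * (q * (1 - r) + r) /
        ((1 - 2 * r + 2 * r ^ 2) * (q ^ 2 + 2 * q * r + 2 * r ^ 2))) := by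
    have := a1.ne'
    have := a2.ne'
    have := (mul_pos a1 a2).ne'
    grind
  have hm : min q 1 ≤ q * (1 - r) + r := by
    nlinarith [min_le_left q 1, min_le_right q 1]
  have h2 : c ≤ (1 + q) * (q * (1 - r) + r) /
        ((1 - 2 * r + 2 * r ^ 2) * (q ^ 2 + 2 * q * r + 2 * r ^ 2)) := by
    have h3 : (1 - 2 * r + 2 * r ^ 2) * (q ^ 2 + 2 * q * r + 2 * r ^ 2) ≤
        1 * (q ^ 2 + 2 * q + 2) :=
      mul_le_mul (by nlinarith) (by nlinarith) a2.le zero_le_one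
    rw [hc]
    refine div_le_div₀ ?_ (by bound) (mul_pos a1 a2) (by linarith)
    exact mul_nonneg (by linarith) (le_trans (le_min hq.le zero_le_one) hm)
  have := mul_le_mul_of_nonneg_left h2 (by positivity : 0 ≤ 4 * r ^ 3)
  linarith

theorem log_second_edge_le {s : ℝ} (hq : 0 < q) (hs : s ∈ Icc (0 : ℝ) 1) :
    (q ^ 2 - 1) * (1 + s) - 2 * (1 + q) * s - log (1 - 2 * s + 2 * s ^ 2) / 2 -
      q ^ 3 * (log (q ^ 2 + 2 * q + 2 + 2 * q * s + 2 * s ^ 2) - log (q ^ 2)) / 2 ≤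
    -((1 + q) * min q 1 / (q ^ 2 + 2 * q + 2)) := by
  have h1 := log_first_edge_le hq (right_mem_Icc.mpr zero_le_one)
  norm_num at h1
  suffices h : ∀ r ∈ Ioo (0 : ℝ) 1, q ^ 2 - 1 - 2 * (1 + q) + 4 * 0 * r ^ 3 ≤
      (2 * r - 1) / (1 - 2 * r + 2 * r ^ 2) +
      q ^ 3 * ((q + 2 * r) / (q ^ 2 + 2 * q + 2 + 2 * q * r + 2 * r ^ 2)) by
    have := log_edge_le hq (by positivity) h hs
    norm_num
    linarith
  rintro r ⟨r0, r1⟩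
  have a1 : 0 < 1 - 2 * r + 2 * r ^ 2 := by nlinarith [sq_nonneg (r - 1 / 2)]
  have a2 : 0 < q ^ 2 + 2 * q + 2 + 2 * q * r + 2 * r ^ 2 := by positivity
  have e : (2 * r - 1) / (1 - 2 * r + 2 * r ^ 2) +
      q ^ 3 * ((q + 2 * r) / (q ^ 2 + 2 * q + 2 + 2 * q * r + 2 * r ^ 2)) =
      q ^ 2 - 1 + 2 * r ^ 2 * (1 / (1 - 2 * r + 2 * r ^ 2)) -
        (2 * (1 + q) + 2 * r ^ 2) * (q ^ 2 / (q ^ 2 + 2 * q + 2 + 2 * q * r + 2 * r ^ 2)) := by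
    have := a1.ne'
    have := a2.ne'
    grind
  have b1 : 1 ≤ 1 / (1 - 2 * r + 2 * r ^ 2) := by
    rw [le_div_iff₀ a1]; nlinarith
  have b2 : q ^ 2 / (q ^ 2 + 2 * q + 2 + 2 * q * r + 2 * r ^ 2) ≤ 1 := by
    rw [div_le_one a2]; nlinarith
  have := mul_le_mul_of_nonneg_left b1 (by positivity : 0 ≤ 2 * r ^ 2)
  have := mul_le_mul_of_nonneg_left b2 (by positivity : 0 ≤ 2 * (1 + q) + 2 * r ^ 2)
  linarith

/-- The saddle point function at the cusp. -/
def cuspWeight (q : ℝ) (n1 n2 : ℕ) (ζ : ℂ) : ℂ :=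
  saddleWeight ((n1 + n2) / (1 + q ^ 3) * (q ^ 2 - 1)) ((n1 + n2) / (1 + q ^ 3) * (1 + q) / 2)
    q n1 n2 ζ

theorem cuspWeight_neg_mul (hq : 0 < q) (n1 n2 : ℕ) (ω : ℂ) :
    cuspWeight q n1 n2 (-q * ω) = cuspWeight q⁻¹ n2 n1 ω := by
  have hq' : (q : ℂ) ≠ 0 := by exact_mod_cast hq.ne'
  have h3 : 1 + q ^ 3 ≠ 0 := by positivity
  have h4 : 1 + q⁻¹ ^ 3 ≠ 0 := by positivity
  have e : (1 : ℝ) / (1 + q⁻¹ ^ 3) = q ^ 3 / (1 + q ^ 3) := by field_simp; ring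
  unfold cuspWeight saddleWeight
  rw [div_eq_mul_one_div ((n2 : ℝ) + n1) (1 + q⁻¹ ^ 3), e, mul_comm ((1 - -(q : ℂ) * ω) ^ n1)]
  congr 1
  · have h3' : (1 + q ^ 3 : ℂ) ≠ 0 := by exact_mod_cast h3
    congr 1
    push_cast
    field_simp
    ring
  · congr 2
    · field_simp; ring
    · push_cast; field_simp; ring

theorem norm_cuspWeight_arm_le (hq : 0 < q) : ∃ k > 0, ∃ C > 0, ∀ (n1 n2 : ℕ),
    |(n1 : ℝ) - 1 / (1 + q ^ 3) * (n1 + n2)| ≤ 1 → ∀ c : ℝ, |c| = 1 → ∀ r ∈ Icc (0 : ℝ) 2,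
      ‖cuspWeight q n1 n2 (armPath c r)‖ ≤ C * exp (-(k * (n1 + n2) * r ^ 4)) := by
  have hp : 0 < 1 / (1 + q ^ 3) := by positivity
  set p := 1 / (1 + q ^ 3) with hpdef
  have hp1 : 1 - p = p * q ^ 3 := by rw [hpdef]; field_simp; ring
  set k0 := (1 + q) * min q 1 / (q ^ 2 + 2 * q + 2) with hk₀
  have hk0 : 0 < k0 := by
    have : 0 < min q 1 := lt_min hq one_pos
    positivity
  set b : ℝ := (1 + 2 / q) ^ 2 + 1 / q ^ 2 with hb
  refine ⟨p * k0 / 16, by positivity, exp (b + 1), exp_pos _, ?_⟩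
  intro n1 n2 hn c hc r hr
  set m := min r (2 - r) with hm
  have hc2 : c ^ 2 = 1 := by rw [← sq_abs, hc, one_pow]
  have hm0 : 0 ≤ m := le_min hr.1 (by linarith [hr.2])
  have hm1 : m ≤ 1 := by
    rcases le_total r 1 with h | h
    · exact (min_le_left _ _).trans h
    · exact (min_le_right _ _).trans (by linarith)
  have hre : (armPath c r).re = r := by simp [armPath]
  have him : (armPath c r).im = c * m := by simp [armPath, hm]
  have hA : normSq (1 - armPath c r) = (1 - r) ^ 2 + m ^ 2 := by
    rw [normSq_apply, sub_re, sub_im, hre, him]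
    simp only [one_re, one_im]
    linear_combination m ^ 2 * hc2
  have hB : normSq (1 + armPath c r / q) = ((q + r) ^ 2 + m ^ 2) / q ^ 2 := by
    rw [normSq_apply, add_re, add_im, div_ofReal_re,
      Complex.div_ofReal_im, hre, him]
    simp only [one_re, one_im]
    field_simp
    linear_combination m ^ 2 * hc2
  have hY : (armPath c r ^ 2).re = r ^ 2 - m ^ 2 := by
    rw [sq, mul_re, hre, him]
    linear_combination -m ^ 2 * hc2
  have hAm : 1 / 2 ≤ (1 - r) ^ 2 + m ^ 2 ∧ (1 - r) ^ 2 + m ^ 2 ≤ 1 := by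
    rcases le_total r 1 with h | h
    · rw [hm, min_eq_left (by linarith)]
      constructor <;> nlinarith [sq_nonneg (r - 1 / 2), hr.1]
    · rw [hm, min_eq_right (by linarith)]
      constructor <;> nlinarith [sq_nonneg (r - 3 / 2), hr.2]
  have hBm : 1 ≤ ((q + r) ^ 2 + m ^ 2) / q ^ 2 ∧ ((q + r) ^ 2 + m ^ 2) / q ^ 2 ≤ b := by
    constructor
    · rw [one_le_div (by positivity)]
      nlinarith [mul_nonneg hq.le hr.1, sq_nonneg m, sq_nonneg r]
    · rw [hb, show (1 + 2 / q) ^ 2 + 1 / q ^ 2 = ((q + 2) ^ 2 + 1 ^ 2) / q ^ 2 by field_simp]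
      have := hr.1; have := hr.2
      gcongr
  have hlA0 : log ((1 - r) ^ 2 + m ^ 2) ≤ 0 := Real.log_nonpos (by positivity) hAm.2
  have hlA1 : -1 ≤ log ((1 - r) ^ 2 + m ^ 2) := by
    have := Real.one_sub_inv_le_log_of_pos (by linarith [hAm.1] : 0 < (1 - r) ^ 2 + m ^ 2)
    have h2 := inv_anti₀ (by norm_num) hAm.1
    norm_num at h2
    linarith
  have hlB0 := Real.log_nonneg hBm.1
  have hlB1 : log (((q + r) ^ 2 + m ^ 2) / q ^ 2) ≤ b :=
    (Real.log_le_self (by linarith [hBm.1])).trans hBm.2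
  have hlB : log (((q + r) ^ 2 + m ^ 2) / q ^ 2) =
      log ((q + r) ^ 2 + m ^ 2) - log (q ^ 2) :=
    Real.log_div (by have := hr.1; positivity) (by positivity)
  have hmain : (q ^ 2 - 1) * r - (1 + q) / 2 * (r ^ 2 - m ^ 2) -
      log ((1 - r) ^ 2 + m ^ 2) / 2 - q ^ 3 * log (((q + r) ^ 2 + m ^ 2) / q ^ 2) / 2 ≤
      -(k0 / 16) * r ^ 4 := by
    rw [hlB]
    rcases le_total r 1 with h | h
    · have := log_first_edge_le hq ⟨hr.1, h⟩
      rw [hm, min_eq_left (by linarith), show (1 - r) ^ 2 + r ^ 2 = 1 - 2 * r + 2 * r ^ 2 by ring,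
        show (q + r) ^ 2 + r ^ 2 = q ^ 2 + 2 * q * r + 2 * r ^ 2 by ring]
      have h4 : 0 ≤ k0 * r ^ 4 := by positivity
      linarith
    · have := log_second_edge_le hq ⟨sub_nonneg.mpr h, by linarith [hr.2]⟩
      rw [hm, min_eq_right (by linarith), show (1 - r) ^ 2 + (2 - r) ^ 2 =
        1 - 2 * (r - 1) + 2 * (r - 1) ^ 2 by ring, show (q + r) ^ 2 + (2 - r) ^ 2 =
        q ^ 2 + 2 * q + 2 + 2 * q * (r - 1) + 2 * (r - 1) ^ 2 by ring]
      have h4 : r ^ 4 ≤ 2 ^ 4 := pow_le_pow_left₀ hr.1 hr.2 4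
      have := mul_le_mul_of_nonneg_left h4 hk0.le
      linarith
  rw [cuspWeight, norm_saddleWeight, hA, hB, hY, hre, ← Real.exp_add]
  · refine Real.exp_le_exp.mpr ?_
    set lA := log ((1 - r) ^ 2 + m ^ 2)
    set lB := log (((q + r) ^ 2 + m ^ 2) / q ^ 2)
    have hn' := abs_le.mp hn
    set N : ℝ := n1 + n2 with hN
    have hθ : (n1 : ℝ) - p * N = n1 - p * N := rfl
    have hN0 : 0 ≤ p * N := by positivity
    have e : N / (1 + q ^ 3) * (q ^ 2 - 1) * r - N / (1 + q ^ 3) * (1 + q) / 2 * (r ^ 2 - m ^ 2) -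
        (n1 * (lA / 2) + n2 * (lB / 2)) = p * N * ((q ^ 2 - 1) * r - (1 + q) / 2 * (r ^ 2 - m ^ 2) -
        lA / 2 - q ^ 3 * lB / 2) + (n1 - p * N) * ((lB - lA) / 2) := by
      have : (n2 : ℝ) = N - n1 := by rw [hN]; ring
      rw [this, div_eq_mul_one_div N (1 + q ^ 3), ← hpdef]
      linear_combination -(N * lB / 2) * hp1
    rw [e]
    have h1 := mul_le_mul_of_nonneg_left hmain hN0
    have h2 : (n1 - p * N) * ((lB - lA) / 2) ≤ 1 * (b + 1) :=
      mul_le_mul hn'.2 (by linarith) (by linarith) zero_le_one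
    linarith
  · rw [← normSq_pos, hA]; linarith [hAm.1]
  · rw [← normSq_pos, hB]; linarith [hBm.1]

theorem norm_cuspWeight_axis_inv_le (hq : 0 < q) : ∃ C > 0, ∀ (n1 n2 : ℕ),
    |(n1 : ℝ) - 1 / (1 + q ^ 3) * (n1 + n2)| ≤ 1 → ∀ u : ℝ,
      ‖(cuspWeight q n1 n2 (u * I))⁻¹‖ ≤
        C * exp (-(1 / (1 + q ^ 3) * (n1 + n2) / 4 * (u ^ 4 / (1 + u ^ 2)))) := by
  have hp : 0 < 1 / (1 + q ^ 3) := by positivity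
  set p := 1 / (1 + q ^ 3) with hpdef
  have hp1 : 1 - p = p * q ^ 3 := by rw [hpdef]; field_simp; ring
  set b : ℝ := |log (q ^ 2)| with hb
  refine ⟨exp b, exp_pos _, ?_⟩
  intro n1 n2 hn u
  have hA : normSq (1 - u * I) = 1 + u ^ 2 := by
    simp [normSq_apply]; ring
  have hB : normSq (1 + u * I / q) = 1 + u ^ 2 / q ^ 2 := by
    rw [normSq_apply, add_re, add_im, div_ofReal_re,
      Complex.div_ofReal_im]
    simp
    field_simp
  have hY : ((u * I : ℂ) ^ 2).re = -u ^ 2 := by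
    rw [mul_pow, I_sq]; simp [← ofReal_pow]
  have hlog : ∀ s : ℝ, 0 ≤ s → log (1 + s) ≤ s - s ^ 2 / (1 + s) / 2 := fun s hs => by
    have h1 := Real.self_le_sinh_iff.mpr (Real.log_nonneg (by linarith : 1 ≤ 1 + s))
    rw [Real.sinh_log (by linarith)] at h1
    refine h1.trans (le_of_eq ?_)
    have : 1 + s ≠ 0 := by linarith
    field_simp
    ring
  have hl1 := hlog (u ^ 2) (sq_nonneg u)
  have hl2 := Real.log_le_sub_one_of_pos (by positivity : 0 < 1 + u ^ 2 / q ^ 2)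
  have hdiff : |log (1 + u ^ 2) - log (1 + u ^ 2 / q ^ 2)| ≤ b := by
    have e1 : log (1 + u ^ 2) - log (1 + u ^ 2 / q ^ 2) =
        log (q ^ 2) + (log (1 + u ^ 2) - log (q ^ 2 + u ^ 2)) := by
      rw [show 1 + u ^ 2 / q ^ 2 = (q ^ 2 + u ^ 2) / q ^ 2 by field_simp,
        Real.log_div (by positivity) (by positivity)]
      ring
    rcases le_total (q ^ 2) 1 with h | h
    · have h1 : log (1 + u ^ 2) ≤ log (1 + u ^ 2 / q ^ 2) :=
        log_le_log (by positivity) (by gcongr; exact le_div_self (sq_nonneg u) (by positivity) h)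
      have h2 : log (q ^ 2 + u ^ 2) ≤ log (1 + u ^ 2) :=
        log_le_log (by positivity) (by linarith)
      rw [abs_of_nonpos (by linarith)]
      linarith [neg_abs_le (log (q ^ 2))]
    · have h1 : log (1 + u ^ 2 / q ^ 2) ≤ log (1 + u ^ 2) :=
        log_le_log (by positivity) (by gcongr; exact div_le_self (sq_nonneg u) h)
      have h2 : log (1 + u ^ 2) ≤ log (q ^ 2 + u ^ 2) :=
        log_le_log (by positivity) (by linarith)
      rw [abs_of_nonneg (by linarith)]
      linarith [le_abs_self (log (q ^ 2))]
  rw [cuspWeight, norm_inv, norm_saddleWeight, hA, hB, hY, ← Real.exp_neg, ← Real.exp_add]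
  · refine Real.exp_le_exp.mpr ?_
    set lA := log (1 + u ^ 2)
    set lB := log (1 + u ^ 2 / q ^ 2)
    set N : ℝ := n1 + n2 with hN
    have hN0 : 0 ≤ p * N := by positivity
    have hre : (u * I : ℂ).re = 0 := by simp
    have e : -(N / (1 + q ^ 3) * (q ^ 2 - 1) * (u * I : ℂ).re -
        N / (1 + q ^ 3) * (1 + q) / 2 * (-u ^ 2) -
        (n1 * (lA / 2) + n2 * (lB / 2))) = p * N / 2 * (lA - u ^ 2) +
        q ^ 3 * (p * N / 2) * (lB - u ^ 2 / q ^ 2) + (n1 - p * N) * ((lA - lB) / 2) := by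
      have h2 : (n2 : ℝ) = N - n1 := by rw [hN]; ring
      have h3 : q ^ 3 * (u ^ 2 / q ^ 2) = q * u ^ 2 := by field_simp
      rw [h2, div_eq_mul_one_div N (1 + q ^ 3), ← hpdef, hre]
      linear_combination (N * lB / 2) * hp1 + (p * N / 2) * h3
    rw [e]
    have h1 := mul_le_mul_of_nonneg_left hl1 hN0
    have h2 := mul_le_mul_of_nonneg_left hl2 (by positivity : 0 ≤ q ^ 3 * (p * N / 2))
    have h3 : (n1 - p * N) * ((lA - lB) / 2) ≤ 1 * b := by
      refine (le_abs_self _).trans ?_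
      rw [abs_mul, abs_div, abs_two]
      exact mul_le_mul hn (by linarith [abs_nonneg (lA - lB)]) (by positivity) zero_le_one
    rw [← pow_mul] at h1
    norm_num at h1 h2 h3 ⊢
    linarith
  · rw [← normSq_pos, hA]; positivity
  · rw [← normSq_pos, hB]; positivity

theorem norm_log_sub_taylor_le {z : ℂ} (hz : ‖z‖ ≤ 1 / 2) :
    ‖Complex.log (1 + z) - (z - z ^ 2 / 2 + z ^ 3 / 3 - z ^ 4 / 4)‖ ≤ ‖z‖ ^ 5 := by
  have h := Complex.norm_log_sub_logTaylor_le 4 (hz.trans_lt (by norm_num))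
  have e : Complex.logTaylor (4 + 1) z = z - z ^ 2 / 2 + z ^ 3 / 3 - z ^ 4 / 4 := by
    simp [Complex.logTaylor, Finset.sum_range_succ]
    ring
  rw [e] at h
  refine h.trans ?_
  have h2 : (1 - ‖z‖)⁻¹ ≤ 2 := by
    rw [show (2 : ℝ) = (1 / 2)⁻¹ by norm_num]
    exact inv_anti₀ (by norm_num) (by linarith)
  have h5 : 0 ≤ ‖z‖ ^ 5 := by positivity
  norm_num at h2 ⊢
  have := mul_le_mul_of_nonneg_left h2 h5
  linarith

theorem tendsto_cuspWeight (hq : 0 < q) {n1 n2 : ℕ → ℕ} {L : ℕ → ℝ}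
    (hn : ∀ N, |(n1 N : ℝ) - 1 / (1 + q ^ 3) * (n1 N + n2 N)| ≤ 1) (hL : ∀ N, 0 < L N)
    (hLt : Tendsto L atTop atTop)
    (hL4 : ∀ N, L N ^ 4 = (n1 N + n2 N) / (1 + q ^ 3) * (1 + q) / q) (V : ℂ) :
    Tendsto (fun N => cuspWeight q (n1 N) (n2 N) (V / L N)) atTop (𝓝 (cexp (V ^ 4 / 4))) := by
  set g : ℂ → ℂ := fun z => Complex.log (1 + z) - (z - z ^ 2 / 2 + z ^ 3 / 3 - z ^ 4 / 4) with hg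
  have hLc : Tendsto (fun N => ((L N : ℝ) : ℂ)⁻¹) atTop (𝓝 0) := by
    rw [tendsto_zero_iff_norm_tendsto_zero]
    simp only [norm_inv, norm_real, norm_eq_abs]
    exact tendsto_inv_atTop_zero.comp (tendsto_abs_atTop_atTop.comp hLt)
  have hz : ∀ a : ℂ, Tendsto (fun N => a / L N) atTop (𝓝 0) := fun a => by
    simpa [div_eq_mul_inv] using hLc.const_mul a
  have hsmall : ∀ a : ℂ, ∀ᶠ N in atTop, ‖a / L N‖ ≤ 1 / 2 := fun a => by
    have := (hz a).norm
    rw [norm_zero] at this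
    exact (this.eventually_lt_const (by norm_num : (0 : ℝ) < 1 / 2)).mono fun N h => h.le
  have hgl : ∀ a : ℂ, Tendsto (fun N => (L N : ℂ) ^ 4 * g (a / L N)) atTop (𝓝 0) := fun a => by
    refine squeeze_zero_norm' (a := fun N => ‖a‖ ^ 5 * (L N)⁻¹) ?_ ?_
    · filter_upwards [hsmall a] with N h
      rw [norm_mul, norm_pow, norm_real, norm_of_nonneg (hL N).le]
      refine (mul_le_mul_of_nonneg_left (norm_log_sub_taylor_le h) (by have := hL N; positivity)).trans
        (le_of_eq ?_)
      rw [norm_div, norm_real, norm_of_nonneg (hL N).le]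
      have := (hL N).ne'
      field_simp
    · simpa using (tendsto_inv_atTop_zero.comp hLt).const_mul (‖a‖ ^ 5)
  have hlog : ∀ a : ℂ, Tendsto (fun N => Complex.log (1 + a / L N)) atTop (𝓝 0) := fun a => by
    have h1 : Tendsto (fun N => 1 + a / L N) atTop (𝓝 1) := by simpa using (hz a).const_add 1
    have := h1.clog (by simp)
    rwa [Complex.log_one] at this
  have hq3 : 0 < 1 + q ^ 3 := by positivity
  have hqc : (q : ℂ) ≠ 0 := by exact_mod_cast hq.ne'
  have hq3c : (1 + q ^ 3 : ℂ) ≠ 0 := by exact_mod_cast hq3.ne'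
  have hq1c : (1 + q : ℂ) ≠ 0 := by exact_mod_cast (by positivity : (1 + q : ℝ) ≠ 0)
  have hθ : Tendsto (fun N => (((n1 N : ℝ) - 1 / (1 + q ^ 3) * (n1 N + n2 N) : ℝ) : ℂ) *
      (Complex.log (1 + -V / L N) - Complex.log (1 + (V / q) / L N))) atTop (𝓝 0) := by
    refine squeeze_zero_norm (a := fun N => ‖Complex.log (1 + -V / L N) -
      Complex.log (1 + (V / q) / L N)‖) (fun N => ?_) ?_
    · rw [norm_mul, norm_real, norm_eq_abs]
      exact mul_le_of_le_one_left (norm_nonneg _) (hn N)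
    · simpa using ((hlog (-V)).sub (hlog (V / q))).norm
  have hexp : Tendsto (fun N => cexp (V ^ 4 / 4 -
      (((n1 N : ℝ) - 1 / (1 + q ^ 3) * (n1 N + n2 N) : ℝ) : ℂ) *
      (Complex.log (1 + -V / L N) - Complex.log (1 + (V / q) / L N)) -
      q / (1 + q) * ((L N : ℂ) ^ 4 * g (-V / L N)) -
      q ^ 4 / (1 + q) * ((L N : ℂ) ^ 4 * g ((V / q) / L N)))) atTop (𝓝 (cexp (V ^ 4 / 4))) := by
    refine (Complex.continuous_exp.tendsto _).comp ?_
    simpa using ((tendsto_const_nhds.sub hθ).sub ((hgl (-V)).const_mul _)).sub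
      ((hgl (V / q)).const_mul (q ^ 4 / (1 + q) : ℂ))
  refine hexp.congr' ?_
  filter_upwards [hsmall (-V), hsmall (V / q)] with N h1 h2
  have hne : ∀ z : ℂ, ‖z‖ ≤ 1 / 2 → 1 + z ≠ 0 := fun z hz h => by
    rw [show z = -1 by linear_combination h] at hz
    norm_num at hz
  have hLN : (L N : ℂ) ≠ 0 := by exact_mod_cast (hL N).ne'
  have h4 : (n1 N + n2 N : ℂ) = L N ^ 4 * q * (1 + q ^ 3) / (1 + q) := by
    have : (L N : ℂ) ^ 4 = (n1 N + n2 N) / (1 + q ^ 3) * (1 + q) / q := by exact_mod_cast hL4 N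
    rw [this]
    field_simp
  have hn2 : (n2 N : ℂ) = L N ^ 4 * q * (1 + q ^ 3) / (1 + q) - n1 N := by rw [← h4]; ring
  rw [cuspWeight, saddleWeight, show 1 - V / L N = 1 + -V / L N by ring,
    show 1 + V / (L N : ℂ) / q = 1 + V / q / L N by ring]
  rw [← exp_log (hne _ h1), ← exp_log (hne _ h2), ← exp_nat_mul,
    ← exp_nat_mul, ← exp_add, ← Complex.exp_sub]
  congr 1
  rw [exp_log (hne _ h1), exp_log (hne _ h2), hg]
  simp only
  push_cast
  rw [h4, hn2]
  generalize Complex.log (1 + -V / L N) = l1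
  generalize Complex.log (1 + V / q / L N) = l2
  field_simp
  ring

theorem integrable_exp_neg_mul_rpow :
    IntegrableOn (fun ρ : ℝ => exp (-ρ) * ρ ^ (-(1 / 2) : ℝ)) (Ioi 0) := by
  have := Real.GammaIntegral_convergent (s := 1 / 2) (by norm_num)
  norm_num at this ⊢
  exact this

theorem integrable_exp_neg_abs_mul_rpow :
    Integrable (fun y : ℝ => exp (-|y|) * |y| ^ (-(1 / 2) : ℝ)) := by
  have h := integrable_exp_neg_mul_rpow
  have h1 : IntegrableOn (fun y : ℝ => exp (-|y|) * |y| ^ (-(1 / 2) : ℝ)) (Ioi 0) :=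
    h.congr_fun (fun y hy => by simp only [abs_of_pos (mem_Ioi.mp hy)]) measurableSet_Ioi
  have h2 : IntegrableOn (fun y : ℝ => exp (-|y|) * |y| ^ (-(1 / 2) : ℝ)) (Iio 0) := by
    have := (Measure.measurePreserving_neg (volume : Measure ℝ)).integrableOn_comp_preimage
      (Homeomorph.neg ℝ).measurableEmbedding (f := fun y : ℝ =>
        exp (-|y|) * |y| ^ (-(1 / 2) : ℝ)) (s := Ioi 0)
    simpa [comp_def] using this.mpr h1
  rw [← integrableOn_univ, ← Iio_union_Ici (a := (0 : ℝ))]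
  exact h2.union ((integrableOn_congr_set_ae Ioi_ae_eq_Ici).mp h1)

theorem norm_div_sub_le {F G V : ℂ} {C ρ y : ℝ} (hF : ‖F‖ ≤ C * exp (-|y|)) (hρ : 0 < ρ)
    (hG : ‖G‖ ≤ C * exp (-ρ)) (hV : ρ * |y| / 4 ≤ ‖V - y * I‖ ^ 2) (hy : y ≠ 0) :
    ‖F * (G / (V - y * I))‖ ≤ C ^ 2 * 2 * ((exp (-|y|) * |y| ^ (-(1 / 2) : ℝ)) *
      (exp (-ρ) * ρ ^ (-(1 / 2) : ℝ))) := by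
  have hy' := abs_pos.mpr hy
  have hd : (√ρ * √|y|) / 2 ≤ ‖V - y * I‖ := by
    refine le_of_sq_le_sq ?_ (norm_nonneg _)
    rw [div_pow, mul_pow, sq_sqrt hρ.le, sq_sqrt hy'.le]
    norm_num
    exact hV
  have hp : 0 < (√ρ * √|y|) / 2 := by positivity
  have e : ∀ z : ℝ, 0 < z → z ^ (-(1 / 2) : ℝ) = (√z)⁻¹ := fun z hz => by
    rw [Real.rpow_neg hz.le, Real.sqrt_eq_rpow]
  rw [norm_mul, norm_div, e ρ hρ, e _ hy']
  have h1 : ‖G‖ / ‖V - y * I‖ ≤ C * exp (-ρ) / ((√ρ * √|y|) / 2) :=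
    div_le_div₀ ((norm_nonneg _).trans hG) hG hp hd
  refine (mul_le_mul hF h1 (by positivity) ((norm_nonneg _).trans hF)).trans (le_of_eq ?_)
  have := (Real.sqrt_pos.mpr hρ).ne'
  have := (Real.sqrt_pos.mpr hy').ne'
  field_simp

theorem ae_prod_pos_ne : ∀ᵐ z : ℝ × ℝ ∂(volume : Measure ℝ).prod (volume.restrict (Ioi 0)),
    z.1 ≠ 0 ∧ 0 < z.2 := by
  have h1 : ∀ᵐ y : ℝ, y ≠ 0 := by simp [ae_iff]
  have h2 : ∀ᵐ ρ : ℝ ∂volume.restrict (Ioi (0 : ℝ)), 0 < ρ := ae_restrict_mem measurableSet_Ioi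
  exact (Measure.quasiMeasurePreserving_fst.ae h1).and (Measure.quasiMeasurePreserving_snd.ae h2)

theorem integrable_div_sub {F G V : ℝ → ℂ} {C : ℝ} (hFm : Measurable F) (hGm : Measurable G)
    (hVm : Measurable V) (hF : ∀ y, ‖F y‖ ≤ C * exp (-|y|))
    (hG : ∀ ρ > 0, ‖G ρ‖ ≤ C * exp (-ρ))
    (hV : ∀ ρ > 0, ∀ y : ℝ, ρ * |y| / 4 ≤ ‖V ρ - y * I‖ ^ 2) :
    Integrable (fun z : ℝ × ℝ => F z.1 * (G z.2 / (V z.2 - z.1 * I)))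
      ((volume : Measure ℝ).prod (volume.restrict (Ioi 0))) := by
  refine ((integrable_exp_neg_abs_mul_rpow.mul_prod integrable_exp_neg_mul_rpow).const_mul
    (C ^ 2 * 2)).mono' (Measurable.aestronglyMeasurable (by fun_prop)) ?_
  filter_upwards [ae_prod_pos_ne] with z hz
  exact norm_div_sub_le (hF _) hz.2 (hG _ hz.2) (hV _ hz.2 _) hz.1

theorem exists_norm_integral_div_sub_le : ∃ K > 0, ∀ {F G V : ℝ → ℂ} {C : ℝ}, Measurable F →
    Measurable G → Measurable V → (∀ y, ‖F y‖ ≤ C * exp (-|y|)) →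
    (∀ ρ > 0, ‖G ρ‖ ≤ C * exp (-ρ)) →
    (∀ ρ > 0, ∀ y : ℝ, ρ * |y| / 4 ≤ ‖V ρ - y * I‖ ^ 2) →
    ‖∫ y : ℝ, F y * ∫ ρ in Ioi (0 : ℝ), G ρ / (V ρ - y * I)‖ ≤ K * C ^ 2 := by
  set D : ℝ × ℝ → ℝ := fun z => (exp (-|z.1|) * |z.1| ^ (-(1 / 2) : ℝ)) *
      (exp (-z.2) * z.2 ^ (-(1 / 2) : ℝ)) with hD
  refine ⟨|2 * ∫ z, D z ∂(volume : Measure ℝ).prod (volume.restrict (Ioi 0))| + 1, by positivity, ?_⟩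
  intro F G V C hFm hGm hVm hF hG hV
  have h := integral_prod _ (integrable_div_sub hFm hGm hVm hF hG hV)
  simp only [integral_const_mul] at h
  rw [← h]
  refine (norm_integral_le_of_norm_le (g := fun z => C ^ 2 * 2 * D z)
    ((integrable_exp_neg_abs_mul_rpow.mul_prod integrable_exp_neg_mul_rpow).const_mul _) ?_).trans ?_
  · filter_upwards [ae_prod_pos_ne] with z hz
    exact norm_div_sub_le (hF _) hz.2 (hG _ hz.2) (hV _ hz.2 _) hz.1
  · rw [integral_const_mul]
    have := le_abs_self (2 * ∫ z, D z ∂(volume : Measure ℝ).prod (volume.restrict (Ioi 0)))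
    nlinarith [sq_nonneg C]

theorem tendsto_integral_div_sub {F G V : ℕ → ℝ → ℂ} {F' G' V' : ℝ → ℂ} {C : ℝ}
    (hFm : ∀ N, Measurable (F N)) (hGm : ∀ N, Measurable (G N)) (hVm : ∀ N, Measurable (V N))
    (hF : ∀ N y, ‖F N y‖ ≤ C * exp (-|y|))
    (hG : ∀ N, ∀ ρ > 0, ‖G N ρ‖ ≤ C * exp (-ρ))
    (hV : ∀ N, ∀ ρ > 0, ∀ y : ℝ, ρ * |y| / 4 ≤ ‖V N ρ - y * I‖ ^ 2)
    (hF' : ∀ y, Tendsto (fun N => F N y) atTop (𝓝 (F' y)))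
    (hG' : ∀ ρ > 0, Tendsto (fun N => G N ρ) atTop (𝓝 (G' ρ)))
    (hV' : ∀ ρ > 0, Tendsto (fun N => V N ρ) atTop (𝓝 (V' ρ)))
    (hFm' : Measurable F') (hGm' : Measurable G') (hVm' : Measurable V') :
    Tendsto (fun N => ∫ y : ℝ, F N y * ∫ ρ in Ioi (0 : ℝ), G N ρ / (V N ρ - y * I)) atTop
      (𝓝 (∫ ρ in Ioi (0 : ℝ), ∫ y : ℝ, F' y * (G' ρ / (V' ρ - y * I)))) := by
  have hF1 : ∀ y, ‖F' y‖ ≤ C * exp (-|y|) := fun y =>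
    le_of_tendsto (hF' y).norm (Eventually.of_forall fun N => hF N y)
  have hG1 : ∀ ρ > 0, ‖G' ρ‖ ≤ C * exp (-ρ) := fun ρ hρ =>
    le_of_tendsto (hG' ρ hρ).norm (Eventually.of_forall fun N => hG N ρ hρ)
  have hV1 : ∀ ρ > 0, ∀ y : ℝ, ρ * |y| / 4 ≤ ‖V' ρ - y * I‖ ^ 2 := fun ρ hρ y =>
    ge_of_tendsto (((hV' ρ hρ).sub_const _).norm.pow 2) (Eventually.of_forall fun N => hV N ρ hρ y)
  have e : ∀ N, ∫ y : ℝ, F N y * ∫ ρ in Ioi (0 : ℝ), G N ρ / (V N ρ - y * I) =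
      ∫ z, F N z.1 * (G N z.2 / (V N z.2 - z.1 * I))
        ∂(volume : Measure ℝ).prod (volume.restrict (Ioi 0)) := fun N => by
    rw [integral_prod _ (integrable_div_sub (hFm N) (hGm N) (hVm N) (hF N) (hG N) (hV N))]
    simp only [integral_const_mul]
  simp only [e]
  rw [← integral_prod_symm (fun z : ℝ × ℝ => F' z.1 * (G' z.2 / (V' z.2 - z.1 * I)))
    (integrable_div_sub hFm' hGm' hVm' hF1 hG1 hV1)]
  refine tendsto_integral_of_dominated_convergence _ (fun N => ?_)
    ((integrable_exp_neg_abs_mul_rpow.mul_prod integrable_exp_neg_mul_rpow).const_mul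
      (C ^ 2 * 2)) (fun N => ?_) ?_
  · have := hFm N; have := hGm N; have := hVm N
    exact Measurable.aestronglyMeasurable (by fun_prop)
  · filter_upwards [ae_prod_pos_ne] with z hz
    exact norm_div_sub_le (hF N _) hz.2 (hG N _ hz.2) (hV N _ hz.2 _) hz.1
  · filter_upwards [ae_prod_pos_ne] with z hz
    refine (hF' _).mul ((hG' _ hz.2).div ((hV' _ hz.2).sub_const _) fun h0 => ?_)
    have := hV1 _ hz.2 z.1
    rw [h0, norm_zero] at this
    have h3 := mul_pos hz.2 (abs_pos.mpr hz.1)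
    norm_num at this
    linarith

/-- The factor of the scaled double integral that lives on the imaginary axis. -/
def axisWeight (q : ℝ) (n1 n2 : ℕ) (L σ τ η y : ℝ) : ℂ :=
  (cexp (σ * (η * (y * I) - τ * (y * I) ^ 2 / 2)) *
    cuspWeight q n1 n2 (y * I / L))⁻¹

/-- The arms of the squares in the scale `L`, parametrized by the absolute value of the real part
near `0`. -/
def armPoint (L h c ρ : ℝ) : ℂ := L * (h * armPath c (ρ / (L * |h|)))

/-- The factor of the scaled double integral that lives on the arms. -/
def armWeight (q : ℝ) (n1 n2 : ℕ) (L σ τ ξ h c ρ : ℝ) : ℂ :=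
  if ρ ≤ 2 * (L * |h|) then
    cexp (σ * (ξ * armPoint L h c ρ - τ * armPoint L h c ρ ^ 2 / 2)) *
      cuspWeight q n1 n2 (armPoint L h c ρ / L) * ((h / |h| : ℝ) * armDeriv c (ρ / (L * |h|)))
  else 0

theorem measurable_cuspWeight (q : ℝ) (n1 n2 : ℕ) : Measurable (cuspWeight q n1 n2) := by
  unfold cuspWeight saddleWeight
  fun_prop

theorem measurable_axisWeight (q : ℝ) (n1 n2 : ℕ) (L σ τ η : ℝ) :
    Measurable (axisWeight q n1 n2 L σ τ η) := by
  have := measurable_cuspWeight q n1 n2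
  unfold axisWeight
  fun_prop

theorem measurable_armPoint (L h c : ℝ) : Measurable (armPoint L h c) := by
  unfold armPoint armPath
  fun_prop

theorem measurable_armWeight (q : ℝ) (n1 n2 : ℕ) (L σ τ ξ h c : ℝ) :
    Measurable (armWeight q n1 n2 L σ τ ξ h c) := by
  have := measurable_cuspWeight q n1 n2
  have h1 := measurable_armPoint L h c
  have h2 := measurable_armDeriv c
  unfold armWeight
  refine Measurable.ite measurableSet_Iic ?_ measurable_const
  fun_prop

theorem integral_arm_div_eq {q L h c : ℝ} (hL : 0 < L) (hh : h ≠ 0) (n1 n2 : ℕ) (σ τ ξ y : ℝ)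
    {S : ℂ → ℂ} (hS : ∀ ζ, S ζ = cexp (σ * (ξ * (L * ζ) - τ * (L * ζ) ^ 2 / 2)) *
      cuspWeight q n1 n2 ζ) :
    ∫ r in (0 : ℝ)..2, S (h * armPath c r) / (h * armPath c r - (y / L : ℝ) * I) *
        (h * armDeriv c r) =
      ∫ ρ in Ioi (0 : ℝ), armWeight q n1 n2 L σ τ ξ h c ρ /
        (armPoint L h c ρ - y * I) := by
  have hk : 0 < L * |h| := mul_pos hL (abs_pos.mpr hh)
  have hL' : (L : ℂ) ≠ 0 := by exact_mod_cast hL.ne'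
  have hh' : ((|h| : ℝ) : ℂ) ≠ 0 := by exact_mod_cast (abs_pos.mpr hh).ne'
  have e1 := intervalIntegral.integral_comp_div (a := 0) (b := 2 * (L * |h|)) (fun r : ℝ =>
    S (h * armPath c r) / (h * armPath c r - (y / L : ℝ) * I) * (h * armDeriv c r)) hk.ne'
  rw [zero_div, mul_div_cancel_right₀ _ hk.ne'] at e1
  have e2 : ∀ ρ : ℝ, armWeight q n1 n2 L σ τ ξ h c ρ / (armPoint L h c ρ - y * I) =
      (Iic (2 * (L * |h|))).indicator (fun ρ => ((L * |h| : ℝ) : ℂ)⁻¹ *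
        (S (h * armPath c (ρ / (L * |h|))) / (h * armPath c (ρ / (L * |h|)) -
          (y / L : ℝ) * I) * (h * armDeriv c (ρ / (L * |h|))))) ρ := fun ρ => by
    unfold armWeight
    rw [indicator_apply]
    simp only [mem_Iic]
    split_ifs with hρ
    · rw [hS]
      have e3 : armPoint L h c ρ / L = h * armPath c (ρ / (L * |h|)) := by
        rw [armPoint, mul_div_cancel_left₀ _ hL']
      have e4 : armPoint L h c ρ - y * I =
          L * (h * armPath c (ρ / (L * |h|)) - (y / L : ℝ) * I) := by
        rw [armPoint]; push_cast; field_simp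
      rw [e3, e4]
      simp only [armPoint]
      push_cast
      simp only [div_eq_mul_inv, mul_inv]
      ring
    · simp
  simp only [e2]
  rw [setIntegral_indicator measurableSet_Iic, Ioi_inter_Iic, integral_const_mul,
    ← integral_of_le (by positivity), e1, real_smul, ← mul_assoc,
    inv_mul_cancel₀ (by exact_mod_cast hk.ne'), one_mul]

theorem le_norm_armPoint_sub {L h c : ℝ} (hL : 0 < L) (hh : h ≠ 0) (hc : |c| = 1) {ρ : ℝ}
    (hρ : 0 < ρ) (y : ℝ) : ρ * |y| / 4 ≤ ‖armPoint L h c ρ - y * I‖ ^ 2 := by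
  have hk : 0 < L * |h| := mul_pos hL (abs_pos.mpr hh)
  have hr : 0 < ρ / (L * |h|) := div_pos hρ hk
  set r := ρ / (L * |h|) with hrdef
  have hm : |min r (2 - r)| ≤ r := by
    rw [abs_le]
    exact ⟨le_min (by linarith) (by linarith), min_le_left _ _⟩
  have hre : (armPoint L h c ρ - y * I).re = L * h * r := by
    simp [armPoint, armPath, ← hrdef, mul_assoc]
  have him : (armPoint L h c ρ - y * I).im = L * h * (c * min r (2 - r)) - y := by
    simp [armPoint, armPath, ← hrdef, mul_assoc]
  have h1 : (L * h * r) ^ 2 = ρ ^ 2 := by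
    rw [show (L * h * r) ^ 2 = (L * |h| * r) ^ 2 by simp only [mul_pow, sq_abs], hrdef,
      mul_div_cancel₀ _ hk.ne']
  have h2 : |L * h * (c * min r (2 - r))| ≤ ρ := by
    rw [abs_mul, abs_mul, abs_mul, hc, one_mul, abs_of_pos hL]
    refine (mul_le_mul_of_nonneg_left hm hk.le).trans (le_of_eq ?_)
    rw [hrdef, mul_div_cancel₀ _ hk.ne']
  rw [sq_norm, normSq_apply, hre, him]
  have h3 : |y| - ρ ≤ |L * h * (c * min r (2 - r)) - y| := by
    have := abs_sub_abs_le_abs_sub y (L * h * (c * min r (2 - r)))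
    rw [abs_sub_comm] at this
    linarith
  have h4 : (L * h * (c * min r (2 - r)) - y) * (L * h * (c * min r (2 - r)) - y) =
      |L * h * (c * min r (2 - r)) - y| ^ 2 := by rw [sq_abs, sq]
  have h5 : L * h * r * (L * h * r) = ρ ^ 2 := by rw [← h1, sq]
  rw [h4, h5]
  rcases le_total |y| ρ with hy | hy
  · nlinarith [sq_nonneg |L * h * (c * min r (2 - r)) - y|, abs_nonneg y]
  · nlinarith [pow_le_pow_left₀ (sub_nonneg.mpr hy) h3 2, sq_nonneg (|y| - 2 * ρ)]

theorem norm_armPath_le {c r : ℝ} (hc : |c| = 1) (hr : 0 ≤ r) : ‖armPath c r‖ ≤ 2 * r := by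
  have hm : |min r (2 - r)| ≤ r := by
    rw [abs_le]
    exact ⟨le_min (by linarith) (by linarith), min_le_left _ _⟩
  refine (norm_add_le _ _).trans ?_
  rw [norm_mul, norm_I, mul_one, norm_real, norm_real, norm_eq_abs,
    norm_eq_abs, abs_mul, hc, abs_of_nonneg hr]
  linarith

theorem norm_cuspWeight_arms_le (hq : 0 < q) : ∃ k > 0, ∃ C > 0, ∀ (n1 n2 : ℕ),
    |(n1 : ℝ) - 1 / (1 + q ^ 3) * (n1 + n2)| ≤ 1 → ∀ h ∈ ({1, -q} : Set ℝ), ∀ c : ℝ, |c| = 1 →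
      ∀ r ∈ Icc (0 : ℝ) 2,
      ‖cuspWeight q n1 n2 (h * armPath c r)‖ ≤ C * exp (-(k * (n1 + n2) * r ^ 4)) := by
  obtain ⟨k, hk, C, hC, h1⟩ := norm_cuspWeight_arm_le hq
  obtain ⟨k', hk', C', hC', h1'⟩ := norm_cuspWeight_arm_le (inv_pos.mpr hq)
  refine ⟨min k k', lt_min hk hk', max C C', lt_max_of_lt_left hC, ?_⟩
  intro n1 n2 hn h hh c hc r hr
  rcases hh with rfl | rfl
  · rw [ofReal_one, one_mul]
    refine (h1 n1 n2 hn c hc r hr).trans ?_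
    gcongr
    · exact le_max_left _ _
    · exact min_le_left _ _
  · rw [Complex.ofReal_neg, cuspWeight_neg_mul hq]
    have hn' : |(n2 : ℝ) - 1 / (1 + q⁻¹ ^ 3) * (n2 + n1)| ≤ 1 := by
      have h3 : 1 + q ^ 3 ≠ 0 := by positivity
      have h4 : 1 + q⁻¹ ^ 3 ≠ 0 := by positivity
      rw [← abs_neg]
      convert hn using 2
      field_simp
      ring
    refine (h1' n2 n1 hn' c hc r hr).trans ?_
    rw [add_comm (n2 : ℝ)]
    gcongr
    · exact le_max_right _ _
    · exact min_le_right _ _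

theorem mul_sq_sub_le (B ρ : ℝ) {k : ℝ} (hk : 0 < k) :
    B * ρ ^ 2 - B ^ 2 / (4 * k) ≤ k * ρ ^ 4 := by
  have e : k * ρ ^ 4 - (B * ρ ^ 2 - B ^ 2 / (4 * k)) = (2 * k * ρ ^ 2 - B) ^ 2 / (4 * k) := by
    field_simp
    ring
  have : 0 ≤ (2 * k * ρ ^ 2 - B) ^ 2 / (4 * k) := by positivity
  linarith

theorem exists_norm_weights_le (hq : 0 < q) (T X : ℝ) (hT : 0 ≤ T) (hX : 0 ≤ X) :
    ∃ C M : ℝ, ∀ (n1 n2 : ℕ) (L : ℝ), |(n1 : ℝ) - 1 / (1 + q ^ 3) * (n1 + n2)| ≤ 1 → 0 < L →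
      L ^ 4 = (n1 + n2) / (1 + q ^ 3) * (1 + q) / q → M ≤ L ^ 2 →
      ∀ σ τ ξ : ℝ, |σ| ≤ 2 → |τ| ≤ T → |ξ| ≤ X →
      (∀ y, ‖axisWeight q n1 n2 L σ τ ξ y‖ ≤ C * exp (-|y|)) ∧
      ∀ h ∈ ({1, -q} : Set ℝ), ∀ c : ℝ, |c| = 1 → ∀ ρ > 0,
        ‖armWeight q n1 n2 L σ τ ξ h c ρ‖ ≤ C * exp (-ρ) := by
  obtain ⟨k, hk, C1, hC1, harm⟩ := norm_cuspWeight_arms_le hq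
  obtain ⟨C2, hC2, haxis⟩ := norm_cuspWeight_axis_inv_le hq
  set k1 := q / (4 * (1 + q)) with hk1
  have hk₁0 : 0 < k1 := by positivity
  set M := (T + 1) / k1 with hM
  have hM0 : 0 < M := by positivity
  set a := max 1 (q ^ 4) with ha
  have ha0 : 0 < a := lt_max_of_lt_left one_pos
  set k2 := k * (q * (1 + q ^ 3) / (1 + q)) / a with hk2
  have hk₂0 : 0 < k2 := by positivity
  set B := 4 * X + 4 * T + 1 with hB
  refine ⟨max (C2 * exp (1 + k1 * M ^ 2)) (C1 * 2 * exp (B + B ^ 2 / (4 * k2))), M, ?_⟩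
  intro n1 n2 L hn hL hL4 hLM σ τ ξ hσ hτ hξ
  have hLc : (L : ℂ) ≠ 0 := by exact_mod_cast hL.ne'
  refine ⟨fun y => ?_, fun h hh c hc ρ hρ => ?_⟩
  · rw [axisWeight, mul_inv, norm_mul, ← exp_neg, norm_exp,
      show (y * I / L : ℂ) = (y / L : ℝ) * I by push_cast; ring]
    have hre : (-(σ * (ξ * (y * I) - τ * (y * I) ^ 2 / 2) : ℂ)).re =
        -(σ * τ * y ^ 2 / 2) := by
      rw [show (-(σ * (ξ * (y * I) - τ * (y * I) ^ 2 / 2) : ℂ)) =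
        ((-(σ * τ * y ^ 2 / 2) : ℝ) : ℂ) + (-(σ * ξ * y) : ℝ) * I by
          rw [mul_pow, I_sq]; push_cast; ring, add_re,
        re_ofReal_mul, I_re, mul_zero, add_zero, ofReal_re]
    rw [hre]
    refine (mul_le_mul_of_nonneg_left (haxis n1 n2 hn _) (exp_nonneg _)).trans ?_
    refine le_trans (le_of_eq (mul_left_comm _ _ _)) ?_
    refine le_trans ?_ (mul_le_mul_of_nonneg_right (le_max_left _ _) (exp_nonneg _))
    rw [← Real.exp_add, mul_assoc C2, ← Real.exp_add]
    refine mul_le_mul_of_nonneg_left (Real.exp_le_exp.mpr ?_) hC2.le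
    have h1 : 1 / (1 + q ^ 3) * (n1 + n2) / 4 * ((y / L) ^ 4 / (1 + (y / L) ^ 2)) =
        k1 * (y ^ 4 / (1 + y ^ 2 / L ^ 2)) := by
      have : (n1 + n2 : ℝ) = L ^ 4 * q * (1 + q ^ 3) / (1 + q) := by rw [hL4]; field_simp
      rw [this, hk1, div_pow, div_pow]
      field_simp
    have h2 : M * y ^ 2 - M ^ 2 ≤ y ^ 4 / (1 + y ^ 2 / L ^ 2) := by
      have h3 : y ^ 4 / (1 + y ^ 2 / M) ≤ y ^ 4 / (1 + y ^ 2 / L ^ 2) := by gcongr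
      refine le_trans ?_ h3
      rw [le_div_iff₀ (by positivity)]
      have : (M * y ^ 2 - M ^ 2) * (1 + y ^ 2 / M) = y ^ 4 - M ^ 2 := by
        field_simp
        ring
      linarith [sq_nonneg M]
    have h3 := mul_le_mul_of_nonneg_left h2 hk₁0.le
    have h4 : -(σ * τ * y ^ 2 / 2) ≤ T * y ^ 2 := by
      have h5 : |σ * τ| ≤ 2 * T := by
        rw [abs_mul]; exact mul_le_mul hσ hτ (abs_nonneg _) zero_le_two
      nlinarith [neg_abs_le (σ * τ), sq_nonneg y]
    have h5 : k1 * M = T + 1 := by rw [hM]; field_simp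
    have h6 : |y| ≤ 1 + y ^ 2 := by nlinarith [sq_abs y, sq_nonneg (|y| - 1), abs_nonneg y]
    have h7 : k1 * (M * y ^ 2 - M ^ 2) = (T + 1) * y ^ 2 - k1 * M ^ 2 := by rw [← h5]; ring
    rw [h1]
    linarith
  · rw [armWeight]
    refine le_trans ?_ (mul_le_mul_of_nonneg_right (le_max_right _ _) (exp_nonneg _))
    split_ifs with hρ2
    · have hh0 : h ≠ 0 := by rcases hh with rfl | rfl <;> simp [hq.ne']
      have hk : 0 < L * |h| := mul_pos hL (abs_pos.mpr hh0)
      set r := ρ / (L * |h|) with hr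
      have hr0 : 0 < r := div_pos hρ hk
      have hr2 : r ≤ 2 := by rw [hr, div_le_iff₀ hk]; exact hρ2
      have hV : ‖armPoint L h c ρ‖ ≤ 2 * ρ := by
        rw [armPoint, norm_mul, norm_mul, norm_real, norm_real,
          norm_of_nonneg hL.le, norm_eq_abs, ← mul_assoc]
        refine (mul_le_mul_of_nonneg_left (norm_armPath_le hc hr0.le) hk.le).trans (le_of_eq ?_)
        rw [hr]; field_simp
      have e1 : armPoint L h c ρ / L = h * armPath c r := by
        rw [armPoint, mul_div_cancel_left₀ _ hLc]
      rw [norm_mul, norm_mul, e1, norm_mul]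
      have b1 : ‖cexp (σ * (ξ * armPoint L h c ρ - τ * armPoint L h c ρ ^ 2 / 2))‖ ≤
          exp (4 * X * ρ + 4 * T * ρ ^ 2) := by
        rw [norm_exp]
        refine Real.exp_le_exp.mpr ((re_le_norm _).trans ?_)
        rw [norm_mul, norm_real, norm_eq_abs]
        have : ‖(ξ * armPoint L h c ρ - τ * armPoint L h c ρ ^ 2 / 2 : ℂ)‖ ≤
            X * (2 * ρ) + T * (2 * ρ) ^ 2 / 2 := by
          refine (norm_sub_le _ _).trans ?_
          rw [norm_div, norm_mul, norm_mul, norm_pow, norm_real, norm_real,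
            norm_eq_abs, norm_eq_abs, norm_ofNat]
          gcongr
        refine (mul_le_mul hσ this (norm_nonneg _) zero_le_two).trans (le_of_eq (by ring))
      have b2 := harm n1 n2 hn h hh c hc r ⟨hr0.le, hr2⟩
      have b3 : ‖((h / |h| : ℝ) : ℂ)‖ * ‖armDeriv c r‖ ≤ 2 := by
        rw [norm_real, norm_eq_abs, abs_div, abs_abs, div_self (abs_pos.mpr hh0).ne',
          one_mul]
        exact norm_armDeriv_le hc
      refine (mul_le_mul (mul_le_mul b1 b2 (norm_nonneg _) (exp_nonneg _)) b3
        (by positivity) (by positivity)).trans ?_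
      rw [show exp (4 * X * ρ + 4 * T * ρ ^ 2) * (C1 * exp (-(k * (n1 + n2) * r ^ 4))) * 2 =
        C1 * 2 * exp (4 * X * ρ + 4 * T * ρ ^ 2 + -(k * (n1 + n2) * r ^ 4)) by
          rw [Real.exp_add (4 * X * ρ + 4 * T * ρ ^ 2)]; ring, mul_assoc (C1 * 2), ← Real.exp_add]
      refine mul_le_mul_of_nonneg_left (Real.exp_le_exp.mpr ?_) (by positivity)
      have h1 : k2 * ρ ^ 4 ≤ k * (n1 + n2) * r ^ 4 := by
        have : (n1 + n2 : ℝ) = L ^ 4 * (q * (1 + q ^ 3) / (1 + q)) := by rw [hL4]; field_simp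
        have h4 : |h| ^ 4 ≤ a := by
          rcases hh with rfl | rfl
          · simp [ha]
          · rw [abs_neg, abs_of_pos hq]; exact le_max_right _ _
        rw [this, hr, hk2, show k * (L ^ 4 * (q * (1 + q ^ 3) / (1 + q))) * (ρ / (L * |h|)) ^ 4 =
          k * (q * (1 + q ^ 3) / (1 + q)) / |h| ^ 4 * ρ ^ 4 by
            have := (abs_pos.mpr hh0).ne'
            generalize |h| = w at this
            field_simp]
        have := abs_pos.mpr hh0
        gcongr
      have h2 := mul_sq_sub_le B ρ hk₂0
      have h3 : ρ ≤ 1 + ρ ^ 2 := by nlinarith [sq_nonneg (ρ - 1)]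
      have h4 := mul_le_mul_of_nonneg_left h3 (by linarith : 0 ≤ 4 * X + 1)
      have h5 : B * ρ ^ 2 = (4 * X + 1) * ρ ^ 2 + 4 * T * ρ ^ 2 := by rw [hB]; ring
      linarith
    · rw [norm_zero]; positivity

/-- The contribution of one ray of the cross to the Pearcey kernel. -/
def rayIntegral (s t x y e c : ℝ) : ℂ :=
  ∫ ρ in Ioi (0 : ℝ), ∫ v : ℝ,
    cexp (-(y * (v * I) - t * (v * I) ^ 2 / 2) - (v * I) ^ 4 / 4) *
      (cexp (x * (e * (ρ * (1 + c * I))) - s * (e * (ρ * (1 + c * I))) ^ 2 / 2 +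
        (e * (ρ * (1 + c * I))) ^ 4 / 4) * (e * (1 + c * I)) /
        (e * (ρ * (1 + c * I)) - v * I))

theorem integral_ray_smul (g : ℂ → ℂ) (w : ℂ) :
    ∫ r in Ioi (0 : ℝ), g (r * w) * w =
      ∫ ρ in Ioi (0 : ℝ), g (ρ * (√2 * w)) * (√2 * w) := by
  have h2 : (0 : ℝ) < √2 := by positivity
  have := integral_comp_mul_left_Ioi (fun r : ℝ => g (r * w) * w) 0 h2
  rw [mul_zero, real_smul, ofReal_inv, eq_inv_mul_iff_mul_eq₀
    (by exact_mod_cast h2.ne')] at this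
  rw [← this, ← integral_const_mul]
  congr 1 with r
  push_cast
  rw [show (√2 * r * w : ℂ) = r * (√2 * w) by ring]
  ring

theorem crossIntegral_eq (g : ℂ → ℂ) : crossIntegral g =
    ((∫ ρ in Ioi (0 : ℝ), g ((1 : ℝ) * (ρ * (1 + (-1 : ℝ) * I))) *
        ((1 : ℝ) * (1 + (-1 : ℝ) * I))) -
      ∫ ρ in Ioi (0 : ℝ), g ((1 : ℝ) * (ρ * (1 + (1 : ℝ) * I))) *
        ((1 : ℝ) * (1 + (1 : ℝ) * I))) +
    ((∫ ρ in Ioi (0 : ℝ), g ((-1 : ℝ) * (ρ * (1 + (-1 : ℝ) * I))) *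
        ((-1 : ℝ) * (1 + (-1 : ℝ) * I))) -
      ∫ ρ in Ioi (0 : ℝ), g ((-1 : ℝ) * (ρ * (1 + (1 : ℝ) * I))) *
        ((-1 : ℝ) * (1 + (1 : ℝ) * I))) := by
  have h2 : (√2 : ℂ) * √2 = 2 := by
    rw [← ofReal_mul, Real.mul_self_sqrt zero_le_two]; norm_num
  have e1 : (√2 : ℂ) * cexp (I * π / 4) = 1 + I := by
    rw [show I * π / 4 = ((π / 4 : ℝ) : ℂ) * I by push_cast; ring,
      Complex.exp_mul_I, ← Complex.ofReal_cos, ← Complex.ofReal_sin, Real.cos_pi_div_four,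
      Real.sin_pi_div_four]
    push_cast
    linear_combination (1 + I) / 2 * h2
  have e2 : (√2 : ℂ) * cexp (-(I * π / 4)) = 1 - I := by
    rw [show -(I * π / 4) = ((-(π / 4) : ℝ) : ℂ) * I by push_cast; ring,
      Complex.exp_mul_I, ← Complex.ofReal_cos, ← Complex.ofReal_sin, Real.cos_neg, Real.sin_neg,
      Real.cos_pi_div_four, Real.sin_pi_div_four]
    push_cast
    linear_combination (1 - I) / 2 * h2
  have hneg : ∀ w : ℂ, ∫ r in Ioi (0 : ℝ), g (-(r * w)) * w =
      ∫ ρ in Ioi (0 : ℝ), g (-(ρ * (√2 * w))) * (√2 * w) := fun w => by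
    exact integral_ray_smul (fun z => g (-z)) w
  unfold crossIntegral
  simp only
  rw [integral_ray_smul g (cexp (I * π / 4)),
    integral_ray_smul g (cexp (-(I * π / 4))),
    hneg (cexp (I * π / 4)), hneg (cexp (-(I * π / 4))),
    e1, e2]
  push_cast
  simp only [one_mul, neg_mul, ← sub_eq_add_neg, mul_neg, integral_neg]
  ring

theorem pearceyKernel_eq (s t x y : ℝ) : pearceyKernel s t x y =
    I / (4 * π ^ 2) *
      ((rayIntegral s t x y 1 (-1) - rayIntegral s t x y 1 1) +
        (rayIntegral s t x y (-1) (-1) - rayIntegral s t x y (-1) 1)) -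
    if s < t then
      ((exp (-(x - y) ^ 2 / (2 * (t - s))) / √(2 * π * (t - s)) : ℝ) : ℂ) else 0 := by
  have h : ∀ e c : ℝ, (∫ ρ in Ioi (0 : ℝ), (fun V => imaginaryAxisIntegral (fun U =>
      cexp (-U ^ 4 / 4 + t * U ^ 2 / 2 - U * y) *
        cexp (V ^ 4 / 4 - s * V ^ 2 / 2 + V * x) * (1 / (U - V))))
        (e * (ρ * (1 + c * I))) * (e * (1 + c * I))) =
      -I * rayIntegral s t x y e c := fun e c => by
    rw [rayIntegral, ← integral_const_mul]
    refine integral_congr_ae (Eventually.of_forall fun ρ => ?_)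
    simp only [imaginaryAxisIntegral]
    rw [← integral_const_mul, ← integral_mul_const]
    refine integral_congr_ae (Eventually.of_forall fun v => ?_)
    simp only
    set V : ℂ := e * (ρ * (1 + c * I))
    rw [show I * (v : ℂ) - V = -(V - v * I) by ring,
      show (v * I : ℂ) = I * v by ring,
      show (-(I * v) ^ 4 / 4 + t * (I * v) ^ 2 / 2 - I * v * y : ℂ) =
        -(y * (I * v) - t * (I * v) ^ 2 / 2) - (I * v) ^ 4 / 4 by ring,
      show V ^ 4 / 4 - s * V ^ 2 / 2 + V * x = x * V - s * V ^ 2 / 2 + V ^ 4 / 4 by ring]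
    rw [one_div, inv_neg, div_eq_mul_inv _ (V - I * v)]
    ring
  unfold pearceyKernel
  rw [crossIntegral_eq, h, h, h, h]
  ring

/-- The double integral of the scaled kernel over the imaginary axis and one of the arms. -/
def armIntegral (q : ℝ) (n1 n2 : ℕ) (L σ τ ξ σ' τ' η h c : ℝ) : ℂ :=
  ∫ y : ℝ, axisWeight q n1 n2 L σ' τ' η y *
    ∫ ρ in Ioi (0 : ℝ), armWeight q n1 n2 L σ τ ξ h c ρ / (armPoint L h c ρ - y * I)

theorem tendsto_armIntegral (hq : 0 < q) {n1 n2 : ℕ → ℕ} {L σ σ' : ℕ → ℝ}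
    (hn : ∀ N, |(n1 N : ℝ) - 1 / (1 + q ^ 3) * (n1 N + n2 N)| ≤ 1) (hL : ∀ N, 0 < L N)
    (hLt : Tendsto L atTop atTop)
    (hL4 : ∀ N, L N ^ 4 = (n1 N + n2 N) / (1 + q ^ 3) * (1 + q) / q)
    (hσ : Tendsto σ atTop (𝓝 1)) (hσ' : Tendsto σ' atTop (𝓝 1)) (τ τ' ξ η : ℝ) {h : ℝ}
    (hh : h ∈ ({1, -q} : Set ℝ)) {c : ℝ} (hc : |c| = 1) :
    Tendsto (fun N => armIntegral q (n1 N) (n2 N) (L N) (σ N) τ ξ (σ' N) τ' η h c) atTop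
      (𝓝 (rayIntegral τ τ' ξ η (h / |h|) c)) := by
  have hh0 : h ≠ 0 := by rcases hh with rfl | rfl <;> simp [hq.ne']
  obtain ⟨C, M, hCM⟩ := exists_norm_weights_le hq (max |τ| |τ'|) (max |ξ| |η|)
    (le_max_of_le_left (abs_nonneg _)) (le_max_of_le_left (abs_nonneg _))
  have hL2 : Tendsto (fun N => L N ^ 2) atTop atTop := (tendsto_pow_atTop two_ne_zero).comp hLt
  have hev : ∀ᶠ N in atTop, M ≤ L N ^ 2 ∧ |σ N| ≤ 2 ∧ |σ' N| ≤ 2 := by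
    have h1 := hσ.abs.eventually_le_const (u := 2) (by norm_num)
    have h2 := hσ'.abs.eventually_le_const (u := 2) (by norm_num)
    filter_upwards [hL2.eventually_ge_atTop M, h1, h2] with N a b c
    exact ⟨a, b, c⟩
  obtain ⟨N0, hN0⟩ := eventually_atTop.mp hev
  rw [← tendsto_add_atTop_iff_nat N0]
  have hsh : Tendsto (fun N => N + N0) atTop atTop := tendsto_add_atTop_nat N0
  have hb := fun N => hCM (n1 (N + N0)) (n2 (N + N0)) (L (N + N0)) (hn _) (hL _) (hL4 _)
    (hN0 (N + N0) (Nat.le_add_left _ _)).1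
  have hcw := fun V => (tendsto_cuspWeight hq hn hL hLt hL4 V).comp hsh
  have hσc : ∀ {σ : ℕ → ℝ}, Tendsto σ atTop (𝓝 1) →
      Tendsto (fun N => ((σ (N + N0) : ℝ) : ℂ)) atTop (𝓝 1) := fun hσ => by
    have := (Complex.continuous_ofReal.tendsto 1).comp (hσ.comp hsh)
    rwa [ofReal_one] at this
  have hp : ∀ ρ > 0, ∀ᶠ N in atTop, ρ / (L (N + N0) * |h|) < 1 ∧
      armPoint (L (N + N0)) h c ρ = (h / |h| : ℝ) * (ρ * (1 + c * I)) := fun ρ hρ => by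
    filter_upwards [(hLt.comp hsh).eventually_gt_atTop (ρ / |h|)] with N hN
    have hk := mul_pos (hL (N + N0)) (abs_pos.mpr hh0)
    have h1 : ρ / (L (N + N0) * |h|) < 1 := by
      rw [div_lt_one hk, ← div_lt_iff₀ (abs_pos.mpr hh0)]
      exact hN
    refine ⟨h1, ?_⟩
    have := (hL (N + N0)).ne'
    have h2 : (L (N + N0) : ℂ) ≠ 0 := by exact_mod_cast this
    have h3 : ((|h| : ℝ) : ℂ) ≠ 0 := by exact_mod_cast (abs_pos.mpr hh0).ne'
    rw [armPoint, armPath, min_eq_left (by linarith)]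
    push_cast
    field_simp
  refine tendsto_integral_div_sub (C := C) (fun N => measurable_axisWeight _ _ _ _ _ _ _)
    (fun N => measurable_armWeight _ _ _ _ _ _ _ _ _) (fun N => measurable_armPoint _ _ _)
    (fun N y => (hb N _ _ _ (hN0 (N + N0) (Nat.le_add_left _ _)).2.2 (le_max_right _ _)
      (le_max_right _ _)).1 y)
    (fun N ρ hρ => (hb N _ _ _ (hN0 (N + N0) (Nat.le_add_left _ _)).2.1 (le_max_left _ _)
      (le_max_left _ _)).2 h hh c hc ρ hρ)
    (fun N ρ hρ y => le_norm_armPoint_sub (hL _) hh0 hc hρ y) (fun y => ?_) (fun ρ hρ => ?_)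
    (fun ρ hρ => ?_) (by fun_prop) (by fun_prop) (by fun_prop)
  · have h1 : Tendsto (fun N => axisWeight q (n1 (N + N0)) (n2 (N + N0)) (L (N + N0)) (σ' (N + N0))
        τ' η y) atTop (𝓝 (cexp (1 * (η * (y * I) - τ' * (y * I) ^ 2 / 2)) *
          cexp ((y * I) ^ 4 / 4))⁻¹) := by
      refine Tendsto.inv₀ (Tendsto.mul ?_ (hcw _))
        (mul_ne_zero (Complex.exp_ne_zero _) (Complex.exp_ne_zero _))
      exact (Complex.continuous_exp.tendsto _).comp ((hσc hσ').mul_const _)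
    convert h1 using 2
    rw [← exp_add, ← exp_neg]
    congr 1
    ring
  · set V : ℂ := (h / |h| : ℝ) * (ρ * (1 + c * I)) with hV
    have h1 : Tendsto (fun N => cexp (σ (N + N0) * (ξ * V - τ * V ^ 2 / 2)) *
        cuspWeight q (n1 (N + N0)) (n2 (N + N0)) (V / L (N + N0)) *
          ((h / |h| : ℝ) * (1 + c * I))) atTop
        (𝓝 (cexp (1 * (ξ * V - τ * V ^ 2 / 2)) * cexp (V ^ 4 / 4) *
          ((h / |h| : ℝ) * (1 + c * I)))) :=
      (((Complex.continuous_exp.tendsto _).comp ((hσc hσ).mul_const _)).mul (hcw V)).mul_const _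
    rw [one_mul, ← exp_add] at h1
    refine h1.congr' ?_
    filter_upwards [hp ρ hρ] with N hN
    have hk := mul_pos (hL (N + N0)) (abs_pos.mpr hh0)
    have h5 : ρ ≤ 2 * (L (N + N0) * |h|) := by
      have := (div_lt_one hk).mp hN.1
      linarith
    rw [armWeight, if_pos h5, hN.2, armDeriv, if_pos hN.1]
  · exact tendsto_const_nhds.congr' ((hp ρ hρ).mono fun N h => h.2.symm)

/-- The double integral of the scaled kernel. -/
def scaledIntegral (q : ℝ) (n1 n2 : ℕ) (L σ τ ξ σ' τ' η : ℝ) : ℂ :=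
  (armIntegral q n1 n2 L σ τ ξ σ' τ' η 1 (-1) - armIntegral q n1 n2 L σ τ ξ σ' τ' η 1 1) +
    (armIntegral q n1 n2 L σ τ ξ σ' τ' η (-q) (-1) - armIntegral q n1 n2 L σ τ ξ σ' τ' η (-q) 1)

theorem tendsto_scaledIntegral (hq : 0 < q) {n1 n2 : ℕ → ℕ} {L σ σ' : ℕ → ℝ}
    (hn : ∀ N, |(n1 N : ℝ) - 1 / (1 + q ^ 3) * (n1 N + n2 N)| ≤ 1) (hL : ∀ N, 0 < L N)
    (hLt : Tendsto L atTop atTop)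
    (hL4 : ∀ N, L N ^ 4 = (n1 N + n2 N) / (1 + q ^ 3) * (1 + q) / q)
    (hσ : Tendsto σ atTop (𝓝 1)) (hσ' : Tendsto σ' atTop (𝓝 1)) (τ τ' ξ η : ℝ) :
    Tendsto (fun N => I / (4 * π ^ 2) *
        scaledIntegral q (n1 N) (n2 N) (L N) (σ N) τ ξ (σ' N) τ' η) atTop
      (𝓝 (pearceyKernel τ τ' ξ η + if τ < τ' then
      ((exp (-(ξ - η) ^ 2 / (2 * (τ' - τ))) / √(2 * π * (τ' - τ)) : ℝ) : ℂ) else 0)) := by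
  rw [pearceyKernel_eq, sub_add_cancel]
  have h1 : (1 : ℝ) / |1| = 1 := by simp
  have h2 : -q / |-q| = -1 := by rw [abs_neg, abs_of_pos hq, neg_div, div_self hq.ne']
  have h := fun {h : ℝ} (hh : h ∈ ({1, -q} : Set ℝ)) {c : ℝ} (hc : |c| = 1) =>
    tendsto_armIntegral hq hn hL hLt hL4 hσ hσ' τ τ' ξ η hh hc
  have a1 := h (h := 1) (by simp) (c := -1) (by simp)
  have a2 := h (h := 1) (by simp) (c := 1) (by simp)
  have a3 := h (h := -q) (by simp) (c := -1) (by simp)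
  have a4 := h (h := -q) (by simp) (c := 1) (by simp)
  rw [h1] at a1 a2
  rw [h2] at a3 a4
  exact (((a1.sub a2).add (a3.sub a4)).const_mul _)

/-- The double integral of the scaled kernel, as an iterated integral. -/
def doubleIntegral (q : ℝ) (n1 n2 : ℕ) (L σ τ ξ σ' τ' η : ℝ) : ℂ :=
  ∫ y : ℝ, axisWeight q n1 n2 L σ' τ' η y *
        (((∫ ρ in Ioi (0 : ℝ), armWeight q n1 n2 L σ τ ξ 1 (-1) ρ /
            (armPoint L 1 (-1) ρ - y * I)) -
          ∫ ρ in Ioi (0 : ℝ), armWeight q n1 n2 L σ τ ξ 1 1 ρ /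
            (armPoint L 1 1 ρ - y * I)) +
        ((∫ ρ in Ioi (0 : ℝ), armWeight q n1 n2 L σ τ ξ (-q) (-1) ρ /
            (armPoint L (-q) (-1) ρ - y * I)) -
          ∫ ρ in Ioi (0 : ℝ), armWeight q n1 n2 L σ τ ξ (-q) 1 ρ /
            (armPoint L (-q) 1 ρ - y * I)))

theorem exists_norm_scaledIntegral_le (hq : 0 < q) (T X : ℝ) (hT : 0 ≤ T) (hX : 0 ≤ X) :
    ∃ B M : ℝ, ∀ (n1 n2 : ℕ) (L : ℝ), |(n1 : ℝ) - 1 / (1 + q ^ 3) * (n1 + n2)| ≤ 1 → 0 < L →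
      L ^ 4 = (n1 + n2) / (1 + q ^ 3) * (1 + q) / q → M ≤ L ^ 2 →
      ∀ σ τ ξ σ' τ' η : ℝ, |σ| ≤ 2 → |τ| ≤ T → |ξ| ≤ X → |σ'| ≤ 2 → |τ'| ≤ T → |η| ≤ X →
      ‖scaledIntegral q n1 n2 L σ τ ξ σ' τ' η‖ ≤ B ∧
      doubleIntegral q n1 n2 L σ τ ξ σ' τ' η =
        scaledIntegral q n1 n2 L σ τ ξ σ' τ' η := by
  obtain ⟨C, M, hCM⟩ := exists_norm_weights_le hq T X hT hX
  obtain ⟨K, hK, hb⟩ := exists_norm_integral_div_sub_le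
  refine ⟨4 * (K * C ^ 2), M, ?_⟩
  intro n1 n2 L hn hL hL4 hM σ τ ξ σ' τ' η hσ hτ hξ hσ' hτ' hη
  have h1 := (hCM n1 n2 L hn hL hL4 hM σ' τ' η hσ' hτ' hη).1
  have h2 := (hCM n1 n2 L hn hL hL4 hM σ τ ξ hσ hτ hξ).2
  have h3 : ∀ h ∈ ({1, -q} : Set ℝ), ∀ c : ℝ, |c| = 1 →
      ‖armIntegral q n1 n2 L σ τ ξ σ' τ' η h c‖ ≤ K * C ^ 2 ∧
      Integrable fun y : ℝ => axisWeight q n1 n2 L σ' τ' η y *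
        ∫ ρ in Ioi (0 : ℝ), armWeight q n1 n2 L σ τ ξ h c ρ / (armPoint L h c ρ - y * I) := by
    intro h hh c hc
    have hh0 : h ≠ 0 := by rcases hh with rfl | rfl <;> simp [hq.ne']
    have a1 := measurable_axisWeight q n1 n2 L σ' τ' η
    have a2 := measurable_armWeight q n1 n2 L σ τ ξ h c
    have a3 := measurable_armPoint L h c
    have a4 : ∀ ρ > 0, ∀ y : ℝ, ρ * |y| / 4 ≤ ‖armPoint L h c ρ - y * I‖ ^ 2 :=
      fun ρ hρ y => le_norm_armPoint_sub hL hh0 hc hρ y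
    refine ⟨hb a1 a2 a3 h1 (h2 h hh c hc) a4, ?_⟩
    have := (integrable_div_sub a1 a2 a3 h1 (h2 h hh c hc) a4).integral_prod_left
    simpa only [integral_const_mul] using this
  have b1 := h3 1 (by simp) (-1) (by simp)
  have b2 := h3 1 (by simp) 1 (by simp)
  have b3 := h3 (-q) (by simp) (-1) (by simp)
  have b4 := h3 (-q) (by simp) 1 (by simp)
  refine ⟨?_, ?_⟩
  · refine (norm_add_le _ _).trans ((add_le_add (norm_sub_le _ _) (norm_sub_le _ _)).trans ?_)
    linarith [b1.1, b2.1, b3.1, b4.1]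
  · rw [doubleIntegral]
    simp only [mul_add, mul_sub]
    exact (integral_add (b1.2.sub b2.2) (b3.2.sub b4.2)).trans
      (congrArg₂ _ (integral_sub b1.2 b2.2) (integral_sub b3.2 b4.2))

/-- The relations between the parameters of the scaling at the cusp: `w` is `√n`, the particles end
at `(ω + α) w` and `(ω - q α) w`, the cusp is at `(x0 w, t0)`, its direction is `γ`, the unit of
length is `ε`, and `L` is the scale of the saddle point. -/
structure IsCuspScaling (q ω α t0 x0 γ ε w L : ℝ) : Prop where
  q_pos : 0 < q
  α_pos : 0 < α
  w_pos : 0 < w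
  ε_pos : 0 < ε
  t₀_pos : 0 < t0
  t₀_lt : t0 < 1
  start : x0 - t0 * ω = t0 * α * (q - 1)
  slope : 2 * ε ^ 2 * w * (ω - x0) = γ * (1 - t0)
  curvature : t0 * α ^ 2 = (1 - t0) * (1 / (1 + q ^ 3) * (1 + q) / 2)
  scale : L * (1 - t0) = 2 * ε * α * w

namespace IsCuspScaling

variable {q ω α t0 x0 γ ε w L : ℝ}

theorem L_pos (hS : IsCuspScaling q ω α t0 x0 γ ε w L) : 0 < L := by
  have h1 := hS.α_pos
  have h2 := hS.ε_pos
  have h3 := hS.w_pos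
  have : 0 < L * (1 - t0) := by rw [hS.scale]; positivity
  exact pos_of_mul_pos_left this (sub_pos.mpr hS.t₀_lt).le

theorem saddleWeight_eq (hS : IsCuspScaling q ω α t0 x0 γ ε w L) {n1 n2 : ℕ}
    (hn : (n1 + n2 : ℝ) = w ^ 2) {τ ξ t x : ℝ} (ht : t = t0 + ε ^ 2 * (2 * τ)) (ht1 : t < 1)
    (hx : x = x0 * w + γ * τ + ε * ξ) (ζ : ℂ) :
    saddleWeight (2 * (x - t * (ω * w)) * (α * w) / (1 - t)) (t * (α * w) ^ 2 / (1 - t)) q n1 n2 ζ =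
      cexp (((1 - t0) / (1 - t) : ℝ) * (ξ * (L * ζ) - τ * (L * ζ) ^ 2 / 2)) *
        cuspWeight q n1 n2 ζ := by
  have h1 : 1 - t ≠ 0 := (sub_pos.mpr ht1).ne'
  have h0 : 1 - t0 ≠ 0 := (sub_pos.mpr hS.t₀_lt).ne'
  have hq := hS.q_pos
  have h3 : 1 + q ^ 3 ≠ 0 := by positivity
  have hst := hS.start
  have hsl := hS.slope
  have hsc := hS.scale
  have hcu : t0 * α ^ 2 / (1 - t0) = 1 / (1 + q ^ 3) * (1 + q) / 2 := by
    rw [hS.curvature, mul_div_cancel_left₀ _ h0]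
  have hL : L = 2 * ε * α * w / (1 - t0) := by rw [← hsc, mul_div_cancel_right₀ _ h0]
  have k1 : x - t * (ω * w) = t0 * α * (q - 1) * w * (1 - t) / (1 - t0) + ε * ξ := by
    rw [hx, ht]
    field_simp
    linear_combination (-τ) * hsl + w * ((1 - t0) - 2 * ε ^ 2 * τ) * hst
  have e1 : 2 * (x - t * (ω * w)) * (α * w) / (1 - t) =
      w ^ 2 / (1 + q ^ 3) * (q ^ 2 - 1) + (1 - t0) / (1 - t) * (L * ξ) := by
    have : w ^ 2 / (1 + q ^ 3) * (q ^ 2 - 1) =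
        2 * (t0 * α ^ 2 / (1 - t0)) * (q - 1) * w ^ 2 := by rw [hcu]; field_simp; ring
    rw [k1, this, hL]
    field_simp
  have e2 : t * (α * w) ^ 2 / (1 - t) =
      w ^ 2 / (1 + q ^ 3) * (1 + q) / 2 + (1 - t0) / (1 - t) * (τ * L ^ 2 / 2) := by
    have : w ^ 2 / (1 + q ^ 3) * (1 + q) / 2 = t0 * α ^ 2 / (1 - t0) * w ^ 2 := by
      rw [hcu]; field_simp
    rw [this, hL]
    field_simp
    rw [ht]
    ring
  rw [e1, e2, cuspWeight, hn]
  simp only [saddleWeight]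
  rw [← mul_div_assoc (cexp _) (cexp _), ← exp_add]
  congr 2
  push_cast
  ring

theorem sum_eq (hS : IsCuspScaling q ω α t0 x0 γ ε w L) (hn : n1 ≤ n)
    (hw : (n : ℝ) = w ^ 2) {τ ξ t x τ' η s y : ℝ} (ht : t = t0 + ε ^ 2 * (2 * τ)) (ht1 : t < 1)
    (hx : x = x0 * w + γ * τ + ε * ξ) (hs : s = t0 + ε ^ 2 * (2 * τ')) (hs0 : 0 < s) (hs1 : s < 1)
    (hy : y = x0 * w + γ * τ' + ε * η)
    (hδ : δ = fun i => (endPoints n n1 (ω * w - q * (α * w)) (ω * w + α * w) i : ℂ))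
    (hI : doubleIntegral q n1 (n - n1) L ((1 - t0) / (1 - t)) τ ξ ((1 - t0) / (1 - s)) τ' η =
        scaledIntegral q n1 (n - n1) L ((1 - t0) / (1 - t)) τ ξ ((1 - t0) / (1 - s)) τ' η) :
    ε * ∑ k : Fin n, nodeWeight (squarePath (ω * w) (α * w) q) (squareWeight (α * w) q)
        δ k (1 - t) x * lineWeight (ω * w) δ k s y =
      (exp (((ω * w) ^ 2 - (ω * w - x) ^ 2 / (1 - t)) -
        ((ω * w) ^ 2 - (ω * w - y) ^ 2 / (1 - s))) : ℝ) *
      (((1 - t0) / √((1 - s) * (1 - t)) : ℝ) * (I / (4 * π ^ 2) *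
        scaledIntegral q n1 (n - n1) L ((1 - t0) / (1 - t)) τ ξ ((1 - t0) / (1 - s)) τ' η)) := by
  have hα := hS.α_pos
  have hw0 := hS.w_pos
  have hL := hS.L_pos
  have hq := hS.q_pos
  have hLc : (L : ℂ) ≠ 0 := by exact_mod_cast hL.ne'
  have hn' : (n1 + (n - n1 : ℕ) : ℝ) = w ^ 2 := by
    rw [← hw, ← Nat.cast_add, Nat.add_sub_cancel' hn]
  simp only [mul_comm (nodeWeight _ _ _ _ _ _)]
  rw [sum_lineWeight_mul_nodeWeight_eq_arms hn (mul_pos hα hw0) hq hs0 hs1 ht1 x y hδ]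
  have e1 := hS.saddleWeight_eq hn' ht ht1 hx
  have e2 := hS.saddleWeight_eq hn' hs hs1 hy
  have hsub := Measure.integral_comp_div (fun u : ℝ =>
    (saddleWeight (2 * (y - s * (ω * w)) * (α * w) / (1 - s)) (s * (α * w) ^ 2 / (1 - s)) q n1
      (n - n1) (u * I))⁻¹ *
        (armsIntegral 1 (fun ζ => saddleWeight (2 * (x - t * (ω * w)) * (α * w) / (1 - t))
            (t * (α * w) ^ 2 / (1 - t)) q n1 (n - n1) ζ / (ζ - u * I)) +
          armsIntegral (-q) (fun ζ => saddleWeight (2 * (x - t * (ω * w)) * (α * w) / (1 - t))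
            (t * (α * w) ^ 2 / (1 - t)) q n1 (n - n1) ζ / (ζ - u * I)))) L
  rw [abs_of_pos hL, real_smul] at hsub
  have hint : ∀ v : ℝ, (saddleWeight (2 * (y - s * (ω * w)) * (α * w) / (1 - s))
      (s * (α * w) ^ 2 / (1 - s)) q n1 (n - n1) ((v / L : ℝ) * I))⁻¹ =
      axisWeight q n1 (n - n1) L ((1 - t0) / (1 - s)) τ' η v := fun v => by
    rw [e2, axisWeight, show (L : ℂ) * ((v / L : ℝ) * I) = v * I by
      push_cast; field_simp, show ((v / L : ℝ) * I : ℂ) = v * I / L by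
        push_cast; ring]
  have harm : ∀ (h : ℝ), h ≠ 0 → ∀ v : ℝ, armsIntegral h (fun ζ =>
      saddleWeight (2 * (x - t * (ω * w)) * (α * w) / (1 - t))
            (t * (α * w) ^ 2 / (1 - t)) q n1 (n - n1) ζ / (ζ - (v / L : ℝ) * I)) =
      (∫ ρ in Ioi (0 : ℝ), armWeight q n1 (n - n1) L ((1 - t0) / (1 - t)) τ ξ h (-1) ρ /
            (armPoint L h (-1) ρ - v * I)) -
          ∫ ρ in Ioi (0 : ℝ), armWeight q n1 (n - n1) L ((1 - t0) / (1 - t)) τ ξ h 1 ρ /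
            (armPoint L h 1 ρ - v * I) := fun h hh v => by
    rw [armsIntegral, integral_arm_div_eq hL hh _ _ _ _ _ _ e1,
      integral_arm_div_eq hL hh _ _ _ _ _ _ e1]
  simp only [hint, harm 1 one_ne_zero, harm (-q) (neg_ne_zero.mpr hq.ne')] at hsub
  rw [← doubleIntegral, hI] at hsub
  generalize (∫ u : ℝ, (saddleWeight (2 * (y - s * (ω * w)) * (α * w) / (1 - s))
    (s * (α * w) ^ 2 / (1 - s)) q n1 (n - n1) (u * I))⁻¹ *
        (armsIntegral 1 (fun ζ => saddleWeight (2 * (x - t * (ω * w)) * (α * w) / (1 - t))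
            (t * (α * w) ^ 2 / (1 - t)) q n1 (n - n1) ζ / (ζ - u * I)) +
          armsIntegral (-q) (fun ζ => saddleWeight (2 * (x - t * (ω * w)) * (α * w) / (1 - t))
            (t * (α * w) ^ 2 / (1 - t)) q n1 (n - n1) ζ / (ζ - u * I)))) = J at hsub ⊢
  rw [hsub]
  have hsc : (L : ℂ) * (1 - t0) = 2 * ε * α * w := by exact_mod_cast hS.scale
  have hsq : ((√((1 - s) * (1 - t)) : ℝ) : ℂ) ≠ 0 := by
    exact_mod_cast (Real.sqrt_pos.mpr (mul_pos (sub_pos.mpr hs1) (sub_pos.mpr ht1))).ne'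
  have hI2 : I ^ 2 = -1 := I_sq
  push_cast
  generalize cexp _ = X
  field_simp
  rw [hI2]
  linear_combination (2 * X * J) * hsc

end IsCuspScaling

variable {E : Fin m → Set ℝ}

theorem HasFredholmDet.congr {K K' : Fin m → Fin m → ℝ → ℝ → ℂ} {D : ℂ}
    (hEm : ∀ i, MeasurableSet (E i)) (h : HasFredholmDet K E D)
    (hK : ∀ i j, ∀ x ∈ E i, ∀ y ∈ E j, K i j x y = K' i j x y) : HasFredholmDet K' E D := by
  have hms : ∀ {k : ℕ} (κ : Fin k → Fin m), MeasurableSet (Set.pi univ fun i => E (κ i)) := fun κ =>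
    MeasurableSet.univ_pi fun i => hEm (κ i)
  have e : ∀ {k : ℕ} (κ : Fin k → Fin m), ∀ x ∈ Set.pi univ fun i => E (κ i),
      det (of fun i j => K (κ i) (κ j) (x i) (x j)) =
        det (of fun i j => K' (κ i) (κ j) (x i) (x j)) := fun κ x hx => by
    congr 2
    ext i j
    exact hK _ _ _ (hx i (mem_univ i)) _ (hx j (mem_univ j))
  refine ⟨fun k κ => (h.1 k κ).congr_fun (e κ) (hms κ), ?_⟩
  convert h.2 using 4 with k κ
  exact (setIntegral_congr_fun (hms _) (e _)).symm

theorem HasFredholmDet.comp_affine {K : Fin m → Fin m → ℝ → ℝ → ℂ} {D : ℂ} {β : Fin m → ℝ} {ε : ℝ}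
    (hε : 0 < ε) (hEm : ∀ i, MeasurableSet (E i))
    (h : HasFredholmDet K (fun i => (fun x => (x - β i) / ε) ⁻¹' E i) D) :
    HasFredholmDet (fun i j x y => ε * K i j (β i + ε * x) (β j + ε * y)) E D := by
  have hE' : ∀ i, MeasurableSet ((fun x => (x - β i) / ε) ⁻¹' E i) := fun i =>
    (by fun_prop : Measurable fun x => (x - β i) / ε) (hEm i)
  have hms : ∀ {k : ℕ} (κ : Fin k → Fin m), MeasurableSet (Set.pi univ fun i => E (κ i)) := fun κ =>
    MeasurableSet.univ_pi fun i => hEm (κ i)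
  have hms' : ∀ {k : ℕ} (κ : Fin k → Fin m),
      MeasurableSet (Set.pi univ fun i => (fun x => (x - β (κ i)) / ε) ⁻¹' E (κ i)) := fun κ =>
    MeasurableSet.univ_pi fun i => hE' (κ i)
  have hind : ∀ {k : ℕ} (κ : Fin k → Fin m) (x : Fin k → ℝ),
      (ε : ℂ) ^ k * (Set.pi univ fun i => (fun x => (x - β (κ i)) / ε) ⁻¹' E (κ i)).indicator
        (fun x : Fin k → ℝ => det (of fun i j => K (κ i) (κ j) (x i) (x j)))
        ((fun i => β (κ i)) + ε • x) =
      (Set.pi univ fun i => E (κ i)).indicator (fun x : Fin k → ℝ => det (of fun i j =>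
        ε * K (κ i) (κ j) (β (κ i) + ε * x i) (β (κ j) + ε * x j))) x := by
    intro k κ x
    have hiff : ((fun i => β (κ i)) + ε • x) ∈ (Set.pi univ fun i =>
        (fun x => (x - β (κ i)) / ε) ⁻¹' E (κ i)) ↔ x ∈ Set.pi univ fun i => E (κ i) := by
      simp only [mem_univ_pi, mem_preimage, Pi.add_apply, Pi.smul_apply, smul_eq_mul,
        add_sub_cancel_left, mul_div_cancel_left₀ _ hε.ne']
    by_cases hx : x ∈ Set.pi univ fun i => E (κ i)
    · rw [indicator_of_mem (hiff.mpr hx), indicator_of_mem hx]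
      have : (of fun i j => (ε : ℂ) * K (κ i) (κ j) (β (κ i) + ε * x i) (β (κ j) + ε * x j)) =
          (ε : ℂ) • of fun i j => K (κ i) (κ j) (β (κ i) + ε * x i) (β (κ j) + ε * x j) := by
        ext i j; simp
      rw [this, Matrix.det_smul, card_fin]
      rfl
    · rw [indicator_of_notMem (fun h' => hx (hiff.mp h')), indicator_of_notMem hx, mul_zero]
  refine ⟨fun k κ => ?_, ?_⟩
  · have h1 := (integrable_indicator_iff (hms' κ)).mpr (h.1 k κ)
    have h2 := ((h1.comp_add_left (fun i => β (κ i))).comp_smul hε.ne').const_mul ((ε : ℂ) ^ k)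
    rw [← integrable_indicator_iff (hms κ)]
    exact h2.congr (Eventually.of_forall fun x => hind κ x)
  · convert h.2 using 4 with k
    rename_i κ _
    rw [← integral_indicator (hms κ), ← integral_indicator (hms' κ),
      integral_congr_ae (Eventually.of_forall fun x => (hind κ x).symm), integral_const_mul]
    have h1 := Measure.integral_comp_smul (volume : Measure (Fin k → ℝ)) (fun x =>
      (Set.pi univ fun i => (fun x => (x - β (κ i)) / ε) ⁻¹' E (κ i)).indicator
        (fun x : Fin k → ℝ => det (of fun i j => K (κ i) (κ j) (x i) (x j)))
        ((fun i => β (κ i)) + x)) ε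
    rw [h1, integral_add_left_eq_self, Module.finrank_fin_fun, abs_of_pos (by positivity),
      real_smul, ← mul_assoc, ← ofReal_pow, ← ofReal_mul,
      mul_inv_cancel₀ (by positivity), ofReal_one, one_mul]

theorem continuous_lineWeight (c : ℝ) (h0 : 0 < t) (h1 : t < 1) (δ : Fin n → ℂ)
    (k : Fin n) : Continuous (lineWeight c δ k t) := by
  obtain ⟨Γ, w, V, hΓ, hz⟩ := exists_isCauchyContour_zero
  have : lineWeight c δ k t = fun y => ∑ i, startMatrix δ k i * nodeWeight Γ w (fun _ => 0) i t y := by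
    ext y
    exact (sum_startMatrix_mul_nodeWeight hΓ hz c y h0 h1 δ k).symm
  rw [this]
  exact continuous_finsetSum _ fun i _ =>
    continuous_const.mul (continuous_nodeWeight hΓ (fun _ => hz) i t)

/-- The transition probability between two times in the scaled kernel. -/
def cuspTransition (t0 ε τ τ' ξ η : ℝ) : ℝ :=
  exp (-((1 - (t0 + ε ^ 2 * (2 * τ))) / (2 * (τ' - τ) * (1 - (t0 + ε ^ 2 * (2 * τ')))) *
    ((η - ξ) + 2 * ε ^ 2 * (τ' - τ) * ξ / (1 - (t0 + ε ^ 2 * (2 * τ)))) ^ 2)) /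
    √(2 * π * (τ' - τ))

/-- The kernel of the non-intersecting Brownian motions in the scale of the cusp. -/
def cuspKernel (q t0 ε L : ℝ) (n1 n2 : ℕ) (τ τ' ξ η : ℝ) : ℂ :=
  ((1 - t0) / √((1 - (t0 + ε ^ 2 * (2 * τ'))) * (1 - (t0 + ε ^ 2 * (2 * τ)))) : ℝ) *
    (I / (4 * π ^ 2) * scaledIntegral q n1 n2 L ((1 - t0) / (1 - (t0 + ε ^ 2 * (2 * τ))))
      τ ξ ((1 - t0) / (1 - (t0 + ε ^ 2 * (2 * τ')))) τ' η) -
  if τ < τ' then (cuspTransition t0 ε τ τ' ξ η : ℂ) else 0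

theorem IsCuspScaling.brownianDensity_eq {q ω α t0 x0 γ ε w L : ℝ}
    (hS : IsCuspScaling q ω α t0 x0 γ ε w L) {τ ξ t x τ' η s y : ℝ}
    (ht : t = t0 + ε ^ 2 * (2 * τ)) (ht1 : t < 1) (hx : x = x0 * w + γ * τ + ε * ξ)
    (hs : s = t0 + ε ^ 2 * (2 * τ')) (hs1 : s < 1) (hy : y = x0 * w + γ * τ' + ε * η) (hτ : τ < τ') :
    exp (-((ω * w) ^ 2 - (ω * w - x) ^ 2 / (1 - t))) * (ε * brownianDensity (s - t) x y) *
      exp ((ω * w) ^ 2 - (ω * w - y) ^ 2 / (1 - s)) = cuspTransition t0 ε τ τ' ξ η := by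
  have hε := hS.ε_pos
  have h1 : 1 - t ≠ 0 := (sub_pos.mpr ht1).ne'
  have h2 : 1 - s ≠ 0 := (sub_pos.mpr hs1).ne'
  have h3 : 0 < τ' - τ := sub_pos.mpr hτ
  have hst : s - t = ε ^ 2 * (2 * (τ' - τ)) := by rw [hs, ht]; ring
  have hsl := hS.slope
  have k1 : y = ω * w + (x - ω * w) * (1 - s) / (1 - t) +
      ε * ((η - ξ) + 2 * ε ^ 2 * (τ' - τ) * ξ / (1 - t)) := by
    have hs2 : 1 - s = (1 - t) - ε ^ 2 * (2 * (τ' - τ)) := by linarith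
    have ht2 : (τ' - τ) * (γ * (1 - t) + 2 * ε ^ 2 * (x0 * w + γ * τ) - 2 * ε ^ 2 * (ω * w)) = 0 := by
      rw [ht]; linear_combination -(τ' - τ) * hsl
    rw [hs2, hy, hx]
    field_simp
    linear_combination ht2
  have hsq : √(π * (s - t)) = ε * √(2 * π * (τ' - τ)) := by
    rw [hst, show π * (ε ^ 2 * (2 * (τ' - τ))) = ε ^ 2 * (2 * π * (τ' - τ)) by ring,
      sqrt_mul (sq_nonneg ε), Real.sqrt_sq hε.le]
  have hsq0 : √(2 * π * (τ' - τ)) ≠ 0 :=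
    (Real.sqrt_pos.mpr (by have := pi_pos; positivity)).ne'
  rw [brownianDensity, cuspTransition, hsq, ← ht, ← hs]
  rw [show ε * (exp (-(x - y) ^ 2 / (s - t)) / (ε * √(2 * π * (τ' - τ)))) =
    exp (-(x - y) ^ 2 / (s - t)) / √(2 * π * (τ' - τ)) by field_simp, ← mul_div_assoc,
    div_mul_eq_mul_div, ← Real.exp_add, ← Real.exp_add]
  congr 2
  generalize (η - ξ) + 2 * ε ^ 2 * (τ' - τ) * ξ / (1 - t) = D at k1 ⊢
  have h4 : τ' - τ = (s - t) / (2 * ε ^ 2) := by rw [hst]; field_simp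
  have h5 : s - t ≠ 0 := by rw [hst]; positivity
  rw [h4, k1]
  field_simp
  ring

variable {E : Fin m → Set ℝ}

theorem IsCuspScaling.exists_gapProbability {q ω α t0 x0 γ ε w L : ℝ}
    (hS : IsCuspScaling q ω α t0 x0 γ ε w L) (hn : n1 ≤ n) (hw : (n : ℝ) = w ^ 2)
    {τ : Fin m → ℝ} (hτ : StrictMono τ) (hE : ∀ i, Bornology.IsBounded (E i))
    (hEm : ∀ i, MeasurableSet (E i)) (h0 : ∀ i, 0 < t0 + ε ^ 2 * (2 * τ i))
    (h1 : ∀ i, t0 + ε ^ 2 * (2 * τ i) < 1)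
    (hI : ∀ i j, ∀ ξ ∈ E i, ∀ η ∈ E j, doubleIntegral q n1 (n - n1) L
      ((1 - t0) / (1 - (t0 + ε ^ 2 * (2 * τ i)))) (τ i) ξ
      ((1 - t0) / (1 - (t0 + ε ^ 2 * (2 * τ j)))) (τ j) η = scaledIntegral q n1 (n - n1) L
      ((1 - t0) / (1 - (t0 + ε ^ 2 * (2 * τ i)))) (τ i) ξ
      ((1 - t0) / (1 - (t0 + ε ^ 2 * (2 * τ j)))) (τ j) η) :
    ∃ (P : ℝ) (K : Fin m → Fin m → ℝ → ℝ → ℂ),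
      HasNonIntersectingProbability n n1 (ω * w - q * (α * w)) (ω * w + α * w)
        (fun i => t0 + ε ^ 2 * (2 * τ i))
        {x | ∀ i j, ∃ ξ ∈ (E i)ᶜ, x i j = x0 * w + γ * τ i + ε * ξ} P ∧
      HasFredholmDet K E P ∧ (∀ i j, Measurable fun z : ℝ × ℝ => K i j z.1 z.2) ∧
      ∀ i j, ∀ ξ ∈ E i, ∀ η ∈ E j,
        K i j ξ η = cuspKernel q t0 ε L n1 (n - n1) (τ i) (τ j) ξ η := by
  have hε := hS.ε_pos
  have hh : 0 < α * w := mul_pos hS.α_pos hS.w_pos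
  have hqh : 0 < q * (α * w) := mul_pos hS.q_pos hh
  obtain ⟨Γ, W, V, h₁, hz⟩ := exists_isCauchyContour_zero
  have h2 := isCauchyContour_square (ω * w) hh hS.q_pos
  have hδV : ∀ j : Fin n, (endPoints n n1 (ω * w - q * (α * w)) (ω * w + α * w) j : ℂ) ∈
      ball ((ω * w + α * w : ℝ) : ℂ) (α * w / 4) ∪
      ball ((ω * w - q * (α * w) : ℝ) : ℂ) (q * (α * w) / 4) := fun j => by
    simp only [endPoints]
    split_ifs
    · right; exact mem_ball_self (by positivity)
    · left; exact mem_ball_self (by positivity)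
  set t : Fin m → ℝ := fun i => t0 + ε ^ 2 * (2 * τ i) with ht
  have htm : StrictMono t := fun i j hij => by
    have := mul_lt_mul_of_pos_left (hτ hij) (by positivity : 0 < 2 * ε ^ 2)
    simp only [ht]
    linarith
  set β : Fin m → ℝ := fun i => x0 * w + γ * τ i with hβ
  set E' : Fin m → Set ℝ := fun i => (fun x => (x - β i) / ε) ⁻¹' E i with hE'
  have hEm' : ∀ i, MeasurableSet (E' i) := fun i =>
    (by fun_prop : Measurable fun x => (x - β i) / ε) (hEm i)
  have hEb' : ∀ i, Bornology.IsBounded (E' i) := fun i => by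
    obtain ⟨R, hR⟩ := (hE i).exists_norm_le
    refine isBounded_iff_forall_norm_le.mpr ⟨|β i| + ε * R, fun x hx => ?_⟩
    have h3 := hR _ hx
    rw [norm_eq_abs, abs_div, abs_of_pos hε, div_le_iff₀ hε] at h3
    have : x = β i + (x - β i) := by ring
    rw [this, norm_eq_abs]
    exact (abs_add_le _ _).trans (by linarith)
  obtain ⟨P, hP, hPd⟩ := hasNonIntersectingProbability_gap_lineWeight h₁ h2
    (n1 := n1) (by linarith : ω * w - q * (α * w) ≤ ω * w + α * w) hz hδV htm hEb' hEm'
    h0 h1 (ω * w)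
  set δ : Fin n → ℂ := fun i => (endPoints n n1 (ω * w - q * (α * w)) (ω * w + α * w) i : ℂ) with hδ
  have hΨ := fun (k : Fin n) (i : Fin m) => continuous_nodeWeight h2 hδV k (1 - t i)
  have hΦ := fun (k : Fin n) (i : Fin m) => continuous_lineWeight (ω * w) (h0 i) (h1 i) δ k
  have hdet := hasFredholmDet_avoidingWeight hEb' hEm' htm hΨ hΦ
  rw [← hPd] at hdet
  set g : Fin m → ℝ → ℂ := fun i ξ =>
    (exp (-((ω * w) ^ 2 - (ω * w - (β i + ε * ξ)) ^ 2 / (1 - t i))) : ℝ) with hg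
  have hdet2 := (hdet.comp_affine hε hEm).gauge (g := g) fun i x => by
    exact Complex.ofReal_ne_zero.mpr (exp_pos _).ne'
  refine ⟨P, _, ?_, hdet2, fun i j => ?_, fun i j ξ hξ η hη => ?_⟩
  · convert hP using 2
    ext x
    refine forall₂_congr fun i j => ⟨fun ⟨ξ, hξ, h⟩ hx => hξ ?_, fun h => ⟨(x i j - β i) / ε, h, ?_⟩⟩
    · rw [hE', mem_preimage, h, show (x0 * w + γ * τ i + ε * ξ - β i) / ε = ξ by
        rw [hβ]; field_simp; ring] at hx
      exact hx
    · simp only [hβ]; field_simp; ring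
  · have hgm : ∀ i, Measurable (g i) := fun i => by fun_prop
    have hW : Measurable fun z : ℝ × ℝ => if i < j then
        ((brownianDensity (t j - t i) (β i + ε * z.1) (β j + ε * z.2) : ℝ) : ℂ) else 0 := by
      split_ifs
      · unfold brownianDensity; fun_prop
      · exact measurable_const
    have hsum : Measurable fun z : ℝ × ℝ => ∑ k, nodeWeight (squarePath (ω * w) (α * w) q)
        (squareWeight (α * w) q) δ k (1 - t i) (β i + ε * z.1) *
        lineWeight (ω * w) δ k (t j) (β j + ε * z.2) :=
      (continuous_finsetSum _ fun k _ => ((hΨ k i).comp (by fun_prop)).mul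
        ((hΦ k j).comp (by fun_prop))).measurable
    exact (((hgm i).comp measurable_fst).mul (measurable_const.mul (hsum.sub hW))).mul
      ((hgm j).comp measurable_snd).inv
  · simp only [mul_sub]
    rw [hS.sum_eq hn hw rfl (h1 i) rfl rfl (h0 j) (h1 j) rfl hδ (hI i j ξ hξ η hη), cuspKernel]
    simp only [sub_mul, hτ.lt_iff_lt]
    congr 1
    · simp only [hg]
      generalize (((1 - t0) / _ : ℝ) : ℂ) * _ = Q
      rw [← ofReal_inv, ← Real.exp_neg, mul_right_comm, ← mul_assoc, ← ofReal_mul,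
        ← Real.exp_add, ← ofReal_mul, ← Real.exp_add]
      refine (congrArg (· * Q) ?_).trans (one_mul Q)
      rw [Complex.ofReal_eq_one, Real.exp_eq_one_iff]
      simp only [hβ, ht]
      ring
    · split_ifs with hij
      · rw [← hS.brownianDensity_eq rfl (h1 i) rfl rfl (h1 j) rfl (hτ hij)]
        simp only [hg]
        rw [← ofReal_inv, ← Real.exp_neg, neg_neg]
        rw [ofReal_mul, ofReal_mul, ofReal_mul]
      · simp

theorem tendsto_gapProbability {q ω α t0 x0 γ : ℝ} {ε L : ℕ → ℝ}
    (hS : ∀ n : ℕ, 0 < n → IsCuspScaling q ω α t0 x0 γ (ε n) √n (L n))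
    (hL4 : ∀ n : ℕ, 0 < n → L n ^ 4 = n / (1 + q ^ 3) * (1 + q) / q)
    (hε : Tendsto ε atTop (𝓝 0)) {n1 : ℕ → ℕ} (hn1 : ∀ n, n1 n ≤ n)
    (hp : ∀ n, |(n1 n : ℝ) - 1 / (1 + q ^ 3) * n| ≤ 1)
    {τ : Fin m → ℝ} (hτ : StrictMono τ) (hE : ∀ i, Bornology.IsBounded (E i))
    (hEm : ∀ i, MeasurableSet (E i)) :
    ∃ (P : ℕ → ℝ) (D : ℝ), (∀ᶠ n : ℕ in atTop,
      HasNonIntersectingProbability n (n1 n) (ω * √n - q * (α * √n)) (ω * √n + α * √n)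
        (fun i => t0 + ε n ^ 2 * (2 * τ i))
        {x | ∀ i j, ∃ ξ ∈ (E i)ᶜ, x i j = x0 * √n + γ * τ i + ε n * ξ} (P n)) ∧
      HasPearceyGapProbability τ E D ∧ Tendsto P atTop (𝓝 D) := by
  have hS1 := hS 1 one_pos
  have hq := hS1.q_pos
  have ht0 := hS1.t₀_pos
  have ht₀1 := sub_pos.mpr hS1.t₀_lt
  have htime : ∀ i, Tendsto (fun n => t0 + ε n ^ 2 * (2 * τ i)) atTop (𝓝 t0) := fun i => by
    simpa using ((hε.pow 2).mul_const (2 * τ i)).const_add t0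
  have hσ : ∀ i, Tendsto (fun n => (1 - t0) / (1 - (t0 + ε n ^ 2 * (2 * τ i)))) atTop (𝓝 1) :=
    fun i => by
      have := (tendsto_const_nhds (x := 1 - t0)).div ((htime i).const_sub 1) ht₀1.ne'
      rwa [div_self ht₀1.ne'] at this
  have hLt : Tendsto (fun n => L n ^ 4) atTop atTop := by
    have h1 : Tendsto (fun n : ℕ => (n : ℝ) * (1 / (1 + q ^ 3) * (1 + q) / q)) atTop atTop :=
      tendsto_natCast_atTop_atTop.atTop_mul_const (by positivity)
    refine h1.congr' ?_
    filter_upwards [eventually_gt_atTop 0] with n hn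
    rw [hL4 n hn]
    ring
  have hLp : ∀ n, 0 < n → 0 < L n := fun n hn => (hS n hn).L_pos
  have hLt1 : Tendsto L atTop atTop := by
    refine tendsto_atTop.mpr fun b => ?_
    filter_upwards [hLt.eventually_ge_atTop (|b| ^ 4), eventually_gt_atTop 0] with n h1 h2
    exact (le_abs_self b).trans (le_of_pow_le_pow_left₀ four_ne_zero (hLp n h2).le h1)
  have hLt2 : Tendsto (fun n => L n ^ 2) atTop atTop := (tendsto_pow_atTop two_ne_zero).comp hLt1
  obtain ⟨X, hX⟩ : ∃ X : ℝ, ∀ i, ∀ ξ ∈ E i, |ξ| ≤ X := by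
    obtain ⟨R, hR⟩ := ((Bornology.isBounded_iUnion (s := E)).mpr hE).exists_norm_le
    exact ⟨R, fun i ξ hξ => hR ξ (mem_iUnion.mpr ⟨i, hξ⟩)⟩
  set T := ∑ i, |τ i| with hT
  have hTi : ∀ i, |τ i| ≤ T := fun i =>
    single_le_sum (f := fun i => |τ i|) (fun _ _ => abs_nonneg _) (Finset.mem_univ i)
  obtain ⟨B, M, hBM⟩ := exists_norm_scaledIntegral_le hq T |X| (sum_nonneg fun _ _ =>
    abs_nonneg _) (abs_nonneg X)
  have hev : ∀ᶠ n : ℕ in atTop, 0 < n ∧ M ≤ L n ^ 2 ∧ ∀ i, 0 < t0 + ε n ^ 2 * (2 * τ i) ∧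
      t0 + ε n ^ 2 * (2 * τ i) < 1 ∧ |(1 - t0) / (1 - (t0 + ε n ^ 2 * (2 * τ i)))| ≤ 2 := by
    refine (eventually_gt_atTop 0).and ((hLt2.eventually_ge_atTop M).and (eventually_all.mpr fun i =>
      ((htime i).eventually_const_lt ht0).and (((htime i).eventually_lt_const hS1.t₀_lt).and ?_)))
    exact (hσ i).abs.eventually_le_const (by norm_num)
  obtain ⟨N0, hN0⟩ := eventually_atTop.mp hev
  have hN := fun N : ℕ => hN0 (N + N0) (Nat.le_add_left _ _)
  have hsum : ∀ n, (n1 n + (n - n1 n : ℕ) : ℝ) = n := fun n => by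
    rw [← Nat.cast_add, Nat.add_sub_cancel' (hn1 n)]
  have hp' : ∀ n, |(n1 n : ℝ) - 1 / (1 + q ^ 3) * (n1 n + (n - n1 n : ℕ))| ≤ 1 := fun n => by
    rw [hsum]; exact hp n
  have hL4' : ∀ n, 0 < n → L n ^ 4 = (n1 n + (n - n1 n : ℕ)) / (1 + q ^ 3) * (1 + q) / q :=
    fun n hn => by rw [hsum]; exact hL4 n hn
  have hb := fun (N : ℕ) (i j : Fin m) (ξ : ℝ) (hξ : ξ ∈ E i) (η : ℝ) (hη : η ∈ E j) =>
    hBM _ _ _ (hp' (N + N0)) (hLp _ (hN N).1) (hL4' _ (hN N).1) (hN N).2.1 _ (τ i) ξ _ (τ j) η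
      ((hN N).2.2 i).2.2 (hTi i) ((hX i ξ hξ).trans (le_abs_self X)) ((hN N).2.2 j).2.2 (hTi j)
      ((hX j η hη).trans (le_abs_self X))
  choose P K hP hK hKm hKeq using fun N : ℕ => (hS (N + N0) (hN N).1).exists_gapProbability
    (hn1 (N + N0)) (sq_sqrt (Nat.cast_nonneg _)).symm hτ hE hEm (fun i => ((hN N).2.2 i).1)
    (fun i => ((hN N).2.2 i).2.1) fun i j ξ hξ η hη => (hb N i j ξ hξ η hη).2
  have hC : ∀ N i j, ∀ ξ ∈ E i, ∀ η ∈ E j, ‖K N i j ξ η‖ ≤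
      2 * |B| + ∑ i, ∑ j, |1 / √(2 * π * (τ j - τ i))| := by
    intro N i j ξ hξ η hη
    rw [hKeq N i j ξ hξ η hη, cuspKernel]
    refine (norm_sub_le _ _).trans (add_le_add ?_ ?_)
    · obtain ⟨-, h1, h2⟩ := (hN N).2.2 i
      obtain ⟨-, h3, h4⟩ := (hN N).2.2 j
      set u := 1 - (t0 + ε (N + N0) ^ 2 * (2 * τ i))
      set v := 1 - (t0 + ε (N + N0) ^ 2 * (2 * τ j))
      have hu : 0 < u := sub_pos.mpr h1
      have hv : 0 < v := sub_pos.mpr h3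
      rw [abs_of_pos (div_pos ht₀1 hu), div_le_iff₀ hu] at h2
      rw [abs_of_pos (div_pos ht₀1 hv), div_le_iff₀ hv] at h4
      have h5 : (1 - t0) / √(v * u) ≤ 2 := by
        rw [div_le_iff₀ (Real.sqrt_pos.mpr (mul_pos hv hu))]
        refine le_of_sq_le_sq ?_ (by positivity)
        rw [mul_pow, sq_sqrt (mul_pos hv hu).le, sq]
        nlinarith [mul_le_mul h4 h2 ht₀1.le (by positivity)]
      rw [norm_mul, norm_mul, norm_real, norm_of_nonneg (div_nonneg ht₀1.le
        (sqrt_nonneg _))]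
      refine mul_le_mul h5 ?_ (by positivity) zero_le_two
      have h6 : ‖I / (4 * π ^ 2)‖ ≤ 1 := by
        rw [norm_div, norm_I, norm_mul, norm_pow, norm_real,
          norm_of_nonneg pi_pos.le, norm_ofNat, div_le_one (by positivity)]
        nlinarith [Real.pi_gt_three]
      exact (mul_le_of_le_one_left (norm_nonneg _) h6).trans ((hb N i j ξ hξ η hη).1.trans
        (le_abs_self B))
    · have h6 : |1 / √(2 * π * (τ j - τ i))| ≤
          ∑ i, ∑ j, |1 / √(2 * π * (τ j - τ i))| :=
        (single_le_sum (f := fun j => |1 / √(2 * π * (τ j - τ i))|)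
          (fun _ _ => abs_nonneg _) (Finset.mem_univ j)).trans
        (single_le_sum (f := fun i => ∑ j, |1 / √(2 * π * (τ j - τ i))|)
          (fun _ _ => sum_nonneg fun _ _ => abs_nonneg _) (Finset.mem_univ i))
      split_ifs with hij
      · refine le_trans ?_ h6
        rw [norm_real, cuspTransition, norm_eq_abs, abs_div, abs_div, abs_one]
        refine div_le_div_of_nonneg_right ?_ (abs_nonneg _)
        rw [abs_of_pos (exp_pos _), Real.exp_le_one_iff, neg_nonpos]
        have h1 := sub_pos.mpr ((hN N).2.2 i).2.1
        have h2 := sub_pos.mpr ((hN N).2.2 j).2.1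
        have h3 := sub_pos.mpr hij
        positivity
      · rw [norm_zero]
        exact (abs_nonneg _).trans h6
  have hKlim : ∀ i j, ∀ ξ ∈ E i, ∀ η ∈ E j,
      Tendsto (fun N => K N i j ξ η) atTop (𝓝 (pearceyKernel (τ i) (τ j) ξ η)) := by
    intro i j ξ hξ η hη
    have hsh : Tendsto (fun N => N + N0) atTop atTop := tendsto_add_atTop_nat N0
    have h1 := tendsto_scaledIntegral hq (n1 := fun N => n1 (N + N0))
      (n2 := fun N => N + N0 - n1 (N + N0)) (L := fun N => L (N + N0)) (fun N => hp' _)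
      (fun N => hLp _ (hN N).1) (hLt1.comp hsh) (fun N => hL4' _ (hN N).1) ((hσ i).comp hsh)
      ((hσ j).comp hsh) (τ i) (τ j) ξ η
    have h2 : Tendsto (fun N => (1 - t0) / √((1 - (t0 + ε (N + N0) ^ 2 * (2 * τ j))) *
        (1 - (t0 + ε (N + N0) ^ 2 * (2 * τ i))))) atTop (𝓝 1) := by
      have h3 := (((htime j).const_sub 1).mul ((htime i).const_sub 1)).sqrt
      rw [Real.sqrt_mul_self ht₀1.le] at h3
      have := (tendsto_const_nhds (x := 1 - t0)).div (h3.comp hsh) ht₀1.ne'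
      rwa [div_self ht₀1.ne'] at this
    have h2c : Tendsto (fun N => (((1 - t0) / √((1 - (t0 + ε (N + N0) ^ 2 * (2 * τ j))) *
        (1 - (t0 + ε (N + N0) ^ 2 * (2 * τ i)))) : ℝ) : ℂ)) atTop (𝓝 1) := by
      have := (Complex.continuous_ofReal.tendsto 1).comp h2
      rwa [ofReal_one] at this
    have h3 : Tendsto (fun N => if τ i < τ j then
        (cuspTransition t0 (ε (N + N0)) (τ i) (τ j) ξ η : ℂ) else 0) atTop
        (𝓝 (if τ i < τ j then ((exp (-(ξ - η) ^ 2 / (2 * (τ j - τ i))) /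
          √(2 * π * (τ j - τ i)) : ℝ) : ℂ) else 0)) := by
      split_ifs with hij
      · refine (Complex.continuous_ofReal.tendsto _).comp (Tendsto.div_const ?_ _)
        refine (Real.continuous_exp.tendsto _).comp ?_
        have hij' := (sub_pos.mpr hij).ne'
        have a1 := (((htime i).const_sub 1).div (((htime j).const_sub 1).const_mul
          (2 * (τ j - τ i))) (mul_ne_zero (mul_ne_zero two_ne_zero hij') ht₀1.ne')).comp hsh
        have a2 : Tendsto (fun N => 2 * ε (N + N0) ^ 2 * (τ j - τ i) * ξ /
            (1 - (t0 + ε (N + N0) ^ 2 * (2 * τ i)))) atTop (𝓝 0) := by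
          have := ((((((hε.comp hsh).pow 2).const_mul 2).mul_const (τ j - τ i)).mul_const ξ).div
            (((htime i).const_sub 1).comp hsh) ht₀1.ne')
          rw [show 2 * (0 : ℝ) ^ 2 * (τ j - τ i) * ξ / (1 - t0) = 0 by simp] at this
          exact this
        have a3 := (a1.mul ((a2.const_add (η - ξ)).pow 2)).neg
        have h5 := ht₀1.ne'
        rw [show -((1 - t0) / (2 * (τ j - τ i) * (1 - t0)) * (η - ξ + 0) ^ 2) =
          -(ξ - η) ^ 2 / (2 * (τ j - τ i)) by field_simp; ring] at a3
        exact a3.congr fun N => by simp only [comp_def, Pi.div_apply]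
      · exact tendsto_const_nhds
    have h4 := (h2c.mul h1).sub h3
    rw [one_mul, add_sub_cancel_right] at h4
    refine h4.congr fun N => ?_
    rw [hKeq N i j ξ hξ η hη, cuspKernel]
    rfl
  obtain ⟨D, hD, hDlim⟩ := tendsto_hasFredholmDet hE hEm hKm hC hKlim
  have hlim := hDlim (fun N => (P N : ℂ)) hK
  have him : D.im = 0 := by
    have h1 := (Complex.continuous_im.tendsto D).comp hlim
    simp only [comp_def, ofReal_im] at h1
    exact tendsto_nhds_unique h1 tendsto_const_nhds
  have hre := (Complex.continuous_re.tendsto D).comp hlim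
  simp only [comp_def, ofReal_re] at hre
  refine ⟨fun n => P (n - N0), D.re, ?_, ?_, ?_⟩
  · filter_upwards [eventually_ge_atTop N0] with n hn
    have := hP (n - N0)
    rwa [Nat.sub_add_cancel hn] at this
  · rw [HasPearceyGapProbability, show ((D.re : ℝ) : ℂ) = D from Complex.ext rfl him.symm]
    exact hD
  · exact hre.comp (tendsto_sub_atTop_nat N0)

theorem integral_exp_mul_gaussWeight (h0 : 0 < t) (h1 : t < 1) (κ : ℝ) (u v : ℂ) :
    ∫ y : ℝ, cexp (κ * y * I) * (gaussWeight t u y * gaussWeight (1 - t) v y) =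
      cexp (2 * u * (v + κ * (1 - t) / 2 * I)) *
        cexp (κ * t * v * I - κ ^ 2 * t * (1 - t) / 4) / (√π : ℝ) := by
  have h1' : 0 < 1 - t := sub_pos.mpr h1
  have ht : (t : ℂ) ≠ 0 := by exact_mod_cast h0.ne'
  have ht1 : (1 - t : ℂ) ≠ 0 := by exact_mod_cast h1'.ne'
  have e : ∀ y : ℝ, cexp (κ * y * I) *
      (gaussWeight t u y * gaussWeight (1 - t) v y) =
      cexp (((-(1 / (t * (1 - t))) : ℝ) : ℂ) * y ^ 2 +
        (2 * u / t + 2 * v / (1 - t) + κ * I) * y +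
        (u ^ 2 + v ^ 2 - u ^ 2 / t - v ^ 2 / (1 - t))) /
        (√(π * t) * √(π * (1 - t)) : ℝ) := fun y => by
    rw [gaussWeight, gaussWeight, div_mul_div_comm, ← exp_add, mul_div_assoc',
      ← exp_add]
    push_cast
    congr 2
    field_simp
    ring
  simp only [e]
  rw [integral_div, integral_cexp_quadratic (by simp only [ofReal_re, neg_lt_zero]; positivity)]
  have hp : ((π : ℂ) / -((-(1 / (t * (1 - t))) : ℝ) : ℂ)) ^ (1 / 2 : ℂ) =
      (√(π * (t * (1 - t))) : ℝ) := by
    rw [Real.sqrt_eq_rpow, Complex.ofReal_cpow (by positivity)]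
    push_cast
    congr 1
    field_simp
  rw [hp, ← exp_add, mul_div_right_comm, div_eq_mul_one_div (cexp _), mul_comm (cexp _)]
  have h2 : √(π * (t * (1 - t))) / (√(π * t) * √(π * (1 - t))) = 1 / √π := by
    rw [sqrt_mul pi_pos.le, sqrt_mul pi_pos.le, sqrt_mul pi_pos.le,
      sqrt_mul h0.le]
    have := Real.sqrt_pos.mpr h0
    have := Real.sqrt_pos.mpr h1'
    have := Real.sqrt_pos.mpr pi_pos
    field_simp
  rw [← ofReal_div, h2, ofReal_div, ofReal_one]
  congr 2
  push_cast
  field_simp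
  linear_combination ((κ : ℂ) ^ 2 * t ^ 2 * (1 - t) ^ 2) * I_sq

section meanDensity


/-- The density of the mean number of paths, for paths leaving from `0`. -/
def meanDensity (Γ1 w1 Γ2 w2 : ℝ → ℂ) {n : ℕ} (δ : Fin n → ℂ) (t y : ℝ) : ℂ :=
  ∑ k, ∑ i, startMatrix δ k i *
    (nodeWeight Γ1 w1 (fun _ => 0) i t y * nodeWeight Γ2 w2 δ k (1 - t) y)

theorem integrable_meanDensity (c1 : IsCauchyContour Γ1 w1 V1) (c2 : IsCauchyContour Γ2 w2 V2) (hz : (0 : ℂ) ∈ V1) (hδ : ∀ j, δ j ∈ V2)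
    (h0 : 0 < t) (h1 : t < 1) : Integrable (meanDensity Γ1 w1 Γ2 w2 δ t) :=
  integrable_finsetSum _ fun k _ => integrable_finsetSum _ fun i _ =>
    (integrable_nodeWeight_mul_nodeWeight c1 c2 (γ := fun _ => 0) (fun _ => hz) hδ h0 h1
      i k).const_mul _

theorem hasNonIntersectingExpectation_sum_meanDensity (c1 : IsCauchyContour Γ1 w1 V1)
    (c2 : IsCauchyContour Γ2 w2 V2)
    {b a : ℝ} (hba : b ≤ a) (hz : (0 : ℂ) ∈ V1)
    (hδ : ∀ j, (endPoints n n1 b a j : ℂ) ∈ V2)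
    (h0 : 0 < t) (h1 : t < 1) {f : ℝ → ℝ} (hf : Measurable f) (hB : ∀ y, |f y| ≤ B) :
    ∃ P : ℝ, HasNonIntersectingExpectation n n1 b a (fun _ : Fin 1 => t)
      (fun x => ∑ j, f (x 0 j)) P ∧ ((∀ y, 0 ≤ f y) → 0 ≤ P) ∧
      (P : ℂ) = ∫ y, f y * meanDensity Γ1 w1 Γ2 w2 (fun i => (endPoints n n1 b a i : ℂ)) t y := by
  set δ : Fin n → ℂ := fun i => (endPoints n n1 b a i : ℂ)
  obtain ⟨P, hP, hpos, e⟩ := hasNonIntersectingExpectation_sum c1 c2 h0 h1 hf hB hba hz hδ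
    (det_freeGram_zero_ne_zero (n := n) c1 c2 hz (δ := δ) hδ)
  refine ⟨P, hP, hpos, ?_⟩
  have hi : ∀ k i : Fin n, Integrable fun y => startMatrix δ k i * ((f y : ℂ) *
      (nodeWeight Γ1 w1 (fun _ => 0) i t y * nodeWeight Γ2 w2 δ k (1 - t) y)) := fun k i => by
    refine Integrable.const_mul ((integrable_nodeWeight_mul_nodeWeight c1 c2
      (γ := fun _ => 0) (fun _ => hz) hδ h0 h1 i k).bdd_mul (c := B) (by fun_prop)
      (ae_of_all _ fun y => ?_)) _
    rw [norm_real]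
    exact hB y
  rw [e, Matrix.inv_eq_left_inv (startMatrix_mul_freeGram c1 c2 hz (δ := δ) hδ),
    Matrix.trace]
  simp only [meanDensity, mul_sum, mul_left_comm ((f _ : ℝ) : ℂ) (startMatrix δ _ _)]
  rw [integral_finsetSum _ fun k _ => integrable_finsetSum _ fun i _ => hi k i]
  refine sum_congr rfl fun k _ => ?_
  rw [integral_finsetSum _ fun i _ => hi k i, Matrix.diag_apply, Matrix.mul_apply]
  refine sum_congr rfl fun i _ => ?_
  rw [integral_const_mul]
  rfl

theorem integral_exp_mul_nodeWeight (c1 : IsCauchyContour Γ1 w1 V1)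
    (c2 : IsCauchyContour Γ2 w2 V2) (hz : (0 : ℂ) ∈ V1)
    (hδ : ∀ j, δ j ∈ V2) (h0 : 0 < t) (h1 : t < 1) (κ : ℝ) (i k : Fin n) :
    ∫ y : ℝ, cexp (κ * y * I) *
      (nodeWeight Γ1 w1 (fun _ => 0) i t y * nodeWeight Γ2 w2 δ k (1 - t) y) =
    dividedDifference Γ2 w2 δ k fun v => (2 * (v + κ * (1 - t) / 2 * I)) ^ (i : ℕ) /
      ((i : ℕ).factorial : ℂ) * cexp (κ * t * v * I - κ ^ 2 * t * (1 - t) / 4) /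
      (√π : ℝ) := by
  have h1' : 0 < 1 - t := sub_pos.mpr h1
  obtain ⟨R, hR⟩ := c1.bounded_path
  obtain ⟨R', hR'⟩ := c2.bounded_path
  obtain ⟨C, hC0, hC⟩ := exists_norm_nodeWeight_le c1 n h0
  have hg : Integrable fun y : ℝ => exp (-y ^ 2 / (2 * t)) := by
    refine (integrable_exp_neg_mul_sq (b := 1 / (2 * t)) (by positivity)).congr
      (ae_of_all _ fun y => ?_)
    simp only; congr 1; ring
  have he : ∀ y : ℝ, ‖cexp (κ * y * I)‖ = 1 := fun y => by
    rw [← ofReal_mul, Complex.norm_exp_ofReal_mul_I]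
  have s1 : ∀ v : ℂ, ∫ y : ℝ, cexp (κ * y * I) *
      (nodeWeight Γ1 w1 (fun _ => 0) i t y * gaussWeight (1 - t) v y) =
      (2 * (v + κ * (1 - t) / 2 * I)) ^ (i : ℕ) /
      ((i : ℕ).factorial : ℂ) * cexp (κ * t * v * I - κ ^ 2 * t * (1 - t) / 4) /
      (√π : ℝ) := fun v => by
    have hF : Continuous fun z : ℝ × ℂ => cexp (κ * z.1 * I) *
        (gaussWeight t z.2 z.1 * gaussWeight (1 - t) v z.1) := by unfold gaussWeight; fun_prop
    have := integral_dividedDifference c1 (δ := fun _ : Fin n => 0) (fun _ => hz) i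
      (F := fun y u => cexp (κ * y * I) *
        (gaussWeight t u y * gaussWeight (1 - t) v y)) hF
      ((hg.const_mul (exp (R ^ 2 + 2 * R ^ 2 / t) / √(π * t))).mul_const
        (exp (‖v‖ ^ 2 + 2 * ‖v‖ ^ 2 / (1 - t)) / √(π * (1 - t)))) fun y s hs => by
        rw [norm_mul, he, one_mul, norm_mul]
        exact mul_le_mul (norm_gaussWeight_le h0 (hR s hs) y) (norm_gaussWeight_le' h1' le_rfl y)
          (norm_nonneg _) (by positivity)
    simp only [integral_exp_mul_gaussWeight h0 h1] at this
    rw [← dividedDifference_zero_exp c1 hz i, dividedDifference, contourIntegral,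
      ← integral_mul_const, ← integral_div]
    refine Eq.trans ?_ (this.trans ?_)
    · congr 1 with y
      simp only [nodeWeight, dividedDifference, contourIntegral]
      rw [← integral_mul_const, ← integral_const_mul]
      congr 1 with s
      ring
    · unfold dividedDifference contourIntegral
      congr 1 with s
      ring
  have hF : Continuous fun z : ℝ × ℂ => cexp (κ * z.1 * I) *
      (nodeWeight Γ1 w1 (fun _ : Fin n => 0) i t z.1 * gaussWeight (1 - t) z.2 z.1) :=
    Continuous.mul (by fun_prop) (((continuous_nodeWeight c1 (fun _ => hz) i t).comp
      continuous_fst).mul (continuous_gaussWeight _))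
  have := integral_dividedDifference c2 hδ k (F := fun y v => cexp (κ * y * I) *
      (nodeWeight Γ1 w1 (fun _ : Fin n => 0) i t y * gaussWeight (1 - t) v y)) hF
      ((hg.const_mul C).mul_const
        (exp (R' ^ 2 + 2 * R' ^ 2 / (1 - t)) / √(π * (1 - t)))) fun y s hs => by
        rw [norm_mul, he, one_mul, norm_mul]
        exact mul_le_mul (hC _ (fun _ => hz) i y) (norm_gaussWeight_le' h1' (hR' s hs) y)
          (norm_nonneg _) (by positivity)
  simp only [s1] at this
  rw [← this]
  congr 1 with y
  simp only [nodeWeight, dividedDifference, contourIntegral]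
  rw [← integral_const_mul, ← integral_const_mul]
  congr 1 with s
  ring

theorem integral_exp_mul_meanDensity (c1 : IsCauchyContour Γ1 w1 V1)
    (c2 : IsCauchyContour Γ2 w2 V2) (hz : (0 : ℂ) ∈ V1)
    (hδ : ∀ j, δ j ∈ V2) (h0 : 0 < t) (h1 : t < 1) (κ : ℝ) :
    ∫ y : ℝ, cexp (κ * y * I) * meanDensity Γ1 w1 Γ2 w2 δ t y =
    ∑ k : Fin n, dividedDifference Γ2 w2 δ k fun v =>
      nodal δ k (v + κ * (1 - t) / 2 * I) *
        cexp (κ * t * v * I - κ ^ 2 * t * (1 - t) / 4) := by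
  have hpi : ((√π : ℝ) : ℂ) ≠ 0 := by
    exact_mod_cast (Real.sqrt_pos.mpr pi_pos).ne'
  have hi : ∀ k i : Fin n, Integrable fun y : ℝ => startMatrix δ k i *
      (cexp (κ * y * I) *
      (nodeWeight Γ1 w1 (fun _ => 0) i t y * nodeWeight Γ2 w2 δ k (1 - t) y)) := fun k i => by
    refine Integrable.const_mul ((integrable_nodeWeight_mul_nodeWeight c1 c2
      (γ := fun _ => 0) (fun _ => hz) hδ h0 h1 i k).bdd_mul (c := 1) (by fun_prop)
      (ae_of_all _ fun y => ?_)) _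
    rw [← ofReal_mul, Complex.norm_exp_ofReal_mul_I]
  simp only [meanDensity, mul_sum, mul_left_comm (cexp _) (startMatrix δ _ _)]
  rw [integral_finsetSum _ fun k _ => integrable_finsetSum _ fun i _ => hi k i]
  refine sum_congr rfl fun k _ => ?_
  rw [integral_finsetSum _ fun i _ => hi k i]
  simp only [integral_const_mul, integral_exp_mul_nodeWeight c1 c2 hz hδ h0 h1 κ]
  rw [← dividedDifference_sum c2 hδ k _ _ fun i => by fun_prop]
  congr 1 with v
  rw [nodal_eq_sum_coeff, sum_mul]
  refine sum_congr rfl fun i _ => ?_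
  have : ((i : ℕ).factorial : ℂ) ≠ 0 := by exact_mod_cast (i : ℕ).factorial_ne_zero
  rw [startMatrix, of_apply, mul_pow]
  field_simp

theorem integral_meanDensity (c1 : IsCauchyContour Γ1 w1 V1)
    (c2 : IsCauchyContour Γ2 w2 V2) (hz : (0 : ℂ) ∈ V1)
    (hδ : ∀ j, δ j ∈ V2) (h0 : 0 < t) (h1 : t < 1) :
    ∫ y : ℝ, meanDensity Γ1 w1 Γ2 w2 δ t y = n := by
  have := integral_exp_mul_meanDensity c1 c2 hz hδ h0 h1 0
  simp only [ofReal_zero, zero_mul, Complex.exp_zero, one_mul, zero_div, add_zero, mul_one,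
    ne_eq, OfNat.ofNat_ne_zero, not_false_eq_true, zero_pow, sub_zero] at this
  rw [this]
  refine (sum_congr rfl fun k _ => dividedDifference_nodal c2 hδ k k).trans ?_
  simp

theorem integral_exp_mul_meanDensity_eq (c1 : IsCauchyContour Γ1 w1 V1)
    (c2 : IsCauchyContour Γ2 w2 V2) (hz : (0 : ℂ) ∈ V1)
    (hδ : ∀ j, δ j ∈ V2) (h0 : 0 < t) (h1 : t < 1) {κ : ℝ} (hκ : κ ≠ 0) :
    ∫ y : ℝ, cexp (κ * y * I) * meanDensity Γ1 w1 Γ2 w2 δ t y =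
    2 / (κ * (1 - t) * I) * contourIntegral Γ2 w2 fun v =>
      cexp (κ * t * v * I - κ ^ 2 * t * (1 - t) / 4) *
        (nodal δ n (v + κ * (1 - t) / 2 * I) / nodal δ n v - 1) := by
  have hκ' : (κ : ℂ) ≠ 0 := by exact_mod_cast hκ
  have ht1 : (1 - t : ℂ) ≠ 0 := by exact_mod_cast (sub_pos.mpr h1).ne'
  have hI := I_ne_zero
  set F : Fin n → ℂ → ℂ := fun k v => nodal δ k (v + κ * (1 - t) / 2 * I) *
    cexp (κ * t * v * I - κ ^ 2 * t * (1 - t) / 4) with hF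
  have hFc : ∀ k, Continuous (F k) := fun k =>
    ((continuous_nodal δ k).comp (by fun_prop)).mul (by fun_prop)
  rw [integral_exp_mul_meanDensity c1 c2 hz hδ h0 h1 κ]
  change ∑ k : Fin n, dividedDifference Γ2 w2 δ k (F k) = _
  unfold dividedDifference contourIntegral
  rw [← integral_finsetSum (f := fun (k : Fin n) s => F k (Γ2 s) / nodal δ (k + 1) (Γ2 s) * w2 s) _
    fun k _ => integrable_dividedDifference c2 hδ k (hFc k), ← integral_const_mul]
  refine setIntegral_congr_fun measurableSet_Icc fun s hs => ?_
  have h := sum_nodal_div_nodal_univ δ (fun j => c2.sub_ne_zero hs (hδ j))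
    (Γ2 s + κ * (1 - t) / 2 * I)
  simp only [hF]
  rw [← neg_sub 1, ← h, mul_sum, ← Finset.sum_neg_distrib, mul_sum, sum_mul,
    mul_sum]
  refine sum_congr rfl fun k _ => ?_
  field_simp
  ring

end meanDensity

theorem HasNonIntersectingExpectation.const_mul {m n n1 : ℕ} {b a : ℝ} {t : Fin m → ℝ}
    {F : (Fin m → Fin n → ℝ) → ℝ} {v : ℝ} (h : HasNonIntersectingExpectation n n1 b a t F v)
    (c : ℝ) : HasNonIntersectingExpectation n n1 b a t (fun x => c * F x) (c * v) := by
  refine (Tendsto.const_mul c h).congr fun z => ?_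
  simp only [bridgeExpectation, mul_assoc, integral_const_mul, mul_div_assoc]

theorem exists_isProbabilityMeasure_charFun (hn : 0 < n) (c1 : IsCauchyContour Γ1 w1 V1) (c2 : IsCauchyContour Γ2 w2 V2) {b a : ℝ} (hba : b ≤ a) (hz : (0 : ℂ) ∈ V1)
    (hδ : ∀ j : Fin n, (endPoints n n1 b a j : ℂ) ∈ V2) (h0 : 0 < t) (h1 : t < 1)
    (r : ℝ) :
    ∃ μ : Measure ℝ, IsProbabilityMeasure μ ∧
      (∀ f : ℝ →ᵇ ℝ, HasNonIntersectingExpectation n n1 b a (fun _ : Fin 1 => t)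
        (fun x => (1 / (n : ℝ)) * ∑ j, f (x 0 j / r)) (∫ x, f x ∂μ)) ∧
      ∀ k : ℝ, charFun μ k = 1 / n * ∫ y : ℝ, cexp ((k / r : ℝ) * y * I) *
        meanDensity Γ1 w1 Γ2 w2 (fun i => (endPoints n n1 b a i : ℂ)) t y := by
  have hn' : (n : ℂ) ≠ 0 := by exact_mod_cast hn.ne'
  set δ : Fin n → ℂ := fun i => (endPoints n n1 b a i : ℂ)
  set ρ := meanDensity Γ1 w1 Γ2 w2 δ t with hρ
  have hi : Integrable ρ := integrable_meanDensity c1 c2 hz (δ := δ) hδ h0 h1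
  have hE := fun (f : ℝ → ℝ) (hf : Measurable f) (B : ℝ) (hB : ∀ y, |f y| ≤ B) =>
    hasNonIntersectingExpectation_sum_meanDensity c1 c2 hba hz hδ h0 h1 hf hB
  have hset : ∀ s, MeasurableSet s → 0 ≤ ∫ y in s, (ρ y).re ∧ ∫ y in s, (ρ y).im = 0 := by
    intro s hs
    obtain ⟨P, -, hpos, e⟩ := hE (s.indicator 1) (measurable_one.indicator hs) 1 fun y => by
      by_cases h : y ∈ s <;> simp [h]
    have e' : (P : ℂ) = ∫ y in s, ρ y := by
      rw [e, ← integral_indicator hs]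
      refine integral_congr_ae (ae_of_all _ fun y => ?_)
      by_cases h : y ∈ s <;> simp [h, hρ, δ]
    have hre := integral_re (𝕜 := ℂ) hi.integrableOn (μ := volume.restrict s)
    have him := integral_im (𝕜 := ℂ) hi.integrableOn (μ := volume.restrict s)
    simp only [RCLike.re_to_complex, RCLike.im_to_complex, ← e', ofReal_re,
      ofReal_im] at hre him
    exact ⟨hre ▸ hpos fun y => indicator_nonneg (fun _ _ => zero_le_one) y, him⟩
  have hre : 0 ≤ᵐ[volume] fun y => (ρ y).re :=
    ae_nonneg_of_forall_setIntegral_nonneg hi.re fun s hs _ => (hset s hs).1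
  have him : (fun y => (ρ y).im) =ᵐ[volume] 0 :=
    hi.im.ae_eq_zero_of_forall_setIntegral_eq_zero fun s hs _ => (hset s hs).2
  set g : ℝ → ℝ := fun y => (ρ y).re / n
  have hg : Integrable g := hi.re.div_const _
  have hg0 : 0 ≤ᵐ[volume] g := hre.mono fun y hy => div_nonneg hy (Nat.cast_nonneg n)
  have hρg : ∀ᵐ y, (g y : ℂ) = 1 / n * ρ y := him.mono fun y hy => by
    apply Complex.ext <;> simp [g, hy, div_eq_inv_mul]
  have hr : Measurable fun y : ℝ => y / r := by fun_prop
  set μ0 := volume.withDensity fun y => ENNReal.ofReal (g y) with hμ0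
  have hint : ∀ F : ℝ → ℂ, AEStronglyMeasurable F (μ0.map fun y => y / r) →
      ∫ x, F x ∂(μ0.map fun y => y / r) = 1 / n * ∫ y, F (y / r) * ρ y := fun F hF => by
    rw [integral_map hr.aemeasurable hF, hμ0, integral_withDensity_eq_integral_toReal_smul₀
      hg.aemeasurable.ennreal_ofReal (ae_of_all _ fun _ => ENNReal.ofReal_lt_top),
      ← integral_const_mul]
    refine integral_congr_ae ?_
    filter_upwards [hg0, hρg] with y h1 h2
    rw [ENNReal.toReal_ofReal h1, real_smul, h2]
    ring
  have h1 := integral_meanDensity c1 c2 hz (δ := δ) hδ h0 h1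
  have hprob : IsProbabilityMeasure (μ0.map fun y => y / r) := by
    refine (Measure.isProbabilityMeasure_map_iff hr.aemeasurable).mpr ⟨?_⟩
    rw [hμ0, withDensity_apply _ MeasurableSet.univ, setLIntegral_univ,
      ← ofReal_integral_eq_lintegral_ofReal hg hg0]
    have : ((∫ y, g y : ℝ) : ℂ) = 1 := by
      rw [← integral_complex_ofReal, integral_congr_ae hρg, integral_const_mul, h1]
      field_simp
    rw [show ∫ y, g y = 1 by exact_mod_cast this, ENNReal.ofReal_one]
  refine ⟨_, hprob, fun f => ?_, fun k => ?_⟩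
  · obtain ⟨P, hP, -, e⟩ := hE (fun y => f (y / r)) (by fun_prop) ‖f‖ fun y =>
      f.norm_coe_le_norm _
    have := hP.const_mul (1 / n)
    convert this using 1
    have h2 := hint (fun x => (f x : ℂ)) (by fun_prop)
    rw [integral_complex_ofReal, ← e] at h2
    exact ofReal_injective (h2.trans (by push_cast; rfl))
  · rw [charFun_apply_real, hint _ (by fun_prop)]
    congr 2 with y
    congr 2
    push_cast
    ring

theorem IsCauchyContour.const_mul (hΓ : IsCauchyContour Γ w V) {r : ℝ}
    (hr : 0 < r) : IsCauchyContour (fun s => r * Γ s) (fun s => r * w s) ((r * · : ℂ → ℂ) '' V) := by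
  have hr' : (r : ℂ) ≠ 0 := by exact_mod_cast hr.ne'
  have hb : ∀ {g : ℝ → ℂ}, (∃ R, ∀ s ∈ Icc (0 : ℝ) 1, ‖g s‖ ≤ R) →
      ∃ R, ∀ s ∈ Icc (0 : ℝ) 1, ‖r * g s‖ ≤ R := fun ⟨R, hR⟩ => ⟨‖(r : ℂ)‖ * R, fun s hs => by
    rw [norm_mul]
    exact mul_le_mul_of_nonneg_left (hR s hs) (norm_nonneg _)⟩
  refine ⟨(Homeomorph.mulLeft₀ _ hr').isOpenMap V hΓ.isOpen, hΓ.measurable_path.const_mul _, hΓ.measurable_weight.const_mul _, hb hΓ.bounded_path,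
    hb hΓ.bounded_weight, ?_, ?_⟩
  · obtain ⟨c, hc, h⟩ := hΓ.separated
    refine ⟨r * c, mul_pos hr hc, ?_⟩
    rintro s hs _ ⟨z, hz, rfl⟩
    simp only
    rw [← mul_sub, norm_mul, norm_real, norm_of_nonneg hr.le]
    exact mul_le_mul_of_nonneg_left (h s hs z hz) hr.le
  · rintro f hf _ ⟨z, hz, rfl⟩
    simp only
    rw [← hΓ.cauchy (fun v => f (r * v)) (by fun_prop) z hz, contourIntegral, contourIntegral]
    congr 1 with s
    rw [← mul_sub]
    field_simp

theorem norm_one_add_div_pow_le (z : ℂ) {m n : ℕ} (h : m ≤ n) :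
    ‖(1 + z / n) ^ m‖ ≤ exp ‖z‖ := by
  rcases n.eq_zero_or_pos with rfl | hn
  · simp [Nat.le_zero.mp h]
  · have hn' : (0 : ℝ) < n := Nat.cast_pos.mpr hn
    have h1 : ‖1 + z / n‖ ≤ exp (‖z‖ / n) := by
      refine (norm_add_le _ _).trans ?_
      rw [norm_one, norm_div, Complex.norm_natCast, add_comm]
      exact Real.add_one_le_exp _
    rw [norm_pow]
    refine (pow_le_pow_left₀ (norm_nonneg _) h1 m).trans ?_
    rw [← Real.exp_nat_mul]
    refine Real.exp_le_exp.mpr ?_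
    rw [mul_div_left_comm]
    exact mul_le_of_le_one_right (norm_nonneg z)
      ((div_le_one hn').mpr (Nat.cast_le.mpr h))

theorem tendsto_one_add_div_pow {m : ℕ → ℕ} {p : ℝ}
    (hm : Tendsto (fun n => (m n : ℝ) / n) atTop (𝓝 p)) (z : ℂ) :
    Tendsto (fun n : ℕ => (1 + z / n) ^ m n) atTop (𝓝 (cexp (p * z))) := by
  have hz : Tendsto (fun n : ℕ => (n : ℂ) * (z / n)) atTop (𝓝 z) :=
    tendsto_const_nhds.congr' ((eventually_ne_atTop 0).mono fun n hn => by
      have : (n : ℂ) ≠ 0 := Nat.cast_ne_zero.mpr hn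
      field_simp)
  have h1 := ((Complex.continuous_ofReal.tendsto p).comp hm).mul
    (Complex.tendsto_nat_mul_log_one_add_of_tendsto hz)
  have h0 : Tendsto (fun n : ℕ => 1 + z / n) atTop (𝓝 1) := by
    simpa using (tendsto_const_div_atTop_nhds_zero_nat z).const_add 1
  refine ((Complex.continuous_exp.tendsto _).comp h1).congr' ?_
  filter_upwards [eventually_ne_atTop 0, h0.eventually_ne one_ne_zero] with n hn hne
  have : (n : ℂ) ≠ 0 := Nat.cast_ne_zero.mpr hn
  simp only [comp_apply]
  push_cast
  rw [← mul_assoc, div_mul_cancel₀ _ this, exp_nat_mul, exp_log hne]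

/-- The map which straightens the limiting boundary curves at time `t`. -/
def spectralMap (p p' a b t : ℝ) (w : ℂ) : ℂ :=
  t * w + (1 - t) / 2 * (p / (w - a) + p' / (w - b))

theorem isLimitingMeanDensity_of_charFun {n1 : ℕ → ℕ} (hn1 : ∀ n, n1 n ≤ n) {p p' : ℝ}
    (hp : ∀ n, |(n1 n : ℝ) - p * n| ≤ 1) (hpp : p + p' = 1) {a b : ℝ} (hba : b ≤ a) (h0 : 0 < t) (h1 : t < 1) (hΓ : IsCauchyContour Γ w V)
    (haV : (a : ℂ) ∈ V) (hbV : (b : ℂ) ∈ V) {ν : Measure ℝ} [IsProbabilityMeasure ν]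
    (hν : ∀ k : ℝ, k ≠ 0 → charFun ν k = 2 / (k * (1 - t) * I) *
      contourIntegral Γ w fun w => cexp (k * I * spectralMap p p' a b t w)) :
    IsLimitingMeanDensity n1 b a t ν := by
  refine ⟨inferInstance, ?_⟩
  have hpn : Tendsto (fun n => (n1 n : ℝ) / n) atTop (𝓝 p) := by
    rw [tendsto_iff_norm_sub_tendsto_zero]
    refine squeeze_zero' (Eventually.of_forall fun n => norm_nonneg _) ?_
      tendsto_one_div_atTop_nhds_zero_nat
    filter_upwards [eventually_gt_atTop 0] with n hn
    have hn' : (0 : ℝ) < n := Nat.cast_pos.mpr hn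
    rw [norm_eq_abs, show (n1 n : ℝ) / n - p = ((n1 n : ℝ) - p * n) / n by field_simp,
      abs_div, abs_of_pos hn']
    exact div_le_div_of_nonneg_right (hp n) hn'.le
  have hpn' : Tendsto (fun n => ((n - n1 n : ℕ) : ℝ) / n) atTop (𝓝 p') := by
    rw [show p' = 1 - p by linarith]
    refine (hpn.const_sub 1).congr' ((eventually_ne_atTop 0).mono fun n hn => ?_)
    have : (n : ℝ) ≠ 0 := Nat.cast_ne_zero.mpr hn
    simp only [Nat.cast_sub (hn1 n)]
    field_simp
  obtain ⟨d, hd, hsep⟩ := hΓ.separated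
  have key : ∀ n : ℕ, 0 < n → ∃ μ : ProbabilityMeasure ℝ,
      (∀ f : ℝ →ᵇ ℝ, HasNonIntersectingExpectation n (n1 n) (b * √n) (a * √n) (fun _ : Fin 1 => t)
        (fun x => (1 / (n : ℝ)) * ∑ j, f (x 0 j / √n)) (∫ x, f x ∂(μ : Measure ℝ))) ∧
      ∀ k : ℝ, k ≠ 0 → charFun (μ : Measure ℝ) k = 2 / (k * (1 - t) * I) *
        contourIntegral Γ w fun v => cexp (k * t * v * I - k ^ 2 * t * (1 - t) / 4 / n) *
          ((1 + k * (1 - t) / 2 * I / (v - a) / n) ^ n1 n *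
            (1 + k * (1 - t) / 2 * I / (v - b) / n) ^ (n - n1 n) - 1) := by
    intro n hn
    have hr : 0 < √(n : ℝ) := Real.sqrt_pos.mpr (Nat.cast_pos.mpr hn)
    have hrc : ((√n : ℝ) : ℂ) ≠ 0 := by exact_mod_cast hr.ne'
    have hΓr := hΓ.const_mul hr
    have hδ : ∀ j : Fin n, (endPoints n (n1 n) (b * √n) (a * √n) j : ℂ) ∈
        ((√n : ℝ) * · : ℂ → ℂ) '' V := fun j => by
      unfold endPoints
      split_ifs
      · exact ⟨b, hbV, by push_cast; ring⟩
      · exact ⟨a, haV, by push_cast; ring⟩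
    obtain ⟨Γ1, w1, V1, hΓ1, h0V⟩ := exists_isCauchyContour_zero
    obtain ⟨μ, hμ, hμE, hμc⟩ := exists_isProbabilityMeasure_charFun hn hΓ1 hΓr
      (mul_le_mul_of_nonneg_right hba hr.le) h0V hδ h0 h1 (√n)
    refine ⟨⟨μ, hμ⟩, hμE, fun k hk => (hμc k).trans ?_⟩
    rw [integral_exp_mul_meanDensity_eq hΓ1 hΓr h0V hδ h0 h1
      (div_ne_zero hk hr.ne'), contourIntegral, contourIntegral, ← integral_const_mul,
      ← integral_const_mul, ← integral_const_mul]
    refine setIntegral_congr_fun measurableSet_Icc fun s hs => ?_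
    have ha0 := hΓ.sub_ne_zero hs haV
    have hb0 := hΓ.sub_ne_zero hs hbV
    have hn2 : (n : ℂ) = ((√n : ℝ) : ℂ) ^ 2 := by
      rw [← ofReal_pow, sq_sqrt (Nat.cast_nonneg n), Complex.ofReal_natCast]
    simp only [nodal_endPoints (hn1 n)]
    have e : ∀ {x : ℝ}, Γ s - x ≠ 0 → 1 + k * (1 - t) / 2 * I / (Γ s - x) / n =
        ((√n : ℝ) * Γ s + (k / √n : ℝ) * (1 - t) / 2 * I - (x * √n : ℝ)) /
          ((√n : ℝ) * Γ s - (x * √n : ℝ)) := fun {x} hx => by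
      push_cast
      rw [mul_comm (x : ℂ), ← mul_sub, hn2]
      field_simp
      ring
    have ee : (((k / √n : ℝ) : ℂ) * t * ((√n : ℝ) * Γ s) * I -
        ((k / √n : ℝ) : ℂ) ^ 2 * t * (1 - t) / 4) =
        k * t * Γ s * I - k ^ 2 * t * (1 - t) / 4 / n := by
      push_cast
      rw [hn2]
      field_simp
    rw [e ha0, e hb0, div_pow, div_pow, div_mul_div_comm, ee, hn2]
    push_cast
    field_simp
  choose! μ hμE hμc using key
  have hlim : Tendsto μ atTop (𝓝 (⟨ν, inferInstance⟩ : ProbabilityMeasure ℝ)) := by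
    refine ProbabilityMeasure.tendsto_of_tendsto_charFun fun k => ?_
    rcases eq_or_ne k 0 with rfl | hk
    · simp [charFun_zero]
    simp only [ProbabilityMeasure.coe_mk]
    rw [hν k hk]
    refine Tendsto.congr' ((eventually_gt_atTop 0).mono fun n hn => (hμc n hn k hk).symm)
      (Tendsto.const_mul _ ?_)
    obtain ⟨R, hR⟩ := hΓ.bounded_path
    set α : ℂ := k * (1 - t) / 2 * I with hα
    have hdiv : ∀ {x : ℂ}, x ∈ V →
        ∀ s ∈ Icc (0 : ℝ) 1, ‖α / (Γ s - x)‖ ≤ ‖α‖ / d := fun {x} hx s hs => by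
      rw [norm_div]
      exact div_le_div_of_nonneg_left (norm_nonneg _) hd (hsep s hs x hx)
    have hexp : ∀ {x : ℂ} {B : ℝ}, ‖x‖ ≤ B → ‖cexp x‖ ≤ exp B := fun {x B} hx =>
      (Complex.norm_exp_le_exp_norm x).trans (Real.exp_le_exp.mpr hx)
    have hlin : ∀ s ∈ Icc (0 : ℝ) 1, ‖k * t * Γ s * I‖ ≤ |k * t| * R := fun s hs => by
      rw [norm_mul, norm_I, mul_one, norm_mul, ← ofReal_mul, norm_real]
      exact mul_le_mul_of_nonneg_left (hR s hs) (norm_nonneg _)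
    have hz : ∀ v : ℂ, cexp (k * I * spectralMap p p' a b t v) =
        cexp (k * t * v * I) * (cexp (p * (α / (v - a))) *
          cexp (p' * (α / (v - b)))) := fun v => by
      rw [← exp_add, ← exp_add, spectralMap, hα]
      congr 1
      ring
    have hsplit : contourIntegral Γ w (fun v => cexp (k * I *
        spectralMap p p' a b t v)) = contourIntegral Γ w fun v => cexp (k * t * v * I) *
        (cexp (p * (α / (v - a))) * cexp (p' * (α / (v - b))) - 1) := by
      have h3 := integral_entire_eq_zero hΓ haV
        (f := fun v => cexp (k * t * v * I)) (by fun_prop)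
      simp only [hz, mul_sub, mul_one]
      rw [contourIntegral, ← sub_zero (∫ _ in _, _), ← h3, contourIntegral, contourIntegral,
        ← integral_sub (hΓ.integrable (g := fun v => cexp (k * t * v * I) *
          (cexp (p * (α / (v - a))) * cexp (p' * (α / (v - b)))))
          (B := exp (|k * t| * R) * (exp (‖(p : ℂ)‖ * (‖α‖ / d)) *
            exp (‖(p' : ℂ)‖ * (‖α‖ / d)))) (by fun_prop) fun s hs => ?_)
        (hΓ.integrable (g := fun v => cexp (k * t * v * I)) (by fun_prop)
          fun s hs => hexp (hlin s hs))]
      · simp only [sub_mul]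
      · rw [norm_mul, norm_mul]
        have := hexp (hlin s hs)
        have h4 := hexp ((norm_mul _ _).trans_le (mul_le_mul_of_nonneg_left (hdiv haV s hs)
          (norm_nonneg (p : ℂ))))
        have h5 := hexp ((norm_mul _ _).trans_le (mul_le_mul_of_nonneg_left (hdiv hbV s hs)
          (norm_nonneg (p' : ℂ))))
        gcongr
    rw [hsplit]
    refine hΓ.tendsto (B := exp (|k * t| * R) * (exp (‖α‖ / d) * exp (‖α‖ / d) + 1))
      (Eventually.of_forall fun n => by fun_prop) (Eventually.of_forall fun n s hs => ?_)
      fun s hs => ?_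
    · rw [norm_mul]
      refine mul_le_mul ?_ ((norm_sub_le _ _).trans (add_le_add ?_ norm_one.le)) (norm_nonneg _)
        (exp_pos _).le
      · rw [norm_exp, Real.exp_le_exp, sub_re]
        have e : ((k : ℂ) ^ 2 * t * (1 - t) / 4 / n).re = k ^ 2 * t * (1 - t) / 4 / n := by
          rw [← ofReal_re (k ^ 2 * t * (1 - t) / 4 / n)]
          congr 1
          push_cast
          rfl
        have : 0 ≤ k ^ 2 * t * (1 - t) / 4 / n := by have := sub_pos.mpr h1; positivity
        linarith [(re_le_norm _).trans (hlin s hs)]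
      · rw [norm_mul]
        exact mul_le_mul ((norm_one_add_div_pow_le _ (hn1 n)).trans (Real.exp_le_exp.mpr
          (hdiv haV s hs))) ((norm_one_add_div_pow_le _ (Nat.sub_le _ _)).trans
          (Real.exp_le_exp.mpr (hdiv hbV s hs))) (norm_nonneg _) (exp_pos _).le
    · refine Tendsto.mul ?_ (((tendsto_one_add_div_pow hpn _).mul
        (tendsto_one_add_div_pow hpn' _)).sub_const 1)
      refine (Complex.continuous_exp.tendsto _).comp ?_
      simpa using (tendsto_const_div_atTop_nhds_zero_nat
        ((k : ℂ) ^ 2 * t * (1 - t) / 4)).const_sub ((k : ℂ) * t * Γ s * I)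
  refine fun f => ⟨fun n => ∫ x, f x ∂(μ n : Measure ℝ),
    (eventually_gt_atTop 0).mono fun n hn => hμE n hn f, ?_⟩
  exact ProbabilityMeasure.tendsto_iff_forall_integral_tendsto.mp hlim f

theorem exists_hasDerivAt_of_starConvex {U : Set ℂ} (hU : IsOpen U) {c : ℂ} (hc : StarConvex ℝ c U)
    (hf : DifferentiableOn ℂ f U) : ∃ H : ℂ → ℂ, ∀ z ∈ U, HasDerivAt H (f z) z := by
  refine ⟨fun z => curveIntegral (fun x => smulRightL ℂ ℂ ℂ 1 (f x))
    (.segment c z), fun z hz => ?_⟩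
  obtain ⟨r, hr, hball⟩ := Metric.isOpen_iff.mp hU z hz
  have hsub : convexHull ℝ (insert c (ball z r)) ⊆ U := by
    rw [convexHull_insert ⟨z, mem_ball_self hr⟩, (convex_ball z r).convexHull_eq]
    intro w hw
    obtain ⟨x, hx, y, hy, h⟩ := mem_convexJoin.mp hw
    rw [mem_singleton_iff.mp hx] at h
    exact hc.segment_subset (hball hy) h
  have hsn : convexHull ℝ (insert c (ball z r)) ∈ 𝓝 z :=
    mem_of_superset (Metric.ball_mem_nhds z hr)
      ((subset_insert _ _).trans (subset_convexHull ℝ _))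
  have := (convex_convexHull ℝ (insert c (ball z r))
    ).hasFDerivWithinAt_curveIntegral_segment_of_hasFDerivWithinAt_symmetric
    (ω := fun x => smulRightL ℂ ℂ ℂ 1 (f x)) (fun x hx =>
      ((smulRightL ℂ ℂ ℂ 1).hasFDerivAt.comp_hasDerivWithinAt x
        ((hf.mono hsub) x hx).hasDerivWithinAt).restrictScalars ℝ)
    (fun x _ y _ w _ => by simp [mul_left_comm]) (subset_convexHull ℝ _ (mem_insert c _))
    (mem_of_mem_nhds hsn)
  exact this.hasFDerivAt hsn

theorem exists_primitive_halfPlane {a b : ℝ}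
    (hf : ∀ w : ℂ, w ≠ a → w ≠ b → DifferentiableAt ℂ f w) {ε : ℝ} (hε : ε ≠ 0) :
    ∃ H : ℂ → ℂ, ∀ w : ℂ, 0 ≤ ε * w.im → w ≠ a → w ≠ b → HasDerivAt H (f w) w := by
  set c : ℂ := ε * I
  have hc : ∀ x : ℝ, c - x ≠ 0 := fun x h => hε (by simpa [c] using congrArg im h)
  have hopen : ∀ x : ℝ, IsOpen {w : ℂ | (w - x) / (c - x) ∈ slitPlane} := fun x =>
    Complex.isOpen_slitPlane.preimage (by fun_prop)
  have hstar : ∀ x : ℝ, StarConvex ℝ c {w : ℂ | (w - x) / (c - x) ∈ slitPlane} := by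
    intro x w hw α β hα hβ h
    have := Complex.starConvex_one_slitPlane hw hα hβ h
    rw [Set.mem_ofPred_eq]
    convert this using 1
    have h' : (α : ℂ) + β = 1 := by exact_mod_cast h
    have := hc x
    simp only [real_smul]
    field_simp
    linear_combination (x : ℂ) * h'
  have hmem : ∀ (x : ℝ) (w : ℂ), 0 ≤ ε * w.im → w ≠ x →
      (w - x) / (c - x) ∈ slitPlane := by
    intro x w hw hne
    by_contra h
    rw [Complex.mem_slitPlane_iff, not_or, not_lt, not_not] at h
    obtain ⟨h1, h2⟩ := h
    have h3 := (div_eq_iff (hc x)).mp (Complex.ext rfl (by simpa using h2) :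
      (w - x) / (c - x) = (((w - x) / (c - x)).re : ℂ))
    have h4 := congrArg im h3
    simp [c] at h4
    have h5 : ((w - x) / (c - x)).re = 0 := by
      refine le_antisymm h1 ?_
      rw [h4] at hw
      have : 0 < ε ^ 2 := by positivity
      nlinarith
    rw [h5, ofReal_zero, zero_mul, sub_eq_zero] at h3
    exact hne h3
  obtain ⟨H, hH⟩ := exists_hasDerivAt_of_starConvex ((hopen a).inter (hopen b))
    ((hstar a).inter (hstar b)) (f := f) fun w hw => (hf w
      (fun h => Complex.zero_notMem_slitPlane (by simpa [h] using hw.1))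
      (fun h => Complex.zero_notMem_slitPlane (by simpa [h] using hw.2))).differentiableWithinAt
  exact ⟨H, fun w h ha hb => hH w ⟨hmem a w h ha, hmem b w h hb⟩⟩

theorem diamond_ne {x z h : ℝ} (hh : h ≠ 0) (hx : |x - (z + h)| ≠ |h|) {w : ℂ} (hw : w ∈ diamond) :
    (z + h * (1 + w) : ℂ) ≠ x := by
  intro e
  have h1 := congrArg re e
  have h2 := congrArg im e
  have h3 : |w.re| + |w.im| = 1 := hw
  simp only [add_re, add_im, ofReal_re, ofReal_im,
    re_ofReal_mul, im_ofReal_mul, one_re, one_im, zero_add,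
    mul_eq_zero, hh, false_or] at h1 h2
  rw [h2, abs_zero, add_zero] at h3
  rw [← h1, show z + h * (1 + w.re) - (z + h) = h * w.re by ring, abs_mul, h3, mul_one] at hx
  exact hx rfl

theorem continuousOn_diamond {a b z h : ℝ}
    (hf : ∀ w : ℂ, w ≠ a → w ≠ b → DifferentiableAt ℂ f w) (hh : h ≠ 0)
    (ha : |a - (z + h)| ≠ |h|) (hb : |b - (z + h)| ≠ |h|) :
    ContinuousOn (fun w => f (z + h * (1 + w))) diamond := fun w hw =>
  (ContinuousAt.comp (f := fun w : ℂ => (z + h * (1 + w) : ℂ))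
    (hf _ (diamond_ne hh ha hw) (diamond_ne hh hb hw)).continuousAt
    (by fun_prop)).continuousWithinAt

theorem armsIntegral_eq_of_halfPlane_primitives {f H H' : ℂ → ℂ} {a b z h : ℝ}
    (hf : ∀ w : ℂ, w ≠ a → w ≠ b → DifferentiableAt ℂ f w)
    (hH : ∀ w : ℂ, 0 ≤ h * w.im → w ≠ a → w ≠ b → HasDerivAt H (f w) w)
    (hH' : ∀ w : ℂ, h * w.im ≤ 0 → w ≠ a → w ≠ b → HasDerivAt H' (f w) w) (hh : h ≠ 0)
    (ha : |a - (z + h)| ≠ |h|) (hb : |b - (z + h)| ≠ |h|) :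
    armsIntegral h (fun v => f (z + v)) =
      (H' (z + h * 2) - H' z) - (H (z + h * 2) - H z) := by
  have hc := continuousOn_diamond hf hh ha hb
  have key : ∀ {e : ℝ} {G : ℂ → ℂ}, |e| = 1 → (∀ w : ℂ, 0 ≤ e * (h * w.im) → w ≠ a → w ≠ b →
      HasDerivAt G (f w) w) → ∫ r in (0 : ℝ)..2, f (z + h * armPath e r) * (h * armDeriv e r) =
        G (z + h * 2) - G z := fun {e G} he hG => by
    rw [integral_arm_eq_sub (g := fun v => f (z + v)) (G := fun v => G (z + v)) hc he fun r hr => ?_,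
      add_zero]
    have hm := armPath_sub_one_mem_diamond he hr
    have h1 := fun {x : ℝ} (hx : |x - (z + h)| ≠ |h|) => diamond_ne hh hx hm
    rw [add_sub_cancel] at h1
    refine HasDerivAt.comp_const_add _ _ (hG _ ?_ (h1 ha) (h1 hb))
    have h0 : 0 ≤ min r (2 - r) := le_min hr.1 (by linarith [hr.2])
    have : e * (h * (z + h * armPath e r : ℂ).im) = (e * h) ^ 2 * min r (2 - r) := by
      simp [armPath]
      ring
    rw [this]
    positivity
  rw [armsIntegral, key (by simp) fun w hw => hH' w (by linarith),
    key (by simp) fun w hw => hH w (by linarith)]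

section hodograph

variable {p p' a b L : ℝ}

/-- The real part of the points mapped to the real line, in terms of `P = p / |w - a| ^ 2`. -/
def curveRe (p p' a b L P : ℝ) : ℝ := (a + b) / 2 - (p / P - p' / (L - P)) / (2 * (a - b))

/-- The square of the imaginary part of the points mapped to the real line. -/
def curveImSq (p p' a b L P : ℝ) : ℝ := p / P - (curveRe p p' a b L P - a) ^ 2

/-- The image of these points. -/
def curveMap (p p' a b t P : ℝ) : ℝ :=
  2 * t * curveRe p p' a b (2 * t / (1 - t)) P -
    (1 - t) / 2 * ((a - b) * P + 2 * t / (1 - t) * b)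

theorem curveImSq_eq (hba : b < a) (P : ℝ) :
    curveImSq p p' a b L P = p' / (L - P) - (curveRe p p' a b L P - b) ^ 2 := by
  have := (sub_pos.mpr hba).ne'
  unfold curveImSq curveRe
  field_simp
  ring

theorem spectralMap_eq_curveMap (hba : b < a) (h1 : t < 1) {P s : ℝ}
    (hP : P ∈ Ioo 0 (2 * t / (1 - t))) (hp : 0 < p) (hp' : 0 < p')
    (hs : s ^ 2 = curveImSq p p' a b (2 * t / (1 - t)) P) :
    spectralMap p p' a b t (curveRe p p' a b (2 * t / (1 - t)) P + s * I) =
      curveMap p p' a b t P := by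
  have hd := (sub_pos.mpr hba).ne'
  have h1' := (sub_pos.mpr h1).ne'
  have hQ := sub_pos.mpr hP.2
  unfold curveMap
  have e2 := hs.trans (curveImSq_eq hba P)
  rw [curveImSq] at hs
  set ξ := curveRe p p' a b (2 * t / (1 - t)) P
  set Q := 2 * t / (1 - t) - P with hQdef
  have inv : ∀ {x c R : ℝ}, 0 < R → 0 < c → s ^ 2 = c / R - (ξ - x) ^ 2 →
      (c : ℂ) / (ξ + s * I - x) = R * (ξ - x - s * I) := by
    intro x c R hR hc h
    have h2 : (ξ - x) ^ 2 + s ^ 2 = c / R := by linarith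
    have h3 : ((ξ : ℂ) - x) ^ 2 + s ^ 2 = c / R := by exact_mod_cast h2
    have hR' : (R : ℂ) ≠ 0 := by exact_mod_cast hR.ne'
    have h4 : (ξ + s * I - x : ℂ) * (ξ - x - s * I) = c / R := by
      rw [← h3]
      linear_combination -(s : ℂ) ^ 2 * I_sq
    have h5 : (ξ + s * I - x : ℂ) ≠ 0 := fun h0 => by
      rw [h0, zero_mul] at h4
      have := div_ne_zero (by exact_mod_cast hc.ne' : (c : ℂ) ≠ 0) hR'
      exact this h4.symm
    rw [div_eq_iff h5, mul_assoc, mul_comm (_ - _), h4]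
    field_simp
  rw [spectralMap, inv hP.1 hp hs, inv hQ hp' e2]
  have hPQ : (P : ℂ) + Q = 2 * t / (1 - t) := by
    rw [hQdef]; push_cast; ring
  have h1c : (1 - t : ℂ) ≠ 0 := by exact_mod_cast h1'
  have hPQ' : ((P : ℂ) + Q) * (1 - t) = 2 * t := by rw [hPQ]; field_simp
  have e : (2 * t / (1 - t) : ℂ) = P + Q := hPQ.symm
  push_cast
  rw [e]
  linear_combination ((ξ - s * I : ℂ) / 2) * hPQ'

theorem hasDerivAt_curveRe {P : ℝ} (hP : P ∈ Ioo 0 L) : HasDerivAt (curveRe p p' a b L)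
    ((p / P ^ 2 + p' / (L - P) ^ 2) / (2 * (a - b))) P := by
  have h1 := ((hasDerivAt_id' P).fun_inv hP.1.ne').const_mul p
  have h2 := (((hasDerivAt_id' P).const_sub L).fun_inv (sub_pos.mpr hP.2).ne').const_mul p'
  have h3 := ((h1.sub h2).div_const (2 * (a - b))).const_sub ((a + b) / 2)
  exact h3.congr_deriv (by ring)

theorem strictMonoOn_curveRe (hba : b < a) (hp : 0 < p) (hp' : 0 < p') :
    StrictMonoOn (curveRe p p' a b L) (Ioo 0 L) := by
  refine strictMonoOn_of_deriv_pos (convex_Ioo 0 L)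
    (fun P hP => (hasDerivAt_curveRe hP).continuousAt.continuousWithinAt) fun P hP => ?_
  rw [interior_Ioo] at hP
  rw [(hasDerivAt_curveRe hP).deriv]
  have := sub_pos.mpr hba
  have := sub_pos.mpr hP.2
  have := hP.1
  positivity

theorem hasDerivAt_curveImSq {P : ℝ} (hP : P ∈ Ioo 0 L) : HasDerivAt (curveImSq p p' a b L)
    (-p / P ^ 2 - 2 * (curveRe p p' a b L P - a) *
      ((p / P ^ 2 + p' / (L - P) ^ 2) / (2 * (a - b)))) P := by
  have h1 := ((hasDerivAt_id' P).fun_inv hP.1.ne').const_mul p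
  refine (h1.sub (((hasDerivAt_curveRe hP).sub_const a).pow 2)).congr_deriv ?_
  simp only [Nat.cast_ofNat, Nat.add_one_sub_one, pow_one]
  ring

/-- The derivative of `curveMap`. -/
def curveMapDeriv (p p' a b t P : ℝ) : ℝ :=
  2 * t * ((p / P ^ 2 + p' / (2 * t / (1 - t) - P) ^ 2) / (2 * (a - b))) - (1 - t) / 2 * (a - b)

theorem hasDerivAt_curveMap {t P : ℝ} (hP : P ∈ Ioo 0 (2 * t / (1 - t))) :
    HasDerivAt (curveMap p p' a b t) (curveMapDeriv p p' a b t P) P := by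
  refine (((hasDerivAt_curveRe hP).const_mul (2 * t)).sub
    ((((hasDerivAt_id' P).const_mul (a - b)).add_const (2 * t / (1 - t) * b)).const_mul
      ((1 - t) / 2))).congr_deriv ?_
  rw [curveMapDeriv]
  ring

theorem curveMapDeriv_pos (hba : b < a) (h1 : t < 1) {P : ℝ}
    (hP : P ∈ Ioo 0 (2 * t / (1 - t))) (h : 0 < curveImSq p p' a b (2 * t / (1 - t)) P) :
    0 < curveMapDeriv p p' a b t P := by
  have hd := sub_pos.mpr hba
  have h1' := sub_pos.mpr h1
  have hQ := sub_pos.mpr hP.2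
  have e2 := curveImSq_eq hba P ▸ h
  rw [curveImSq] at h
  have ht : 2 * t = (1 - t) * (P + (2 * t / (1 - t) - P)) := by field_simp; ring
  rw [curveMapDeriv]
  rw [sub_pos] at h e2
  set ξ := curveRe p p' a b (2 * t / (1 - t)) P
  set Q := 2 * t / (1 - t) - P
  have hP0 := hP.1
  have k1 : (a - ξ) ^ 2 / P < p / P ^ 2 := by
    rw [show (a - ξ) ^ 2 = (ξ - a) ^ 2 by ring, sq P, ← div_div]
    exact div_lt_div_of_pos_right h hP0
  have k2 : (ξ - b) ^ 2 / Q < p' / Q ^ 2 := by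
    rw [sq Q, ← div_div]
    exact div_lt_div_of_pos_right e2 hQ
  have k3 : (a - b) ^ 2 ≤ (P + Q) * ((a - ξ) ^ 2 / P + (ξ - b) ^ 2 / Q) := by
    have : (P + Q) * ((a - ξ) ^ 2 / P + (ξ - b) ^ 2 / Q) - (a - b) ^ 2 =
        (Q * (a - ξ) - P * (ξ - b)) ^ 2 / (P * Q) := by
      field_simp
      ring
    have : 0 ≤ (Q * (a - ξ) - P * (ξ - b)) ^ 2 / (P * Q) := by positivity
    linarith
  have k4 : (a - b) ^ 2 < (P + Q) * (p / P ^ 2 + p' / Q ^ 2) :=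
    k3.trans_lt (mul_lt_mul_of_pos_left (add_lt_add k1 k2) (by positivity))
  have : 2 * t * ((p / P ^ 2 + p' / Q ^ 2) / (2 * (a - b))) - (1 - t) / 2 * (a - b) =
      (1 - t) / (2 * (a - b)) * ((P + Q) * (p / P ^ 2 + p' / Q ^ 2) - (a - b) ^ 2) := by
    rw [ht]
    field_simp
  rw [this]
  exact mul_pos (by positivity) (sub_pos.mpr k4)

theorem finite_curveImSq_eq_zero (hba : b < a) (hp : 0 < p) (hL : 0 < L) :
    {P | P ∈ Ioo 0 L ∧ curveImSq p p' a b L P = 0}.Finite := by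
  have hd := (sub_pos.mpr hba).ne'
  set R : Polynomial ℝ := Polynomial.C (4 * (a - b) ^ 2 * p) * Polynomial.X *
    (Polynomial.C L - Polynomial.X) ^ 2 - (Polynomial.C ((a - b) ^ 2) * Polynomial.X *
    (Polynomial.C L - Polynomial.X) + Polynomial.C p * (Polynomial.C L - Polynomial.X) -
    Polynomial.C p' * Polynomial.X) ^ 2 with hR
  have h0 : R ≠ 0 := fun h => by
    have := congrArg (Polynomial.eval 0) h
    simp [hR, hp.ne', hL.ne'] at this
  refine (Polynomial.finite_setOfPred_isRoot h0).subset fun P hP => ?_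
  obtain ⟨⟨hP0, hPL⟩, h⟩ := hP
  have hQ := (sub_pos.mpr hPL).ne'
  have hP0' := hP0.ne'
  have : R.eval P = 4 * (a - b) ^ 2 * P ^ 2 * (L - P) ^ 2 * curveImSq p p' a b L P := by
    simp only [hR, curveImSq, curveRe, Polynomial.eval_sub, Polynomial.eval_mul, Polynomial.eval_add,
      Polynomial.eval_pow, Polynomial.eval_C, Polynomial.eval_X]
    field_simp
    ring
  rw [Set.mem_ofPred_eq, Polynomial.IsRoot.def, this, h, mul_zero]

theorem curveRe_ne_of_curveImSq (hba : b < a) (hp : 0 < p) (hp' : 0 < p') {P : ℝ} (hP : P ∈ Ioo 0 L)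
    (h : curveImSq p p' a b L P ≤ 0) : curveRe p p' a b L P ≠ a ∧ curveRe p p' a b L P ≠ b := by
  have h' := curveImSq_eq hba P ▸ h
  have h1 := div_pos hp hP.1
  have h2 := div_pos hp' (sub_pos.mpr hP.2)
  rw [curveImSq] at h
  constructor <;> intro e
  · rw [e] at h; linarith
  · rw [e] at h'; linarith

/-- Cauchy's theorem for the functions of `spectralMap`: the contour is deformed to the curve which is
mapped to the real line. -/
theorem contourIntegral_spectralMap (hba : b < a) (hp : 0 < p) (hp' : 0 < p') (h0 : 0 < t)
    (h1 : t < 1) {z h : ℝ} (hh : 0 < h) (ha : |a - (z + h)| < h) (hb : |b - (z + h)| < h)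
    {P1 P2 : ℝ} (hP1 : 0 < P1) (h12 : P1 ≤ P2) (hP2 : P2 < 2 * t / (1 - t))
    (e₁ : curveRe p p' a b (2 * t / (1 - t)) P1 = z - 2 * h)
    (e₂ : curveRe p p' a b (2 * t / (1 - t)) P2 = z + 2 * h)
    (i1 : curveImSq p p' a b (2 * t / (1 - t)) P1 ≤ 0)
    (i2 : curveImSq p p' a b (2 * t / (1 - t)) P2 ≤ 0) {Ψ Ψ' : ℂ → ℂ}
    (hΨ : ∀ z, HasDerivAt Ψ (Ψ' z) z) (hΨ' : Continuous Ψ') :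
    contourIntegral (squarePath z h 1) (squareWeight h 1)
      (fun w => Ψ (spectralMap p p' a b t w)) = (π : ℂ)⁻¹ *
      ∫ P in P1..P2, (√(curveImSq p p' a b (2 * t / (1 - t)) P) * curveMapDeriv p p' a b t P : ℝ) *
        Ψ' (curveMap p p' a b t P) := by
  set ξ := curveRe p p' a b (2 * t / (1 - t))
  set X := curveImSq p p' a b (2 * t / (1 - t))
  set x := curveMap p p' a b t
  set f : ℂ → ℂ := fun w => Ψ (spectralMap p p' a b t w) with hfdef
  have hf : ∀ w : ℂ, w ≠ a → w ≠ b → DifferentiableAt ℂ f w := fun w ha hb =>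
    (hΨ _).differentiableAt.comp w (by
      have := sub_ne_zero.mpr ha
      have := sub_ne_zero.mpr hb
      unfold spectralMap
      fun_prop (disch := assumption))
  obtain ⟨H, hH⟩ := exists_primitive_halfPlane hf one_ne_zero
  obtain ⟨H', hH'⟩ := exists_primitive_halfPlane hf (neg_ne_zero.mpr one_ne_zero)
  simp only [one_mul] at hH
  simp only [neg_mul, one_mul, neg_nonneg] at hH'
  have n1 : ∀ {y : ℝ}, |y - (z + h)| < h → |y - (z + h)| ≠ |h| := fun hy => by
    rw [abs_of_pos hh]; exact hy.ne
  have n2 : ∀ {y : ℝ}, |y - (z + h)| < h → |y - (z + -(1 * h))| ≠ |-(1 * h)| := fun {y} hy => by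
    rw [one_mul, abs_neg, abs_of_pos hh]
    exact (lt_of_lt_of_le (by linarith [(abs_lt.mp hy).1]) (le_abs_self _)).ne'
  have hh' : -(1 * h) ≠ 0 := by simp [hh.ne']
  have z1 : (z + (-(1 * h) : ℝ) * 2 : ℂ) = ξ P1 := by rw [e₁]; push_cast; ring
  have z2 : (z + h * 2 : ℂ) = ξ P2 := by rw [e₂]; push_cast; ring
  rw [contourIntegral_square,
    armsIntegral_eq_of_halfPlane_primitives hf (fun w hw => hH w (by nlinarith))
      (fun w hw => hH' w (by nlinarith)) hh.ne' (n1 ha) (n1 hb),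
    armsIntegral_eq_of_halfPlane_primitives hf (fun w hw => hH' w (by nlinarith))
      (fun w hw => hH w (by nlinarith)) hh' (n2 ha) (n2 hb), z1, z2]
  rotate_left
  · rintro e (rfl | rfl)
    · exact continuousOn_diamond hf hh.ne' (n1 ha) (n1 hb)
    · exact continuousOn_diamond hf hh' (n2 ha) (n2 hb)
  have hIcc : ∀ P ∈ Icc P1 P2, P ∈ Ioo 0 (2 * t / (1 - t)) := fun P hP =>
    ⟨hP1.trans_le hP.1, hP.2.trans_lt hP2⟩
  have cξ : ContinuousOn ξ (Icc P1 P2) := fun P hP =>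
    (hasDerivAt_curveRe (hIcc P hP)).continuousAt.continuousWithinAt
  have cX : ContinuousOn X (Icc P1 P2) := fun P hP =>
    (hasDerivAt_curveImSq (hIcc P hP)).continuousAt.continuousWithinAt
  have cx : ContinuousOn x (Icc P1 P2) := fun P hP =>
    (hasDerivAt_curveMap (hIcc P hP)).continuousAt.continuousWithinAt
  have cx' : ContinuousOn (curveMapDeriv p p' a b t) (Icc P1 P2) := fun P hP => by
    have := (hIcc P hP).1.ne'
    have := (sub_pos.mpr (hIcc P hP).2).ne'
    unfold curveMapDeriv
    fun_prop (disch := positivity)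
  have cΨ : Continuous Ψ := continuous_iff_continuousAt.mpr fun z => (hΨ z).continuousAt
  have hcf := Complex.continuous_ofReal
  have hne : ∀ P ∈ Icc P1 P2, ∀ ε : ℝ, ε ≠ 0 → (ξ P + ε * √(X P) * I : ℂ) ≠ a ∧
      (ξ P + ε * √(X P) * I : ℂ) ≠ b := by
    intro P hP ε hε
    have key : ∀ y : ℝ, ξ P ≠ y ∨ 0 < X P → (ξ P + ε * √(X P) * I : ℂ) ≠ y := by
      intro y hy e
      have e1 := congrArg re e
      have e2 := congrArg im e
      simp [hε] at e1 e2
      rcases hy with hy | hy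
      · exact hy e1
      · exact (Real.sqrt_pos.mpr hy).ne' e2
    rcases lt_or_ge 0 (X P) with h | h
    · exact ⟨key a (.inr h), key b (.inr h)⟩
    · have := curveRe_ne_of_curveImSq hba hp hp' (hIcc P hP) h
      exact ⟨key a (.inl this.1), key b (.inl this.2)⟩
  set γ : ℝ → ℝ → ℂ := fun ε P => ξ P + ε * √(X P) * I
  have cγ : ∀ ε, ContinuousOn (γ ε) (Icc P1 P2) := fun ε => (hcf.comp_continuousOn cξ).add
    ((continuousOn_const.mul (hcf.comp_continuousOn cX.sqrt)).mul continuousOn_const)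
  have dH : ∀ P ∈ Icc P1 P2, HasDerivAt H (f (γ 1 P)) (γ 1 P) := fun P hP =>
    hH _ (by simp [γ, sqrt_nonneg]) (hne P hP 1 one_ne_zero).1 (hne P hP 1 one_ne_zero).2
  have dH' : ∀ P ∈ Icc P1 P2, HasDerivAt H' (f (γ (-1) P)) (γ (-1) P) := fun P hP =>
    hH' _ (by simp [γ, sqrt_nonneg]) (hne P hP (-1) (by norm_num)).1
      (hne P hP (-1) (by norm_num)).2
  set Φ : ℝ → ℂ := fun P => 2 * I * √(X P) * Ψ (x P) - (H (γ 1 P) - H' (γ (-1) P))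
  set g : ℝ → ℂ := fun P => (√(X P) * curveMapDeriv p p' a b t P : ℝ) * Ψ' (x P)
  have cg : ContinuousOn g (Icc P1 P2) := (hcf.comp_continuousOn (cX.sqrt.mul cx')).mul
    (hΨ'.comp_continuousOn (hcf.comp_continuousOn cx))
  have cΦ : ContinuousOn Φ (Icc P1 P2) := by
    refine ((continuousOn_const.mul (hcf.comp_continuousOn cX.sqrt)).mul
      (cΨ.comp_continuousOn (hcf.comp_continuousOn cx))).sub (ContinuousOn.sub ?_ ?_)
    · exact fun P hP => (dH P hP).continuousAt.comp_continuousWithinAt (cγ 1 P hP)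
    · exact fun P hP => (dH' P hP).continuousAt.comp_continuousWithinAt (cγ (-1) P hP)
  have hFTC := integral_eq_of_hasDerivAt_off_countable_of_le Φ (fun P => 2 * I * g P) h12
    (finite_curveImSq_eq_zero (p' := p') hba hp (div_pos (mul_pos two_pos h0) (sub_pos.mpr h1))).countable
    cΦ (fun P hP => by
      have hPI := hIcc P (Ioo_subset_Icc_self hP.1)
      have dξ := (hasDerivAt_curveRe (p := p) (p' := p') (a := a) (b := b) hPI).ofReal_comp
      have dx := (hasDerivAt_curveMap (p := p) (p' := p') (a := a) (b := b) hPI)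
      have dΨ := (hΨ (x P)).comp P dx.ofReal_comp
      have hX0 : X P ≠ 0 := fun h => hP.2 ⟨hPI, h⟩
      have dX := hasDerivAt_curveImSq (p := p) (p' := p') (a := a) (b := b) hPI
      obtain ⟨s', F, ds, f1, f2, hs'⟩ : ∃ (s' : ℝ) (F : ℂ), HasDerivAt (fun P => √(X P)) s' P ∧
          f (γ 1 P) = F ∧ f (γ (-1) P) = F ∧ s' * (F - Ψ (x P)) = 0 := by
        rcases lt_or_gt_of_ne hX0 with h | h
        · refine ⟨0, f (ξ P), ?_, ?_, ?_, by simp⟩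
          · refine (hasDerivAt_const P (0 : ℝ)).congr_of_eventuallyEq ?_
            filter_upwards [dX.continuousAt.eventually_lt_const h] with P' h'
            exact Real.sqrt_eq_zero_of_nonpos (le_of_lt h')
          all_goals simp [γ, Real.sqrt_eq_zero_of_nonpos h.le]
        · have hF : ∀ ε : ℝ, ε ^ 2 = 1 → f (γ ε P) = Ψ (x P) := fun ε hε => by
            rw [hfdef]
            have := spectralMap_eq_curveMap hba h1 hPI hp hp' (s := ε * √(X P))
              (by rw [mul_pow, hε, one_mul, sq_sqrt h.le])
            simp only [γ]
            rw [← this]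
            push_cast
            rfl
          exact ⟨_, _, dX.sqrt hX0, hF 1 (by norm_num), hF (-1) (by norm_num), by simp⟩
      have dγ : ∀ ε : ℝ, HasDerivAt (γ ε) _ P := fun ε =>
        dξ.add ((ds.ofReal_comp.const_mul (ε : ℂ)).mul_const I)
      have d1 := (dH P (Ioo_subset_Icc_self hP.1)).comp P (dγ 1)
      have d2 := (dH' P (Ioo_subset_Icc_self hP.1)).comp P (dγ (-1))
      refine (((ds.ofReal_comp.const_mul (2 * I)).mul dΨ).sub (d1.sub d2)).congr_deriv ?_
      rw [f1, f2]
      simp only [g, comp_apply]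
      push_cast
      linear_combination (-2 * I) * hs')
    ((cg.const_mul _).intervalIntegrable_of_Icc h12)
  rw [intervalIntegral.integral_const_mul] at hFTC
  have hend : ∀ P, X P ≤ 0 → Φ P = -(H (ξ P) - H' (ξ P)) := fun P h => by
    simp [Φ, γ, Real.sqrt_eq_zero_of_nonpos h]
  rw [hend _ i1, hend _ i2] at hFTC
  have hpi : (π : ℂ) ≠ 0 := by exact_mod_cast pi_pos.ne'
  have hI := I_ne_zero
  change _ = (π : ℂ)⁻¹ * ∫ P in P1..P2, g P
  rw [show ∫ P in P1..P2, g P = (2 * I)⁻¹ * (-(H (ξ P2) - H' (ξ P2)) -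
    -(H (ξ P1) - H' (ξ P1))) by rw [← hFTC]; field_simp]
  field_simp
  ring

end hodograph

section limitMeasure

variable {p p' a b : ℝ}

theorem exists_curveRe_eq (hba : b < a) (hp : 0 < p) (hp' : 0 < p') {L : ℝ} (hL : 0 < L) (y : ℝ) :
    ∃ P ∈ Ioo 0 L, curveRe p p' a b L P = y := by
  have hd := (sub_pos.mpr hba).ne'
  set f : ℝ → ℝ := fun P => p * (L - P) - p' * P - (a + b - 2 * y) * (a - b) * (P * (L - P))
  obtain ⟨P, hP, h⟩ := intermediate_value_Ioo' hL.le (f := f) (by fun_prop)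
    (show (0 : ℝ) ∈ Ioo (f L) (f 0) by simp only [f]; constructor <;> ring_nf <;> nlinarith)
  refine ⟨P, hP, ?_⟩
  have h1 := hP.1.ne'
  have h2 := (sub_pos.mpr hP.2).ne'
  rw [curveRe]
  simp only [f] at h
  field_simp
  linear_combination -h

/-- The positive density, with respect to `P`, of the limiting mean density. -/
def curveDensity (p p' a b t P : ℝ) : ℝ :=
  2 / (π * (1 - t)) * (√(curveImSq p p' a b (2 * t / (1 - t)) P) * curveMapDeriv p p' a b t P)

/-- The limiting mean density at time `t`. -/
def limitMeasure (p p' a b t : ℝ) : Measure ℝ :=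
  ((volume.restrict (Ioo 0 (2 * t / (1 - t)))).withDensity
    fun P => ENNReal.ofReal (curveDensity p p' a b t P)).map (curveMap p p' a b t)

theorem measurable_curveMap (t : ℝ) : Measurable (curveMap p p' a b t) := by
  unfold curveMap curveRe
  fun_prop

theorem measurable_curveDensity (t : ℝ) : Measurable (curveDensity p p' a b t) := by
  unfold curveDensity curveMapDeriv curveImSq curveRe
  fun_prop

theorem curveDensity_pos (hba : b < a) (h1 : t < 1) {P : ℝ}
    (hP : P ∈ Ioo 0 (2 * t / (1 - t))) (h : 0 < curveImSq p p' a b (2 * t / (1 - t)) P) :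
    0 < curveDensity p p' a b t P := by
  have := sub_pos.mpr h1
  exact mul_pos (by positivity) (mul_pos (Real.sqrt_pos.mpr h) (curveMapDeriv_pos hba h1 hP h))

theorem curveDensity_eq_zero {t P : ℝ} (h : curveImSq p p' a b (2 * t / (1 - t)) P ≤ 0) :
    curveDensity p p' a b t P = 0 := by
  rw [curveDensity, Real.sqrt_eq_zero_of_nonpos h, zero_mul, mul_zero]

theorem curveDensity_nonneg (hba : b < a) (h1 : t < 1) {P : ℝ}
    (hP : P ∈ Ioo 0 (2 * t / (1 - t))) : 0 ≤ curveDensity p p' a b t P := by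
  rcases le_or_gt (curveImSq p p' a b (2 * t / (1 - t)) P) 0 with h | h
  · exact (curveDensity_eq_zero h).ge
  · exact (curveDensity_pos hba h1 hP h).le

theorem support_limitMeasure (hba : b < a) (h1 : t < 1) :
    (limitMeasure p p' a b t).support = closure (curveMap p p' a b t ''
      {P | P ∈ Ioo 0 (2 * t / (1 - t)) ∧ 0 < curveImSq p p' a b (2 * t / (1 - t)) P}) := by
  have hm := measurable_curveMap (p := p) (p' := p') (a := a) (b := b) t
  have hd := (measurable_curveDensity (p := p) (p' := p') (a := a) (b := b) t).ennreal_ofReal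
  apply Subset.antisymm
  · refine Measure.support_subset_of_isClosed isClosed_closure ?_
    rw [mem_ae_iff, limitMeasure, Measure.map_apply hm isClosed_closure.measurableSet.compl,
      withDensity_apply _ (hm isClosed_closure.measurableSet.compl),
      setLIntegral_eq_zero_iff (hm isClosed_closure.measurableSet.compl) hd,
      ae_restrict_iff' measurableSet_Ioo]
    refine Eventually.of_forall fun P hP hP' => ENNReal.ofReal_of_nonpos
      (curveDensity_eq_zero ?_).le
    by_contra! h
    exact hP' (subset_closure ⟨P, ⟨hP, h⟩, rfl⟩)
  · refine closure_minimal ?_ Measure.isClosed_support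
    rintro _ ⟨P, ⟨hP, h⟩, rfl⟩
    rw [Measure.support_eq_forall_isOpen]
    intro U hPU hU
    rw [limitMeasure, Measure.map_apply hm hU.measurableSet, withDensity_apply _ (hm hU.measurableSet),
      setLIntegral_pos_iff hd, Measure.restrict_apply' measurableSet_Ioo]
    refine (Measure.measure_pos_of_mem_nhds volume (x := P) ?_)
    filter_upwards [(hasDerivAt_curveMap (p := p) (p' := p') (a := a) (b := b)
      hP).continuousAt.eventually_mem (hU.mem_nhds hPU), isOpen_Ioo.mem_nhds hP,
      (hasDerivAt_curveImSq (p := p) (p' := p') (a := a) (b := b)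
        hP).continuousAt.eventually_const_lt h] with P' i1 i2 i3
    exact ⟨⟨(ENNReal.ofReal_pos.mpr (curveDensity_pos hba h1 i2 i3)).ne', i1⟩, i2⟩

theorem abs_curveRe_sub_lt (hba : b < a) (hp : 0 < p) (hp' : 0 < p') {L P : ℝ}
    (hP : P ∈ Ioo 0 L) (h : 0 < curveImSq p p' a b L P) :
    |curveRe p p' a b L P - (a + b) / 2| < √(2 * (p + p') / L) + (a - b) / 2 := by
  have hL := hP.1.trans hP.2
  have h' := curveImSq_eq hba P ▸ h
  rw [curveImSq, sub_pos] at h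
  rw [sub_pos] at h'
  have hQ := sub_pos.mpr hP.2
  have key : ∀ c R : ℝ, 0 < c → c ≤ p + p' → L / 2 ≤ R → c / R ≤ 2 * (p + p') / L := by
    intro c R hc hc' hR
    rw [show 2 * (p + p') / L = (p + p') / (L / 2) by field_simp]
    exact div_le_div₀ (hc.le.trans hc') hc' (by positivity) hR
  rcases le_total (L / 2) P with hP2 | hP2
  · have := abs_lt.mp (Real.lt_sqrt_of_sq_lt ((sq_abs _).trans_lt
      (h.trans_le (key p P hp (by linarith) hP2))))
    rw [abs_lt]
    constructor <;> linarith [this.1, this.2]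
  · have := abs_lt.mp (Real.lt_sqrt_of_sq_lt ((sq_abs _).trans_lt
      (h'.trans_le (key p' (L - P) hp' (by linarith) (by linarith)))))
    rw [abs_lt]
    constructor <;> linarith [this.1, this.2]

theorem isLimitingMeanDensity_limitMeasure {n1 : ℕ → ℕ} (hn1 : ∀ n, n1 n ≤ n)
    (hpn : ∀ n, |(n1 n : ℝ) - p * n| ≤ 1) (hpp : p + p' = 1) (hba : b < a) (hp : 0 < p)
    (hp' : 0 < p') (h0 : 0 < t) (h1 : t < 1) :
    IsLimitingMeanDensity n1 b a t (limitMeasure p p' a b t) := by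
  have hd := sub_pos.mpr hba
  have h1' := sub_pos.mpr h1
  set L := 2 * t / (1 - t) with hL
  have hL0 : 0 < L := by positivity
  set R := 4 * (a - b) + √(2 * (p + p') / L) with hR
  have hR4 : 4 * (a - b) ≤ R := le_add_of_nonneg_right (sqrt_nonneg _)
  have hR0 : 0 < R := by linarith
  set c := (a + b) / 2 - R with hc
  obtain ⟨P1, m1, e1⟩ := exists_curveRe_eq hba hp hp' hL0 (c - 2 * R)
  obtain ⟨P2, m2, e2⟩ := exists_curveRe_eq hba hp hp' hL0 (c + 2 * R)
  have hmono := strictMonoOn_curveRe (L := L) hba hp hp'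
  have h12 : P1 ≤ P2 := (hmono.le_iff_le m1 m2).mp (by rw [e1, e2]; linarith)
  have hin : ∀ P ∈ Ioo 0 L, 0 < curveImSq p p' a b L P → P1 < P ∧ P < P2 := by
    intro P hP h
    have := abs_lt.mp (abs_curveRe_sub_lt hba hp hp' hP h)
    exact ⟨(hmono.lt_iff_lt m1 hP).mp (by rw [e1]; linarith [this.1]),
      (hmono.lt_iff_lt hP m2).mp (by rw [e2]; linarith [this.2])⟩
  have i1 : curveImSq p p' a b L P1 ≤ 0 := not_lt.mp fun h => (hin _ m1 h).1.false
  have i2 : curveImSq p p' a b L P2 ≤ 0 := not_lt.mp fun h => (hin _ m2 h).2.false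
  have hsub : Ioc P1 P2 ⊆ Ioo 0 L := fun P hP => ⟨m1.1.trans hP.1, hP.2.trans_lt m2.2⟩
  have hzero : ∀ P ∈ Ioo 0 L \ Ioc P1 P2, curveDensity p p' a b t P = 0 := fun P hP =>
    curveDensity_eq_zero (not_lt.mp fun h =>
      hP.2 ⟨(hin P hP.1 h).1, (hin P hP.1 h).2.le⟩)
  have hm := measurable_curveMap (p := p) (p' := p') (a := a) (b := b) t
  have hmd := measurable_curveDensity (p := p) (p' := p') (a := a) (b := b) t
  have hc4 : c + R = (a + b) / 2 := by rw [hc]; ring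
  have hac : |a - (c + R)| < R / 4 := by rw [abs_lt]; constructor <;> linarith
  have hbc : |b - (c + R)| < R / 4 := by rw [abs_lt]; constructor <;> linarith
  set Γ := squarePath c R 1
  set W := squareWeight R 1
  have hint : ∀ {Ψ Ψ' : ℂ → ℂ}, (∀ z, HasDerivAt Ψ (Ψ' z) z) → Continuous Ψ' →
      ∫ P in Ioo 0 L, (curveDensity p p' a b t P : ℂ) * Ψ' (curveMap p p' a b t P) =
        2 / (1 - t) * contourIntegral Γ W fun w => Ψ (spectralMap p p' a b t w) := by
    intro Ψ Ψ' hΨ hΨ'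
    rw [contourIntegral_spectralMap hba hp hp' h0 h1 hR0 (hac.trans (by linarith))
      (hbc.trans (by linarith)) m1.1 h12 m2.2 e1 e2 i1 i2 hΨ hΨ',
      integral_of_le h12,
      setIntegral_eq_of_subset_of_forall_sdiff_eq_zero measurableSet_Ioo hsub fun P hP => by
        rw [hzero P hP, ofReal_zero, zero_mul], ← mul_assoc, ← integral_const_mul]
    refine setIntegral_congr_fun measurableSet_Ioc fun P _ => ?_
    simp only [curveDensity]
    push_cast
    have : (π : ℂ) ≠ 0 := by exact_mod_cast pi_pos.ne'
    have : (1 - t : ℂ) ≠ 0 := by exact_mod_cast h1'.ne'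
    field_simp
  have hΓ := isCauchyContour_square c hR0 one_pos
  set V := ball ((c + R : ℝ) : ℂ) (R / 4) ∪ ball ((c - 1 * R : ℝ) : ℂ) (1 * R / 4)
  have hball : ∀ {x : ℝ}, |x - (c + R)| < R / 4 → (x : ℂ) ∈ V := fun hx => .inl (by
    rwa [mem_ball_iff_norm, ← Complex.ofReal_sub, norm_real])
  have ha := hball hac
  have hb := hball hbc
  have hone : (contourIntegral Γ W fun w => spectralMap p p' a b t w) = (1 - t) / 2 := by
    obtain ⟨r, hr, hsep⟩ := hΓ.separated
    obtain ⟨M, hM⟩ := hΓ.bounded_path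
    have hi : ∀ z ∈ V,
        IntegrableOn (fun s => (1 / (Γ s - z)) * W s) (Icc 0 1) := fun z hz =>
      hΓ.integrable (g := fun w => 1 / (w - z)) (B := 1 / r) (by fun_prop) fun s hs => by
        rw [norm_div, norm_one]
        exact one_div_le_one_div_of_le hr (hsep s hs z hz)
    have hid : IntegrableOn (fun s => Γ s * W s) (Icc 0 1) :=
      hΓ.integrable (g := fun w => w) measurable_id hM
    have hA : IntegrableOn (fun s => t * (Γ s * W s) +
        (1 - t) / 2 * p * (1 / (Γ s - a) * W s)) (Icc 0 1) :=
      (hid.const_mul _).add ((hi a ha).const_mul _)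
    have e0 := integral_entire_eq_zero hΓ ha (f := fun w => w) differentiable_id
    have ea := hΓ.cauchy (fun _ => 1) (by fun_prop) a ha
    have eb := hΓ.cauchy (fun _ => 1) (by fun_prop) b hb
    rw [contourIntegral] at e0 ea eb ⊢
    have e : (∫ s in Icc (0 : ℝ) 1, spectralMap p p' a b t (Γ s) * W s) =
        ∫ s in Icc (0 : ℝ) 1, (t * (Γ s * W s) + (1 - t) / 2 * p * (1 / (Γ s - a) * W s) +
          (1 - t) / 2 * p' * (1 / (Γ s - b) * W s)) := by
      congr 1
      ext s
      rw [spectralMap]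
      ring
    rw [e, integral_add hA ((hi b hb).const_mul _),
      integral_add (hid.const_mul _) ((hi a ha).const_mul _), integral_const_mul,
      integral_const_mul, integral_const_mul, e0, ea, eb]
    have : (p : ℂ) + p' = 1 := by exact_mod_cast hpp
    linear_combination (1 - t : ℂ) / 2 * this
  have htot := hint (Ψ := id) (Ψ' := fun _ => 1) (fun z => hasDerivAt_id z) continuous_const
  simp only [id, hone, mul_one] at htot
  have h1c : (1 - t : ℂ) ≠ 0 := by exact_mod_cast h1'.ne'
  rw [integral_complex_ofReal, show (2 / (1 - t) * ((1 - t) / 2) : ℂ) = (1 : ℝ) by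
    push_cast; field_simp, Complex.ofReal_inj] at htot
  have hprob : IsProbabilityMeasure (limitMeasure p p' a b t) := ⟨by
    rw [limitMeasure, Measure.map_apply hm .univ, preimage_univ, withDensity_apply _ .univ,
      Measure.restrict_univ, ← ofReal_integral_eq_lintegral_ofReal, htot, ENNReal.ofReal_one]
    · by_contra h
      rw [integral_undef h] at htot
      exact zero_ne_one htot
    · exact (ae_restrict_mem measurableSet_Ioo).mono fun P hP => curveDensity_nonneg hba h1 hP⟩
  refine isLimitingMeanDensity_of_charFun hn1 hpn hpp hba.le h0 h1 hΓ ha hb fun k hk => ?_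
  have hkI : (k * I : ℂ) ≠ 0 := mul_ne_zero (by exact_mod_cast hk) I_ne_zero
  have := hint (Ψ := fun z => cexp (k * I * z))
    (Ψ' := fun z => k * I * cexp (k * I * z))
    (fun z => (((hasDerivAt_id z).const_mul (k * I)).cexp).congr_deriv
      (by simp only [id]; ring)) (by fun_prop)
  rw [charFun_apply_real, limitMeasure, integral_map hm.aemeasurable (by fun_prop),
    integral_withDensity_eq_integral_toReal_smul hmd.ennreal_ofReal
      (Eventually.of_forall fun _ => ENNReal.ofReal_lt_top)]
  refine (mul_left_cancel₀ hkI (Eq.trans ?_ (this.trans ?_)))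
  · rw [← integral_const_mul]
    refine setIntegral_congr_fun measurableSet_Ioo fun P hP => ?_
    rw [ENNReal.toReal_ofReal (curveDensity_nonneg hba h1 hP), real_smul]
    ring_nf
  · have := I_ne_zero
    have : (k : ℂ) ≠ 0 := by exact_mod_cast hk
    field_simp
    rfl

end limitMeasure

section branches

variable {p p' a b : ℝ}

/-- The restriction of `spectralMap` to the real line. -/
def realMap (p p' a b t s : ℝ) : ℝ := t * s + (1 - t) / 2 * (p / (s - a) + p' / (s - b))

/-- The critical points of `realMap` at time `t` are the solutions of `poleSum = 2 t / (1 - t)`. -/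
def poleSum (p p' a b s : ℝ) : ℝ := p / (s - a) ^ 2 + p' / (s - b) ^ 2

theorem realMap_neg (t s : ℝ) : realMap p' p (-b) (-a) t (-s) = -realMap p p' a b t s := by
  rw [realMap, realMap, show -s - -b = -(s - b) by ring, show -s - -a = -(s - a) by ring,
    div_neg, div_neg]
  ring

theorem poleSum_neg (s : ℝ) : poleSum p' p (-b) (-a) (-s) = poleSum p p' a b s := by
  rw [poleSum, poleSum, show -s - -b = -(s - b) by ring, show -s - -a = -(s - a) by ring, neg_sq,
    neg_sq, add_comm]

theorem hasDerivAt_realMap (t : ℝ) {s : ℝ} (ha : s ≠ a) (hb : s ≠ b) :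
    HasDerivAt (realMap p p' a b t) (t - (1 - t) / 2 * poleSum p p' a b s) s := by
  have d : ∀ c x : ℝ, s ≠ x → HasDerivAt (fun s => c / (s - x)) (-c / (s - x) ^ 2) s :=
    fun c x h => ((hasDerivAt_const s c).div ((hasDerivAt_id' s).sub_const x)
      (sub_ne_zero.mpr h)).congr_deriv (by simp)
  refine (((hasDerivAt_id' s).const_mul t).add (((d p a ha).add (d p' b hb)).const_mul
    ((1 - t) / 2))).congr_deriv ?_
  rw [poleSum]
  ring

theorem curveImSq_pos_iff (hba : b < a) (hp : 0 < p) (hp' : 0 < p') {L P : ℝ} (hP : P ∈ Ioo 0 L) :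
    0 < curveImSq p p' a b L P ↔ curveRe p p' a b L P = a ∨ curveRe p p' a b L P = b ∨
      L < poleSum p p' a b (curveRe p p' a b L P) := by
  have e := curveImSq_eq (p := p) (p' := p') (L := L) hba P
  have hQ := sub_pos.mpr hP.2
  constructor
  · intro h
    by_contra! hn
    have h' := e ▸ h
    rw [curveImSq, sub_pos, lt_div_comm₀ (by have := sub_ne_zero.mpr hn.1; positivity) hP.1] at h
    rw [sub_pos, lt_div_comm₀ (by have := sub_ne_zero.mpr hn.2.1; positivity) hQ] at h'
    have := hn.2.2
    rw [poleSum] at this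
    linarith
  · intro h
    by_contra! h0
    have hn := curveRe_ne_of_curveImSq hba hp hp' hP h0
    have h0' := e ▸ h0
    rw [curveImSq, sub_nonpos, div_le_comm₀ hP.1
      (by have := sub_ne_zero.mpr hn.1; positivity)] at h0
    rw [sub_nonpos, div_le_comm₀ hQ (by have := sub_ne_zero.mpr hn.2; positivity)] at h0'
    rcases h with h | h | h
    · exact hn.1 h
    · exact hn.2 h
    · rw [poleSum] at h
      linarith

theorem curveMap_eq_realMap (hba : b < a) (hp : 0 < p) (hp' : 0 < p') (h1 : t < 1) {P : ℝ}
    (hP : P ∈ Ioo 0 (2 * t / (1 - t))) (ha : curveRe p p' a b (2 * t / (1 - t)) P ≠ a)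
    (hb : curveRe p p' a b (2 * t / (1 - t)) P ≠ b)
    (h : poleSum p p' a b (curveRe p p' a b (2 * t / (1 - t)) P) = 2 * t / (1 - t)) :
    curveMap p p' a b t P = realMap p p' a b t (curveRe p p' a b (2 * t / (1 - t)) P) := by
  have e := curveImSq_eq (p := p) (p' := p') (L := 2 * t / (1 - t)) hba P
  have hX : curveImSq p p' a b (2 * t / (1 - t)) P = 0 := by
    refine le_antisymm (not_lt.mp fun h0 => ?_) (not_lt.mp fun h0 => ?_)
    · rcases (curveImSq_pos_iff hba hp hp' hP).mp h0 with h' | h' | h'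
      · exact ha h'
      · exact hb h'
      · exact h'.ne' h
    · have h0' := e ▸ h0
      rw [curveImSq, sub_neg, div_lt_comm₀ hP.1
        (by have := sub_ne_zero.mpr ha; positivity)] at h0
      rw [sub_neg, div_lt_comm₀ (sub_pos.mpr hP.2)
        (by have := sub_ne_zero.mpr hb; positivity)] at h0'
      rw [poleSum] at h
      linarith
  have := spectralMap_eq_curveMap hba h1 hP hp hp' (s := 0) (by rw [hX]; norm_num)
  rw [spectralMap, ofReal_zero, zero_mul, add_zero] at this
  rw [realMap]
  exact_mod_cast this.symm

theorem closure_image_curveMap (hba : b < a) (hp : 0 < p) (hp' : 0 < p') (h0 : 0 < t)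
    (h1 : t < 1) {u v : ℝ} (huv : u < v) (hua : u ≠ a) (hub : u ≠ b) (hva : v ≠ a) (hvb : v ≠ b)
    (hu : poleSum p p' a b u = 2 * t / (1 - t)) (hv : poleSum p p' a b v = 2 * t / (1 - t))
    (h : ∀ s ∈ Ioo u v, s = a ∨ s = b ∨ 2 * t / (1 - t) < poleSum p p' a b s) :
    realMap p p' a b t u < realMap p p' a b t v ∧
    closure (curveMap p p' a b t '' {P | P ∈ Ioo 0 (2 * t / (1 - t)) ∧
      curveRe p p' a b (2 * t / (1 - t)) P ∈ Ioo u v}) =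
      Icc (realMap p p' a b t u) (realMap p p' a b t v) := by
  have hL : 0 < 2 * t / (1 - t) := div_pos (by positivity) (sub_pos.mpr h1)
  obtain ⟨P1, m1, rfl⟩ := exists_curveRe_eq hba hp hp' hL u
  obtain ⟨P2, m2, rfl⟩ := exists_curveRe_eq hba hp hp' hL v
  have hmono := strictMonoOn_curveRe (L := 2 * t / (1 - t)) hba hp hp'
  have h12 := (hmono.lt_iff_lt m1 m2).mp huv
  have hI : ∀ P ∈ Icc P1 P2, P ∈ Ioo 0 (2 * t / (1 - t)) := fun P hP =>
    ⟨m1.1.trans_le hP.1, hP.2.trans_lt m2.2⟩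
  rw [← curveMap_eq_realMap hba hp hp' h1 m1 hua hub hu,
    ← curveMap_eq_realMap hba hp hp' h1 m2 hva hvb hv]
  have hset : {P | P ∈ Ioo 0 (2 * t / (1 - t)) ∧ curveRe p p' a b (2 * t / (1 - t)) P ∈
      Ioo (curveRe p p' a b (2 * t / (1 - t)) P1) (curveRe p p' a b (2 * t / (1 - t)) P2)} =
      Ioo P1 P2 := by
    ext P
    constructor
    · rintro ⟨hP, hs⟩
      exact ⟨(hmono.lt_iff_lt m1 hP).mp hs.1, (hmono.lt_iff_lt hP m2).mp hs.2⟩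
    · intro hP
      have := hI P (Ioo_subset_Icc_self hP)
      exact ⟨this, (hmono.lt_iff_lt m1 this).mpr hP.1, (hmono.lt_iff_lt this m2).mpr hP.2⟩
  have hc : ContinuousOn (curveMap p p' a b t) (Icc P1 P2) := fun P hP =>
    (hasDerivAt_curveMap (hI P hP)).continuousAt.continuousWithinAt
  have hm : StrictMonoOn (curveMap p p' a b t) (Icc P1 P2) := by
    refine strictMonoOn_of_deriv_pos (convex_Icc _ _) hc fun P hP => ?_
    rw [interior_Icc] at hP
    have hP' := hI P (Ioo_subset_Icc_self hP)
    rw [(hasDerivAt_curveMap hP').deriv]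
    refine curveMapDeriv_pos hba h1 hP' ((curveImSq_pos_iff hba hp hp' hP').mpr (h _ ?_))
    rw [← hset] at hP
    exact hP.2
  refine ⟨hm (left_mem_Icc.mpr h12.le) (right_mem_Icc.mpr h12.le) h12, ?_⟩
  rw [hset]
  apply Subset.antisymm
  · exact closure_minimal (hm.monotoneOn.mapsTo_Icc.image_subset.trans' (image_mono
      Ioo_subset_Icc_self)) isClosed_Icc
  · rw [← closure_Ioo h12.ne] at hc
    refine (intermediate_value_Icc h12.le (hc.mono (closure_Ioo h12.ne).ge)).trans ?_
    rw [← closure_Ioo h12.ne]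
    exact hc.image_closure

theorem continuousOn_of_comp_strictMonoOn {I T : Set ℝ} [I.OrdConnected] {f σ l : ℝ → ℝ}
    (hf : StrictMonoOn f I) (hσ : ∀ t ∈ T, σ t ∈ I) (hl : ContinuousOn l T)
    (h : ∀ t ∈ T, f (σ t) = l t) : ContinuousOn σ T := by
  intro t ht
  rw [ContinuousWithinAt, tendsto_order]
  constructor
  · intro c hc
    by_cases hex : ∃ d ∈ I, c < d ∧ d < σ t
    · obtain ⟨d, hd, hcd, hdt⟩ := hex
      have h1 := hf hd (hσ t ht) hdt
      rw [h t ht] at h1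
      filter_upwards [(hl t ht).eventually_const_lt h1, self_mem_nhdsWithin] with t' h2 ht'
      rw [← h t' ht'] at h2
      exact hcd.trans ((hf.lt_iff_lt hd (hσ t' ht')).mp h2)
    · filter_upwards [self_mem_nhdsWithin] with t' ht'
      by_contra! h'
      obtain ⟨d, h1, h2⟩ := exists_between hc
      exact hex ⟨d, Set.OrdConnected.out ‹_› (hσ t' ht') (hσ t ht) ⟨h'.trans h1.le, h2.le⟩, h1, h2⟩
  · intro c hc
    by_cases hex : ∃ d ∈ I, σ t < d ∧ d < c
    · obtain ⟨d, hd, htd, hdc⟩ := hex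
      have h1 := hf (hσ t ht) hd htd
      rw [h t ht] at h1
      filter_upwards [(hl t ht).eventually_lt_const h1, self_mem_nhdsWithin] with t' h2 ht'
      rw [← h t' ht'] at h2
      exact ((hf.lt_iff_lt (hσ t' ht') hd).mp h2).trans hdc
    · filter_upwards [self_mem_nhdsWithin] with t' ht'
      by_contra! h'
      obtain ⟨d, h1, h2⟩ := exists_between hc
      exact hex ⟨d, Set.OrdConnected.out ‹_› (hσ t ht) (hσ t' ht') ⟨h1.le, h2.le.trans h'⟩, h1, h2⟩

theorem strictAntiOn_poleSum (hba : b < a) (hp : 0 < p) (hp' : 0 < p') :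
    StrictAntiOn (poleSum p p' a b) (Ioi a) := by
  intro s hs s' hs' h
  have h1 := sub_pos.mpr (mem_Ioi.mp hs)
  have h2 : 0 < s - b := by linarith
  unfold poleSum
  gcongr

theorem continuousAt_poleSum {s : ℝ} (ha : s ≠ a) (hb : s ≠ b) :
    ContinuousAt (poleSum p p' a b) s := by
  have := sub_ne_zero.mpr ha
  have := sub_ne_zero.mpr hb
  unfold poleSum
  fun_prop (disch := positivity)

theorem strictMonoOn_poleSum (hp : 0 < p) (hp' : 0 < p') {ω : ℝ} (hωb : b < ω)
    (hcrit : p / (a - ω) ^ 3 = p' / (ω - b) ^ 3) :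
    StrictMonoOn (poleSum p p' a b) (Ico ω a) := by
  refine strictMonoOn_of_deriv_pos (convex_Ico ω a) (fun s hs => (continuousAt_poleSum hs.2.ne
    (hωb.trans_le hs.1).ne').continuousWithinAt) fun s hs => ?_
  rw [interior_Ico] at hs
  have h1 := sub_pos.mpr hs.2
  have h2 : 0 < s - b := by linarith [hs.1]
  have h3 : 0 < ω - b := by linarith [hs.1]
  have d : ∀ c x : ℝ, s - x ≠ 0 → HasDerivAt (fun s => c / (s - x) ^ 2) (-2 * c / (s - x) ^ 3) s :=
    fun c x h => ((hasDerivAt_const s c).div (((hasDerivAt_id' s).sub_const x).fun_pow 2)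
      (pow_ne_zero 2 h)).congr_deriv (by field_simp; simp; ring)
  have h4 : p / (a - ω) ^ 3 < p / (a - s) ^ 3 := by
    have := hs.1
    gcongr
  have h5 : p' / (s - b) ^ 3 < p' / (ω - b) ^ 3 := by
    have := hs.1
    gcongr
  have h6 : HasDerivAt (poleSum p p' a b) _ s := (d p a (by linarith)).add (d p' b h2.ne')
  rw [h6.deriv, show s - a = -(a - s) by ring,
    Odd.neg_pow (by decide), mul_div_assoc, mul_div_assoc, div_neg]
  linarith

theorem continuousOn_time : ContinuousOn (fun t : ℝ => 2 * t / (1 - t)) (Ioo 0 1) := fun t ht => by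
  have := (sub_pos.mpr ht.2).ne'
  exact ContinuousAt.continuousWithinAt (by fun_prop (disch := assumption))

theorem time_pos (ht : t ∈ Ioo (0 : ℝ) 1) : 0 < 2 * t / (1 - t) :=
  div_pos (mul_pos two_pos ht.1) (sub_pos.mpr ht.2)

theorem time_lt {t t' : ℝ} (ht : t ∈ Ioo (0 : ℝ) 1) (ht' : t' < 1) (h : t < t') :
    2 * t / (1 - t) < 2 * t' / (1 - t') := by
  have := sub_pos.mpr ht'
  have := ht.1
  have := this.trans h
  gcongr

theorem continuousOn_realMap_comp {T : Set ℝ} {σ : ℝ → ℝ} (hσ : ContinuousOn σ T)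
    (ha : ∀ t ∈ T, σ t ≠ a) (hb : ∀ t ∈ T, σ t ≠ b) :
    ContinuousOn (fun t => realMap p p' a b t (σ t)) T := by
  unfold realMap
  have ha' := fun t ht => sub_ne_zero.mpr (ha t ht)
  have hb' := fun t ht => sub_ne_zero.mpr (hb t ht)
  exact (continuousOn_id.mul hσ).add (((continuousOn_const.sub continuousOn_id).div_const 2).mul
    ((continuousOn_const.div (hσ.sub continuousOn_const) ha').add
      (continuousOn_const.div (hσ.sub continuousOn_const) hb')))

theorem exists_outer_branch (hba : b < a) (hp : 0 < p) (hp' : 0 < p') :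
    ∃ σ : ℝ → ℝ, ContinuousOn (fun t => realMap p p' a b t (σ t)) (Ioo 0 1) ∧
      ∀ t ∈ Ioo (0 : ℝ) 1, a < σ t ∧ poleSum p p' a b (σ t) = 2 * t / (1 - t) ∧
        ∀ s, a < s → (2 * t / (1 - t) < poleSum p p' a b s ↔ s < σ t) := by
  have hmono := strictAntiOn_poleSum hba hp hp'
  have hex : ∀ t ∈ Ioo (0 : ℝ) 1, ∃ s, a < s ∧ poleSum p p' a b s = 2 * t / (1 - t) := by
    intro t ht
    have hL := time_pos ht
    set L := 2 * t / (1 - t)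
    have hs1 : 0 < √(p / L) := Real.sqrt_pos.mpr (by positivity)
    have hs12 : √(p / L) ≤ √((p + p') / L) := Real.sqrt_le_sqrt (by gcongr; linarith)
    have hcont : ContinuousOn (poleSum p p' a b) (Icc (a + √(p / L)) (a + √((p + p') / L))) :=
      fun s hs => (continuousAt_poleSum (by linarith [hs.1] : a < s).ne'
        (by linarith [hs.1] : b < s).ne').continuousWithinAt
    obtain ⟨s, hs, h⟩ := intermediate_value_Icc' (by linarith) hcont (show L ∈ Icc _ _ by
      rw [poleSum, poleSum, add_sub_cancel_left, add_sub_cancel_left, sq_sqrt (by positivity),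
        sq_sqrt (by positivity)]
      constructor
      · have hq : 0 < √((p + p') / L) := hs1.trans_le hs12
        have : p' / (a + √((p + p') / L) - b) ^ 2 ≤ p' / ((p + p') / L) := by
          rw [div_le_div_iff_of_pos_left hp' (by have := hba; nlinarith) (by positivity)]
          exact (sq_sqrt (by positivity)).symm.le.trans
            (pow_le_pow_left₀ hq.le (by linarith) 2)
        refine (add_le_add_right this _).trans (le_of_eq ?_)
        field_simp
      · rw [div_div_cancel₀ hp.ne']
        have : 0 ≤ p' / (a + √(p / L) - b) ^ 2 := by positivity
        linarith)
    exact ⟨s, by linarith [hs.1], h⟩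
  choose! σ hσ using hex
  refine ⟨σ, continuousOn_realMap_comp (continuousOn_of_comp_strictMonoOn (I := Ioi a)
    (f := fun s => -poleSum p p' a b s) hmono.neg (fun t ht => (hσ t ht).1)
    continuousOn_time.neg fun t ht => by rw [(hσ t ht).2]; rfl) (fun t ht => (hσ t ht).1.ne')
    fun t ht => (hba.trans (hσ t ht).1).ne', fun t ht => ⟨(hσ t ht).1, (hσ t ht).2, fun s hs => ?_⟩⟩
  rw [← (hσ t ht).2]
  exact hmono.lt_iff_gt (hσ t ht).1 hs

theorem exists_inner_branch (hp : 0 < p) (hp' : 0 < p') {ω t0 : ℝ} (hωb : b < ω)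
    (hωa : ω < a) (hcrit : p / (a - ω) ^ 3 = p' / (ω - b) ^ 3) (ht0 : t0 ∈ Ioo (0 : ℝ) 1)
    (hω : poleSum p p' a b ω = 2 * t0 / (1 - t0)) :
    ∃ σ : ℝ → ℝ, ContinuousOn (fun t => realMap p p' a b t (σ t)) (Ico t0 1) ∧ σ t0 = ω ∧
      (∀ t ∈ Ico t0 1, ω ≤ σ t ∧ σ t < a ∧ poleSum p p' a b (σ t) = 2 * t / (1 - t) ∧
        ∀ s, ω ≤ s → s < a → (2 * t / (1 - t) < poleSum p p' a b s ↔ σ t < s)) ∧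
      (∀ t ∈ Ioo 0 t0, ∀ s, ω ≤ s → s < a → 2 * t / (1 - t) < poleSum p p' a b s) ∧
      (∀ t ∈ Ioo t0 1, realMap p p' a b t ω < realMap p p' a b t (σ t)) ∧
      HasDerivWithinAt (fun t => realMap p p' a b t (σ t))
        (ω - (p / (ω - a) + p' / (ω - b)) / 2) (Ici t0) t0 := by
  have hmono := strictMonoOn_poleSum (a := a) hp hp' hωb hcrit
  have hT : ∀ t ∈ Ico t0 1, t ∈ Ioo (0 : ℝ) 1 := fun t ht => ⟨ht0.1.trans_le ht.1, ht.2⟩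
  have hmω : ω ∈ Ico ω a := ⟨le_rfl, hωa⟩
  have htime : ∀ t ∈ Ico t0 1, 2 * t0 / (1 - t0) ≤ 2 * t / (1 - t) := fun t ht => by
    rcases ht.1.eq_or_lt with h | h
    · rw [h]
    · exact (time_lt ht0 ht.2 h).le
  have hex : ∀ t ∈ Ico t0 1, ∃ s ∈ Ico ω a, poleSum p p' a b s = 2 * t / (1 - t) := by
    intro t ht
    have hL := time_pos (hT t ht)
    have hL0 := htime t ht
    set L := 2 * t / (1 - t)
    have h1 := sub_pos.mpr hωa
    have h2 := sub_pos.mpr hωb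
    have hs1 : 0 < √(p / L) := Real.sqrt_pos.mpr (by positivity)
    have hs2 : √(p / L) ≤ a - ω := by
      rw [Real.sqrt_le_left h1.le, div_le_comm₀ hL (by positivity)]
      rw [poleSum] at hω
      have : 0 < p' / (ω - b) ^ 2 := by positivity
      rw [show (a - ω) ^ 2 = (ω - a) ^ 2 by ring]
      linarith
    have hcont : ContinuousOn (poleSum p p' a b) (Icc ω (a - √(p / L))) :=
      fun s hs => (continuousAt_poleSum (by linarith [hs.2] : s < a).ne
        (by linarith [hs.1] : b < s).ne').continuousWithinAt
    obtain ⟨s, hs, h⟩ := intermediate_value_Icc (by linarith) hcont (show L ∈ Icc _ _ by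
      refine ⟨hω ▸ hL0, ?_⟩
      rw [poleSum, show a - √(p / L) - a = -√(p / L) by ring, neg_sq, sq_sqrt (by positivity),
        div_div_cancel₀ hp.ne']
      have : 0 ≤ p' / (a - √(p / L) - b) ^ 2 := by positivity
      linarith)
    exact ⟨s, ⟨hs.1, by linarith [hs.2]⟩, h⟩
  choose! σ hσ using hex
  have hσc : ContinuousOn σ (Ico t0 1) := continuousOn_of_comp_strictMonoOn (I := Ico ω a)
    hmono (fun t ht => (hσ t ht).1) (continuousOn_time.mono hT) fun t ht => (hσ t ht).2
  have hm0 : t0 ∈ Ico t0 1 := ⟨le_rfl, ht0.2⟩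
  have hσ0 : σ t0 = ω := hmono.injOn (hσ _ hm0).1 hmω ((hσ _ hm0).2.trans hω.symm)
  have hne : ∀ {s}, s ∈ Ico ω a → s ≠ a ∧ s ≠ b := fun hs => ⟨hs.2.ne, (hωb.trans_le hs.1).ne'⟩
  have hder : ∀ t, ∀ s ∈ Ico ω a, HasDerivAt (realMap p p' a b t)
    (t - (1 - t) / 2 * poleSum p p' a b s) s := fun t s hs =>
      hasDerivAt_realMap t (hne hs).1 (hne hs).2
  have hsub : ∀ t ∈ Ico t0 1, Icc ω (σ t) ⊆ Ico ω a := fun t ht s hs =>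
    ⟨hs.1, hs.2.trans_lt (hσ t ht).1.2⟩
  have ht1 : ∀ t < (1 : ℝ), (1 - t) / 2 * (2 * t / (1 - t)) = t := fun t ht => by
    have := (sub_pos.mpr ht).ne'
    field_simp
  have hstrict : ∀ t ∈ Ico t0 1, StrictMonoOn (realMap p p' a b t) (Icc ω (σ t)) := fun t ht => by
    refine strictMonoOn_of_deriv_pos (convex_Icc _ _)
      (fun s hs => (hder t s (hsub t ht hs)).continuousAt.continuousWithinAt) fun s hs => ?_
    rw [interior_Icc] at hs
    have hs' := hsub t ht (Ioo_subset_Icc_self hs)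
    rw [(hder t s hs').deriv, sub_pos]
    have h1 := hmono hs' (hσ t ht).1 hs.2
    rw [(hσ t ht).2] at h1
    calc _ < (1 - t) / 2 * (2 * t / (1 - t)) :=
          mul_lt_mul_of_pos_left h1 (half_pos (sub_pos.mpr ht.2))
      _ = t := ht1 t ht.2
  have hupper : ∀ t ∈ Ico t0 1, realMap p p' a b t (σ t) - realMap p p' a b t ω ≤
      (t - t0) / (1 - t0) * (σ t - ω) := fun t ht => by
    refine (convex_Icc ω (σ t)).image_sub_le_mul_sub_of_deriv_le
      (fun s hs => (hder t s (hsub t ht hs)).continuousAt.continuousWithinAt)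
      (fun s hs => (hder t s (hsub t ht (interior_subset hs))).differentiableAt.differentiableWithinAt)
      (fun s hs => ?_) _ (left_mem_Icc.mpr (hσ t ht).1.1) _ (right_mem_Icc.mpr (hσ t ht).1.1)
      (hσ t ht).1.1
    have hs' := hsub t ht (interior_subset hs)
    rw [(hder t s hs').deriv]
    have h1 := hmono.monotoneOn hmω hs' hs'.1
    have h2 : (1 - t) / 2 * (2 * t0 / (1 - t0)) ≤ (1 - t) / 2 * poleSum p p' a b s :=
      mul_le_mul_of_nonneg_left (hω ▸ h1) (half_pos (sub_pos.mpr ht.2)).le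
    have h3 : t - (1 - t) / 2 * (2 * t0 / (1 - t0)) = (t - t0) / (1 - t0) := by
      have := (sub_pos.mpr ht0.2).ne'
      field_simp
      ring
    linarith
  refine ⟨σ, continuousOn_realMap_comp hσc (fun t ht => (hne (hσ t ht).1).1)
    fun t ht => (hne (hσ t ht).1).2, hσ0, fun t ht => ⟨(hσ t ht).1.1, (hσ t ht).1.2, (hσ t ht).2,
    fun s h1 h2 => ?_⟩, fun t ht s h1 h2 => ?_, fun t ht => ?_, ?_⟩
  · rw [← (hσ t ht).2]
    exact hmono.lt_iff_lt (hσ t ht).1 ⟨h1, h2⟩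
  · refine (time_lt ⟨ht.1, ht.2.trans ht0.2⟩ ht0.2 ht.2).trans_le ?_
    rw [← hω]
    exact hmono.monotoneOn hmω ⟨h1, h2⟩ h1
  · have ht' := Ioo_subset_Ico_self ht
    have hlt : ω < σ t := (hσ t ht').1.1.lt_of_ne fun h => by
      have h1 := (hσ t ht').2
      rw [← h, hω] at h1
      exact (time_lt ht0 ht.2 ht.1).ne h1
    exact hstrict t ht' (left_mem_Icc.mpr hlt.le) (right_mem_Icc.mpr hlt.le) hlt
  · have hlin : HasDerivWithinAt (fun t => realMap p p' a b t ω)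
        (ω - (p / (ω - a) + p' / (ω - b)) / 2) (Ici t0) t0 := by
      refine ((((hasDerivAt_id' t0).mul_const ω).add ((((hasDerivAt_id' t0).const_sub 1).div_const
        2).mul_const (p / (ω - a) + p' / (ω - b)))).congr_deriv ?_).hasDerivWithinAt
      ring
    have hsmall : HasDerivWithinAt
        (fun t => realMap p p' a b t (σ t) - realMap p p' a b t ω) 0 (Ici t0) t0 := by
      rw [hasDerivWithinAt_iff_isLittleO, hσ0]
      simp only [sub_self, smul_zero, sub_zero]
      have hlim : Tendsto (fun t => (σ t - ω) / (1 - t0)) (𝓝[≥] t0) (𝓝 0) := by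
        have h1 := (hσc t0 hm0).tendsto
        rw [nhdsWithin_Ico_eq_nhdsGE ht0.2, hσ0] at h1
        simpa using (h1.sub_const ω).div_const (1 - t0)
      have ho := ((Asymptotics.isBigO_refl (fun t => t - t0) (𝓝[≥] t0)).mul_isLittleO
        ((Asymptotics.isLittleO_one_iff ℝ).mpr hlim)).congr_right fun t => mul_one _
      refine (Asymptotics.IsBigO.of_bound 1 ?_).trans_isLittleO ho
      filter_upwards [Ico_mem_nhdsGE ht0.2] with t ht
      have h1 := hupper t ht
      have h2 := (hstrict t ht).monotoneOn (left_mem_Icc.mpr (hσ t ht).1.1)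
        (right_mem_Icc.mpr (hσ t ht).1.1) (hσ t ht).1.1
      rw [norm_of_nonneg (sub_nonneg.mpr h2), one_mul]
      refine h1.trans (le_trans (le_of_eq ?_) (Real.le_norm_self _))
      ring
    exact (hlin.add hsmall).congr_deriv (add_zero _) |>.congr (fun t _ => by simp) (by simp)

end branches

theorem splitsAtCusp_support_limitMeasure {p p' a b : ℝ} (hba : b < a) (hp : 0 < p) (hp' : 0 < p')
    {ω t0 x0 : ℝ} (hωb : b < ω) (hωa : ω < a) (hcrit : p / (a - ω) ^ 3 = p' / (ω - b) ^ 3)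
    (ht0 : t0 ∈ Ioo (0 : ℝ) 1) (hω : poleSum p p' a b ω = 2 * t0 / (1 - t0))
    (hx0 : realMap p p' a b t0 ω = x0) :
    SplitsAtCusp (fun t => (limitMeasure p p' a b t).support) x0 t0 := by
  have hba' : -a < -b := neg_lt_neg hba
  have rn : ∀ t s, realMap p p' a b t (-s) = -realMap p' p (-b) (-a) t s := fun t s => by
    rw [← neg_neg (realMap p p' a b t (-s)), ← realMap_neg, neg_neg]
  have pn : ∀ s, poleSum p p' a b (-s) = poleSum p' p (-b) (-a) s := fun s => by
    rw [← poleSum_neg, neg_neg]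
  obtain ⟨σ, cσ, hσ⟩ := exists_outer_branch hba hp hp'
  obtain ⟨σ', cσ', hσ'⟩ := exists_outer_branch hba' hp' hp
  obtain ⟨ρ, cρ, ρ0, hρ, hbelow, hlt, dρ⟩ := exists_inner_branch hp hp' hωb hωa hcrit ht0 hω
  obtain ⟨ρ', cρ', ρ0', hρ', hbelow', hlt', dρ'⟩ := exists_inner_branch (p := p') (p' := p)
    (ω := -ω) (a := -b) (b := -a) (t0 := t0) hp' hp (neg_lt_neg hωa) (neg_lt_neg hωb)
    (by rw [neg_sub_neg, neg_sub_neg]; exact hcrit.symm) ht0 (by rw [poleSum_neg, hω])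
  have hT : ∀ t ∈ Ico t0 1, t ∈ Ioo (0 : ℝ) 1 := fun t ht => ⟨ht0.1.trans_le ht.1, ht.2⟩
  have hsupp : ∀ t ∈ Ioo (0 : ℝ) 1, ∀ A : Set ℝ,
      (∀ s, s ∈ A ↔ s = a ∨ s = b ∨ 2 * t / (1 - t) < poleSum p p' a b s) →
      (limitMeasure p p' a b t).support = closure (curveMap p p' a b t ''
        {P | P ∈ Ioo 0 (2 * t / (1 - t)) ∧ curveRe p p' a b (2 * t / (1 - t)) P ∈ A}) := by
    intro t ht A hA
    rw [support_limitMeasure hba ht.2]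
    congr 2
    ext P
    exact and_congr_right fun hP => (curveImSq_pos_iff hba hp hp' hP).trans (hA _).symm
  have hleft : ∀ t ∈ Ioo (0 : ℝ) 1, -σ' t < b ∧ poleSum p p' a b (-σ' t) = 2 * t / (1 - t) ∧
      ∀ s < b, (2 * t / (1 - t) < poleSum p p' a b s ↔ -σ' t < s) := fun t ht => by
    obtain ⟨h1, h2, h3⟩ := hσ' t ht
    refine ⟨by linarith, by rw [pn, h2], fun s hs => ?_⟩
    have := h3 (-s) (by linarith)
    rw [poleSum_neg] at this
    rw [this]
    exact neg_lt
  have hinner : ∀ t ∈ Ico t0 1, b < -ρ' t ∧ -ρ' t ≤ ω ∧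
      poleSum p p' a b (-ρ' t) = 2 * t / (1 - t) ∧
      ∀ s, b < s → s ≤ ω → (2 * t / (1 - t) < poleSum p p' a b s ↔ s < -ρ' t) := fun t ht => by
    obtain ⟨h1, h1', h2, h3⟩ := hρ' t ht
    refine ⟨by linarith, by linarith, by rw [pn, h2], fun s hs hs' => ?_⟩
    have := h3 (-s) (by linarith) (by linarith)
    rw [poleSum_neg] at this
    rw [this]
    exact lt_neg
  have hone : ∀ t ∈ Ioo 0 t0, realMap p p' a b t (-σ' t) < realMap p p' a b t (σ t) ∧
      (limitMeasure p p' a b t).support =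
        Icc (realMap p p' a b t (-σ' t)) (realMap p p' a b t (σ t)) := by
    intro t ht
    have ht1 : t ∈ Ioo (0 : ℝ) 1 := ⟨ht.1, ht.2.trans ht0.2⟩
    obtain ⟨l1, l2, l3⟩ := hleft t ht1
    obtain ⟨r1, r2, r3⟩ := hσ t ht1
    have hA : ∀ s, s ∈ Ioo (-σ' t) (σ t) ↔
        s = a ∨ s = b ∨ 2 * t / (1 - t) < poleSum p p' a b s := by
      intro s
      rcases lt_trichotomy s b with h | rfl | h
      · rw [l3 s h]
        exact ⟨fun h => .inr (.inr h.1), fun h' => ⟨by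
          rcases h' with h' | h' | h' <;> linarith, by linarith⟩⟩
      · exact iff_of_true ⟨l1, by linarith⟩ (by simp)
      rcases lt_trichotomy s a with h' | rfl | h'
      · refine iff_of_true ⟨by linarith, by linarith⟩ (.inr (.inr ?_))
        rcases le_total ω s with h'' | h''
        · exact hbelow t ht s h'' h'
        · have := hbelow' t ht (-s) (by linarith) (by linarith)
          rwa [poleSum_neg] at this
      · exact iff_of_true ⟨by linarith, r1⟩ (by simp)
      · rw [r3 s h']
        exact ⟨fun h => .inr (.inr h.2), fun h' => ⟨by linarith, by
          rcases h' with h' | h' | h' <;> linarith⟩⟩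
    rw [hsupp t ht1 _ hA]
    exact closure_image_curveMap hba hp hp' ht1.1 ht1.2 (by linarith) (by linarith) l1.ne
      r1.ne' (by linarith) l2 r2 fun s hs => (hA s).mp hs
  have htwo : ∀ t ∈ Ico t0 1, realMap p p' a b t (-σ' t) < realMap p p' a b t (-ρ' t) ∧
      realMap p p' a b t (ρ t) < realMap p p' a b t (σ t) ∧ (limitMeasure p p' a b t).support =
        Icc (realMap p p' a b t (-σ' t)) (realMap p p' a b t (-ρ' t)) ∪
          Icc (realMap p p' a b t (ρ t)) (realMap p p' a b t (σ t)) := by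
    intro t ht
    have ht1 := hT t ht
    obtain ⟨l1, l2, l3⟩ := hleft t ht1
    obtain ⟨r1, r2, r3⟩ := hσ t ht1
    obtain ⟨m1, m2, m3, m4⟩ := hinner t ht
    obtain ⟨n1, n2, n3, n4⟩ := hρ t ht
    have hA : ∀ s, s ∈ Ioo (-σ' t) (-ρ' t) ∪ Ioo (ρ t) (σ t) ↔
        s = a ∨ s = b ∨ 2 * t / (1 - t) < poleSum p p' a b s := by
      intro s
      rw [mem_union, mem_Ioo, mem_Ioo]
      rcases lt_trichotomy s b with h | rfl | h
      · rw [l3 s h]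
        clear * - hba l1 m1 m2 n1 h
        grind
      · clear * - l1 m1
        grind
      rcases lt_trichotomy s a with h' | rfl | h'
      · rcases le_total ω s with h'' | h''
        · rw [n4 s h'' h']
          clear * - r1 m2 h h' h''
          grind
        · rw [m4 s h h'']
          clear * - l1 n1 h h' h''
          grind
      · clear * - n2 r1
        grind
      · rw [r3 s h']
        clear * - m2 n1 n2 h h'
        grind
    obtain ⟨i1, i2⟩ := closure_image_curveMap hba hp hp' ht1.1 ht1.2 (l1.trans m1) (by linarith)
      l1.ne (by linarith) m1.ne' l2 m3 fun s hs => (hA s).mp (.inl hs)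
    obtain ⟨j1, j2⟩ := closure_image_curveMap hba hp hp' ht1.1 ht1.2 (n2.trans r1) n2.ne
      (by linarith) r1.ne' (by linarith) n3 r2 fun s hs => (hA s).mp (.inr hs)
    refine ⟨i1, j1, ?_⟩
    rw [hsupp t ht1 _ hA, ← i2, ← j2, ← closure_union, ← image_union]
    congr 2
    ext P
    simp only [mem_union, mem_ofPred_eq]
    tauto
  have hm0 : t0 ∈ Ico t0 1 := ⟨le_rfl, ht0.2⟩
  obtain ⟨i1, j1, hS0⟩ := htwo t0 hm0
  rw [ρ0', neg_neg, ρ0, hx0] at hS0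
  rw [ρ0', neg_neg, hx0] at i1
  rw [ρ0, hx0] at j1
  refine ⟨ht0, fun t => realMap p p' a b t (-σ' t), fun t => realMap p p' a b t (-ρ' t),
    fun t => realMap p p' a b t (ρ t), fun t => realMap p p' a b t (σ t), ?_, cσ, ?_, cρ,
    fun t ht => ?_, fun t ht => ?_, i1, j1, by simp [ρ0', hx0], by simp [ρ0, hx0],
    _, ?_, dρ⟩
  · simp only [rn]
    exact cσ'.neg
  · simp only [rn]
    exact cρ'.neg
  · rcases ht.2.lt_or_eq with h | rfl
    · exact hone t ⟨ht.1, h⟩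
    · exact ⟨i1.trans j1, hS0.trans (Icc_union_Icc_eq_Icc i1.le j1.le)⟩
  · obtain ⟨i1, j1, hS⟩ := htwo t (Ioo_subset_Ico_self ht)
    refine ⟨i1, ?_, j1, hS⟩
    have h1 := hlt' t ht
    have h2 := hlt t ht
    rw [realMap_neg] at h1
    simp only [rn]
    linarith
  · simp only [rn]
    refine dρ'.neg.congr_deriv ?_
    rw [neg_sub_neg, neg_sub_neg, ← neg_sub ω a, ← neg_sub b ω, div_neg, div_neg]
    ring

end

theorem theorem1
    (a b q p r t₀ x₀ c₀ μ A : ℝ) (hba : b < a) (hq : 0 < q)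
    (hp : p = 1 / (1 + q ^ 3))
    (hr : r = √(q ^ 2 - q + 1))
    (ht₀ : t₀ = 1 / (1 + 2 * (r * (a - b) / (q + 1)) ^ 2))
    (hx₀ : x₀ = ((2 * a - b) * q + (2 * b - a)) / (q + 1) * t₀)
    (hc₀ : c₀ = √(t₀ * (1 - t₀) / 2))
    (hμ : μ = ((q ^ 2 - q + 1) / q) ^ (1 / 4 : ℝ))
    (hA : A = (q ^ (1 / 2 : ℝ) * (a - x₀) + q ^ (-(1 / 2) : ℝ) * (b - x₀)) / (a - b))
    -- the number of paths ending up at `a √n`, i.e. `p n` up to rounding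
    (n₁ : ℕ → ℕ) (hn₁ : ∀ n, n₁ n ≤ n) (hn₁p : ∀ n, |(n₁ n : ℝ) - p * n| < 1) :
    -- the constants
    (0 < μ ∧ c₀ = t₀ * (r * (a - b) / (q + 1)) ∧ 0 < c₀) ∧
    -- the cusp
    (∃ ν : ℝ → Measure ℝ,
      (∀ t ∈ Ioo (0 : ℝ) 1, IsLimitingMeanDensity n₁ b a t (ν t)) ∧
      SplitsAtCusp (fun t => (ν t).support) x₀ t₀) ∧
    -- the limit of the gap probabilities
    (∀ (m : ℕ) (τ : Fin m → ℝ) (E : Fin m → Set ℝ), StrictMono τ →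
      (∀ i, MeasurableSet (E i)) → (∀ i, Bornology.IsBounded (E i)) →
      ∃ (P : ℕ → ℝ) (D : ℝ),
        (∀ᶠ n : ℕ in atTop,
          HasNonIntersectingProbability n (n₁ n) (b * √n) (a * √n)
            (fun i => t₀ + (c₀ * μ / (n : ℝ) ^ (1 / 4 : ℝ)) ^ 2 * (2 * τ i))
            {x | ∀ i j, ∃ ξ ∈ (E i)ᶜ,
              x i j = x₀ * (n : ℝ) ^ (1 / 2 : ℝ) + c₀ * A * τ i
                + c₀ * μ / (n : ℝ) ^ (1 / 4 : ℝ) * ξ} (P n)) ∧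
        HasPearceyGapProbability τ E D ∧
        Tendsto P atTop (𝓝 D)) := by
  have hd := sub_pos.mpr hba
  have hr2 : r ^ 2 = q ^ 2 - q + 1 := by
    rw [hr, Real.sq_sqrt (by nlinarith [sq_nonneg (q - 1)])]
  have hr0 : 0 < r := by
    rw [hr]
    exact Real.sqrt_pos.mpr (by nlinarith [sq_nonneg (q - 1)])
  obtain ⟨α, hα⟩ : ∃ α, α = (a - b) / (q + 1) := ⟨_, rfl⟩
  obtain ⟨ω, hω⟩ : ∃ ω, ω = (q * a + b) / (q + 1) := ⟨_, rfl⟩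
  have hα0 : 0 < α := by rw [hα]; positivity
  have hrα : r * (a - b) / (q + 1) = r * α := by rw [hα]; ring
  have haω : ω + α = a := by rw [hα, hω]; field_simp; ring
  have hbω : ω - q * α = b := by rw [hα, hω]; field_simp; ring
  rw [hrα] at ht₀ ⊢
  have ht₀0 : 0 < t₀ := by rw [ht₀]; positivity
  have ht₀1 : 1 - t₀ = 2 * (r * α) ^ 2 * t₀ := by rw [ht₀]; field_simp; ring
  have ht₀1' : 0 < 1 - t₀ := by rw [ht₀1]; positivity
  have ht : t₀ ∈ Ioo (0 : ℝ) 1 := ⟨ht₀0, sub_pos.mp ht₀1'⟩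
  have hc : c₀ = t₀ * (r * α) := by
    rw [hc₀, ht₀1, show t₀ * (2 * (r * α) ^ 2 * t₀) / 2 = (t₀ * (r * α)) ^ 2 by ring,
      Real.sqrt_sq (by positivity)]
  have hμb : 0 < (q ^ 2 - q + 1) / q := by rw [← hr2]; positivity
  have hμ0 : 0 < μ := by rw [hμ]; positivity
  have hμ4 : μ ^ 4 = r ^ 2 / q := by
    rw [hμ, hr2, ← Real.rpow_natCast, ← Real.rpow_mul hμb.le]
    norm_num
  have hsq : 0 < √q := Real.sqrt_pos.mpr hq
  have hμ2 : μ ^ 2 = r / √q := by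
    rw [← sq_eq_sq₀ (by positivity) (by positivity), div_pow, Real.sq_sqrt hq.le, ← hμ4]
    ring
  have hc0 : 0 < c₀ := by rw [hc]; positivity
  have hxω : x₀ - t₀ * ω = t₀ * α * (q - 1) := by rw [hx₀, hω, hα]; field_simp; ring
  have hA' : A = (ω - x₀) / (√q * α) := by
    rw [hA, ← Real.sqrt_eq_rpow, Real.rpow_neg hq.le, ← Real.sqrt_eq_rpow,
      show a - x₀ = ω - x₀ + α by rw [← haω]; ring,
      show b - x₀ = ω - x₀ - q * α by rw [← hbω]; ring,
      show a - b = (q + 1) * α by rw [hα]; field_simp]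
    field_simp
    rw [Real.sq_sqrt hq.le]
    ring
  have hq3 : 1 + q ^ 3 = (1 + q) * r ^ 2 := by rw [hr2]; ring
  have hp0 : 0 < p := by rw [hp]; positivity
  refine ⟨⟨hμ0, hc, hc0⟩, ⟨limitMeasure p (q ^ 3 * p) a b, fun t ht =>
    isLimitingMeanDensity_limitMeasure hn₁ (fun n => (hn₁p n).le) (by rw [hp]; field_simp) hba hp0
      (by positivity) ht.1 ht.2, splitsAtCusp_support_limitMeasure hba hp0 (by positivity)
      (ω := ω) (by rw [← hbω]; linarith [mul_pos hq hα0]) (by linarith) ?_ ht ?_ ?_⟩,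
    fun m τ E hτ hEm hE => ?_⟩
  · rw [← haω, ← hbω, add_sub_cancel_left, sub_sub_cancel]
    field_simp
  · rw [poleSum, ← haω, ← hbω, sub_add_cancel_left, sub_sub_cancel, hp, hq3, ht₀1]
    field_simp
  · rw [realMap, ← haω, ← hbω, sub_add_cancel_left, sub_sub_cancel, hp, hq3, ht₀1,
      ← sub_eq_zero, ← neg_eq_zero, ← sub_eq_zero.mpr hxω]
    field_simp
    ring
  · set ε : ℕ → ℝ := fun n => c₀ * μ / (n : ℝ) ^ (1 / 4 : ℝ)
    have h4 : ∀ n : ℕ, ((n : ℝ) ^ (1 / 4 : ℝ)) ^ 4 = n := fun n => by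
      rw [← Real.rpow_natCast, ← Real.rpow_mul n.cast_nonneg]
      norm_num
    have h2 : ∀ n : ℕ, ((n : ℝ) ^ (1 / 4 : ℝ)) ^ 2 = √n := fun n => by
      rw [Real.sqrt_eq_rpow, ← Real.rpow_natCast, ← Real.rpow_mul n.cast_nonneg]
      norm_num
    have hpos : ∀ n : ℕ, 0 < n → 0 < (n : ℝ) ^ (1 / 4 : ℝ) := fun n hn =>
      Real.rpow_pos_of_pos (Nat.cast_pos.mpr hn) _
    have := tendsto_gapProbability (q := q) (ω := ω) (α := α) (t0 := t₀) (x0 := x₀)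
      (γ := c₀ * A) (ε := ε) (L := fun n => 2 * ε n * α * √n / (1 - t₀)) (fun n hn => ?_)
      (fun n hn => ?_) ?_ hn₁ (fun n => hp ▸ (hn₁p n).le) hτ hE hEm
    · simp only [show ∀ n : ℕ, ω * √n - q * (α * √n) = b * √n from fun n => by rw [← hbω]; ring,
        ← add_mul, haω] at this
      simp only [Real.sqrt_eq_rpow] at this ⊢
      exact this
    · have hn' := hpos n hn
      refine ⟨hq, hα0, by positivity, by positivity, ht.1, ht.2, hxω, ?_, ?_, by field_simp⟩
      · simp only [ε]
        rw [div_pow, mul_pow, h2, hμ2, hA', ht₀1, hc]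
        field_simp
      · rw [hq3, ht₀1]
        field_simp
    · have hn' := hpos n hn
      have hs : √(n : ℝ) ^ 4 = n ^ 2 := by
        rw [show √(n : ℝ) ^ 4 = (√n ^ 2) ^ 2 by ring, Real.sq_sqrt n.cast_nonneg]
      simp only [ε]
      rw [div_pow, mul_pow, mul_pow, mul_pow, div_pow, mul_pow, h4, hs, hμ4, hq3, ht₀1, hc]
      have : (0 : ℝ) < n := Nat.cast_pos.mpr hn
      field_simp
    · exact Tendsto.const_div_atTop ((tendsto_rpow_atTop (by norm_num)).comp
        tendsto_natCast_atTop_atTop) _
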